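/- Let $T$ be a semisimple $\mathbb C$-linear tensor category: $\mathbb C$-linear monoidal with bilinear tensor product, finite direct sums, split idempotents, semisimple endomorphism rings, and $\operatorname{End}(1)=\mathbb C$. **Frobenius dualities.** Let $\mathcal B$ be a bicategory (for example a tensor category, viewed as a bicategory with one object) with a chosen $1$-cell $X^*:b\to a$ for every $1$-cell $X:a\to b$. A *Frobenius duality* consists of rigidity pairs $\epsilon_X:X\otimes X^*\to 1_a$, $\delta_X:1_b\to X^*\otimes X$ satisfying both hook identities, and of identifications $X\cong X^{**}$ and $Y^*\otimes X^*\cong (X\otimes Y)^*$ such that $\epsilon_{X\otimes Y}=\epsilon_X(1\otimes\epsilon_Y\otimes 1)$, $f^{**}=f$ for all $2$-cells $f$, and the identification $X\cong X^{**}$ is compatible with $\otimes$ and with $*$. In the strict case the identifications are identities. The duality is *neutral* if, for every endomorphism $f$ of every $X$, the left and the right trace of $f$ are the same scalar multiple of $1_a$ and of $1_b$. **The bicategory $M(T)$.** Fix a Frobenius duality $\{\epsilon_X\}$ on $T$. The objects of $M(T)$ are the finite-dimensional semisimple complex Hopf algebras $A$ realized in $T$: a fully faithful linear tensor functor $F:\mathrm{Rep}(A)\to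 T$ is given, such that the duality of $T$ restricts on the image of $F$ to the usual one. That is, the usual pairing $V\otimes V^*\to\mathbb C$ is $A$-linear, and there is a morphism $F(V^*)\to F(V)^*$ under which the usual pairings on $V\otimes V^*$ and on $V^*\otimes V$ become $\epsilon_{F(V)}$ and $\epsilon_{F(V)^*}$ (with $F(V)\cong F(V)^{**}$). A $1$-cell from $(A,F)$ to $(B,G)$ is an $A$-$B$ module: an object $X$ of $T$ with commuting trivializing isomorphisms $F(V)\otimes X\cong X\otimes V$ and $X\otimes G(W)\cong W\otimes X$, natural in the modules $V$ and $W$ and compatible with tensor products. Here $X\otimes V$ denotes the multiple of $X$ by the vector space $V$. $2$-cells are the morphisms of $T$ commuting with these. Composition is the relative tensor product $X\otimes_B Y$, the image of the idempotent on $X\otimes Y$ given by the sum over the irreducible $B$-modules $W$ of the partial traces over $W$ of the morphisms $X\otimes Y\to X\otimes G(W)\otimes Y\to X\otimes Y$, with weights $d(W)/\dim B$, where $d(W)=\dim W$. The unit is $\mathbb A=\bigoplus_V F(V)\otimes V^*$ (over the irreducible $A$-modules $V$), with both actions renormalized by the gauge $\{\sqrt{d(V)}\}$. The unit constraints are the actions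 $\mathbb A\otimes X\to X$ and $X\otimes\mathbb A\to X$ multiplied by $\omega_A=|A|^{-1/2}$, where $|A|=\dim A$. The dual of $X$ is $X^*$ with the transposed actions. For an $A$-$B$ module $X$ let $\epsilon:X\otimes X^*\to\mathbb A$ be the morphism obtained from $$X\otimes X^*\to F(V)\otimes X\otimes V^*\otimes X^*\to F(V)\otimes V^*$$ (trivialization of $X$, followed by the pairing $\epsilon_X$ of $T$), summed over the irreducible $A$-modules $V$ with weights $\sqrt{d(V)}$. **Proposition.** The family $\{|A|^{-1/4}|B|^{-1/4}\,\epsilon\}$, indexed by the $A$-$B$ modules $X$, is a Frobenius duality in the bicategory $M(T)$: each $|A|^{-1/4}|B|^{-1/4}\epsilon$ induces the pairing $X\otimes_B X^*\to\mathbb A$ of such a duality, whose identifications $X\cong X^{**}$ and $Y^*\otimes_B X^*\cong(X\otimes_B Y)^*$ are the ones induced by those of $T$ (so they are the identities, respectively the canonical identification of $Y^*\otimes_BX^*$ with the dual of $X\otimes_BY$, if the duality of $T$ is strict). If the duality of $T$ is neutral, so is this one. -/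

import Mathlib

universe v u

set_option linter.unusedVariables false
set_option linter.unusedSectionVars false
set_option linter.style.haveILetI false
set_option linter.unusedSimpArgs false

noncomputable section

open CategoryTheory MonoidalCategory
open scoped TensorProduct

/-- A finite-dimensional (left) module over the complex algebra `A`. -/
structure HopfRep (A : Type) [Ring A] [Algebra ℂ A] where
  carrier : Type
  [grp : AddCommGroup carrier]
  [mod : Module ℂ carrier]
  [fin : Module.Finite ℂ carrier]
  ρ : A →ₐ[ℂ] Module.End ℂ carrier

namespace HopfRep

attribute [instance] HopfRep.grp HopfRep.mod HopfRep.fin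

section Linear

variable {A : Type} [Ring A] [Algebra ℂ A]

/-- The space of `A`-linear maps. -/
def homs (V W : HopfRep A) : Submodule ℂ (V.carrier →ₗ[ℂ] W.carrier) where
  carrier := {f | ∀ a x, f (V.ρ a x) = W.ρ a (f x)}
  add_mem' hf hg a x := by simp [hf a x, hg a x]
  zero_mem' a x := by simp
  smul_mem' c f hf a x := by simp [hf a x]

instance : Category (HopfRep A) where
  Hom V W := homs V W
  id V := ⟨LinearMap.id, fun _ _ => rfl⟩
  comp f g := ⟨g.1 ∘ₗ f.1, fun a x => by
    have h1 := f.2 a x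
    have h2 := g.2 a (f.1 x)
    simp only [LinearMap.comp_apply]
    rw [h1, h2]⟩

/-- The underlying linear map of a morphism. -/
def lin {V W : HopfRep A} (f : V ⟶ W) : V.carrier →ₗ[ℂ] W.carrier := f.1

/-- An `A`-linear map as a morphism. -/
def mk' {V W : HopfRep A} (f : V.carrier →ₗ[ℂ] W.carrier)
    (h : ∀ a x, f (V.ρ a x) = W.ρ a (f x)) : V ⟶ W := ⟨f, h⟩

@[simp] lemma lin_mk' {V W : HopfRep A} (f : V.carrier →ₗ[ℂ] W.carrier)
    (h : ∀ a x, f (V.ρ a x) = W.ρ a (f x)) : lin (mk' f h) = f := rfl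

@[simp] lemma lin_id (V : HopfRep A) : lin (𝟙 V) = LinearMap.id := rfl

@[simp] lemma lin_comp {U V W : HopfRep A} (f : U ⟶ V) (g : V ⟶ W) :
    lin (f ≫ g) = lin g ∘ₗ lin f := rfl

lemma lin_comm {V W : HopfRep A} (f : V ⟶ W) (a : A) (x : V.carrier) :
    lin f (V.ρ a x) = W.ρ a (lin f x) := f.2 a x

@[ext] lemma hom_ext {V W : HopfRep A} {f g : V ⟶ W} (h : lin f = lin g) : f = g := Subtype.ext h

instance : Preadditive (HopfRep A) where
  homGroup V W := inferInstanceAs (AddCommGroup (homs V W))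
  add_comp U V W f g h := hom_ext (LinearMap.ext fun x => h.1.map_add (f.1 x) (g.1 x))
  comp_add U V W f g h := hom_ext (LinearMap.ext fun x => rfl)

instance : Linear ℂ (HopfRep A) where
  homModule V W := inferInstanceAs (Module ℂ (homs V W))
  smul_comp U V W c f g := hom_ext (LinearMap.ext fun x => g.1.map_smul c (f.1 x))
  comp_smul U V W f c g := hom_ext (LinearMap.ext fun x => rfl)

@[simp] lemma lin_add {V W : HopfRep A} (f g : V ⟶ W) : lin (f + g) = lin f + lin g := rfl
@[simp] lemma lin_smul {V W : HopfRep A} (c : ℂ) (f : V ⟶ W) : lin (c • f) = c • lin f := rfl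

/-- The underlying vector space. -/
def forget : HopfRep A ⥤ ModuleCat.{0} ℂ where
  obj V := ModuleCat.of ℂ V.carrier
  map f := ModuleCat.ofHom (lin f)

instance : (forget (A := A)).Faithful where
  map_injective h := hom_ext (congrArg ModuleCat.Hom.hom h)

/-- A linear isomorphism compatible with the actions. -/
def mkIso {V W : HopfRep A} (e : V.carrier ≃ₗ[ℂ] W.carrier)
    (h : ∀ a x, e (V.ρ a x) = W.ρ a (e x)) : V ≅ W where
  hom := mk' e.toLinearMap h
  inv := mk' e.symm.toLinearMap fun a x => e.injective (by simp [h])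
  hom_inv_id := hom_ext (LinearMap.ext fun x => e.symm_apply_apply x)
  inv_hom_id := hom_ext (LinearMap.ext fun x => e.apply_symm_apply x)

end Linear

section Actions

variable {A : Type} [Ring A] [HopfAlgebra ℂ A]
  {M N L M' N' : Type} [AddCommGroup M] [Module ℂ M] [AddCommGroup N] [Module ℂ N]
  [AddCommGroup L] [Module ℂ L] [AddCommGroup M'] [Module ℂ M'] [AddCommGroup N'] [Module ℂ N']

/-- The diagonal action: `a` acts on `M ⊗ N` by `a₍₁₎ ⊗ a₍₂₎`. -/
def diag (p : A →ₐ[ℂ] Module.End ℂ M) (q : A →ₐ[ℂ] Module.End ℂ N) :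
    A →ₐ[ℂ] Module.End ℂ (M ⊗[ℂ] N) :=
  (Module.endTensorEndAlgHom (R := ℂ) (S := ℂ) (A := ℂ)).comp
    ((Algebra.TensorProduct.map p q).comp (Bialgebra.comulAlgHom ℂ A))

/-- The trivial action on `ℂ`, through the counit. -/
def trivAct : A →ₐ[ℂ] Module.End ℂ ℂ :=
  (Algebra.ofId ℂ (Module.End ℂ ℂ)).comp (Bialgebra.counitAlgHom ℂ A)

lemma trivAct_apply (a : A) (c : ℂ) : trivAct a c = Coalgebra.counit (R := ℂ) a * c := rfl

/-- The orbit map `a ↦ a v`. -/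
def orb (p : A →ₐ[ℂ] Module.End ℂ M) (v : M) : A →ₗ[ℂ] M :=
  LinearMap.applyₗ v ∘ₗ p.toLinearMap

@[simp] lemma orb_apply (p : A →ₐ[ℂ] Module.End ℂ M) (v : M) (a : A) : orb p v a = p a v := rfl

lemma diag_apply (p : A →ₐ[ℂ] Module.End ℂ M) (q : A →ₐ[ℂ] Module.End ℂ N) (a : A) (v : M) (w : N) :
    diag p q a (v ⊗ₜ w) = TensorProduct.map (orb p v) (orb q w) (Coalgebra.comul (R := ℂ) a) := by
  change (Module.endTensorEndAlgHom (R := ℂ) (S := ℂ) (A := ℂ)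
    (Algebra.TensorProduct.map p q (Coalgebra.comul (R := ℂ) a))) (v ⊗ₜ w) = _
  induction Coalgebra.comul (R := ℂ) a using TensorProduct.induction_on with
  | zero => simp
  | tmul x y => rfl
  | add x y hx hy => simp only [map_add, LinearMap.add_apply, hx, hy]

lemma orb_diag (p : A →ₐ[ℂ] Module.End ℂ M) (q : A →ₐ[ℂ] Module.End ℂ N) (v : M) (w : N) :
    orb (diag p q) (v ⊗ₜ w) = TensorProduct.map (orb p v) (orb q w) ∘ₗ Coalgebra.comul (R := ℂ) :=
  LinearMap.ext fun a => diag_apply p q a v w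

lemma assoc_comm (p : A →ₐ[ℂ] Module.End ℂ M) (q : A →ₐ[ℂ] Module.End ℂ N)
    (r : A →ₐ[ℂ] Module.End ℂ L) (a : A) (x : (M ⊗[ℂ] N) ⊗[ℂ] L) :
    TensorProduct.assoc ℂ M N L (diag (diag p q) r a x) =
      diag p (diag q r) a (TensorProduct.assoc ℂ M N L x) := by
  revert x
  suffices h : (TensorProduct.assoc ℂ M N L).toLinearMap ∘ₗ (diag (diag p q) r a) =
      (diag p (diag q r) a) ∘ₗ (TensorProduct.assoc ℂ M N L).toLinearMap from
    fun x => LinearMap.congr_fun h x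
  refine TensorProduct.ext_threefold fun x y z => ?_
  have key : (TensorProduct.assoc ℂ M N L).toLinearMap ∘ₗ
      TensorProduct.map (TensorProduct.map (orb p x) (orb q y)) (orb r z) =
      TensorProduct.map (orb p x) (TensorProduct.map (orb q y) (orb r z)) ∘ₗ
        (TensorProduct.assoc ℂ A A A).toLinearMap := (TensorProduct.map_map_comp_assoc_eq _ _ _).symm
  have h1 : TensorProduct.map (orb (diag p q) (x ⊗ₜ y)) (orb r z) =
      TensorProduct.map (TensorProduct.map (orb p x) (orb q y)) (orb r z) ∘ₗ
        (Coalgebra.comul (R := ℂ)).rTensor A := by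
    rw [orb_diag, LinearMap.rTensor, ← TensorProduct.map_comp, LinearMap.comp_id]
  have h2 : TensorProduct.map (orb p x) (orb (diag q r) (y ⊗ₜ z)) =
      TensorProduct.map (orb p x) (TensorProduct.map (orb q y) (orb r z)) ∘ₗ
        (Coalgebra.comul (R := ℂ)).lTensor A := by
    rw [orb_diag, LinearMap.lTensor, ← TensorProduct.map_comp, LinearMap.comp_id]
  simp only [LinearMap.comp_apply, LinearEquiv.coe_coe, TensorProduct.assoc_tmul, diag_apply]
  rw [h1, h2, LinearMap.comp_apply, LinearMap.comp_apply, ← Coalgebra.coassoc_apply]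
  exact LinearMap.congr_fun key _

lemma lid_comm (p : A →ₐ[ℂ] Module.End ℂ M) (a : A) (x : ℂ ⊗[ℂ] M) :
    TensorProduct.lid ℂ M (diag trivAct p a x) = p a (TensorProduct.lid ℂ M x) := by
  induction x using TensorProduct.induction_on with
  | zero => simp
  | add x y hx hy => simp only [map_add, hx, hy]
  | tmul c v =>
    have h2 : ∀ y : A ⊗[ℂ] A, TensorProduct.lid ℂ M (TensorProduct.map (orb trivAct c) (orb p v) y) =
        c • p (TensorProduct.lid ℂ A ((Coalgebra.counit (R := ℂ)).rTensor A y)) v := by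
      intro y
      induction y using TensorProduct.induction_on with
      | zero => simp
      | add x y hx hy => simp only [map_add, hx, hy, LinearMap.add_apply, smul_add]
      | tmul b d => simp [trivAct_apply, mul_comm, mul_smul]
    rw [diag_apply, h2, Coalgebra.rTensor_counit_comul]
    simp

lemma rid_comm (p : A →ₐ[ℂ] Module.End ℂ M) (a : A) (x : M ⊗[ℂ] ℂ) :
    TensorProduct.rid ℂ M (diag p trivAct a x) = p a (TensorProduct.rid ℂ M x) := by
  induction x using TensorProduct.induction_on with
  | zero => simp
  | add x y hx hy => simp only [map_add, hx, hy]
  | tmul v c =>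
    have h2 : ∀ y : A ⊗[ℂ] A, TensorProduct.rid ℂ M (TensorProduct.map (orb p v) (orb trivAct c) y) =
        c • p (TensorProduct.rid ℂ A ((Coalgebra.counit (R := ℂ)).lTensor A y)) v := by
      intro y
      induction y using TensorProduct.induction_on with
      | zero => simp
      | add x y hx hy => simp only [map_add, hx, hy, LinearMap.add_apply, smul_add]
      | tmul b d => simp [trivAct_apply, mul_comm, mul_smul]
    rw [diag_apply, h2, Coalgebra.lTensor_counit_comul]
    simp

lemma map_comm {p : A →ₐ[ℂ] Module.End ℂ M} {q : A →ₐ[ℂ] Module.End ℂ N}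
    {p' : A →ₐ[ℂ] Module.End ℂ M'} {q' : A →ₐ[ℂ] Module.End ℂ N'} (f : M →ₗ[ℂ] M') (g : N →ₗ[ℂ] N')
    (hf : ∀ a x, f (p a x) = p' a (f x)) (hg : ∀ a x, g (q a x) = q' a (g x)) (a : A)
    (x : M ⊗[ℂ] N) : TensorProduct.map f g (diag p q a x) = diag p' q' a (TensorProduct.map f g x) := by
  induction x using TensorProduct.induction_on with
  | zero => simp
  | add x y hx hy => simp only [map_add, hx, hy]
  | tmul u w =>
    rw [diag_apply, TensorProduct.map_tmul, diag_apply, ← LinearMap.comp_apply,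
      ← TensorProduct.map_comp]
    congr 2
    · ext b; exact hf b u
    · ext b; exact hg b w

end Actions

section Monoidal

variable {A : Type} [Ring A] [HopfAlgebra ℂ A]

instance : MonoidalCategoryStruct (HopfRep A) where
  tensorObj V W := { carrier := V.carrier ⊗[ℂ] W.carrier, ρ := diag V.ρ W.ρ }
  tensorUnit := { carrier := ℂ, ρ := trivAct }
  tensorHom f g := mk' (TensorProduct.map (lin f) (lin g)) (map_comm _ _ (lin_comm f) (lin_comm g))
  whiskerLeft V _ _ g := mk' (TensorProduct.map LinearMap.id (lin g))
    (map_comm _ _ (fun _ _ => rfl) (lin_comm g))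
  whiskerRight f V := mk' (TensorProduct.map (lin f) LinearMap.id)
    (map_comm _ _ (lin_comm f) (fun _ _ => rfl))
  associator U V W := mkIso (TensorProduct.assoc ℂ U.carrier V.carrier W.carrier)
    (assoc_comm U.ρ V.ρ W.ρ)
  leftUnitor V := mkIso (TensorProduct.lid ℂ V.carrier) (lid_comm V.ρ)
  rightUnitor V := mkIso (TensorProduct.rid ℂ V.carrier) (rid_comm V.ρ)

/-- The monoidal structure, induced from that of vector spaces. -/
instance : MonoidalCategory (HopfRep A) :=
  Monoidal.induced (forget (A := A))
    { μIso := fun X Y => Iso.refl _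
      εIso := Iso.refl _
      whiskerLeft_eq := fun X _ _ f => by ext x; rfl
      whiskerRight_eq := fun f X => by ext x; rfl
      tensorHom_eq := fun f g => by ext x; rfl
      associator_eq := fun X Y Z => by
        refine ModuleCat.hom_ext (TensorProduct.ext_threefold fun x y z => ?_)
        rfl
      leftUnitor_eq := fun X => by
        refine ModuleCat.hom_ext (TensorProduct.ext' fun x y => ?_)
        rfl
      rightUnitor_eq := fun X => by
        refine ModuleCat.hom_ext (TensorProduct.ext' fun x y => ?_)
        rfl }

end Monoidal
end HopfRep
end

noncomputable section

open CategoryTheory MonoidalCategory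
open scoped TensorProduct

namespace HopfRep

section Actions

open HopfAlgebra Coalgebra

variable {A : Type} [Ring A] [HopfAlgebra ℂ A] {M : Type} [AddCommGroup M] [Module ℂ M]

/-- The contragredient action: `a` acts on `M*` by the transpose of its antipode. -/
def dualAct (p : A →ₐ[ℂ] Module.End ℂ M) : A →ₐ[ℂ] Module.End ℂ (Module.Dual ℂ M) :=
  AlgHom.ofLinearMap
    (Module.Dual.transpose (R := ℂ) (M := M) (M' := M) ∘ₗ p.toLinearMap ∘ₗ antipode ℂ (A := A))
    (by ext; simp [antipode_one, Module.Dual.transpose])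
    (fun x y => by ext; simp [antipode_mul_antidistrib, Module.Dual.transpose])

@[simp] lemma dualAct_apply (p : A →ₐ[ℂ] Module.End ℂ M) (a : A) (ξ : Module.Dual ℂ M) (v : M) :
    dualAct p a ξ v = ξ (p (antipode ℂ a) v) := rfl

lemma mul_antipode₁ (a : A) :
    LinearMap.mul' ℂ A ((antipode ℂ).rTensor A (comul a)) = algebraMap ℂ A (counit a) :=
  mul_antipode_rTensor_comul_apply a

lemma mul_antipode₂ (a : A) :
    LinearMap.mul' ℂ A ((antipode ℂ).lTensor A (comul a)) = algebraMap ℂ A (counit a) :=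
  mul_antipode_lTensor_comul_apply a

lemma antipode_algebraMap (c : ℂ) : antipode ℂ (algebraMap ℂ A c) = algebraMap ℂ A c := by
  rw [Algebra.algebraMap_eq_smul_one, map_smul, antipode_one]

/-- The twisted product `x ⊗ y ↦ y x`. -/
def mulOp (A : Type) [Ring A] [Algebra ℂ A] : A ⊗[ℂ] A →ₗ[ℂ] A :=
  LinearMap.mul' ℂ A ∘ₗ (TensorProduct.comm ℂ A A).toLinearMap

@[simp] lemma mulOp_tmul {B : Type} [Ring B] [Algebra ℂ B] (x y : B) :
    mulOp B (x ⊗ₜ y) = y * x := rfl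

lemma mul_antipode₃ (hS : ∀ a : A, antipode ℂ (antipode ℂ a) = a) (a : A) :
    mulOp A ((antipode ℂ).lTensor A (comul a)) = algebraMap ℂ A (counit a) := by
  have h : ∀ y : A ⊗[ℂ] A, mulOp A ((antipode ℂ).lTensor A y) =
      antipode ℂ (LinearMap.mul' ℂ A ((antipode ℂ).rTensor A y)) := by
    intro y
    induction y using TensorProduct.induction_on with
    | zero => simp
    | add x y hx hy => simp only [map_add, hx, hy]
    | tmul b d => simp [antipode_mul_antidistrib, hS]
  rw [h, mul_antipode₁, antipode_algebraMap]

lemma mul_antipode₄ (hS : ∀ a : A, antipode ℂ (antipode ℂ a) = a) (a : A) :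
    mulOp A ((antipode ℂ).rTensor A (comul a)) = algebraMap ℂ A (counit a) := by
  have h : ∀ y : A ⊗[ℂ] A, mulOp A ((antipode ℂ).rTensor A y) =
      antipode ℂ (LinearMap.mul' ℂ A ((antipode ℂ).lTensor A y)) := by
    intro y
    induction y using TensorProduct.induction_on with
    | zero => simp
    | add x y hx hy => simp only [map_add, hx, hy]
    | tmul b d => simp [antipode_mul_antidistrib, hS]
  rw [h, mul_antipode₂, antipode_algebraMap]

/-- If `S(a₍₂₎) a₍₁₎` is the counit of `a`, then the antipode is involutive. -/
lemma antipode_sq (h : ∀ a : A, mulOp A ((antipode ℂ).lTensor A (comul a)) =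
    algebraMap ℂ A (counit a)) (a : A) : antipode ℂ (antipode ℂ a) = a := by
  let T : A ⊗[ℂ] (A ⊗[ℂ] A) →ₗ[ℂ] A := mulOp A ∘ₗ LinearMap.lTensor A
    (antipode ℂ ∘ₗ LinearMap.mul' ℂ A ∘ₗ (antipode ℂ).lTensor A)
  have e1 : T ((comul (R := ℂ)).lTensor A (comul a)) = a := by
    have : ∀ y : A ⊗[ℂ] A, T ((comul (R := ℂ)).lTensor A y) =
        TensorProduct.rid ℂ A ((counit (R := ℂ)).lTensor A y) := by
      intro y
      induction y using TensorProduct.induction_on with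
      | zero => simp
      | add x y hx hy => simp only [map_add, hx, hy]
      | tmul b d =>
        simp [T, Algebra.algebraMap_eq_smul_one, map_smul, antipode_one]
    rw [this, Coalgebra.lTensor_counit_comul]; simp
  have e2 : T ((comul (R := ℂ)).lTensor A (comul a)) = antipode ℂ (antipode ℂ a) := by
    rw [← Coalgebra.coassoc_apply]
    have h0 : ∀ (d : A) (z : A ⊗[ℂ] A), T (TensorProduct.assoc ℂ A A A (z ⊗ₜ d)) =
        antipode ℂ (antipode ℂ d) * mulOp A ((antipode ℂ).lTensor A z) := by
      intro d z
      induction z using TensorProduct.induction_on with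
      | zero => simp
      | add x y hx hy => simp only [map_add, TensorProduct.add_tmul, hx, hy, mul_add]
      | tmul b c => simp [T, antipode_mul_antidistrib, mul_assoc]
    have : ∀ y : A ⊗[ℂ] A, T (TensorProduct.assoc ℂ A A A ((comul (R := ℂ)).rTensor A y)) =
        antipode ℂ (antipode ℂ (TensorProduct.lid ℂ A ((counit (R := ℂ)).rTensor A y))) := by
      intro y
      induction y using TensorProduct.induction_on with
      | zero => simp
      | add x y hx hy => simp only [map_add, hx, hy]
      | tmul b d =>
        rw [LinearMap.rTensor_tmul, h0, h, ← Algebra.commutes, ← Algebra.smul_def]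
        simp
    rw [this, Coalgebra.rTensor_counit_comul]; simp
  rw [← e2, e1]

lemma ev_comm (p : A →ₐ[ℂ] Module.End ℂ M) (a : A) (x : Module.Dual ℂ M ⊗[ℂ] M) :
    contractLeft ℂ M (diag (dualAct p) p a x) = trivAct a (contractLeft ℂ M x) := by
  induction x using TensorProduct.induction_on with
  | zero => simp
  | add x y hx hy => simp only [map_add, hx, hy]
  | tmul ξ v =>
    have h : ∀ y : A ⊗[ℂ] A, contractLeft ℂ M (TensorProduct.map (orb (dualAct p) ξ) (orb p v) y) =
        ξ (p (LinearMap.mul' ℂ A ((antipode ℂ).rTensor A y)) v) := by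
      intro y
      induction y using TensorProduct.induction_on with
      | zero => simp
      | add x y hx hy => simp only [map_add, hx, hy, LinearMap.add_apply]
      | tmul b d => simp
    rw [diag_apply, h, mul_antipode₁]
    simp [trivAct_apply]

lemma ev'_apply (p : A →ₐ[ℂ] Module.End ℂ M) (a : A) (ξ : Module.Dual ℂ M) (v : M) :
    contractRight ℂ M (diag p (dualAct p) a (v ⊗ₜ ξ)) =
      ξ (p (mulOp A ((antipode ℂ).lTensor A (comul a))) v) := by
  have h : ∀ y : A ⊗[ℂ] A, contractRight ℂ M (TensorProduct.map (orb p v) (orb (dualAct p) ξ) y) =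
      ξ (p (mulOp A ((antipode ℂ).lTensor A y)) v) := by
    intro y
    induction y using TensorProduct.induction_on with
    | zero => simp
    | add x y hx hy => simp only [map_add, hx, hy, LinearMap.add_apply]
    | tmul b d => simp
  rw [diag_apply, h]

lemma ev'_comm (hS : ∀ a : A, antipode ℂ (antipode ℂ a) = a) (p : A →ₐ[ℂ] Module.End ℂ M) (a : A)
    (x : M ⊗[ℂ] Module.Dual ℂ M) :
    contractRight ℂ M (diag p (dualAct p) a x) = trivAct a (contractRight ℂ M x) := by
  induction x using TensorProduct.induction_on with
  | zero => simp
  | add x y hx hy => simp only [map_add, hx, hy]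
  | tmul v ξ =>
    rw [ev'_apply, mul_antipode₃ hS]
    simp [trivAct_apply]

variable [Module.Finite ℂ M]

/-- The canonical element `∑ vᵢ ⊗ vᵢ*`. -/
def canEl (M : Type) [AddCommGroup M] [Module ℂ M] [Module.Finite ℂ M] :
    M ⊗[ℂ] Module.Dual ℂ M :=
  ∑ i, Module.finBasis ℂ M i ⊗ₜ (Module.finBasis ℂ M).coord i

/-- The canonical element `∑ vᵢ* ⊗ vᵢ`. -/
def canEl' (M : Type) [AddCommGroup M] [Module ℂ M] [Module.Finite ℂ M] :
    Module.Dual ℂ M ⊗[ℂ] M :=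
  ∑ i, (Module.finBasis ℂ M).coord i ⊗ₜ Module.finBasis ℂ M i

lemma dualTensorHom_canEl' : dualTensorHom ℂ M M (canEl' M) = LinearMap.id := by
  ext x
  simp only [canEl', map_sum, LinearMap.sum_apply, dualTensorHom_apply, LinearMap.id_apply]
  exact (Module.finBasis ℂ M).sum_repr x

lemma dualTensorHom_inj : Function.Injective (dualTensorHom ℂ M M) :=
  (dualTensorHomEquivOfBasis (Module.finBasis ℂ M)).injective

lemma comm_canEl : TensorProduct.comm ℂ M (Module.Dual ℂ M) (canEl M) = canEl' M := by
  simp [canEl, canEl']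

lemma coev_comm (p : A →ₐ[ℂ] Module.End ℂ M) (a : A) :
    diag p (dualAct p) a (canEl M) = (counit a : ℂ) • canEl M := by
  apply (TensorProduct.comm ℂ M (Module.Dual ℂ M)).injective
  apply dualTensorHom_inj
  rw [map_smul, comm_canEl, map_smul, dualTensorHom_canEl']
  have h0 : ∀ (y : A ⊗[ℂ] A) (v : M) (ξ : Module.Dual ℂ M), dualTensorHom ℂ M M
      (TensorProduct.comm ℂ M (Module.Dual ℂ M)
        (TensorProduct.map (orb p v) (orb (dualAct p) ξ) y)) =
      LinearMap.mul' ℂ (Module.End ℂ M) (TensorProduct.map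
        ((LinearMap.mulRight ℂ (dualTensorHom ℂ M M (ξ ⊗ₜ v))) ∘ₗ p.toLinearMap)
        (p.toLinearMap ∘ₗ antipode ℂ) y) := by
    intro y v ξ
    induction y using TensorProduct.induction_on with
    | zero => simp
    | add x y hx hy => simp only [map_add, hx, hy]
    | tmul b d => ext x; simp
  have h2 : ∀ x : M ⊗[ℂ] Module.Dual ℂ M, dualTensorHom ℂ M M
      (TensorProduct.comm ℂ M (Module.Dual ℂ M) (diag p (dualAct p) a x)) =
      LinearMap.mul' ℂ (Module.End ℂ M) (TensorProduct.map
        ((LinearMap.mulRight ℂ (dualTensorHom ℂ M M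
          (TensorProduct.comm ℂ M (Module.Dual ℂ M) x))) ∘ₗ p.toLinearMap)
        (p.toLinearMap ∘ₗ antipode ℂ) (comul a)) := by
    intro x
    induction x using TensorProduct.induction_on with
    | zero =>
      have : (LinearMap.mulRight ℂ (0 : Module.End ℂ M)) = 0 := by ext; simp
      simp [this]
    | add x y hx hy =>
      have : ∀ f g : Module.End ℂ M, LinearMap.mulRight ℂ (f + g) =
        LinearMap.mulRight ℂ f + LinearMap.mulRight ℂ g := fun f g => by ext; simp [mul_add]
      simp only [map_add, hx, hy, this, LinearMap.add_comp, TensorProduct.map_add_left,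
        LinearMap.add_apply]
    | tmul v ξ => rw [diag_apply, h0]; rfl
  rw [h2, comm_canEl, dualTensorHom_canEl']
  have h3 : ∀ y : A ⊗[ℂ] A, LinearMap.mul' ℂ (Module.End ℂ M) (TensorProduct.map
        ((LinearMap.mulRight ℂ (LinearMap.id : Module.End ℂ M)) ∘ₗ p.toLinearMap)
        (p.toLinearMap ∘ₗ antipode ℂ) y) =
        p (LinearMap.mul' ℂ A ((antipode ℂ).lTensor A y)) := by
    intro y
    induction y using TensorProduct.induction_on with
    | zero => simp
    | add x y hx hy => simp only [map_add, hx, hy]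
    | tmul b d => ext x; simp
  rw [h3, mul_antipode₂, Algebra.algebraMap_eq_smul_one, map_smul, map_one]
  rfl

lemma coev'_comm (hS : ∀ a : A, antipode ℂ (antipode ℂ a) = a) (p : A →ₐ[ℂ] Module.End ℂ M)
    (a : A) : diag (dualAct p) p a (canEl' M) = (counit a : ℂ) • canEl' M := by
  apply dualTensorHom_inj
  rw [map_smul, dualTensorHom_canEl']
  have h0 : ∀ (y : A ⊗[ℂ] A) (v : M) (ξ : Module.Dual ℂ M), dualTensorHom ℂ M M
      (TensorProduct.map (orb (dualAct p) ξ) (orb p v) y) =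
      mulOp (Module.End ℂ M) (TensorProduct.map (p.toLinearMap ∘ₗ antipode ℂ)
        ((LinearMap.mulRight ℂ (dualTensorHom ℂ M M (ξ ⊗ₜ v))) ∘ₗ p.toLinearMap) y) := by
    intro y v ξ
    induction y using TensorProduct.induction_on with
    | zero => simp
    | add x y hx hy => simp only [map_add, hx, hy]
    | tmul b d => ext x; simp
  have h2 : ∀ x : Module.Dual ℂ M ⊗[ℂ] M, dualTensorHom ℂ M M (diag (dualAct p) p a x) =
      mulOp (Module.End ℂ M) (TensorProduct.map (p.toLinearMap ∘ₗ antipode ℂ)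
        ((LinearMap.mulRight ℂ (dualTensorHom ℂ M M x)) ∘ₗ p.toLinearMap) (comul a)) := by
    intro x
    induction x using TensorProduct.induction_on with
    | zero =>
      have : (LinearMap.mulRight ℂ (0 : Module.End ℂ M)) = 0 := by ext; simp
      simp [this]
    | add x y hx hy =>
      have : ∀ f g : Module.End ℂ M, LinearMap.mulRight ℂ (f + g) =
        LinearMap.mulRight ℂ f + LinearMap.mulRight ℂ g := fun f g => by ext; simp [mul_add]
      simp only [map_add, hx, hy, this, LinearMap.add_comp, TensorProduct.map_add_right,
        LinearMap.add_apply]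
    | tmul v ξ => rw [diag_apply, h0]
  rw [h2, dualTensorHom_canEl']
  have h3 : ∀ y : A ⊗[ℂ] A, mulOp (Module.End ℂ M) (TensorProduct.map
        (p.toLinearMap ∘ₗ antipode ℂ)
        ((LinearMap.mulRight ℂ (LinearMap.id : Module.End ℂ M)) ∘ₗ p.toLinearMap) y) =
        p (mulOp A ((antipode ℂ).rTensor A y)) := by
    intro y
    induction y using TensorProduct.induction_on with
    | zero => simp
    | add x y hx hy => simp only [map_add, hx, hy]
    | tmul b d => ext x; simp
  rw [h3, mul_antipode₄ hS, Algebra.algebraMap_eq_smul_one, map_smul, map_one]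
  rfl

end Actions

section Objects

open HopfAlgebra Coalgebra

variable {A : Type} [Ring A] [HopfAlgebra ℂ A]

/-- The simple tensor `v ⊗ w`. -/
def tmul {V W : HopfRep A} (v : V.carrier) (w : W.carrier) : (V ⊗ W).carrier :=
  (v ⊗ₜ[ℂ] w : V.carrier ⊗[ℂ] W.carrier)

/-- The functional `v ⊗ w ↦ ξ v * ζ w`. -/
def dmul {V W : HopfRep A} (ξ : Module.Dual ℂ V.carrier) (ζ : Module.Dual ℂ W.carrier) :
    Module.Dual ℂ (V ⊗ W).carrier :=
  (TensorProduct.lid ℂ ℂ).toLinearMap ∘ₗ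
    (TensorProduct.map ξ ζ : V.carrier ⊗[ℂ] W.carrier →ₗ[ℂ] ℂ ⊗[ℂ] ℂ)

@[simp] lemma dmul_tmul {V W : HopfRep A} (ξ : Module.Dual ℂ V.carrier)
    (ζ : Module.Dual ℂ W.carrier) (v : V.carrier) (w : W.carrier) :
    dmul ξ ζ (tmul v w) = ξ v * ζ w := rfl

/-- The vector `1` of the trivial module. -/
def one : (𝟙_ (HopfRep A)).carrier := (1 : ℂ)

/-- The functional `1 ↦ 1` on the trivial module. -/
def oneD : Module.Dual ℂ (𝟙_ (HopfRep A)).carrier := (LinearMap.id : ℂ →ₗ[ℂ] ℂ)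

@[simp] lemma oneD_one : oneD (one : (𝟙_ (HopfRep A)).carrier) = 1 := rfl

lemma tensor_lin_ext {V W : HopfRep A} {M : Type*} [AddCommGroup M] [Module ℂ M]
    {f g : (V ⊗ W).carrier →ₗ[ℂ] M} (h : ∀ v w, f (tmul v w) = g (tmul v w)) : f = g :=
  TensorProduct.ext' h

lemma unit_lin_ext {M : Type*} [AddCommGroup M] [Module ℂ M]
    {f g : (𝟙_ (HopfRep A)).carrier →ₗ[ℂ] M} (h : f one = g one) : f = g :=
  LinearMap.ext_ring (R := ℂ) h

lemma eq_smul_one (x : (𝟙_ (HopfRep A)).carrier) : x = oneD x • one :=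
  (mul_one (show ℂ from x)).symm

@[simp] lemma whiskerLeft_tmul (U : HopfRep A) {V W : HopfRep A} (f : V ⟶ W) (u : U.carrier)
    (v : V.carrier) : lin (U ◁ f) (tmul u v) = tmul u (lin f v) := rfl
@[simp] lemma whiskerRight_tmul (U : HopfRep A) {V W : HopfRep A} (f : V ⟶ W) (u : U.carrier)
    (v : V.carrier) : lin (f ▷ U) (tmul v u) = tmul (lin f v) u := rfl
@[simp] lemma assoc_tmul {U V W : HopfRep A} (u : U.carrier) (v : V.carrier) (w : W.carrier) :
    lin (α_ U V W).hom (tmul (tmul u v) w) = tmul u (tmul v w) := rfl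
@[simp] lemma assoc_inv_tmul {U V W : HopfRep A} (u : U.carrier) (v : V.carrier) (w : W.carrier) :
    lin (α_ U V W).inv (tmul u (tmul v w)) = tmul (tmul u v) w := rfl
@[simp] lemma leftUnitor_tmul {V : HopfRep A} (x : (𝟙_ (HopfRep A)).carrier) (v : V.carrier) :
    lin (λ_ V).hom (tmul x v) = oneD x • v := rfl
@[simp] lemma leftUnitor_inv {V : HopfRep A} (v : V.carrier) :
    lin (λ_ V).inv v = tmul one v := rfl
@[simp] lemma rightUnitor_tmul {V : HopfRep A} (x : (𝟙_ (HopfRep A)).carrier) (v : V.carrier) :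
    lin (ρ_ V).hom (tmul v x) = oneD x • v := rfl
@[simp] lemma rightUnitor_inv {V : HopfRep A} (v : V.carrier) :
    lin (ρ_ V).inv v = tmul v one := rfl

lemma tmul_sum {V W : HopfRep A} {ι : Type*} (s : Finset ι) (v : V.carrier) (w : ι → W.carrier) :
    tmul v (∑ i ∈ s, w i) = ∑ i ∈ s, tmul v (w i) := TensorProduct.tmul_sum v s w
lemma sum_tmul {V W : HopfRep A} {ι : Type*} (s : Finset ι) (v : ι → V.carrier) (w : W.carrier) :
    tmul (∑ i ∈ s, v i) w = ∑ i ∈ s, tmul (v i) w := TensorProduct.sum_tmul s v w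
lemma tmul_smul {V W : HopfRep A} (c : ℂ) (v : V.carrier) (w : W.carrier) :
    tmul v (c • w) = c • tmul v w := TensorProduct.tmul_smul c v w
lemma smul_tmul {V W : HopfRep A} (c : ℂ) (v : V.carrier) (w : W.carrier) :
    tmul (c • v) w = c • tmul v w := (TensorProduct.smul_tmul' c v w).symm

/-- A fixed basis of the underlying space. -/
abbrev bas (V : HopfRep A) : Module.Basis (Fin (Module.finrank ℂ V.carrier)) ℂ V.carrier :=
  Module.finBasis ℂ V.carrier

/-- The dual module `V* `, on which `a` acts by the transpose of its antipode. -/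
def dual (V : HopfRep A) : HopfRep A where
  carrier := Module.Dual ℂ V.carrier
  ρ := dualAct V.ρ

/-- A functional on `V`, as a vector of the dual module. -/
def toDual {V : HopfRep A} : Module.Dual ℂ V.carrier ≃ₗ[ℂ] (dual V).carrier :=
  LinearEquiv.refl ℂ (Module.Dual ℂ V.carrier)

/-- A vector of `V`, as a functional on the dual module. -/
def bid {V : HopfRep A} : V.carrier →ₗ[ℂ] Module.Dual ℂ (dual V).carrier :=
  Module.Dual.eval ℂ V.carrier

@[simp] lemma bid_toDual {V : HopfRep A} (v : V.carrier) (ξ : Module.Dual ℂ V.carrier) :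
    bid v (toDual ξ) = ξ v := rfl

/-- The pairing `ξ ⊗ v ↦ ξ v`. -/
def ev (V : HopfRep A) : dual V ⊗ V ⟶ 𝟙_ (HopfRep A) :=
  mk' (V := dual V ⊗ V) (W := 𝟙_ (HopfRep A)) (contractLeft ℂ V.carrier) (ev_comm V.ρ)

/-- The copairing `1 ↦ ∑ vᵢ ⊗ vᵢ*`. -/
def coev (V : HopfRep A) : 𝟙_ (HopfRep A) ⟶ V ⊗ dual V :=
  mk' (V := 𝟙_ (HopfRep A)) (W := V ⊗ dual V)
    (LinearMap.toSpanSingleton ℂ (V.carrier ⊗[ℂ] Module.Dual ℂ V.carrier) (canEl V.carrier))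
    (fun a x => by
      refine Eq.trans ?_ ((diag V.ρ (dualAct V.ρ) a).map_smul (show ℂ from x)
        (canEl V.carrier)).symm
      rw [coev_comm]
      exact (mul_smul _ _ _).trans (smul_comm _ _ _))

@[simp] lemma lin_ev (V : HopfRep A) (ξ : Module.Dual ℂ V.carrier) (v : V.carrier) :
    oneD (lin (ev V) (tmul (toDual ξ) v)) = ξ v := rfl

@[simp] lemma lin_coev (V : HopfRep A) :
    lin (coev V) one = ∑ i, tmul (bas V i) (toDual ((bas V).coord i)) := one_smul ℂ _

/-- The pairing `v ⊗ ξ ↦ ξ v`, when the antipode is involutive. -/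
def ev' (hS : ∀ a : A, antipode ℂ (antipode ℂ a) = a) (V : HopfRep A) :
    V ⊗ dual V ⟶ 𝟙_ (HopfRep A) :=
  mk' (V := V ⊗ dual V) (W := 𝟙_ (HopfRep A)) (contractRight ℂ V.carrier) (ev'_comm hS V.ρ)

/-- The copairing `1 ↦ ∑ vᵢ* ⊗ vᵢ`, when the antipode is involutive. -/
def coev' (hS : ∀ a : A, antipode ℂ (antipode ℂ a) = a) (V : HopfRep A) :
    𝟙_ (HopfRep A) ⟶ dual V ⊗ V :=
  mk' (V := 𝟙_ (HopfRep A)) (W := dual V ⊗ V)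
    (LinearMap.toSpanSingleton ℂ (Module.Dual ℂ V.carrier ⊗[ℂ] V.carrier) (canEl' V.carrier))
    (fun a x => by
      refine Eq.trans ?_ ((diag (dualAct V.ρ) V.ρ a).map_smul (show ℂ from x)
        (canEl' V.carrier)).symm
      rw [coev'_comm hS]
      exact (mul_smul _ _ _).trans (smul_comm _ _ _))

@[simp] lemma lin_ev' (hS : ∀ a : A, antipode ℂ (antipode ℂ a) = a) (V : HopfRep A)
    (ξ : Module.Dual ℂ V.carrier) (v : V.carrier) :
    oneD (lin (ev' hS V) (tmul v (toDual ξ))) = ξ v := rfl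

@[simp] lemma lin_coev' (hS : ∀ a : A, antipode ℂ (antipode ℂ a) = a) (V : HopfRep A) :
    lin (coev' hS V) one = ∑ i, tmul (toDual ((bas V).coord i)) (bas V i) := one_smul ℂ _

lemma zigzag (V : HopfRep A) :
    (λ_ V).inv ≫ coev V ▷ V ≫ (α_ _ _ _).hom ≫ V ◁ ev V ≫ (ρ_ V).hom = 𝟙 V := by
  ext v
  simp [sum_tmul]

lemma zigzag' (hS : ∀ a : A, antipode ℂ (antipode ℂ a) = a) (V : HopfRep A) :
    (ρ_ V).inv ≫ V ◁ coev' hS V ≫ (α_ _ _ _).inv ≫ ev' hS V ▷ V ≫ (λ_ V).hom = 𝟙 V := by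
  ext v
  simp [tmul_sum]

lemma zigzag_dual (V : HopfRep A) :
    (ρ_ (dual V)).inv ≫ dual V ◁ coev V ≫ (α_ _ _ _).inv ≫ ev V ▷ dual V ≫ (λ_ (dual V)).hom =
      𝟙 (dual V) := by
  ext ξ
  obtain ⟨ξ, rfl⟩ := toDual.surjective ξ
  simp [tmul_sum]
  simp only [← map_smul, ← map_sum]
  congr 1
  refine (bas V).ext fun i => ?_
  simp

variable [Module.Finite ℂ A]

variable (A) in
/-- The function algebra of `A`: the functionals `f` on `A`, with `(a f)(b) = f (b a)`. -/
def fn : HopfRep A where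
  carrier := Module.Dual ℂ A
  ρ := AlgHom.ofLinearMap
    (Module.Dual.transpose (R := ℂ) (M := A) (M' := A) ∘ₗ (LinearMap.mul ℂ A).flip)
    (by ext; simp [Module.Dual.transpose])
    (fun x y => by ext; simp [Module.Dual.transpose, mul_assoc])

/-- A functional on `A` as a vector of the function algebra. -/
def toFn : Module.Dual ℂ A ≃ₗ[ℂ] (fn A).carrier := LinearEquiv.refl ℂ (Module.Dual ℂ A)

lemma fn_apply (a b : A) (f : (fn A).carrier) :
    toFn.symm ((fn A).ρ a f) b = toFn.symm f (b * a) := rfl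

/-- Evaluation of functions at `a`. -/
def evalAt (a : A) : Module.Dual ℂ (fn A).carrier := Module.Dual.eval ℂ A a

@[simp] lemma evalAt_toFn (a : A) (f : Module.Dual ℂ A) : evalAt a (toFn f) = f a := rfl

/-- The matrix coefficient map `v ↦ ξ ((·) v)`. -/
def coeffMap {V : HopfRep A} (ξ : Module.Dual ℂ V.carrier) : V ⟶ fn A :=
  mk' (toFn.toLinearMap ∘ₗ LinearMap.compRight ℂ ξ ∘ₗ V.ρ.toLinearMap.flip)
    (fun a x => by
      apply toFn.symm.injective
      ext b
      rw [fn_apply]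
      simp)

@[simp] lemma coeffMap_apply {V : HopfRep A} (ξ : Module.Dual ℂ V.carrier) (v : V.carrier) (b : A) :
    evalAt b (lin (coeffMap ξ) v) = ξ (V.ρ b v) := rfl

lemma evalAt_one_coeffMap {V : HopfRep A} (ξ : Module.Dual ℂ V.carrier) :
    evalAt 1 ∘ₗ lin (coeffMap ξ) = ξ := by
  ext v; simp

lemma evalAt_ext {f g : (fn A).carrier} (h : ∀ a, evalAt a f = evalAt a g) : f = g :=
  LinearMap.ext (f := show Module.Dual ℂ A from f) (g := show Module.Dual ℂ A from g) h

lemma evalAt_ρ (a b : A) (f : (fn A).carrier) : evalAt b ((fn A).ρ a f) = evalAt (b * a) f := rfl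

/-- A morphism to the function algebra is determined by its composition with evaluation at `1`. -/
lemma hom_fn_ext {V : HopfRep A} {f g : V ⟶ fn A}
    (h : evalAt 1 ∘ₗ lin f = evalAt 1 ∘ₗ lin g) : f = g := by
  ext v
  refine evalAt_ext fun a => ?_
  have h1 := LinearMap.congr_fun h (V.ρ a v)
  simp only [LinearMap.comp_apply, lin_comm, evalAt_ρ, one_mul] at h1
  exact h1

end Objects
end HopfRep
end

noncomputable section

open CategoryTheory MonoidalCategory
open scoped TensorProduct

namespace HopfRep

open HopfAlgebra Coalgebra

section Character

variable {A : Type} [Ring A] [HopfAlgebra ℂ A]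

/-- The convolution product of functions: `b ↦ f(b₍₁₎) g(b₍₂₎)`. -/
def conv (f g : Module.Dual ℂ A) : Module.Dual ℂ A :=
  LinearMap.mul' ℂ ℂ ∘ₗ TensorProduct.map f g ∘ₗ comul

lemma conv_repr (f g : Module.Dual ℂ A) {b : A} {ι : Type*} (r : Coalgebra.Repr ℂ b ι) :
    conv f g b = ∑ i ∈ r.index, f (r.left i) * g (r.right i) := by
  simp [conv, ← r.eq]

lemma conv_assoc (f g h : Module.Dual ℂ A) : conv (conv f g) h = conv f (conv g h) :=
  congrArg WithConv.ofConv
    (mul_assoc (WithConv.toConv f : WithConv (A →ₗ[ℂ] ℂ)) (WithConv.toConv g) (WithConv.toConv h))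

lemma conv_counit (f : Module.Dual ℂ A) : conv f counit = f :=
  congrArg WithConv.ofConv (mul_one (WithConv.toConv f : WithConv (A →ₗ[ℂ] ℂ)))

lemma counit_conv (f : Module.Dual ℂ A) : conv counit f = f :=
  congrArg WithConv.ofConv (one_mul (WithConv.toConv f : WithConv (A →ₗ[ℂ] ℂ)))

/-- Convolution on the right. -/
def convR (c : Module.Dual ℂ A) : Module.Dual ℂ A →ₗ[ℂ] Module.Dual ℂ A where
  toFun g := conv g c
  map_add' f g := by ext b; simp [conv_repr _ _ (ℛ ℂ b), add_mul, Finset.sum_add_distrib]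
  map_smul' k f := by ext b; simp [conv_repr _ _ (ℛ ℂ b), Finset.mul_sum, mul_assoc]

/-- Convolution on the left. -/
def convL (c : Module.Dual ℂ A) : Module.Dual ℂ A →ₗ[ℂ] Module.Dual ℂ A where
  toFun g := conv c g
  map_add' f g := by ext b; simp [conv_repr _ _ (ℛ ℂ b), mul_add, Finset.sum_add_distrib]
  map_smul' k f := by
    ext b; simp [conv_repr _ _ (ℛ ℂ b), Finset.mul_sum, mul_left_comm]

@[simp] lemma convR_apply (c g : Module.Dual ℂ A) : convR c g = conv g c := rfl
@[simp] lemma convL_apply (c g : Module.Dual ℂ A) : convL c g = conv c g := rfl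

lemma sum_conv {ι : Type*} (s : Finset ι) (f : ι → Module.Dual ℂ A) (g : Module.Dual ℂ A) :
    ∑ i ∈ s, conv (f i) g = conv (∑ i ∈ s, f i) g := (map_sum (convR g) f s).symm
lemma conv_sum {ι : Type*} (s : Finset ι) (f : ι → Module.Dual ℂ A) (g : Module.Dual ℂ A) :
    ∑ i ∈ s, conv g (f i) = conv g (∑ i ∈ s, f i) := (map_sum (convL g) f s).symm
lemma smul_conv (c : ℂ) (f g : Module.Dual ℂ A) : conv (c • f) g = c • conv f g :=
  (convR g).map_smul c f
lemma conv_smul (c : ℂ) (f g : Module.Dual ℂ A) : conv f (c • g) = c • conv f g :=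
  (convL f).map_smul c g

/-- Left translation of functions: `g ↦ g (b ·)`. -/
def lt (b : A) : Module.Dual ℂ A →ₗ[ℂ] Module.Dual ℂ A :=
  Module.Dual.transpose (R := ℂ) (LinearMap.mulLeft ℂ b)

/-- Right translation of functions: `g ↦ g (· b)`. -/
def rt (b : A) : Module.Dual ℂ A →ₗ[ℂ] Module.Dual ℂ A :=
  Module.Dual.transpose (R := ℂ) (LinearMap.mulRight ℂ b)

@[simp] lemma lt_apply (b x : A) (g : Module.Dual ℂ A) : lt b g x = g (b * x) := rfl
@[simp] lemma rt_apply (b x : A) (g : Module.Dual ℂ A) : rt b g x = g (x * b) := rfl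

lemma lt_conv (f g : Module.Dual ℂ A) {b : A} {ι : Type*} (r : Coalgebra.Repr ℂ b ι) :
    lt b (conv f g) = ∑ i ∈ r.index, conv (lt (r.left i) f) (lt (r.right i) g) := by
  ext x
  rw [lt_apply, LinearMap.sum_apply]
  simp only [conv_repr _ _ (ℛ ℂ x)]
  simp [conv, Bialgebra.comul_mul, ← r.eq, ← (ℛ ℂ x).eq, Finset.sum_mul_sum]

lemma rt_conv (f g : Module.Dual ℂ A) {b : A} {ι : Type*} (r : Coalgebra.Repr ℂ b ι) :
    rt b (conv f g) = ∑ i ∈ r.index, conv (rt (r.left i) f) (rt (r.right i) g) := by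
  ext x
  rw [rt_apply, LinearMap.sum_apply]
  simp only [conv_repr _ _ (ℛ ℂ x)]
  rw [Finset.sum_comm]
  simp [conv, Bialgebra.comul_mul, ← r.eq, ← (ℛ ℂ x).eq, Finset.sum_mul_sum]

variable [Module.Finite ℂ A]

/-- The character of the regular module: `b ↦ tr (x ↦ b x)`. -/
def regChar (A : Type) [Ring A] [Algebra ℂ A] : Module.Dual ℂ A :=
  LinearMap.trace ℂ A ∘ₗ LinearMap.mul ℂ A

lemma regChar_one : regChar A 1 = Module.finrank ℂ A := by
  have : LinearMap.mul ℂ A 1 = LinearMap.id := by ext; simp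
  simp [regChar, this]

lemma trace_lt (b : A) : LinearMap.trace ℂ _ (lt b) = regChar A b := by
  rw [lt, LinearMap.trace_transpose']; rfl

lemma trace_rt (hS : ∀ a : A, antipode ℂ (antipode ℂ a) = a) (b : A) :
    LinearMap.trace ℂ _ (rt b) = regChar A (antipode ℂ b) := by
  rw [rt, LinearMap.trace_transpose']
  let e : A ≃ₗ[ℂ] A := LinearEquiv.ofInvolutive (antipode ℂ) hS
  have h : LinearMap.mul ℂ A (antipode ℂ b) = e.conj (LinearMap.mulRight ℂ b) := by
    ext x
    change antipode ℂ b * x = antipode ℂ (antipode ℂ x * b)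
    rw [antipode_mul_antidistrib, hS]
  change _ = LinearMap.trace ℂ A (LinearMap.mul ℂ A (antipode ℂ b))
  rw [h, LinearMap.trace_conj']

lemma basis_expand (f : Module.Dual ℂ A) (x y : A) :
    ∑ j, f (x * Module.finBasis ℂ A j) * (Module.finBasis ℂ A).coord j y = f (x * y) := by
  have h := congrArg (fun z => f (x * z)) ((Module.finBasis ℂ A).sum_repr y)
  simp only [Finset.mul_sum, map_sum, mul_smul_comm, map_smul, smul_eq_mul] at h
  rw [← h]
  exact Finset.sum_congr rfl fun j _ => mul_comm _ _

/-- The regular character is a left integral: `χ(b₍₁₎) f(b₍₂₎) = f(1) χ(b)`. -/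
lemma regChar_conv (hS : ∀ a : A, antipode ℂ (antipode ℂ a) = a) (f : Module.Dual ℂ A) :
    conv (regChar A) f = f 1 • regChar A := by
  ext b
  let β := Module.finBasis ℂ A
  let c : Fin (Module.finrank ℂ A) → Module.Dual ℂ A := fun j => rt (β j) f
  let d : Fin (Module.finrank ℂ A) → Module.Dual ℂ A := fun j => β.coord j ∘ₗ antipode ℂ
  have h1 : ∑ j, convR (c j) ∘ₗ convR (d j) = f 1 • LinearMap.id := by
    have : ∑ j, conv (d j) (c j) = f 1 • counit := by
      ext z
      have h := congrArg f (mul_antipode₄ hS z)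
      rw [LinearMap.sum_apply]
      simp only [conv_repr _ _ (ℛ ℂ z)]
      rw [Finset.sum_comm]
      rw [← (ℛ ℂ z).eq] at h
      simp only [map_sum, LinearMap.rTensor_tmul, mulOp_tmul, Algebra.algebraMap_eq_smul_one,
        map_smul] at h
      simp only [c, d, LinearMap.comp_apply, rt_apply]
      simp only [mul_comm (β.coord _ _), β, basis_expand]
      rw [h]; simp [mul_comm]
    ext1 g
    simp only [LinearMap.sum_apply, LinearMap.comp_apply, convR_apply, conv_assoc]
    rw [conv_sum, this, conv_smul, conv_counit]; rfl
  have h2 : ∑ j, convR (d j) ∘ₗ lt b ∘ₗ convR (c j) =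
      ∑ i ∈ (ℛ ℂ b).index, f ((ℛ ℂ b).right i) • lt ((ℛ ℂ b).left i) := by
    have key : ∀ q : A, ∑ j, conv (lt q (c j)) (d j) = f q • counit := by
      intro q
      ext z
      have h := congrArg (fun y => f (q * y)) (mul_antipode₂ z)
      rw [LinearMap.sum_apply]
      simp only [conv_repr _ _ (ℛ ℂ z)]
      rw [Finset.sum_comm]
      rw [← (ℛ ℂ z).eq] at h
      simp only [map_sum, LinearMap.lTensor_tmul, LinearMap.mul'_apply, Finset.mul_sum,
        Algebra.algebraMap_eq_smul_one, mul_smul_comm, map_smul, mul_one, ← mul_assoc] at h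
      simp only [c, d, LinearMap.comp_apply, rt_apply, lt_apply]
      simp only [β, basis_expand]
      rw [h]; simp [mul_comm]
    ext1 g
    simp only [LinearMap.sum_apply, LinearMap.comp_apply, convR_apply, lt_conv _ _ (ℛ ℂ b)]
    simp only [← sum_conv]
    rw [Finset.sum_comm]
    refine Finset.sum_congr rfl fun i _ => ?_
    simp only [conv_assoc]
    rw [conv_sum, key, conv_smul, conv_counit]; rfl
  have h3 := congrArg (LinearMap.trace ℂ _) h2
  rw [map_sum, map_sum] at h3
  have h4 : ∀ j, LinearMap.trace ℂ _ (convR (d j) ∘ₗ lt b ∘ₗ convR (c j)) =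
      LinearMap.trace ℂ _ (lt b ∘ₗ convR (c j) ∘ₗ convR (d j)) := fun j =>
    LinearMap.trace_comp_comm' (lt b ∘ₗ convR (c j)) (convR (d j))
  have h5 : ∑ j, lt b ∘ₗ convR (c j) ∘ₗ convR (d j) = lt b ∘ₗ ∑ j, convR (c j) ∘ₗ convR (d j) := by
    ext1 g; simp only [LinearMap.sum_apply, LinearMap.comp_apply, map_sum]
  simp only [h4] at h3
  rw [← map_sum, h5, h1] at h3
  simp only [LinearMap.comp_smul, map_smul, LinearMap.comp_id, trace_lt] at h3
  rw [conv_repr _ _ (ℛ ℂ b)]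
  simp only [LinearMap.smul_apply, h3, smul_eq_mul, mul_comm]

/-- The transposed antipode of the regular character is a right integral. -/
lemma conv_regChar (hS : ∀ a : A, antipode ℂ (antipode ℂ a) = a) (f : Module.Dual ℂ A) :
    conv f (regChar A ∘ₗ antipode ℂ) = f 1 • (regChar A ∘ₗ antipode ℂ) := by
  ext b
  let β := Module.finBasis ℂ A
  let c : Fin (Module.finrank ℂ A) → Module.Dual ℂ A := fun j => β.coord j
  let d : Fin (Module.finrank ℂ A) → Module.Dual ℂ A := fun j => rt (β j) f ∘ₗ antipode ℂ
  have h1 : ∑ j, convL (c j) ∘ₗ convL (d j) = f 1 • LinearMap.id := by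
    have : ∑ j, conv (c j) (d j) = f 1 • counit := by
      ext z
      have h := congrArg f (mul_antipode₃ hS z)
      rw [LinearMap.sum_apply]
      simp only [conv_repr _ _ (ℛ ℂ z)]
      rw [Finset.sum_comm]
      rw [← (ℛ ℂ z).eq] at h
      simp only [map_sum, LinearMap.lTensor_tmul, mulOp_tmul, Algebra.algebraMap_eq_smul_one,
        map_smul] at h
      simp only [c, d, LinearMap.comp_apply, rt_apply]
      simp only [mul_comm (β.coord _ _), β, basis_expand]
      rw [h]; simp [mul_comm]
    ext1 g
    simp only [LinearMap.sum_apply, LinearMap.comp_apply, convL_apply, ← conv_assoc]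
    rw [sum_conv, this, smul_conv, counit_conv]; rfl
  have h2 : ∑ j, convL (d j) ∘ₗ rt b ∘ₗ convL (c j) =
      ∑ i ∈ (ℛ ℂ b).index, f ((ℛ ℂ b).left i) • rt ((ℛ ℂ b).right i) := by
    have key : ∀ q : A, ∑ j, conv (d j) (rt q (c j)) = f q • counit := by
      intro q
      ext z
      have h := congrArg (fun y => f (y * q)) (mul_antipode₁ z)
      rw [LinearMap.sum_apply]
      simp only [conv_repr _ _ (ℛ ℂ z)]
      rw [Finset.sum_comm]
      rw [← (ℛ ℂ z).eq] at h
      simp only [map_sum, LinearMap.rTensor_tmul, LinearMap.mul'_apply, Finset.sum_mul,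
        Algebra.algebraMap_eq_smul_one, smul_mul_assoc, map_smul, one_mul, mul_assoc] at h
      simp only [c, d, LinearMap.comp_apply, rt_apply]
      simp only [β, basis_expand]
      rw [h]; simp [mul_comm]
    ext1 g
    simp only [LinearMap.sum_apply, LinearMap.comp_apply, convL_apply, rt_conv _ _ (ℛ ℂ b)]
    simp only [← conv_sum]
    rw [Finset.sum_comm]
    refine Finset.sum_congr rfl fun i _ => ?_
    simp only [← conv_assoc]
    rw [sum_conv, key, smul_conv, counit_conv]; rfl
  have h3 := congrArg (LinearMap.trace ℂ _) h2
  rw [map_sum, map_sum] at h3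
  have h4 : ∀ j, LinearMap.trace ℂ _ (convL (d j) ∘ₗ rt b ∘ₗ convL (c j)) =
      LinearMap.trace ℂ _ (rt b ∘ₗ convL (c j) ∘ₗ convL (d j)) := fun j =>
    LinearMap.trace_comp_comm' (rt b ∘ₗ convL (c j)) (convL (d j))
  have h5 : ∑ j, rt b ∘ₗ convL (c j) ∘ₗ convL (d j) = rt b ∘ₗ ∑ j, convL (c j) ∘ₗ convL (d j) := by
    ext1 g; simp only [LinearMap.sum_apply, LinearMap.comp_apply, map_sum]
  simp only [h4] at h3
  rw [← map_sum, h5, h1] at h3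
  simp only [LinearMap.comp_smul, map_smul, LinearMap.comp_id, trace_rt hS] at h3
  rw [conv_repr _ _ (ℛ ℂ b)]
  simp only [LinearMap.smul_apply, LinearMap.comp_apply, h3, smul_eq_mul]

/-- The product of the function algebra, as a morphism. -/
def fnMul (A : Type) [Ring A] [HopfAlgebra ℂ A] [Module.Finite ℂ A] : fn A ⊗ fn A ⟶ fn A :=
  coeffMap (dmul (evalAt 1) (evalAt 1))

lemma fnMul_apply (f g : Module.Dual ℂ A) :
    lin (fnMul A) (tmul (toFn f) (toFn g)) = toFn (conv f g) := by
  refine evalAt_ext fun b => ?_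
  rw [fnMul, coeffMap_apply]
  have h := congrArg (dmul (V := fn A) (W := fn A) (evalAt 1) (evalAt 1))
    (diag_apply (fn A).ρ (fn A).ρ b (toFn f) (toFn g))
  refine h.trans ?_
  rw [evalAt_toFn, conv_repr _ _ (ℛ ℂ b), ← (ℛ ℂ b).eq]
  simp only [map_sum]
  refine Finset.sum_congr rfl fun i _ => ?_
  change evalAt 1 ((fn A).ρ _ (toFn f)) * evalAt 1 ((fn A).ρ _ (toFn g)) = _
  rw [evalAt_ρ, evalAt_ρ, one_mul, one_mul]; rfl

end Character
end HopfRep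
end

noncomputable section

open CategoryTheory

section Duality

open Bicategory

universe w₁ v₁ u₁

variable {B : Type u₁} [Bicategory.{w₁, v₁} B]

/-- A choice, for every `1`-cell `X : a ⟶ b`, of a rigidity pair `ε : X ⊗ X* ⟶ 1`,
`δ : 1 ⟶ X* ⊗ X` exhibiting the given `1`-cell `X* : b ⟶ a` as its dual. -/
structure RigidityPairs (B : Type u₁) [Bicategory.{w₁, v₁} B]
    (dual : ∀ ⦃a b : B⦄, (a ⟶ b) → (b ⟶ a)) where
  pair : ∀ {a b : B} (X : a ⟶ b), X ≫ dual X ⟶ 𝟙 a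
  copair : ∀ {a b : B} (X : a ⟶ b), 𝟙 b ⟶ dual X ≫ X
  hook : ∀ {a b : B} (X : a ⟶ b),
    (ρ_ X).inv ≫ X ◁ copair X ≫ (α_ X (dual X) X).inv ≫ pair X ▷ X ≫ (λ_ X).hom = 𝟙 X
  hook_dual : ∀ {a b : B} (X : a ⟶ b),
    (λ_ (dual X)).inv ≫ copair X ▷ dual X ≫ (α_ (dual X) X (dual X)).hom ≫ dual X ◁ pair X ≫
      (ρ_ (dual X)).hom = 𝟙 (dual X)

namespace RigidityPairs

variable {dual : ∀ ⦃a b : B⦄, (a ⟶ b) → (b ⟶ a)}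

/-- The transposed morphism `Y* ⟶ X*` of `f : X ⟶ Y`. -/
def transpose (R : RigidityPairs B dual) {a b : B} {X Y : a ⟶ b} (f : X ⟶ Y) : dual Y ⟶ dual X :=
  (λ_ (dual Y)).inv ≫ R.copair X ▷ dual Y ≫ (α_ (dual X) X (dual Y)).hom ≫ dual X ◁ (f ▷ dual Y) ≫
    dual X ◁ R.pair Y ≫ (ρ_ (dual X)).hom

end RigidityPairs

/-- A Frobenius duality: a choice of rigidity pairs, together with identifications
`X ≅ X**` and `Y* ⊗ X* ≅ (X ⊗ Y)*`, such that `ε` is multiplicative,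
`ε_{X ⊗ Y} = ε_X (1 ⊗ ε_Y ⊗ 1)`, and `f** = f`, coherently.
A strict Frobenius duality is one in which the identifications are identities. -/
structure FrobeniusDuality (B : Type u₁) [Bicategory.{w₁, v₁} B]
    (dual : ∀ ⦃a b : B⦄, (a ⟶ b) → (b ⟶ a)) extends RigidityPairs B dual where
  bidual : ∀ {a b : B} (X : a ⟶ b), X ≅ dual (dual X)
  dualComp : ∀ {a b c : B} (X : a ⟶ b) (Y : b ⟶ c), dual Y ≫ dual X ≅ dual (X ≫ Y)
  multiplicative : ∀ {a b c : B} (X : a ⟶ b) (Y : b ⟶ c),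
    (X ≫ Y) ◁ (dualComp X Y).hom ≫ pair (X ≫ Y) =
      (α_ X Y (dual Y ≫ dual X)).hom ≫ X ◁ (α_ Y (dual Y) (dual X)).inv ≫ X ◁ (pair Y ▷ dual X) ≫
        X ◁ (λ_ (dual X)).hom ≫ pair X
  bidual_natural : ∀ {a b : B} {X Y : a ⟶ b} (f : X ⟶ Y),
    f ≫ (bidual Y).hom =
      (bidual X).hom ≫ toRigidityPairs.transpose (toRigidityPairs.transpose f)
  bidual_comp : ∀ {a b c : B} (X : a ⟶ b) (Y : b ⟶ c),
    (bidual (X ≫ Y)).hom ≫ toRigidityPairs.transpose (dualComp X Y).hom =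
      (bidual X).hom ▷ Y ≫ dual (dual X) ◁ (bidual Y).hom ≫ (dualComp (dual Y) (dual X)).hom
  bidual_dual : ∀ {a b : B} (X : a ⟶ b),
    (bidual (dual X)).hom ≫ toRigidityPairs.transpose (bidual X).hom = 𝟙 (dual X)

namespace FrobeniusDuality

variable {dual : ∀ ⦃a b : B⦄, (a ⟶ b) → (b ⟶ a)} (D : FrobeniusDuality B dual)

/-- The left trace `1 ⟶ X ⊗ X* ⟶ X ⊗ X* ⟶ 1` of an endomorphism of `X`. -/
def leftTrace {a b : B} {X : a ⟶ b} (f : X ⟶ X) : 𝟙 a ⟶ 𝟙 a :=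
  D.copair (dual X) ≫ (D.bidual X).inv ▷ dual X ≫ f ▷ dual X ≫ D.pair X

/-- The right trace `1 ⟶ X* ⊗ X ⟶ X* ⊗ X ⟶ 1` of an endomorphism of `X`. -/
def rightTrace {a b : B} {X : a ⟶ b} (f : X ⟶ X) : 𝟙 b ⟶ 𝟙 b :=
  D.copair X ≫ dual X ◁ f ≫ dual X ◁ (D.bidual X).hom ≫ D.pair (dual X)

/-- Left and right traces agree (as scalars). -/
def IsNeutral [∀ a b : B, ∀ X Y : a ⟶ b, SMul ℂ (X ⟶ Y)] : Prop :=
  ∀ {a b : B} (X : a ⟶ b) (f : X ⟶ X), ∃ s : ℂ,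
    D.leftTrace f = s • 𝟙 (𝟙 a) ∧ D.rightTrace f = s • 𝟙 (𝟙 b)

end FrobeniusDuality

end Duality

section Tensor

open MonoidalCategory

variable {T : Type u} [Category.{v} T] [MonoidalCategory T]

/-- A Frobenius duality in a tensor category, regarded as a bicategory with one object. -/
abbrev TensorDuality (dual : T → T) : Type (max u v) :=
  FrobeniusDuality (MonoidalSingleObj T) (fun _ _ (X : T) => dual X)

instance [Preadditive T] [Linear ℂ T] (a b : MonoidalSingleObj T) (X Y : a ⟶ b) :
    SMul ℂ (X ⟶ Y) :=
  inferInstanceAs (SMul ℂ ((show T from X) ⟶ (show T from Y)))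

namespace TensorDuality

variable {dual : T → T} (D : TensorDuality dual)

/-- The pairing `ε_X : X ⊗ X* ⟶ 1`. -/
def pair (X : T) : X ⊗ dual X ⟶ 𝟙_ T :=
  RigidityPairs.pair (a := MonoidalSingleObj.star T) (b := MonoidalSingleObj.star T)
    D.toRigidityPairs X

/-- The copairing `δ_X : 1 ⟶ X* ⊗ X`. -/
def copair (X : T) : 𝟙_ T ⟶ dual X ⊗ X :=
  RigidityPairs.copair (a := MonoidalSingleObj.star T) (b := MonoidalSingleObj.star T)
    D.toRigidityPairs X

lemma hook (X : T) :
    (ρ_ X).inv ≫ X ◁ D.copair X ≫ (α_ X (dual X) X).inv ≫ D.pair X ▷ X ≫ (λ_ X).hom = 𝟙 X :=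
  RigidityPairs.hook (a := MonoidalSingleObj.star T) (b := MonoidalSingleObj.star T)
    D.toRigidityPairs X

lemma hook_dual (X : T) :
    (λ_ (dual X)).inv ≫ D.copair X ▷ dual X ≫ (α_ (dual X) X (dual X)).hom ≫ dual X ◁ D.pair X ≫
      (ρ_ (dual X)).hom = 𝟙 (dual X) :=
  RigidityPairs.hook_dual (a := MonoidalSingleObj.star T) (b := MonoidalSingleObj.star T)
    D.toRigidityPairs X

/-- The identification `X ≅ X**`. -/
def bidual (X : T) : X ≅ dual (dual X) :=
  FrobeniusDuality.bidual (a := MonoidalSingleObj.star T) (b := MonoidalSingleObj.star T) D X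

/-- The identification `Y* ⊗ X* ≅ (X ⊗ Y)*`. -/
def dualComp (X Y : T) : dual Y ⊗ dual X ≅ dual (X ⊗ Y) :=
  FrobeniusDuality.dualComp (a := MonoidalSingleObj.star T) (b := MonoidalSingleObj.star T)
    (c := MonoidalSingleObj.star T) D X Y

/-- The transposed morphism `Y* ⟶ X*` of `f : X ⟶ Y`. -/
def transpose {X Y : T} (f : X ⟶ Y) : dual Y ⟶ dual X :=
  RigidityPairs.transpose (a := MonoidalSingleObj.star T) (b := MonoidalSingleObj.star T)
    D.toRigidityPairs f

/-- The pairing `X* ⊗ X ≅ X* ⊗ X** ⟶ 1`. -/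
def pair' (X : T) : dual X ⊗ X ⟶ 𝟙_ T := dual X ◁ (D.bidual X).hom ≫ D.pair (dual X)

end TensorDuality

end Tensor
end

noncomputable section

open CategoryTheory
open scoped TensorProduct

section Trivializations

open MonoidalCategory HopfRep Functor.LaxMonoidal Functor.OplaxMonoidal

variable {T : Type u} [Category.{v} T] [Preadditive T] [Linear ℂ T] [MonoidalCategory T]
  [MonoidalPreadditive T] [MonoidalLinear ℂ T]
  {A : Type} [Ring A] [HopfAlgebra ℂ A] (F : HopfRep A ⥤ T) [F.Monoidal]

/-- A left action on `X`: trivializing isomorphisms `F(V) ⊗ X ≅ X ⊗ V`, natural in `V` and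
compatible with tensor products. Here `X ⊗ V` is the multiple of `X` by the vector space `V`; the
morphism `X ⊗ V ⟶ F(V) ⊗ X` is recorded by its restrictions `hom V v` to `X ⊗ v`, and
the morphism `F(V) ⊗ X ⟶ X ⊗ V` by its components `inv V ξ` along the functionals `ξ`. -/
structure TrivL (X : T) where
  hom : ∀ V : HopfRep A, V.carrier →ₗ[ℂ] (X ⟶ F.obj V ⊗ X)
  inv : ∀ V : HopfRep A, Module.Dual ℂ V.carrier →ₗ[ℂ] (F.obj V ⊗ X ⟶ X)
  hom_inv : ∀ V v ξ, hom V v ≫ inv V ξ = ξ v • 𝟙 X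
  inv_hom : ∀ V, ∑ i, inv V ((bas V).coord i) ≫ hom V (bas V i) = 𝟙 (F.obj V ⊗ X)
  naturality : ∀ {V W : HopfRep A} (f : V ⟶ W) (v : V.carrier),
    hom W (lin f v) = hom V v ≫ F.map f ▷ X
  unit : hom (𝟙_ _) one ≫ η F ▷ X = (λ_ X).inv
  assoc : ∀ (V W : HopfRep A) (v : V.carrier) (w : W.carrier),
    hom (V ⊗ W) (tmul v w) ≫ δ F V W ▷ X =
      hom V v ≫ F.obj V ◁ hom W w ≫ (α_ (F.obj V) (F.obj W) X).inv

/-- A right action on `X`: trivializing isomorphisms `X ⊗ F(W) ≅ W ⊗ X`, natural in `W` and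
compatible with tensor products. -/
structure TrivR (X : T) where
  hom : ∀ V : HopfRep A, V.carrier →ₗ[ℂ] (X ⟶ X ⊗ F.obj V)
  inv : ∀ V : HopfRep A, Module.Dual ℂ V.carrier →ₗ[ℂ] (X ⊗ F.obj V ⟶ X)
  hom_inv : ∀ V v ξ, hom V v ≫ inv V ξ = ξ v • 𝟙 X
  inv_hom : ∀ V, ∑ i, inv V ((bas V).coord i) ≫ hom V (bas V i) = 𝟙 (X ⊗ F.obj V)
  naturality : ∀ {V W : HopfRep A} (f : V ⟶ W) (v : V.carrier),
    hom W (lin f v) = hom V v ≫ X ◁ F.map f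
  unit : hom (𝟙_ _) one ≫ X ◁ η F = (ρ_ X).inv
  assoc : ∀ (V W : HopfRep A) (v : V.carrier) (w : W.carrier),
    hom (V ⊗ W) (tmul v w) ≫ X ◁ δ F V W =
      hom W w ≫ hom V v ▷ F.obj W ≫ (α_ X (F.obj V) (F.obj W)).hom

lemma dual_ext_dmul {V W : HopfRep A} {M : Type*} [AddCommGroup M] [Module ℂ M]
    {f g : Module.Dual ℂ (V ⊗ W).carrier →ₗ[ℂ] M}
    (h : ∀ ξ ζ, f (dmul ξ ζ) = g (dmul ξ ζ)) : f = g := by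
  let b : Module.Basis _ ℂ (V ⊗ W).carrier := (bas V).tensorProduct (bas W)
  haveI : Module.Finite ℂ (V ⊗ W).carrier := (V ⊗ W).fin
  refine (Module.Basis.dualBasis b).ext fun ij => ?_
  have : b.dualBasis ij = dmul ((bas V).coord ij.1) ((bas W).coord ij.2) := by
    refine b.ext fun kl => ?_
    have hb : b kl = tmul (bas V kl.1) (bas W kl.2) := Module.Basis.tensorProduct_apply' _ _ _
    conv_rhs => rw [hb]
    rw [dmul_tmul, Module.Basis.dualBasis_apply_self]
    obtain ⟨i, j⟩ := ij
    obtain ⟨k, l⟩ := kl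
    by_cases h1 : k = i <;> by_cases h2 : l = j <;> simp [h1, h2, Finsupp.single_apply]
  rw [this, h]

/-- Two vectors on which all functionals agree: the comparison through the pairing. -/
lemma sum_coord_smul {V : HopfRep A} {M : Type*} [AddCommGroup M] [Module ℂ M]
    (f : V.carrier →ₗ[ℂ] M) (v : V.carrier) :
    ∑ i, (bas V).coord i v • f (bas V i) = f v := by
  conv_rhs => rw [← (bas V).sum_repr v]
  rw [map_sum]
  exact Finset.sum_congr rfl fun i _ => (f.map_smul _ _).symm

lemma sum_smul_coord {V : HopfRep A} {M : Type*} [AddCommGroup M] [Module ℂ M]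
    (f : Module.Dual ℂ V.carrier →ₗ[ℂ] M) (ξ : Module.Dual ℂ V.carrier) :
    ∑ i, ξ (bas V i) • f ((bas V).coord i) = f ξ := by
  have : ξ = ∑ i, ξ (bas V i) • (bas V).coord i := by
    refine (bas V).ext fun j => ?_
    simp [Finsupp.single_apply]
  conv_rhs => rw [this]
  rw [map_sum]
  exact Finset.sum_congr rfl fun i _ => (f.map_smul _ _).symm

lemma exists_smul_one (v : (𝟙_ (HopfRep A)).carrier) : ∃ c : ℂ, v = c • one := ⟨_, eq_smul_one v⟩

namespace TrivL

variable {F} {X : T}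

section Core

variable {hom : ∀ V : HopfRep A, V.carrier →ₗ[ℂ] (X ⟶ F.obj V ⊗ X)}
  {inv : ∀ V : HopfRep A, Module.Dual ℂ V.carrier →ₗ[ℂ] (F.obj V ⊗ X ⟶ X)}

lemma epiP (inv_hom : ∀ V, ∑ i, inv V ((bas V).coord i) ≫ hom V (bas V i) = 𝟙 (F.obj V ⊗ X))
    (P : T) {V : HopfRep A} {Z : T} {g h : P ⊗ F.obj V ⊗ X ⟶ Z}
    (H : ∀ v, P ◁ hom V v ≫ g = P ◁ hom V v ≫ h) : g = h := by
  have e : ∀ k : P ⊗ F.obj V ⊗ X ⟶ Z,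
      k = ∑ i, P ◁ inv V ((bas V).coord i) ≫ P ◁ hom V (bas V i) ≫ k := by
    intro k
    have := congrArg (fun t => P ◁ t ≫ k) (inv_hom V)
    simpa [Preadditive.sum_comp, whiskerLeft_sum] using this.symm
  rw [e g, e h]
  simp only [H]

lemma monoP (inv_hom : ∀ V, ∑ i, inv V ((bas V).coord i) ≫ hom V (bas V i) = 𝟙 (F.obj V ⊗ X))
    (P : T) {V : HopfRep A} {Z : T} {g h : Z ⟶ P ⊗ F.obj V ⊗ X}
    (H : ∀ ξ, g ≫ P ◁ inv V ξ = h ≫ P ◁ inv V ξ) : g = h := by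
  have e : ∀ k : Z ⟶ P ⊗ F.obj V ⊗ X,
      k = ∑ i, (k ≫ P ◁ inv V ((bas V).coord i)) ≫ P ◁ hom V (bas V i) := by
    intro k
    have := congrArg (fun t => k ≫ P ◁ t) (inv_hom V)
    simpa [Preadditive.comp_sum, whiskerLeft_sum] using this.symm
  rw [e g, e h]
  simp only [H]

lemma epi0 (inv_hom : ∀ V, ∑ i, inv V ((bas V).coord i) ≫ hom V (bas V i) = 𝟙 (F.obj V ⊗ X))
    {V : HopfRep A} {Z : T} {g h : F.obj V ⊗ X ⟶ Z}
    (H : ∀ v, hom V v ≫ g = hom V v ≫ h) : g = h := by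
  have e : ∀ k : F.obj V ⊗ X ⟶ Z, k = ∑ i, inv V ((bas V).coord i) ≫ hom V (bas V i) ≫ k := by
    intro k
    have := congrArg (· ≫ k) (inv_hom V)
    simpa [Preadditive.sum_comp] using this.symm
  rw [e g, e h]
  simp only [H]

lemma mono0 (inv_hom : ∀ V, ∑ i, inv V ((bas V).coord i) ≫ hom V (bas V i) = 𝟙 (F.obj V ⊗ X))
    {V : HopfRep A} {Z : T} {g h : Z ⟶ F.obj V ⊗ X}
    (H : ∀ ξ, g ≫ inv V ξ = h ≫ inv V ξ) : g = h := by
  have e : ∀ k : Z ⟶ F.obj V ⊗ X,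
      k = ∑ i, (k ≫ inv V ((bas V).coord i)) ≫ hom V (bas V i) := by
    intro k
    have := congrArg (k ≫ ·) (inv_hom V)
    simpa [Preadditive.comp_sum] using this.symm
  rw [e g, e h]
  simp only [H]

/-- An action, from the properties of the inverse morphisms. -/
def ofCore (hom : ∀ V : HopfRep A, V.carrier →ₗ[ℂ] (X ⟶ F.obj V ⊗ X))
    (inv : ∀ V : HopfRep A, Module.Dual ℂ V.carrier →ₗ[ℂ] (F.obj V ⊗ X ⟶ X))
    (hom_inv : ∀ V v ξ, hom V v ≫ inv V ξ = ξ v • 𝟙 X)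
    (inv_hom : ∀ V, ∑ i, inv V ((bas V).coord i) ≫ hom V (bas V i) = 𝟙 (F.obj V ⊗ X))
    (inv_nat : ∀ {V W : HopfRep A} (f : V ⟶ W) (ξ : Module.Dual ℂ W.carrier),
      F.map f ▷ X ≫ inv W ξ = inv V (ξ ∘ₗ lin f))
    (inv_unit : η F ▷ X ≫ (λ_ X).hom = inv (𝟙_ _) oneD)
    (inv_assoc : ∀ (V W : HopfRep A) (ξ : Module.Dual ℂ V.carrier) (ζ : Module.Dual ℂ W.carrier),
      μ F V W ▷ X ≫ inv (V ⊗ W) (dmul ξ ζ) =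
        (α_ (F.obj V) (F.obj W) X).hom ≫ F.obj V ◁ inv W ζ ≫ inv V ξ) : TrivL F X where
  hom := hom
  inv := inv
  hom_inv := hom_inv
  inv_hom := inv_hom
  naturality f v := by
    refine mono0 inv_hom fun ξ => ?_
    rw [hom_inv, Category.assoc, inv_nat, hom_inv]; rfl
  unit := by
    rw [← cancel_mono (λ_ X).hom, Category.assoc, inv_unit, hom_inv]
    simp
  assoc V W v w := by
    have key : hom (V ⊗ W) (tmul v w) =
        hom V v ≫ F.obj V ◁ hom W w ≫ (α_ (F.obj V) (F.obj W) X).inv ≫ μ F V W ▷ X := by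
      refine mono0 inv_hom fun ξ => ?_
      rw [hom_inv]
      let f : Module.Dual ℂ (V ⊗ W).carrier →ₗ[ℂ] (X ⟶ X) :=
        (LinearMap.toSpanSingleton ℂ _ (𝟙 X)) ∘ₗ LinearMap.applyₗ (tmul v w)
      let g : Module.Dual ℂ (V ⊗ W).carrier →ₗ[ℂ] (X ⟶ X) :=
        Linear.leftComp ℂ X (hom V v ≫ F.obj V ◁ hom W w ≫ (α_ (F.obj V) (F.obj W) X).inv ≫
          μ F V W ▷ X) ∘ₗ inv (V ⊗ W)
      refine LinearMap.congr_fun (f := f) (g := g) (dual_ext_dmul fun ξ ζ => ?_) ξ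
      change dmul ξ ζ (tmul v w) • 𝟙 X = (_ ≫ _ ≫ _ ≫ _) ≫ _
      simp only [Category.assoc, inv_assoc, Iso.inv_hom_id_assoc, dmul_tmul]
      rw [← MonoidalCategory.whiskerLeft_comp_assoc, hom_inv]
      simp [hom_inv, smul_smul, mul_comm]
    rw [key]
    simp

end Core

variable (L : TrivL F X)

lemma inv_naturality {V W : HopfRep A} (f : V ⟶ W) (ξ : Module.Dual ℂ W.carrier) :
    F.map f ▷ X ≫ L.inv W ξ = L.inv V (ξ ∘ₗ lin f) := by
  refine epi0 L.inv_hom fun v => ?_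
  rw [← Category.assoc, ← L.naturality, L.hom_inv, L.hom_inv]; rfl

lemma inv_unit : η F ▷ X ≫ (λ_ X).hom = L.inv (𝟙_ _) oneD := by
  refine epi0 L.inv_hom fun v => ?_
  obtain ⟨c, rfl⟩ := exists_smul_one v
  rw [L.hom_inv, map_smul, map_smul, Linear.smul_comp, reassoc_of% L.unit]
  simp

lemma hom_tmul (V W : HopfRep A) (v : V.carrier) (w : W.carrier) :
    L.hom (V ⊗ W) (tmul v w) =
      L.hom V v ≫ F.obj V ◁ L.hom W w ≫ (α_ (F.obj V) (F.obj W) X).inv ≫ μ F V W ▷ X := by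
  have := congrArg (· ≫ μ F V W ▷ X) (L.assoc V W v w)
  simpa [← comp_whiskerRight] using this

lemma inv_assoc (V W : HopfRep A) (ξ : Module.Dual ℂ V.carrier) (ζ : Module.Dual ℂ W.carrier) :
    μ F V W ▷ X ≫ L.inv (V ⊗ W) (dmul ξ ζ) =
      (α_ (F.obj V) (F.obj W) X).hom ≫ F.obj V ◁ L.inv W ζ ≫ L.inv V ξ := by
  rw [← cancel_epi (α_ (F.obj V) (F.obj W) X).inv]
  refine epiP L.inv_hom _ fun w => epi0 L.inv_hom fun v => ?_
  have h := congrArg (· ≫ L.inv (V ⊗ W) (dmul ξ ζ)) (L.hom_tmul V W v w)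
  simp only [Category.assoc, L.hom_inv, dmul_tmul] at h
  rw [← h, Iso.inv_hom_id_assoc, ← MonoidalCategory.whiskerLeft_comp_assoc, L.hom_inv]
  simp [L.hom_inv, smul_smul, mul_comm]

end TrivL

namespace TrivR

variable {F} {X : T}

section Core

variable {hom : ∀ V : HopfRep A, V.carrier →ₗ[ℂ] (X ⟶ X ⊗ F.obj V)}
  {inv : ∀ V : HopfRep A, Module.Dual ℂ V.carrier →ₗ[ℂ] (X ⊗ F.obj V ⟶ X)}

lemma epiP (inv_hom : ∀ V, ∑ i, inv V ((bas V).coord i) ≫ hom V (bas V i) = 𝟙 (X ⊗ F.obj V))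
    (P : T) {V : HopfRep A} {Z : T} {g h : (X ⊗ F.obj V) ⊗ P ⟶ Z}
    (H : ∀ v, hom V v ▷ P ≫ g = hom V v ▷ P ≫ h) : g = h := by
  have e : ∀ k : (X ⊗ F.obj V) ⊗ P ⟶ Z,
      k = ∑ i, inv V ((bas V).coord i) ▷ P ≫ hom V (bas V i) ▷ P ≫ k := by
    intro k
    have := congrArg (fun t => t ▷ P ≫ k) (inv_hom V)
    simpa [Preadditive.sum_comp, sum_whiskerRight] using this.symm
  rw [e g, e h]
  simp only [H]

lemma epi0 (inv_hom : ∀ V, ∑ i, inv V ((bas V).coord i) ≫ hom V (bas V i) = 𝟙 (X ⊗ F.obj V))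
    {V : HopfRep A} {Z : T} {g h : X ⊗ F.obj V ⟶ Z}
    (H : ∀ v, hom V v ≫ g = hom V v ≫ h) : g = h := by
  have e : ∀ k : X ⊗ F.obj V ⟶ Z, k = ∑ i, inv V ((bas V).coord i) ≫ hom V (bas V i) ≫ k := by
    intro k
    have := congrArg (· ≫ k) (inv_hom V)
    simpa [Preadditive.sum_comp] using this.symm
  rw [e g, e h]
  simp only [H]

lemma mono0 (inv_hom : ∀ V, ∑ i, inv V ((bas V).coord i) ≫ hom V (bas V i) = 𝟙 (X ⊗ F.obj V))
    {V : HopfRep A} {Z : T} {g h : Z ⟶ X ⊗ F.obj V}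
    (H : ∀ ξ, g ≫ inv V ξ = h ≫ inv V ξ) : g = h := by
  have e : ∀ k : Z ⟶ X ⊗ F.obj V,
      k = ∑ i, (k ≫ inv V ((bas V).coord i)) ≫ hom V (bas V i) := by
    intro k
    have := congrArg (k ≫ ·) (inv_hom V)
    simpa [Preadditive.comp_sum] using this.symm
  rw [e g, e h]
  simp only [H]

/-- An action, from the properties of the inverse morphisms. -/
def ofCore (hom : ∀ V : HopfRep A, V.carrier →ₗ[ℂ] (X ⟶ X ⊗ F.obj V))
    (inv : ∀ V : HopfRep A, Module.Dual ℂ V.carrier →ₗ[ℂ] (X ⊗ F.obj V ⟶ X))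
    (hom_inv : ∀ V v ξ, hom V v ≫ inv V ξ = ξ v • 𝟙 X)
    (inv_hom : ∀ V, ∑ i, inv V ((bas V).coord i) ≫ hom V (bas V i) = 𝟙 (X ⊗ F.obj V))
    (inv_nat : ∀ {V W : HopfRep A} (f : V ⟶ W) (ξ : Module.Dual ℂ W.carrier),
      X ◁ F.map f ≫ inv W ξ = inv V (ξ ∘ₗ lin f))
    (inv_unit : X ◁ η F ≫ (ρ_ X).hom = inv (𝟙_ _) oneD)
    (inv_assoc : ∀ (V W : HopfRep A) (ξ : Module.Dual ℂ V.carrier) (ζ : Module.Dual ℂ W.carrier),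
      X ◁ μ F V W ≫ inv (V ⊗ W) (dmul ξ ζ) =
        (α_ X (F.obj V) (F.obj W)).inv ≫ inv V ξ ▷ F.obj W ≫ inv W ζ) : TrivR F X where
  hom := hom
  inv := inv
  hom_inv := hom_inv
  inv_hom := inv_hom
  naturality f v := by
    refine mono0 inv_hom fun ξ => ?_
    rw [hom_inv, Category.assoc, inv_nat, hom_inv]; rfl
  unit := by
    rw [← cancel_mono (ρ_ X).hom, Category.assoc, inv_unit, hom_inv]
    simp
  assoc V W v w := by
    have key : hom (V ⊗ W) (tmul v w) =
        hom W w ≫ hom V v ▷ F.obj W ≫ (α_ X (F.obj V) (F.obj W)).hom ≫ X ◁ μ F V W := by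
      refine mono0 inv_hom fun ξ => ?_
      rw [hom_inv]
      let f : Module.Dual ℂ (V ⊗ W).carrier →ₗ[ℂ] (X ⟶ X) :=
        (LinearMap.toSpanSingleton ℂ _ (𝟙 X)) ∘ₗ LinearMap.applyₗ (tmul v w)
      let g : Module.Dual ℂ (V ⊗ W).carrier →ₗ[ℂ] (X ⟶ X) :=
        Linear.leftComp ℂ X (hom W w ≫ hom V v ▷ F.obj W ≫ (α_ X (F.obj V) (F.obj W)).hom ≫
          X ◁ μ F V W) ∘ₗ inv (V ⊗ W)
      refine LinearMap.congr_fun (f := f) (g := g) (dual_ext_dmul fun ξ ζ => ?_) ξ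
      change dmul ξ ζ (tmul v w) • 𝟙 X = (_ ≫ _ ≫ _ ≫ _) ≫ _
      simp only [Category.assoc, inv_assoc, Iso.hom_inv_id_assoc, dmul_tmul]
      rw [← comp_whiskerRight_assoc, hom_inv]
      simp [hom_inv, smul_smul, mul_comm]
    rw [key]
    simp

end Core

variable (R : TrivR F X)

lemma inv_naturality {V W : HopfRep A} (f : V ⟶ W) (ξ : Module.Dual ℂ W.carrier) :
    X ◁ F.map f ≫ R.inv W ξ = R.inv V (ξ ∘ₗ lin f) := by
  refine epi0 R.inv_hom fun v => ?_
  rw [← Category.assoc, ← R.naturality, R.hom_inv, R.hom_inv]; rfl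

lemma inv_unit : X ◁ η F ≫ (ρ_ X).hom = R.inv (𝟙_ _) oneD := by
  refine epi0 R.inv_hom fun v => ?_
  obtain ⟨c, rfl⟩ := exists_smul_one v
  rw [R.hom_inv, map_smul, map_smul, Linear.smul_comp, reassoc_of% R.unit]
  simp

lemma hom_tmul (V W : HopfRep A) (v : V.carrier) (w : W.carrier) :
    R.hom (V ⊗ W) (tmul v w) =
      R.hom W w ≫ R.hom V v ▷ F.obj W ≫ (α_ X (F.obj V) (F.obj W)).hom ≫ X ◁ μ F V W := by
  have := congrArg (· ≫ X ◁ μ F V W) (R.assoc V W v w)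
  simpa [← MonoidalCategory.whiskerLeft_comp] using this

lemma inv_assoc (V W : HopfRep A) (ξ : Module.Dual ℂ V.carrier) (ζ : Module.Dual ℂ W.carrier) :
    X ◁ μ F V W ≫ R.inv (V ⊗ W) (dmul ξ ζ) =
      (α_ X (F.obj V) (F.obj W)).inv ≫ R.inv V ξ ▷ F.obj W ≫ R.inv W ζ := by
  rw [← cancel_epi (α_ X (F.obj V) (F.obj W)).hom]
  refine epiP R.inv_hom _ fun w => epi0 R.inv_hom fun v => ?_
  have h := congrArg (· ≫ R.inv (V ⊗ W) (dmul ξ ζ)) (R.hom_tmul V W w v)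
  simp only [Category.assoc, R.hom_inv, dmul_tmul] at h
  rw [← h, Iso.hom_inv_id_assoc, ← comp_whiskerRight_assoc, R.hom_inv]
  simp [R.hom_inv, smul_smul, mul_comm]

end TrivR
end Trivializations
end

noncomputable section

open CategoryTheory
open scoped TensorProduct

section Constructors

open MonoidalCategory HopfRep Functor.LaxMonoidal Functor.OplaxMonoidal HopfAlgebra

variable {T : Type u} [Category.{v} T] [Preadditive T] [Linear ℂ T] [MonoidalCategory T]
  [MonoidalPreadditive T] [MonoidalLinear ℂ T]
  {A : Type} [Ring A] [HopfAlgebra ℂ A] (F : HopfRep A ⥤ T) [F.Monoidal]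

/-- The image of a pairing. -/
def pairF {V W : HopfRep A} (e : V ⊗ W ⟶ 𝟙_ _) : F.obj V ⊗ F.obj W ⟶ 𝟙_ T :=
  μ F V W ≫ F.map e ≫ η F

/-- The image of a copairing. -/
def copairF {V W : HopfRep A} (c : 𝟙_ _ ⟶ V ⊗ W) : 𝟙_ T ⟶ F.obj V ⊗ F.obj W :=
  Functor.LaxMonoidal.ε F ≫ F.map c ≫ δ F V W

lemma zigzagF {V W : HopfRep A} (c : 𝟙_ _ ⟶ V ⊗ W) (e : W ⊗ V ⟶ 𝟙_ _)
    (h : (λ_ V).inv ≫ c ▷ V ≫ (α_ _ _ _).hom ≫ V ◁ e ≫ (ρ_ V).hom = 𝟙 V) :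
    (λ_ (F.obj V)).inv ≫ copairF F c ▷ F.obj V ≫ (α_ _ _ _).hom ≫ F.obj V ◁ pairF F e ≫
      (ρ_ (F.obj V)).hom = 𝟙 _ := by
  have h2 := congrArg F.map h
  simp only [Functor.map_comp, Functor.Monoidal.map_leftUnitor_inv,
    Functor.Monoidal.map_whiskerRight, Functor.Monoidal.map_associator,
    Functor.Monoidal.map_whiskerLeft, Functor.Monoidal.map_rightUnitor, Functor.map_id,
    Category.assoc, Functor.Monoidal.μ_δ_assoc] at h2
  simp only [pairF, copairF, comp_whiskerRight, MonoidalCategory.whiskerLeft_comp, Category.assoc]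
  exact h2.trans (F.map_id V)

lemma zigzagF' {V W : HopfRep A} (c : 𝟙_ _ ⟶ W ⊗ V) (e : V ⊗ W ⟶ 𝟙_ _)
    (h : (ρ_ V).inv ≫ V ◁ c ≫ (α_ _ _ _).inv ≫ e ▷ V ≫ (λ_ V).hom = 𝟙 V) :
    (ρ_ (F.obj V)).inv ≫ F.obj V ◁ copairF F c ≫ (α_ _ _ _).inv ≫ pairF F e ▷ F.obj V ≫
      (λ_ (F.obj V)).hom = 𝟙 _ := by
  have h2 := congrArg F.map h
  simp only [Functor.map_comp, Functor.Monoidal.map_leftUnitor,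
    Functor.Monoidal.map_whiskerRight, Functor.Monoidal.map_associator_inv,
    Functor.Monoidal.map_whiskerLeft, Functor.Monoidal.map_rightUnitor_inv, Functor.map_id,
    Category.assoc, Functor.Monoidal.μ_δ_assoc] at h2
  simp only [pairF, copairF, comp_whiskerRight, MonoidalCategory.whiskerLeft_comp, Category.assoc]
  exact h2.trans (F.map_id V)

lemma coev_dual (V : HopfRep A) (ξ : Module.Dual ℂ V.carrier) (v : V.carrier) :
    dmul ξ (bid v) ∘ₗ lin (coev V) = ξ v • oneD := by
  refine unit_lin_ext ?_
  simp only [LinearMap.comp_apply, lin_coev, map_sum, dmul_tmul, bid_toDual, LinearMap.smul_apply,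
    oneD_one, smul_eq_mul, mul_one]
  have := sum_coord_smul (V := V) ξ v
  simpa [mul_comm] using this

lemma ev_dual (V : HopfRep A) :
    ∑ i, dmul (bid (bas V i)) ((bas V).coord i) = oneD ∘ₗ lin (ev V) := by
  refine tensor_lin_ext fun ξ v => ?_
  obtain ⟨ξ, rfl⟩ := toDual.surjective ξ
  simp only [LinearMap.sum_apply, dmul_tmul, bid_toDual, LinearMap.comp_apply, lin_ev]
  have := sum_coord_smul (V := V) ξ v
  simpa [mul_comm] using this

lemma coev'_dual (hS : ∀ a : A, antipode ℂ (antipode ℂ a) = a) (V : HopfRep A)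
    (ξ : Module.Dual ℂ V.carrier) (v : V.carrier) :
    dmul (bid v) ξ ∘ₗ lin (coev' hS V) = ξ v • oneD := by
  refine unit_lin_ext ?_
  simp only [LinearMap.comp_apply, lin_coev', map_sum, dmul_tmul, bid_toDual, LinearMap.smul_apply,
    oneD_one, smul_eq_mul, mul_one]
  have := sum_coord_smul (V := V) ξ v
  simpa [mul_comm] using this

lemma ev'_dual (hS : ∀ a : A, antipode ℂ (antipode ℂ a) = a) (V : HopfRep A) :
    ∑ i, dmul ((bas V).coord i) (bid (bas V i)) = oneD ∘ₗ lin (ev' hS V) := by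
  refine tensor_lin_ext fun v ξ => ?_
  obtain ⟨ξ, rfl⟩ := toDual.surjective ξ
  simp only [LinearMap.sum_apply, dmul_tmul, bid_toDual, LinearMap.comp_apply, lin_ev']
  have := sum_coord_smul (V := V) ξ v
  simpa [mul_comm] using this

variable {F} {X : T}

/-- A left action, given by morphisms `F(V) ⊗ X ⟶ X` for the functionals on `V`. -/
def TrivL.ofInv (inv : ∀ V : HopfRep A, Module.Dual ℂ V.carrier →ₗ[ℂ] (F.obj V ⊗ X ⟶ X))
    (inv_nat : ∀ {V W : HopfRep A} (f : V ⟶ W) (ξ : Module.Dual ℂ W.carrier),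
      F.map f ▷ X ≫ inv W ξ = inv V (ξ ∘ₗ lin f))
    (inv_unit : η F ▷ X ≫ (λ_ X).hom = inv (𝟙_ _) oneD)
    (inv_assoc : ∀ (V W : HopfRep A) (ξ : Module.Dual ℂ V.carrier) (ζ : Module.Dual ℂ W.carrier),
      μ F V W ▷ X ≫ inv (V ⊗ W) (dmul ξ ζ) =
        (α_ (F.obj V) (F.obj W) X).hom ≫ F.obj V ◁ inv W ζ ≫ inv V ξ) : TrivL F X :=
  TrivL.ofCore
    (fun V =>
      { toFun := fun v => (λ_ X).inv ≫ copairF F (coev V) ▷ X ≫ (α_ _ _ _).hom ≫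
          F.obj V ◁ inv (dual V) (bid v)
        map_add' := fun v w => by simp
        map_smul' := fun c v => by simp })
    inv
    (fun V v ξ => by
      change ((λ_ X).inv ≫ copairF F (coev V) ▷ X ≫ (α_ _ _ _).hom ≫
          F.obj V ◁ inv (dual V) (bid v)) ≫ inv V ξ = _
      simp only [Category.assoc, ← inv_assoc]
      rw [← comp_whiskerRight_assoc]
      have : copairF F (coev V) ≫ μ F V (dual V) = Functor.LaxMonoidal.ε F ≫ F.map (coev V) := by
        simp [copairF]
      rw [this, comp_whiskerRight_assoc, inv_nat, coev_dual, map_smul, ← inv_unit,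
        Linear.comp_smul, Linear.comp_smul]
      rw [← comp_whiskerRight_assoc, Functor.Monoidal.ε_η]
      simp)
    (fun V => by
      change ∑ i, inv V ((bas V).coord i) ≫ ((λ_ X).inv ≫ copairF F (coev V) ▷ X ≫
        (α_ _ _ _).hom ≫ F.obj V ◁ inv (dual V) (bid (bas V i))) = _
      have h1 : ∀ i, inv V ((bas V).coord i) ≫ ((λ_ X).inv ≫ copairF F (coev V) ▷ X ≫
          (α_ _ _ _).hom ≫ F.obj V ◁ inv (dual V) (bid (bas V i))) =
          (λ_ _).inv ≫ copairF F (coev V) ▷ (F.obj V ⊗ X) ≫ (α_ _ _ _).hom ≫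
            F.obj V ◁ (α_ _ _ _).inv ≫ F.obj V ◁ (μ F (dual V) V ▷ X ≫
              inv (dual V ⊗ V) (dmul (bid (bas V i)) ((bas V).coord i))) := by
        intro i
        rw [inv_assoc]
        simp only [MonoidalCategory.whiskerLeft_comp]
        rw [leftUnitor_inv_naturality_assoc, whisker_exchange_assoc]
        monoidal
      simp only [h1, ← Preadditive.comp_sum, ← whiskerLeft_sum, ← map_sum, ev_dual, ← inv_nat,
        ← inv_unit]
      have h2 := congrArg (· ▷ X) (zigzagF F _ _ (zigzag V))
      simp only [id_whiskerRight] at h2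
      rw [← h2]
      simp only [pairF, comp_whiskerRight, MonoidalCategory.whiskerLeft_comp]
      monoidal)
    inv_nat inv_unit inv_assoc

/-- A right action, given by morphisms `X ⊗ F(V) ⟶ X` for the functionals on `V`. -/
def TrivR.ofInv (hS : ∀ a : A, antipode ℂ (antipode ℂ a) = a)
    (inv : ∀ V : HopfRep A, Module.Dual ℂ V.carrier →ₗ[ℂ] (X ⊗ F.obj V ⟶ X))
    (inv_nat : ∀ {V W : HopfRep A} (f : V ⟶ W) (ξ : Module.Dual ℂ W.carrier),
      X ◁ F.map f ≫ inv W ξ = inv V (ξ ∘ₗ lin f))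
    (inv_unit : X ◁ η F ≫ (ρ_ X).hom = inv (𝟙_ _) oneD)
    (inv_assoc : ∀ (V W : HopfRep A) (ξ : Module.Dual ℂ V.carrier) (ζ : Module.Dual ℂ W.carrier),
      X ◁ μ F V W ≫ inv (V ⊗ W) (dmul ξ ζ) =
        (α_ X (F.obj V) (F.obj W)).inv ≫ inv V ξ ▷ F.obj W ≫ inv W ζ) : TrivR F X :=
  TrivR.ofCore
    (fun V =>
      { toFun := fun v => (ρ_ X).inv ≫ X ◁ copairF F (coev' hS V) ≫ (α_ _ _ _).inv ≫
          inv (dual V) (bid v) ▷ F.obj V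
        map_add' := fun v w => by simp
        map_smul' := fun c v => by simp })
    inv
    (fun V v ξ => by
      change ((ρ_ X).inv ≫ X ◁ copairF F (coev' hS V) ≫ (α_ _ _ _).inv ≫
          inv (dual V) (bid v) ▷ F.obj V) ≫ inv V ξ = _
      simp only [Category.assoc, ← inv_assoc]
      rw [← MonoidalCategory.whiskerLeft_comp_assoc]
      have : copairF F (coev' hS V) ≫ μ F (dual V) V =
          Functor.LaxMonoidal.ε F ≫ F.map (coev' hS V) := by
        simp [copairF]
      rw [this, MonoidalCategory.whiskerLeft_comp_assoc, inv_nat, coev'_dual, map_smul, ← inv_unit,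
        Linear.comp_smul, Linear.comp_smul]
      rw [← MonoidalCategory.whiskerLeft_comp_assoc, Functor.Monoidal.ε_η]
      simp)
    (fun V => by
      change ∑ i, inv V ((bas V).coord i) ≫ ((ρ_ X).inv ≫ X ◁ copairF F (coev' hS V) ≫
        (α_ _ _ _).inv ≫ inv (dual V) (bid (bas V i)) ▷ F.obj V) = _
      have h1 : ∀ i, inv V ((bas V).coord i) ≫ ((ρ_ X).inv ≫ X ◁ copairF F (coev' hS V) ≫
          (α_ _ _ _).inv ≫ inv (dual V) (bid (bas V i)) ▷ F.obj V) =
          (ρ_ _).inv ≫ (X ⊗ F.obj V) ◁ copairF F (coev' hS V) ≫ (α_ _ _ _).inv ≫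
            (α_ _ _ _).hom ▷ F.obj V ≫ (X ◁ μ F V (dual V) ≫
              inv (V ⊗ dual V) (dmul ((bas V).coord i) (bid (bas V i)))) ▷ F.obj V := by
        intro i
        rw [inv_assoc]
        simp only [comp_whiskerRight]
        rw [rightUnitor_inv_naturality_assoc, ← whisker_exchange_assoc]
        monoidal
      simp only [h1, ← Preadditive.comp_sum, ← sum_whiskerRight, ← map_sum, ev'_dual hS, ← inv_nat,
        ← inv_unit]
      have h2 := congrArg (X ◁ ·) (zigzagF' F _ _ (zigzag' hS V))
      simp only [whiskerLeft_id] at h2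
      rw [← h2]
      simp only [pairF, comp_whiskerRight, MonoidalCategory.whiskerLeft_comp]
      monoidal)
    inv_nat inv_unit inv_assoc

lemma coev_sum (V : HopfRep A) :
    ∑ i, tmul (bas V i) (toDual ((bas V).coord i)) = lin (coev V) one := (lin_coev V).symm

lemma ev_lin (V : HopfRep A) (ξ : Module.Dual ℂ V.carrier) (v : V.carrier) :
    lin (ev V) (tmul (toDual ξ) v) = ξ v • one := eq_smul_one _

/-- A right action, given by morphisms `X ⟶ X ⊗ F(V)` for the vectors of `V`. -/
def TrivR.ofHom (hom : ∀ V : HopfRep A, V.carrier →ₗ[ℂ] (X ⟶ X ⊗ F.obj V))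
    (naturality : ∀ {V W : HopfRep A} (f : V ⟶ W) (v : V.carrier),
      hom W (lin f v) = hom V v ≫ X ◁ F.map f)
    (unit : hom (𝟙_ _) one ≫ X ◁ η F = (ρ_ X).inv)
    (assoc : ∀ (V W : HopfRep A) (v : V.carrier) (w : W.carrier),
      hom (V ⊗ W) (tmul v w) ≫ X ◁ δ F V W =
        hom W w ≫ hom V v ▷ F.obj W ≫ (α_ X (F.obj V) (F.obj W)).hom) : TrivR F X where
  hom := hom
  inv V :=
    { toFun := fun ξ => hom (dual V) (toDual ξ) ▷ F.obj V ≫ (α_ _ _ _).hom ≫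
        X ◁ pairF F (ev V) ≫ (ρ_ X).hom
      map_add' := fun v w => by simp
      map_smul' := fun c v => by simp }
  hom_inv V v ξ := by
    change hom V v ≫ hom (dual V) (toDual ξ) ▷ F.obj V ≫ (α_ _ _ _).hom ≫
        X ◁ pairF F (ev V) ≫ (ρ_ X).hom = _
    have h := assoc (dual V) V (toDual ξ) v
    rw [← reassoc_of% h, ← MonoidalCategory.whiskerLeft_comp_assoc]
    have h2 : δ F (dual V) V ≫ pairF F (ev V) = F.map (ev V) ≫ η F := by simp [pairF]
    rw [h2, MonoidalCategory.whiskerLeft_comp_assoc, ← reassoc_of% naturality, ev_lin, map_smul,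
      Linear.smul_comp, reassoc_of% unit]
    simp
  inv_hom V := by
    change ∑ i, (hom (dual V) (toDual ((bas V).coord i)) ▷ F.obj V ≫ (α_ _ _ _).hom ≫
        X ◁ pairF F (ev V) ≫ (ρ_ X).hom) ≫ hom V (bas V i) = _
    have h1 : ∀ i, (hom (dual V) (toDual ((bas V).coord i)) ▷ F.obj V ≫ (α_ _ _ _).hom ≫
        X ◁ pairF F (ev V) ≫ (ρ_ X).hom) ≫ hom V (bas V i) =
        (hom (V ⊗ dual V) (tmul (bas V i) (toDual ((bas V).coord i))) ≫ X ◁ δ F V (dual V)) ▷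
          F.obj V ≫ (α_ _ _ _).hom ≫ X ◁ (α_ _ _ _).hom ≫ X ◁ F.obj V ◁ pairF F (ev V) ≫
            X ◁ (ρ_ _).hom := by
      intro i
      rw [assoc]
      simp only [comp_whiskerRight, Category.assoc]
      rw [← rightUnitor_naturality, whisker_exchange_assoc]
      monoidal
    simp only [h1, ← Preadditive.sum_comp, ← sum_whiskerRight, ← map_sum, coev_sum, naturality]
    have h3 : hom (𝟙_ _) one = (ρ_ X).inv ≫ X ◁ Functor.LaxMonoidal.ε F := by
      rw [← unit, Category.assoc, ← MonoidalCategory.whiskerLeft_comp]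
      simp
    rw [h3]
    have h2 := congrArg (X ◁ ·) (zigzagF F _ _ (zigzag V))
    simp only [whiskerLeft_id] at h2
    rw [← h2]
    simp only [copairF, comp_whiskerRight, MonoidalCategory.whiskerLeft_comp]
    monoidal
  naturality := naturality
  unit := unit
  assoc := assoc

end Constructors
end

noncomputable section

open CategoryTheory
open scoped TensorProduct

section Mates

open MonoidalCategory

variable {T : Type u} [Category.{v} T] [MonoidalCategory T] {X X' : T}
  (p : X ⊗ X' ⟶ 𝟙_ T) (c : 𝟙_ T ⟶ X' ⊗ X)

/-- Bending a strand down by the pairing. -/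
def bend {P Q : T} (f : Q ⟶ X' ⊗ P) : X ⊗ Q ⟶ P :=
  X ◁ f ≫ (α_ _ _ _).inv ≫ p ▷ P ≫ (λ_ P).hom

/-- Bending a strand up by the copairing. -/
def unbend {P Q : T} (h : X ⊗ Q ⟶ P) : Q ⟶ X' ⊗ P :=
  (λ_ Q).inv ≫ c ▷ Q ≫ (α_ _ _ _).hom ≫ X' ◁ h

lemma bend_unbend (hook : (ρ_ X).inv ≫ X ◁ c ≫ (α_ _ _ _).inv ≫ p ▷ X ≫ (λ_ X).hom = 𝟙 X)
    {P Q : T} (h : X ⊗ Q ⟶ P) : bend p (unbend c h) = h := by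
  simp only [bend, unbend, MonoidalCategory.whiskerLeft_comp, Category.assoc,
    associator_inv_naturality_right_assoc, whisker_exchange_assoc, leftUnitor_naturality]
  have h2 := congrArg (· ▷ Q) hook
  simp only [id_whiskerRight] at h2
  conv_rhs => rw [← Category.id_comp h, ← h2]
  simp only [comp_whiskerRight]
  monoidal

lemma unbend_bend (hook : (λ_ X').inv ≫ c ▷ X' ≫ (α_ _ _ _).hom ≫ X' ◁ p ≫ (ρ_ X').hom = 𝟙 X')
    {P Q : T} (f : Q ⟶ X' ⊗ P) : unbend c (bend p f) = f := by
  simp only [bend, unbend, MonoidalCategory.whiskerLeft_comp, Category.assoc,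
    ← associator_naturality_right_assoc, ← whisker_exchange_assoc, ← leftUnitor_inv_naturality_assoc]
  have h2 := congrArg (f ≫ · ▷ P) hook
  simp only [id_whiskerRight, Category.comp_id] at h2
  conv_rhs => rw [← h2]
  simp only [comp_whiskerRight]
  monoidal

lemma bend_inj (hook : (λ_ X').inv ≫ c ▷ X' ≫ (α_ _ _ _).hom ≫ X' ◁ p ≫ (ρ_ X').hom = 𝟙 X')
    {P Q : T} {f g : Q ⟶ X' ⊗ P} (h : bend p f = bend p g) : f = g := by
  rw [← unbend_bend p c hook f, h, unbend_bend p c hook g]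

lemma bend_whisker {P P' Q : T} (f : Q ⟶ X' ⊗ P) (t : P ⟶ P') :
    bend p (f ≫ X' ◁ t) = bend p f ≫ t := by
  simp only [bend, MonoidalCategory.whiskerLeft_comp, Category.assoc,
    associator_inv_naturality_right_assoc, whisker_exchange_assoc, leftUnitor_naturality]

lemma bend_comp {P Q Q' : T} (t : Q' ⟶ Q) (f : Q ⟶ X' ⊗ P) :
    bend p (t ≫ f) = X ◁ t ≫ bend p f := by
  simp [bend]

lemma bend_rightUnitor_inv : bend p (ρ_ X').inv = p := by
  simp only [bend]; monoidal

/-- The transpose `X* ⟶ X* ⊗ P` of a morphism `X ⟶ P ⊗ X`. -/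
def mateR {P : T} (k : X ⟶ P ⊗ X) : X' ⟶ X' ⊗ P :=
  unbend c (k ▷ X' ≫ (α_ _ _ _).hom ≫ P ◁ p ≫ (ρ_ P).hom)

/-- The transpose `P ⊗ X* ⟶ X*` of a morphism `X ⊗ P ⟶ X`. -/
def mateL {P : T} (k : X ⊗ P ⟶ X) : P ⊗ X' ⟶ X' :=
  unbend c ((α_ _ _ _).inv ≫ k ▷ X' ≫ p) ≫ (ρ_ X').hom

lemma bend_mateR
    (hook : (ρ_ X).inv ≫ X ◁ c ≫ (α_ _ _ _).inv ≫ p ▷ X ≫ (λ_ X).hom = 𝟙 X)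
    {P : T} (k : X ⟶ P ⊗ X) :
    bend p (mateR p c k) = k ▷ X' ≫ (α_ _ _ _).hom ≫ P ◁ p ≫ (ρ_ P).hom :=
  bend_unbend p c hook _

lemma whisker_mateL
    (hook : (ρ_ X).inv ≫ X ◁ c ≫ (α_ _ _ _).inv ≫ p ▷ X ≫ (λ_ X).hom = 𝟙 X)
    {P : T} (k : X ⊗ P ⟶ X) :
    X ◁ mateL p c k ≫ p = (α_ _ _ _).inv ≫ k ▷ X' ≫ p := by
  have h1 := bend_comp p (mateL p c k) (ρ_ X').inv
  rw [bend_rightUnitor_inv, mateL, Category.assoc, Iso.hom_inv_id, Category.comp_id,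
    bend_unbend p c hook] at h1
  exact h1.symm

lemma whisker_inj
    (hook' : (λ_ X').inv ≫ c ▷ X' ≫ (α_ _ _ _).hom ≫ X' ◁ p ≫ (ρ_ X').hom = 𝟙 X')
    {Q : T} {f g : Q ⟶ X'} (h : X ◁ f ≫ p = X ◁ g ≫ p) : f = g := by
  rw [← cancel_mono (ρ_ X').inv]
  refine bend_inj p c hook' ?_
  rw [bend_comp, bend_comp, bend_rightUnitor_inv, h]

end Mates

section DualActions

open MonoidalCategory HopfRep Functor.LaxMonoidal Functor.OplaxMonoidal HopfAlgebra

variable {T : Type u} [Category.{v} T] [Preadditive T] [Linear ℂ T] [MonoidalCategory T]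
  [MonoidalPreadditive T] [MonoidalLinear ℂ T]
  {A : Type} [Ring A] [HopfAlgebra ℂ A] {F : HopfRep A ⥤ T} [F.Monoidal]
  {X X' : T} (p : X ⊗ X' ⟶ 𝟙_ T) (c : 𝟙_ T ⟶ X' ⊗ X)
  (hook : (ρ_ X).inv ≫ X ◁ c ≫ (α_ _ _ _).inv ≫ p ▷ X ≫ (λ_ X).hom = 𝟙 X)
  (hook' : (λ_ X').inv ≫ c ▷ X' ≫ (α_ _ _ _).hom ≫ X' ◁ p ≫ (ρ_ X').hom = 𝟙 X')

/-- The right action on `X*` transposed from a left action on `X`. -/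
def TrivL.mate (L : TrivL F X) : TrivR F X' :=
  TrivR.ofHom
    (fun V =>
      { toFun := fun v => mateR p c (L.hom V v)
        map_add' := fun v w => by simp [mateR, unbend]
        map_smul' := fun z v => by simp [mateR, unbend] })
    (by
      intro V W f v
      change mateR p c (L.hom W (lin f v)) = mateR p c (L.hom V v) ≫ X' ◁ F.map f
      refine bend_inj p c hook' ?_
      rw [bend_whisker, bend_mateR p c hook, bend_mateR p c hook, L.naturality]
      simp only [comp_whiskerRight, Category.assoc, associator_naturality_left_assoc,
        ← whisker_exchange_assoc, rightUnitor_naturality])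
    (by
      change mateR p c (L.hom (𝟙_ _) one) ≫ X' ◁ η F = _
      refine bend_inj p c hook' ?_
      rw [bend_whisker, bend_mateR p c hook, bend_rightUnitor_inv]
      have h := congrArg (· ▷ X' ≫ (α_ _ _ _).hom ≫ 𝟙_ T ◁ p) L.unit
      simp only [comp_whiskerRight, Category.assoc, associator_naturality_left_assoc,
        ← whisker_exchange] at h
      have e : ((ρ_ (F.obj (𝟙_ (HopfRep A)))).hom ≫ η F) = η F ▷ 𝟙_ T ≫ (ρ_ _).hom := by simp
      simp only [Category.assoc, e]
      rw [reassoc_of% h]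
      monoidal)
    (by
      intro V W v w
      change mateR p c (L.hom (V ⊗ W) (tmul v w)) ≫ X' ◁ δ F V W =
        mateR p c (L.hom W w) ≫ mateR p c (L.hom V v) ▷ F.obj W ≫ (α_ X' (F.obj V) (F.obj W)).hom
      refine bend_inj p c hook' ?_
      rw [bend_whisker, bend_mateR p c hook]
      have h1 : bend p (mateR p c (L.hom W w) ≫ mateR p c (L.hom V v) ▷ F.obj W ≫
          (α_ X' (F.obj V) (F.obj W)).hom) = X ◁ mateR p c (L.hom W w) ≫ (α_ _ _ _).inv ≫
          bend p (mateR p c (L.hom V v)) ▷ F.obj W := by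
        simp only [bend, MonoidalCategory.whiskerLeft_comp, comp_whiskerRight]
        monoidal
      rw [h1, bend_mateR p c hook]
      have h2 : X ◁ mateR p c (L.hom W w) ≫ (α_ _ _ _).inv ≫
          (L.hom V v ▷ X' ≫ (α_ _ _ _).hom ≫ F.obj V ◁ p ≫ (ρ_ _).hom) ▷ F.obj W =
          L.hom V v ▷ X' ≫ (α_ _ _ _).hom ≫ F.obj V ◁ bend p (mateR p c (L.hom W w)) := by
        simp only [bend, MonoidalCategory.whiskerLeft_comp, comp_whiskerRight]
        rw [← associator_inv_naturality_left_assoc, whisker_exchange_assoc]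
        monoidal
      rw [h2, bend_mateR p c hook]
      have h3 : (L.hom (V ⊗ W) (tmul v w) ▷ X' ≫ (α_ _ _ _).hom ≫ F.obj (V ⊗ W) ◁ p ≫
          (ρ_ _).hom) ≫ δ F V W = (L.hom (V ⊗ W) (tmul v w) ≫ δ F V W ▷ X) ▷ X' ≫ (α_ _ _ _).hom ≫
            (F.obj V ⊗ F.obj W) ◁ p ≫ (ρ_ _).hom := by
        simp only [comp_whiskerRight, Category.assoc, associator_naturality_left_assoc,
          ← whisker_exchange_assoc, rightUnitor_naturality]
      rw [h3, L.assoc]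
      simp only [comp_whiskerRight, MonoidalCategory.whiskerLeft_comp]
      monoidal)

lemma TrivL.mate_hom (L : TrivL F X) (V : HopfRep A) (v : V.carrier) :
    (L.mate p c hook hook').hom V v = mateR p c (L.hom V v) := rfl

/-- The left action on `X*` transposed from a right action on `X`. -/
def TrivR.mate (R : TrivR F X) : TrivL F X' :=
  TrivL.ofInv
    (fun V =>
      { toFun := fun ξ => mateL p c (R.inv V ξ)
        map_add' := fun v w => by simp [mateL, unbend]
        map_smul' := fun z v => by simp [mateL, unbend] })
    (by
      intro V W f ξ
      change F.map f ▷ X' ≫ mateL p c (R.inv W ξ) = mateL p c (R.inv V (ξ ∘ₗ lin f))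
      refine whisker_inj p c hook' ?_
      rw [MonoidalCategory.whiskerLeft_comp, Category.assoc, whisker_mateL p c hook,
        whisker_mateL p c hook, ← R.inv_naturality, comp_whiskerRight, Category.assoc,
        associator_inv_naturality_middle_assoc])
    (by
      change _ = mateL p c (R.inv (𝟙_ _) oneD)
      refine whisker_inj p c hook' ?_
      rw [whisker_mateL p c hook, ← R.inv_unit]
      simp only [MonoidalCategory.whiskerLeft_comp, comp_whiskerRight]
      monoidal)
    (by
      intro V W ξ ζ
      change μ F V W ▷ X' ≫ mateL p c (R.inv (V ⊗ W) (dmul ξ ζ)) = (α_ _ _ _).hom ≫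
        F.obj V ◁ mateL p c (R.inv W ζ) ≫ mateL p c (R.inv V ξ)
      refine whisker_inj p c hook' ?_
      simp only [MonoidalCategory.whiskerLeft_comp, Category.assoc, whisker_mateL p c hook]
      rw [associator_inv_naturality_right_assoc, whisker_exchange_assoc, whisker_mateL p c hook,
        associator_inv_naturality_middle_assoc, ← comp_whiskerRight_assoc, R.inv_assoc]
      simp only [comp_whiskerRight]
      monoidal)

lemma TrivR.mate_inv (R : TrivR F X) (V : HopfRep A) (ξ : Module.Dual ℂ V.carrier) :
    (R.mate p c hook hook').inv V ξ = mateL p c (R.inv V ξ) := rfl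

end DualActions
end

noncomputable section

open CategoryTheory
open scoped TensorProduct

section BiModules

open MonoidalCategory HopfRep Functor.LaxMonoidal Functor.OplaxMonoidal HopfAlgebra

variable {T : Type u} [Category.{v} T] [Preadditive T] [Linear ℂ T] [MonoidalCategory T]
  [MonoidalPreadditive T] [MonoidalLinear ℂ T]
  {A : Type} [Ring A] [HopfAlgebra ℂ A] {F : HopfRep A ⥤ T} [F.Monoidal]
  {B : Type} [Ring B] [HopfAlgebra ℂ B] {G : HopfRep B ⥤ T} [G.Monoidal]
  {C : Type} [Ring C] [HopfAlgebra ℂ C] {H : HopfRep C ⥤ T} [H.Monoidal]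
  {E : Type} [Ring E] [HopfAlgebra ℂ E] {K : HopfRep E ⥤ T} [K.Monoidal]

variable (F G) in
/-- An object of `T` with commuting left and right actions of two Hopf algebras realized in `T`. -/
structure BiMod where
  obj : T
  left : TrivL F obj
  right : TrivR G obj
  comm : ∀ (V : HopfRep A) (W : HopfRep B) (v : V.carrier) (w : W.carrier),
    left.hom V v ≫ F.obj V ◁ right.hom W w =
      right.hom W w ≫ left.hom V v ▷ G.obj W ≫ (α_ (F.obj V) obj (G.obj W)).hom

namespace BiMod

/-- The space of morphisms commuting with the trivializing isomorphisms. -/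
def homs (X Y : BiMod F G) : Submodule ℂ (X.obj ⟶ Y.obj) where
  carrier := {f | (∀ V v, X.left.hom V v ≫ F.obj V ◁ f = f ≫ Y.left.hom V v) ∧
    ∀ W w, X.right.hom W w ≫ f ▷ G.obj W = f ≫ Y.right.hom W w}
  add_mem' hf hg := ⟨fun V v => by simp [hf.1 V v, hg.1 V v], fun V v => by simp [hf.2 V v, hg.2 V v]⟩
  zero_mem' := ⟨fun V v => by simp, fun V v => by simp⟩
  smul_mem' c f hf := ⟨fun V v => by simp [hf.1 V v], fun V v => by simp [hf.2 V v]⟩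

instance : Category (BiMod F G) where
  Hom X Y := homs X Y
  id X := ⟨𝟙 X.obj, fun V v => by simp, fun V v => by simp⟩
  comp {X Y Z} f g := ⟨f.1 ≫ g.1, fun V v => by
      rw [MonoidalCategory.whiskerLeft_comp, reassoc_of% (f.2.1 V v), g.2.1 V v, Category.assoc],
    fun V v => by rw [comp_whiskerRight, reassoc_of% (f.2.2 V v), g.2.2 V v, Category.assoc]⟩

/-- The underlying morphism in `T`. -/
def mor {X Y : BiMod F G} (f : X ⟶ Y) : X.obj ⟶ Y.obj := f.1

/-- A morphism of `T` commuting with the actions, as a morphism of bimodules. -/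
def mk' {X Y : BiMod F G} (f : X.obj ⟶ Y.obj)
    (hl : ∀ V v, X.left.hom V v ≫ F.obj V ◁ f = f ≫ Y.left.hom V v)
    (hr : ∀ W w, X.right.hom W w ≫ f ▷ G.obj W = f ≫ Y.right.hom W w) : X ⟶ Y := ⟨f, hl, hr⟩

@[simp] lemma mor_mk' {X Y : BiMod F G} (f : X.obj ⟶ Y.obj)
    (hl : ∀ V v, X.left.hom V v ≫ F.obj V ◁ f = f ≫ Y.left.hom V v)
    (hr : ∀ W w, X.right.hom W w ≫ f ▷ G.obj W = f ≫ Y.right.hom W w) : mor (mk' f hl hr) = f := rfl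

@[simp] lemma mor_id (X : BiMod F G) : mor (𝟙 X) = 𝟙 X.obj := rfl
@[simp] lemma mor_comp {X Y Z : BiMod F G} (f : X ⟶ Y) (g : Y ⟶ Z) :
    mor (f ≫ g) = mor f ≫ mor g := rfl

@[ext] lemma hom_ext {X Y : BiMod F G} {f g : X ⟶ Y} (h : mor f = mor g) : f = g := Subtype.ext h

lemma mor_left {X Y : BiMod F G} (f : X ⟶ Y) (V : HopfRep A) (v : V.carrier) :
    X.left.hom V v ≫ F.obj V ◁ mor f = mor f ≫ Y.left.hom V v := f.2.1 V v

lemma mor_right {X Y : BiMod F G} (f : X ⟶ Y) (V : HopfRep B) (v : V.carrier) :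
    X.right.hom V v ≫ mor f ▷ G.obj V = mor f ≫ Y.right.hom V v := f.2.2 V v

lemma mor_left_inv {X Y : BiMod F G} (f : X ⟶ Y) (V : HopfRep A)
    (ξ : Module.Dual ℂ V.carrier) : F.obj V ◁ mor f ≫ Y.left.inv V ξ = X.left.inv V ξ ≫ mor f := by
  refine TrivL.epi0 X.left.inv_hom fun v => ?_
  rw [reassoc_of% mor_left, Y.left.hom_inv, reassoc_of% X.left.hom_inv]
  simp

lemma mor_right_inv {X Y : BiMod F G} (f : X ⟶ Y) (V : HopfRep B)
    (ξ : Module.Dual ℂ V.carrier) :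
    mor f ▷ G.obj V ≫ Y.right.inv V ξ = X.right.inv V ξ ≫ mor f := by
  refine TrivR.epi0 X.right.inv_hom fun v => ?_
  rw [reassoc_of% mor_right, Y.right.hom_inv, reassoc_of% X.right.hom_inv]
  simp

/-- Compatibility with the left actions may be checked on the inverse morphisms. -/
lemma left_of_inv {X Y : BiMod F G} (f : X.obj ⟶ Y.obj) (V : HopfRep A)
    (h : ∀ ξ, F.obj V ◁ f ≫ Y.left.inv V ξ = X.left.inv V ξ ≫ f) (v : V.carrier) :
    X.left.hom V v ≫ F.obj V ◁ f = f ≫ Y.left.hom V v := by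
  refine TrivL.mono0 Y.left.inv_hom fun ξ => ?_
  rw [Category.assoc, h, Category.assoc, Y.left.hom_inv, reassoc_of% X.left.hom_inv]
  simp

lemma right_of_inv {X Y : BiMod F G} (f : X.obj ⟶ Y.obj) (V : HopfRep B)
    (h : ∀ ξ, f ▷ G.obj V ≫ Y.right.inv V ξ = X.right.inv V ξ ≫ f) (v : V.carrier) :
    X.right.hom V v ≫ f ▷ G.obj V = f ≫ Y.right.hom V v := by
  refine TrivR.mono0 Y.right.inv_hom fun ξ => ?_
  rw [Category.assoc, h, Category.assoc, Y.right.hom_inv, reassoc_of% X.right.hom_inv]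
  simp

instance : Preadditive (BiMod F G) where
  homGroup X Y := inferInstanceAs (AddCommGroup (homs X Y))
  add_comp X Y Z f g h := hom_ext (Preadditive.add_comp _ _ _ _ _ _)
  comp_add X Y Z f g h := hom_ext (Preadditive.comp_add _ _ _ _ _ _)

instance : Linear ℂ (BiMod F G) where
  homModule X Y := inferInstanceAs (Module ℂ (homs X Y))
  smul_comp X Y Z c f g := hom_ext (Linear.smul_comp _ _ _ _ _ _)
  comp_smul X Y Z f c g := hom_ext (Linear.comp_smul _ _ _ _ _ _)

@[simp] lemma mor_smul {X Y : BiMod F G} (c : ℂ) (f : X ⟶ Y) : mor (c • f) = c • mor f := rfl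
@[simp] lemma mor_add {X Y : BiMod F G} (f g : X ⟶ Y) : mor (f + g) = mor f + mor g := rfl

/-- An invertible morphism of bimodules. -/
def mkIso {X Y : BiMod F G} (f : X ⟶ Y) (g : Y.obj ⟶ X.obj) (h1 : mor f ≫ g = 𝟙 _)
    (h2 : g ≫ mor f = 𝟙 _) : X ≅ Y where
  hom := f
  inv := mk' g
    (fun V v => by
      have e := congrArg (fun t => g ≫ t ≫ F.obj V ◁ g) (mor_left f V v)
      simp only [Category.assoc, ← MonoidalCategory.whiskerLeft_comp, h1, reassoc_of% h2] at e
      simpa using e.symm)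
    (fun V v => by
      have e := congrArg (fun t => g ≫ t ≫ g ▷ G.obj V) (mor_right f V v)
      simp only [Category.assoc, ← comp_whiskerRight, h1, reassoc_of% h2] at e
      simpa using e.symm)
  hom_inv_id := hom_ext h1
  inv_hom_id := hom_ext h2

section Retract

variable (X : BiMod F G) {P : T} (i : P ⟶ X.obj) (r : X.obj ⟶ P)

lemma r_mor (hir : i ≫ r = 𝟙 P) (e : X ⟶ X) (he : r ≫ i = mor e) : r = mor e ≫ r := by rw [← he, Category.assoc, hir, Category.comp_id]

lemma i_mor (hir : i ≫ r = 𝟙 P) (e : X ⟶ X) (he : r ≫ i = mor e) : i ≫ mor e = i := by rw [← he, reassoc_of% hir]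

variable (hir : i ≫ r = 𝟙 P) (e : X ⟶ X) (he : r ≫ i = mor e)

/-- The bimodule structure on the image of an idempotent. -/
def retract : BiMod F G where
  obj := P
  left :=
    { hom := fun V =>
        { toFun := fun v => i ≫ X.left.hom V v ≫ F.obj V ◁ r
          map_add' := fun _ _ => by simp
          map_smul' := fun _ _ => by simp }
      inv := fun V =>
        { toFun := fun ξ => F.obj V ◁ i ≫ X.left.inv V ξ ≫ r
          map_add' := fun _ _ => by simp
          map_smul' := fun _ _ => by simp }
      hom_inv := fun V v ξ => by
        change (i ≫ X.left.hom V v ≫ F.obj V ◁ r) ≫ F.obj V ◁ i ≫ X.left.inv V ξ ≫ r = _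
        simp only [Category.assoc]
        rw [← MonoidalCategory.whiskerLeft_comp_assoc, he, reassoc_of% mor_left,
          reassoc_of% X.left.hom_inv, Linear.smul_comp, Linear.comp_smul, Linear.comp_smul,
          Category.id_comp, ← r_mor X i r hir e he, hir]
      inv_hom := fun V => by
        change ∑ j, (F.obj V ◁ i ≫ X.left.inv V _ ≫ r) ≫ i ≫ X.left.hom V _ ≫ F.obj V ◁ r = _
        have h : ∀ j, (F.obj V ◁ i ≫ X.left.inv V ((bas V).coord j) ≫ r) ≫ i ≫
            X.left.hom V (bas V j) ≫ F.obj V ◁ r =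
            F.obj V ◁ i ≫ (X.left.inv V ((bas V).coord j) ≫ X.left.hom V (bas V j)) ≫
              F.obj V ◁ r := by
          intro j
          simp only [Category.assoc]
          rw [reassoc_of% he, ← reassoc_of% mor_left, ← MonoidalCategory.whiskerLeft_comp,
            ← r_mor X i r hir e he]
        simp only [h, ← Preadditive.comp_sum, ← Preadditive.sum_comp, X.left.inv_hom]
        rw [Category.id_comp, ← MonoidalCategory.whiskerLeft_comp, hir, whiskerLeft_id]
      naturality := fun {V W} f v => by
        change i ≫ X.left.hom W (lin f v) ≫ F.obj W ◁ r = (i ≫ X.left.hom V v ≫ F.obj V ◁ r) ≫ _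
        simp only [X.left.naturality, Category.assoc, whisker_exchange]
      unit := by
        change (i ≫ X.left.hom _ one ≫ F.obj _ ◁ r) ≫ _ = _
        simp only [Category.assoc, whisker_exchange]
        rw [reassoc_of% X.left.unit, ← leftUnitor_inv_naturality, reassoc_of% hir]
      assoc := fun V W v w => by
        change (i ≫ X.left.hom _ _ ≫ F.obj _ ◁ r) ≫ _ =
          (i ≫ X.left.hom _ _ ≫ F.obj _ ◁ r) ≫ F.obj _ ◁ (i ≫ X.left.hom _ _ ≫ F.obj _ ◁ r) ≫ _
        simp only [Category.assoc, whisker_exchange]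
        rw [reassoc_of% X.left.assoc, ← MonoidalCategory.whiskerLeft_comp_assoc, reassoc_of% he,
          ← reassoc_of% mor_left, ← MonoidalCategory.whiskerLeft_comp, ← r_mor X i r hir e he]
        simp only [MonoidalCategory.whiskerLeft_comp, Category.assoc,
          associator_inv_naturality_right] }
  right :=
    { hom := fun V =>
        { toFun := fun v => i ≫ X.right.hom V v ≫ r ▷ G.obj V
          map_add' := fun _ _ => by simp
          map_smul' := fun _ _ => by simp }
      inv := fun V =>
        { toFun := fun ξ => i ▷ G.obj V ≫ X.right.inv V ξ ≫ r
          map_add' := fun _ _ => by simp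
          map_smul' := fun _ _ => by simp }
      hom_inv := fun V v ξ => by
        change (i ≫ X.right.hom V v ≫ r ▷ G.obj V) ≫ i ▷ G.obj V ≫ X.right.inv V ξ ≫ r = _
        simp only [Category.assoc]
        rw [← comp_whiskerRight_assoc, he, reassoc_of% mor_right,
          reassoc_of% X.right.hom_inv, Linear.smul_comp, Linear.comp_smul, Linear.comp_smul,
          Category.id_comp, ← r_mor X i r hir e he, hir]
      inv_hom := fun V => by
        change ∑ j, (i ▷ G.obj V ≫ X.right.inv V _ ≫ r) ≫ i ≫ X.right.hom V _ ≫ r ▷ G.obj V = _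
        have h : ∀ j, (i ▷ G.obj V ≫ X.right.inv V ((bas V).coord j) ≫ r) ≫ i ≫
            X.right.hom V (bas V j) ≫ r ▷ G.obj V =
            i ▷ G.obj V ≫ (X.right.inv V ((bas V).coord j) ≫ X.right.hom V (bas V j)) ≫
              r ▷ G.obj V := by
          intro j
          simp only [Category.assoc]
          rw [reassoc_of% he, ← reassoc_of% mor_right, ← comp_whiskerRight,
            ← r_mor X i r hir e he]
        simp only [h, ← Preadditive.comp_sum, ← Preadditive.sum_comp, X.right.inv_hom]
        rw [Category.id_comp, ← comp_whiskerRight, hir, id_whiskerRight]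
      naturality := fun {V W} f v => by
        change i ≫ X.right.hom W (lin f v) ≫ r ▷ G.obj W = (i ≫ X.right.hom V v ≫ r ▷ G.obj V) ≫ _
        simp only [X.right.naturality, Category.assoc, whisker_exchange]
      unit := by
        change (i ≫ X.right.hom _ one ≫ r ▷ G.obj _) ≫ _ = _
        simp only [Category.assoc, ← whisker_exchange]
        rw [reassoc_of% X.right.unit, ← rightUnitor_inv_naturality, reassoc_of% hir]
      assoc := fun V W v w => by
        change (i ≫ X.right.hom _ _ ≫ r ▷ G.obj _) ≫ _ =
          (i ≫ X.right.hom _ _ ≫ r ▷ G.obj _) ≫ (i ≫ X.right.hom _ _ ≫ r ▷ G.obj _) ▷ G.obj _ ≫ _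
        simp only [Category.assoc, ← whisker_exchange]
        rw [reassoc_of% X.right.assoc, ← comp_whiskerRight_assoc, reassoc_of% he,
          ← reassoc_of% mor_right, ← comp_whiskerRight, ← r_mor X i r hir e he]
        simp only [comp_whiskerRight, Category.assoc, associator_naturality_left] }
  comm V W v w := by
    change (i ≫ X.left.hom V v ≫ F.obj V ◁ r) ≫ F.obj V ◁ (i ≫ X.right.hom W w ≫ r ▷ G.obj W) =
      (i ≫ X.right.hom W w ≫ r ▷ G.obj W) ≫ (i ≫ X.left.hom V v ≫ F.obj V ◁ r) ▷ G.obj W ≫ _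
    have h1 : r ≫ i ≫ X.right.hom W w ≫ r ▷ G.obj W = X.right.hom W w ≫ r ▷ G.obj W := by
      rw [reassoc_of% he, ← reassoc_of% mor_right, ← comp_whiskerRight, ← r_mor X i r hir e he]
    have h2 : r ≫ i ≫ X.left.hom V v ≫ F.obj V ◁ r = X.left.hom V v ≫ F.obj V ◁ r := by
      rw [reassoc_of% he, ← reassoc_of% mor_left, ← MonoidalCategory.whiskerLeft_comp,
        ← r_mor X i r hir e he]
    have h3 : (i ≫ X.left.hom V v ≫ F.obj V ◁ r) ≫ F.obj V ◁ (i ≫ X.right.hom W w ≫ r ▷ G.obj W) =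
        i ≫ X.left.hom V v ≫ F.obj V ◁ (r ≫ i ≫ X.right.hom W w ≫ r ▷ G.obj W) := by simp
    have h4 : (i ≫ X.right.hom W w ≫ r ▷ G.obj W) ≫ (i ≫ X.left.hom V v ≫ F.obj V ◁ r) ▷ G.obj W =
        i ≫ X.right.hom W w ≫ (r ≫ i ≫ X.left.hom V v ≫ F.obj V ◁ r) ▷ G.obj W := by simp
    rw [h3, ← Category.assoc (i ≫ X.right.hom W w ≫ r ▷ G.obj W), h4, h1, h2]
    have h5 := congrArg (fun t => i ≫ t ≫ F.obj V ◁ r ▷ G.obj W) (X.comm V W v w)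
    simp only [Category.assoc] at h5
    simp only [MonoidalCategory.whiskerLeft_comp, comp_whiskerRight, Category.assoc, h5,
      associator_naturality_middle]

/-- The inclusion of the image of an idempotent. -/
def retractι : retract X i r hir e he ⟶ X :=
  mk' (X := retract X i r hir e he) i
    (fun V v => by
      change (i ≫ X.left.hom V v ≫ F.obj V ◁ r) ≫ F.obj V ◁ i = _
      simp only [Category.assoc, ← MonoidalCategory.whiskerLeft_comp, he, mor_left]
      rw [← Category.assoc, i_mor X i r hir e he]
      rfl)
    (fun V v => by
      change (i ≫ X.right.hom V v ≫ r ▷ G.obj V) ≫ i ▷ G.obj V = _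
      simp only [Category.assoc, ← comp_whiskerRight, he, mor_right]
      rw [← Category.assoc, i_mor X i r hir e he]
      rfl)

/-- The projection to the image of an idempotent. -/
def retractπ : X ⟶ retract X i r hir e he :=
  mk' (Y := retract X i r hir e he) r
    (fun V v => by
      change _ = r ≫ i ≫ X.left.hom V v ≫ F.obj V ◁ r
      rw [reassoc_of% he, ← reassoc_of% mor_left, ← MonoidalCategory.whiskerLeft_comp,
        ← r_mor X i r hir e he]
      rfl)
    (fun V v => by
      change _ = r ≫ i ≫ X.right.hom V v ≫ r ▷ G.obj V
      rw [reassoc_of% he, ← reassoc_of% mor_right, ← comp_whiskerRight, ← r_mor X i r hir e he]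
      rfl)

end Retract

/-- The outer tensor product, with the left action of the first factor and the right action of the
second factor. -/
def outer (X : BiMod F G) (Y : BiMod G H) : BiMod F H where
  obj := X.obj ⊗ Y.obj
  left :=
    { hom := fun V =>
        { toFun := fun v => X.left.hom V v ▷ Y.obj ≫ (α_ _ _ _).hom
          map_add' := fun _ _ => by simp
          map_smul' := fun _ _ => by simp }
      inv := fun V =>
        { toFun := fun ξ => (α_ _ _ _).inv ≫ X.left.inv V ξ ▷ Y.obj
          map_add' := fun _ _ => by simp
          map_smul' := fun _ _ => by simp }
      hom_inv := fun V v ξ => by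
        change (X.left.hom V v ▷ Y.obj ≫ (α_ _ _ _).hom) ≫ (α_ _ _ _).inv ≫
          X.left.inv V ξ ▷ Y.obj = _
        rw [Category.assoc, Iso.hom_inv_id_assoc, ← comp_whiskerRight, X.left.hom_inv]
        simp
      inv_hom := fun V => by
        change ∑ j, ((α_ _ _ _).inv ≫ X.left.inv V _ ▷ Y.obj) ≫ X.left.hom V _ ▷ Y.obj ≫
          (α_ _ _ _).hom = _
        simp only [Category.assoc, ← Preadditive.comp_sum]
        simp only [← comp_whiskerRight_assoc, ← Preadditive.sum_comp, ← sum_whiskerRight,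
          X.left.inv_hom]
        simp
      naturality := fun {V W} f v => by
        change X.left.hom W (lin f v) ▷ Y.obj ≫ _ = (X.left.hom V v ▷ Y.obj ≫ _) ≫ _
        rw [X.left.naturality]
        simp
      unit := by
        change (X.left.hom _ one ▷ Y.obj ≫ _) ≫ _ = _
        rw [Category.assoc, ← associator_naturality_left, ← comp_whiskerRight_assoc, X.left.unit]
        monoidal
      assoc := fun V W v w => by
        change (X.left.hom _ _ ▷ Y.obj ≫ _) ≫ _ =
          (X.left.hom _ _ ▷ Y.obj ≫ _) ≫ F.obj _ ◁ (X.left.hom _ _ ▷ Y.obj ≫ _) ≫ _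
        rw [Category.assoc, ← associator_naturality_left, ← comp_whiskerRight_assoc, X.left.assoc]
        simp only [comp_whiskerRight, MonoidalCategory.whiskerLeft_comp]
        monoidal }
  right :=
    { hom := fun V =>
        { toFun := fun v => X.obj ◁ Y.right.hom V v ≫ (α_ _ _ _).inv
          map_add' := fun _ _ => by simp
          map_smul' := fun _ _ => by simp }
      inv := fun V =>
        { toFun := fun ξ => (α_ _ _ _).hom ≫ X.obj ◁ Y.right.inv V ξ
          map_add' := fun _ _ => by simp
          map_smul' := fun _ _ => by simp }
      hom_inv := fun V v ξ => by
        change (X.obj ◁ Y.right.hom V v ≫ (α_ _ _ _).inv) ≫ (α_ _ _ _).hom ≫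
          X.obj ◁ Y.right.inv V ξ = _
        rw [Category.assoc, Iso.inv_hom_id_assoc, ← MonoidalCategory.whiskerLeft_comp,
          Y.right.hom_inv]
        simp
      inv_hom := fun V => by
        change ∑ j, ((α_ _ _ _).hom ≫ X.obj ◁ Y.right.inv V _) ≫ X.obj ◁ Y.right.hom V _ ≫
          (α_ _ _ _).inv = _
        simp only [Category.assoc, ← Preadditive.comp_sum]
        simp only [← MonoidalCategory.whiskerLeft_comp_assoc, ← Preadditive.sum_comp,
          ← whiskerLeft_sum, Y.right.inv_hom]
        simp
      naturality := fun {V W} f v => by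
        change X.obj ◁ Y.right.hom W (lin f v) ≫ _ = (X.obj ◁ Y.right.hom V v ≫ _) ≫ _
        rw [Y.right.naturality]
        simp
      unit := by
        change (X.obj ◁ Y.right.hom _ one ≫ _) ≫ _ = _
        rw [Category.assoc, ← associator_inv_naturality_right,
          ← MonoidalCategory.whiskerLeft_comp_assoc, Y.right.unit]
        monoidal
      assoc := fun V W v w => by
        change (X.obj ◁ Y.right.hom _ _ ≫ _) ≫ _ =
          (X.obj ◁ Y.right.hom _ _ ≫ _) ≫ (X.obj ◁ Y.right.hom _ _ ≫ _) ▷ H.obj _ ≫ _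
        rw [Category.assoc, ← associator_inv_naturality_right,
          ← MonoidalCategory.whiskerLeft_comp_assoc, Y.right.assoc]
        simp only [comp_whiskerRight, MonoidalCategory.whiskerLeft_comp]
        monoidal }
  comm V W v w := by
    change (X.left.hom V v ▷ Y.obj ≫ (α_ _ _ _).hom) ≫ F.obj V ◁ (X.obj ◁ Y.right.hom W w ≫
      (α_ _ _ _).inv) = (X.obj ◁ Y.right.hom W w ≫ (α_ _ _ _).inv) ≫
        (X.left.hom V v ▷ Y.obj ≫ (α_ _ _ _).hom) ▷ H.obj W ≫ (α_ _ _ _).hom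
    simp only [comp_whiskerRight, MonoidalCategory.whiskerLeft_comp, Category.assoc]
    rw [← associator_naturality_right_assoc, ← whisker_exchange_assoc,
      ← associator_inv_naturality_left_assoc]
    monoidal

lemma outer_left_hom (X : BiMod F G) (Y : BiMod G H) (V : HopfRep A) (v : V.carrier) :
    (outer X Y).left.hom V v = X.left.hom V v ▷ Y.obj ≫ (α_ _ _ _).hom := rfl
lemma outer_left_inv (X : BiMod F G) (Y : BiMod G H) (V : HopfRep A) (ξ : Module.Dual ℂ V.carrier) :
    (outer X Y).left.inv V ξ = (α_ _ _ _).inv ≫ X.left.inv V ξ ▷ Y.obj := rfl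
lemma outer_right_hom (X : BiMod F G) (Y : BiMod G H) (V : HopfRep C) (v : V.carrier) :
    (outer X Y).right.hom V v = X.obj ◁ Y.right.hom V v ≫ (α_ _ _ _).inv := rfl
lemma outer_right_inv (X : BiMod F G) (Y : BiMod G H) (V : HopfRep C)
    (ξ : Module.Dual ℂ V.carrier) :
    (outer X Y).right.inv V ξ = (α_ _ _ _).hom ≫ X.obj ◁ Y.right.inv V ξ := rfl

end BiMod

/-- Commutativity of a left and a right action may be checked on the inverse morphisms. -/
lemma comm_of_inv {X : T} (L : TrivL F X) (R : TrivR G X) (V : HopfRep A) (W : HopfRep B)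
    (h : ∀ (ξ : Module.Dual ℂ V.carrier) (ζ : Module.Dual ℂ W.carrier),
      L.inv V ξ ▷ G.obj W ≫ R.inv W ζ = (α_ _ _ _).hom ≫ F.obj V ◁ R.inv W ζ ≫ L.inv V ξ)
    (v : V.carrier) (w : W.carrier) :
    L.hom V v ≫ F.obj V ◁ R.hom W w =
      R.hom W w ≫ L.hom V v ▷ G.obj W ≫ (α_ (F.obj V) X (G.obj W)).hom := by
  have e : ∀ k : X ⟶ F.obj V ⊗ X ⊗ G.obj W, k = ∑ i,
      (k ≫ F.obj V ◁ R.inv W ((bas W).coord i)) ≫ F.obj V ◁ R.hom W (bas W i) := by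
    intro k
    have := congrArg (fun t => k ≫ F.obj V ◁ t) (R.inv_hom W)
    simpa [Preadditive.comp_sum, whiskerLeft_sum] using this.symm
  rw [e (L.hom V v ≫ F.obj V ◁ R.hom W w), e (R.hom W w ≫ _)]
  refine Finset.sum_congr rfl fun i _ => ?_
  congr 1
  refine TrivL.mono0 L.inv_hom fun ξ => ?_
  simp only [Category.assoc]
  rw [← h, ← MonoidalCategory.whiskerLeft_comp_assoc, R.hom_inv, ← comp_whiskerRight_assoc,
    L.hom_inv]
  simp [R.hom_inv, L.hom_inv, smul_smul, mul_comm]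

lemma left_inv_right_hom
    (X : BiMod F G) (V : HopfRep A) (W : HopfRep B) (ξ : Module.Dual ℂ V.carrier) (w : W.carrier) :
    X.left.inv V ξ ≫ X.right.hom W w =
      F.obj V ◁ X.right.hom W w ≫ (α_ _ _ _).inv ≫ X.left.inv V ξ ▷ G.obj W := by
  refine TrivL.epi0 X.left.inv_hom fun v => ?_
  rw [reassoc_of% (X.comm V W v w), Iso.hom_inv_id_assoc, ← comp_whiskerRight,
    reassoc_of% X.left.hom_inv, X.left.hom_inv]
  simp

lemma right_inv_left_hom
    (X : BiMod F G) (V : HopfRep A) (W : HopfRep B) (v : V.carrier) (ζ : Module.Dual ℂ W.carrier) :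
    X.right.inv W ζ ≫ X.left.hom V v =
      X.left.hom V v ▷ G.obj W ≫ (α_ _ _ _).hom ≫ F.obj V ◁ X.right.inv W ζ := by
  refine TrivR.epi0 X.right.inv_hom fun w => ?_
  rw [← reassoc_of% (X.comm V W v w), ← MonoidalCategory.whiskerLeft_comp,
    reassoc_of% X.right.hom_inv, X.right.hom_inv]
  simp

end BiModules
end

noncomputable section

open CategoryTheory
open scoped TensorProduct

/-- The square of the antipode is the identity. -/
class IsInvolutive (A : Type) [Ring A] [HopfAlgebra ℂ A] : Prop where
  sq : ∀ a : A, HopfAlgebra.antipode ℂ (HopfAlgebra.antipode ℂ a) = a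

section TensorOver

open MonoidalCategory HopfRep Functor.LaxMonoidal Functor.OplaxMonoidal HopfAlgebra

variable {T : Type u} [Category.{v} T] [Preadditive T] [Linear ℂ T] [MonoidalCategory T]
  [MonoidalPreadditive T] [MonoidalLinear ℂ T]
  {A : Type} [Ring A] [HopfAlgebra ℂ A] {F : HopfRep A ⥤ T} [F.Monoidal]
  {B : Type} [Ring B] [HopfAlgebra ℂ B] {G : HopfRep B ⥤ T} [G.Monoidal]
  {C : Type} [Ring C] [HopfAlgebra ℂ C] {H : HopfRep C ⥤ T} [H.Monoidal]
  {E : Type} [Ring E] [HopfAlgebra ℂ E] {K : HopfRep E ⥤ T} [K.Monoidal]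

namespace BiMod

/-- The outer tensor product on morphisms of the second factor. -/
def outL (X : BiMod F G) {Y Y' : BiMod G H} (g : Y ⟶ Y') : outer X Y ⟶ outer X Y' :=
  mk' (X := outer X Y) (Y := outer X Y') (X.obj ◁ mor g)
    (fun V v => by
      change (X.left.hom V v ▷ Y.obj ≫ (α_ (F.obj V) X.obj Y.obj).hom) ≫ F.obj V ◁ X.obj ◁ mor g =
        X.obj ◁ mor g ≫ X.left.hom V v ▷ Y'.obj ≫ (α_ (F.obj V) X.obj Y'.obj).hom
      rw [Category.assoc, ← associator_naturality_right, whisker_exchange_assoc])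
    (fun V v => by
      change (X.obj ◁ Y.right.hom V v ≫ (α_ X.obj Y.obj (H.obj V)).inv) ≫
        (X.obj ◁ mor g) ▷ H.obj V =
          X.obj ◁ mor g ≫ X.obj ◁ Y'.right.hom V v ≫ (α_ X.obj Y'.obj (H.obj V)).inv
      rw [Category.assoc, ← associator_inv_naturality_middle,
        ← MonoidalCategory.whiskerLeft_comp_assoc, mor_right,
        MonoidalCategory.whiskerLeft_comp_assoc])

/-- The outer tensor product on morphisms of the first factor. -/
def outR {X X' : BiMod F G} (f : X ⟶ X') (Y : BiMod G H) : outer X Y ⟶ outer X' Y :=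
  mk' (X := outer X Y) (Y := outer X' Y) (mor f ▷ Y.obj)
    (fun V v => by
      change (X.left.hom V v ▷ Y.obj ≫ (α_ (F.obj V) X.obj Y.obj).hom) ≫ F.obj V ◁ mor f ▷ Y.obj =
        mor f ▷ Y.obj ≫ X'.left.hom V v ▷ Y.obj ≫ (α_ (F.obj V) X'.obj Y.obj).hom
      rw [Category.assoc, ← associator_naturality_middle,
        ← comp_whiskerRight_assoc, mor_left, comp_whiskerRight_assoc])
    (fun V v => by
      change (X.obj ◁ Y.right.hom V v ≫ (α_ X.obj Y.obj (H.obj V)).inv) ≫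
        mor f ▷ Y.obj ▷ H.obj V =
          mor f ▷ Y.obj ≫ X'.obj ◁ Y.right.hom V v ≫ (α_ X'.obj Y.obj (H.obj V)).inv
      rw [Category.assoc, ← associator_inv_naturality_left, whisker_exchange_assoc])

/-- The associativity of outer tensor products. -/
def outA (X : BiMod F G) (Y : BiMod G H) (Z : BiMod H K) :
    outer (outer X Y) Z ≅ outer X (outer Y Z) :=
  mkIso (X := outer (outer X Y) Z) (Y := outer X (outer Y Z))
    (mk' (X := outer (outer X Y) Z) (Y := outer X (outer Y Z)) (α_ X.obj Y.obj Z.obj).hom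
      (fun V v => by
        change ((X.left.hom V v ▷ Y.obj ≫ (α_ (F.obj V) X.obj Y.obj).hom) ▷ Z.obj ≫
          (α_ (F.obj V) (X.obj ⊗ Y.obj) Z.obj).hom) ≫ F.obj V ◁ (α_ X.obj Y.obj Z.obj).hom =
          (α_ X.obj Y.obj Z.obj).hom ≫ X.left.hom V v ▷ (Y.obj ⊗ Z.obj) ≫
            (α_ (F.obj V) X.obj (Y.obj ⊗ Z.obj)).hom
        monoidal)
      (fun V v => by
        change ((X.obj ⊗ Y.obj) ◁ Z.right.hom V v ≫ (α_ (X.obj ⊗ Y.obj) Z.obj (K.obj V)).inv) ≫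
          (α_ X.obj Y.obj Z.obj).hom ▷ K.obj V = (α_ X.obj Y.obj Z.obj).hom ≫
            X.obj ◁ (Y.obj ◁ Z.right.hom V v ≫ (α_ Y.obj Z.obj (K.obj V)).inv) ≫
              (α_ X.obj (Y.obj ⊗ Z.obj) (K.obj V)).inv
        monoidal))
    (α_ X.obj Y.obj Z.obj).inv (Iso.hom_inv_id _) (Iso.inv_hom_id _)

@[simp] lemma mor_outL (X : BiMod F G) {Y Y' : BiMod G H} (g : Y ⟶ Y') :
    mor (outL X g) = X.obj ◁ mor g := rfl
@[simp] lemma mor_outR {X X' : BiMod F G} (f : X ⟶ X') (Y : BiMod G H) :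
    mor (outR f Y) = mor f ▷ Y.obj := rfl
@[simp] lemma mor_outA_hom (X : BiMod F G) (Y : BiMod G H) (Z : BiMod H K) :
    mor (outA X Y Z).hom = (α_ X.obj Y.obj Z.obj).hom := rfl
@[simp] lemma mor_outA_inv (X : BiMod F G) (Y : BiMod G H) (Z : BiMod H K) :
    mor (outA X Y Z).inv = (α_ X.obj Y.obj Z.obj).inv := rfl

@[simp] lemma outL_id (X : BiMod F G) (Y : BiMod G H) : outL X (𝟙 Y) = 𝟙 (outer X Y) :=
  hom_ext (whiskerLeft_id _ _)
@[simp] lemma outR_id (X : BiMod F G) (Y : BiMod G H) : outR (𝟙 X) Y = 𝟙 (outer X Y) :=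
  hom_ext (id_whiskerRight _ _)
lemma outL_comp (X : BiMod F G) {Y Y' Y'' : BiMod G H} (g : Y ⟶ Y') (h : Y' ⟶ Y'') :
    outL X (g ≫ h) = outL X g ≫ outL X h := hom_ext (MonoidalCategory.whiskerLeft_comp _ _ _)
lemma outR_comp {X X' X'' : BiMod F G} (g : X ⟶ X') (h : X' ⟶ X'') (Y : BiMod G H) :
    outR (g ≫ h) Y = outR g Y ≫ outR h Y := hom_ext (comp_whiskerRight _ _ _)
lemma out_exchange {X X' : BiMod F G} (f : X ⟶ X') {Y Y' : BiMod G H} (g : Y ⟶ Y') :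
    outL X g ≫ outR f Y' = outR f Y ≫ outL X' g := hom_ext (whisker_exchange _ _)
lemma outA_left {X X' : BiMod F G} (f : X ⟶ X') (Y : BiMod G H) (Z : BiMod H K) :
    outR (outR f Y) Z ≫ (outA X' Y Z).hom = (outA X Y Z).hom ≫ outR f (outer Y Z) :=
  hom_ext (associator_naturality_left _ _ _)
lemma outA_middle (X : BiMod F G) {Y Y' : BiMod G H} (g : Y ⟶ Y') (Z : BiMod H K) :
    outR (outL X g) Z ≫ (outA X Y' Z).hom = (outA X Y Z).hom ≫ outL X (outR g Z) :=
  hom_ext (associator_naturality_middle _ _ _)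
lemma outA_right (X : BiMod F G) (Y : BiMod G H) {Z Z' : BiMod H K} (h : Z ⟶ Z') :
    outL (outer X Y) h ≫ (outA X Y Z').hom = (outA X Y Z).hom ≫ outL X (outL Y h) :=
  hom_ext (associator_naturality_right _ _ _)

lemma outL_smul (X : BiMod F G) {Y Y' : BiMod G H} (c : ℂ) (g : Y ⟶ Y') :
    outL X (c • g) = c • outL X g := hom_ext (MonoidalLinear.whiskerLeft_smul _ _ _)
lemma outR_smul {X X' : BiMod F G} (c : ℂ) (f : X ⟶ X') (Y : BiMod G H) :
    outR (c • f) Y = c • outR f Y := hom_ext (MonoidalLinear.smul_whiskerRight _ _ _)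

section Coefficients

/-- The action on `X ⊗ Y` of the coefficient `ξ ((·) v)` of a module `V` over the Hopf algebra
acting in the middle. -/
def coefV (X : BiMod F G) (Y : BiMod G H) {V : HopfRep B} (v : V.carrier)
    (ξ : Module.Dual ℂ V.carrier) : X.obj ⊗ Y.obj ⟶ X.obj ⊗ Y.obj :=
  X.right.hom V v ▷ Y.obj ≫ (α_ _ _ _).hom ≫ X.obj ◁ Y.left.inv V ξ

lemma coefV_nat (X : BiMod F G) (Y : BiMod G H) {V W : HopfRep B} (f : V ⟶ W) (v : V.carrier)
    (ξ : Module.Dual ℂ W.carrier) : coefV X Y (lin f v) ξ = coefV X Y v (ξ ∘ₗ lin f) := by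
  simp only [coefV, X.right.naturality, ← Y.left.inv_naturality, comp_whiskerRight,
    MonoidalCategory.whiskerLeft_comp, Category.assoc]
  monoidal

lemma coefV_comp (X : BiMod F G) (Y : BiMod G H) {V W : HopfRep B} (v : V.carrier) (w : W.carrier)
    (ξ : Module.Dual ℂ V.carrier) (ζ : Module.Dual ℂ W.carrier) :
    coefV X Y w ζ ≫ coefV X Y v ξ = coefV X Y (tmul v w) (dmul ξ ζ) := by
  simp only [coefV, X.right.hom_tmul, comp_whiskerRight, Category.assoc, whisker_assoc,
    Iso.inv_hom_id_assoc]
  rw [← MonoidalCategory.whiskerLeft_comp, Y.left.inv_assoc, whisker_exchange_assoc]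
  simp only [MonoidalCategory.whiskerLeft_comp]
  monoidal

variable [Module.Finite ℂ B]

/-- The action of the function `f` on `X ⊗ Y`. -/
def coef (X : BiMod F G) (Y : BiMod G H) (f : Module.Dual ℂ B) : outer X Y ⟶ outer X Y :=
  mk' (X := outer X Y) (Y := outer X Y) (coefV X Y (toFn f) (evalAt 1))
    (fun V v => by
      change (X.left.hom V v ▷ Y.obj ≫ (α_ (F.obj V) X.obj Y.obj).hom) ≫
        F.obj V ◁ coefV X Y (toFn f) (evalAt 1) = coefV X Y (toFn f) (evalAt 1) ≫
          X.left.hom V v ▷ Y.obj ≫ (α_ (F.obj V) X.obj Y.obj).hom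
      have h := congrArg (· ▷ Y.obj) (X.comm V (fn B) v (toFn f))
      simp only [comp_whiskerRight] at h
      simp only [coefV, Category.assoc]
      rw [whisker_exchange_assoc]
      simp only [MonoidalCategory.whiskerLeft_comp]
      rw [← associator_naturality_middle_assoc, reassoc_of% h]
      monoidal)
    (fun V v => by
      change (X.obj ◁ Y.right.hom V v ≫ (α_ X.obj Y.obj (H.obj V)).inv) ≫
        coefV X Y (toFn f) (evalAt 1) ▷ H.obj V = coefV X Y (toFn f) (evalAt 1) ≫
          X.obj ◁ Y.right.hom V v ≫ (α_ X.obj Y.obj (H.obj V)).inv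
      have h : Y.left.inv (fn B) (evalAt 1) ≫ Y.right.hom V v =
          G.obj (fn B) ◁ Y.right.hom V v ≫ (α_ _ _ _).inv ≫
            Y.left.inv (fn B) (evalAt 1) ▷ H.obj V := by
        refine TrivL.epi0 Y.left.inv_hom fun w => ?_
        have e := Y.comm (fn B) V w v
        rw [reassoc_of% e, Iso.hom_inv_id_assoc, ← comp_whiskerRight, reassoc_of% Y.left.hom_inv,
          Y.left.hom_inv]
        simp
      simp only [coefV, Category.assoc]
      rw [← MonoidalCategory.whiskerLeft_comp_assoc, h]
      simp only [comp_whiskerRight, MonoidalCategory.whiskerLeft_comp, Category.assoc]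
      rw [← associator_inv_naturality_left_assoc, whisker_exchange_assoc]
      monoidal)

@[simp] lemma mor_coef (X : BiMod F G) (Y : BiMod G H) (f : Module.Dual ℂ B) :
    mor (coef X Y f) = coefV X Y (toFn f) (evalAt 1) := rfl

lemma coefV_eq (X : BiMod F G) (Y : BiMod G H) {V : HopfRep B} (v : V.carrier)
    (ξ : Module.Dual ℂ V.carrier) :
    coefV X Y v ξ = coefV X Y (lin (coeffMap ξ) v) (evalAt 1) := by
  rw [coefV_nat, evalAt_one_coeffMap]

lemma coef_comp (X : BiMod F G) (Y : BiMod G H) (f g : Module.Dual ℂ B) :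
    coef X Y f ≫ coef X Y g = coef X Y (conv g f) := by
  refine hom_ext ?_
  change coefV X Y (toFn f) (evalAt 1) ≫ coefV X Y (toFn g) (evalAt 1) =
    coefV X Y (toFn (conv g f)) (evalAt 1)
  rw [coefV_comp, coefV_eq, ← fnMul_apply]
  rfl

lemma coef_outL (X : BiMod F G) {Y Y' : BiMod G H} (g : Y ⟶ Y') (f : Module.Dual ℂ B) :
    outL X g ≫ coef X Y' f = coef X Y f ≫ outL X g := by
  refine hom_ext ?_
  change X.obj ◁ mor g ≫ coefV X Y' (toFn f) (evalAt 1) =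
    coefV X Y (toFn f) (evalAt 1) ≫ X.obj ◁ mor g
  simp only [coefV, Category.assoc]
  rw [← MonoidalCategory.whiskerLeft_comp, ← mor_left_inv, whisker_exchange_assoc]
  simp only [MonoidalCategory.whiskerLeft_comp]
  monoidal

lemma coef_outR {X X' : BiMod F G} (g : X ⟶ X') (Y : BiMod G H) (f : Module.Dual ℂ B) :
    outR g Y ≫ coef X' Y f = coef X Y f ≫ outR g Y := by
  refine hom_ext ?_
  change mor g ▷ Y.obj ≫ coefV X' Y (toFn f) (evalAt 1) =
    coefV X Y (toFn f) (evalAt 1) ≫ mor g ▷ Y.obj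
  simp only [coefV, Category.assoc]
  rw [← comp_whiskerRight_assoc, ← mor_right, whisker_exchange]
  monoidal

lemma coef_outer_right (X : BiMod F G) (Y : BiMod G H) (Z : BiMod H K)
    (f : Module.Dual ℂ B) :
    coef X (outer Y Z) f ≫ (outA X Y Z).inv = (outA X Y Z).inv ≫ outR (coef X Y f) Z := by
  refine hom_ext ?_
  change (X.right.hom (fn B) (toFn f) ▷ (Y.obj ⊗ Z.obj) ≫
    (α_ X.obj (G.obj (fn B)) (Y.obj ⊗ Z.obj)).hom ≫ X.obj ◁ ((α_ (G.obj (fn B)) Y.obj Z.obj).inv ≫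
      Y.left.inv (fn B) (evalAt 1) ▷ Z.obj)) ≫ (α_ X.obj Y.obj Z.obj).inv =
    (α_ X.obj Y.obj Z.obj).inv ≫ (X.right.hom (fn B) (toFn f) ▷ Y.obj ≫
      (α_ X.obj (G.obj (fn B)) Y.obj).hom ≫ X.obj ◁ Y.left.inv (fn B) (evalAt 1)) ▷ Z.obj
  monoidal

variable [Module.Finite ℂ C]

lemma coef_outer_left (X : BiMod F G) (Y : BiMod G H) (Z : BiMod H K)
    (f : Module.Dual ℂ C) :
    coef (outer X Y) Z f ≫ (outA X Y Z).hom = (outA X Y Z).hom ≫ outL X (coef Y Z f) := by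
  refine hom_ext ?_
  change ((X.obj ◁ Y.right.hom (fn C) (toFn f) ≫ (α_ X.obj Y.obj (H.obj (fn C))).inv) ▷ Z.obj ≫
    (α_ (X.obj ⊗ Y.obj) (H.obj (fn C)) Z.obj).hom ≫
      (X.obj ⊗ Y.obj) ◁ Z.left.inv (fn C) (evalAt 1)) ≫ (α_ X.obj Y.obj Z.obj).hom =
    (α_ X.obj Y.obj Z.obj).hom ≫ X.obj ◁ (Y.right.hom (fn C) (toFn f) ▷ Z.obj ≫
      (α_ Y.obj (H.obj (fn C)) Z.obj).hom ≫ Y.obj ◁ Z.left.inv (fn C) (evalAt 1))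
  monoidal

end Coefficients

lemma finrank_ne_zero' (B : Type) [Ring B] [HopfAlgebra ℂ B] [Module.Finite ℂ B] :
    (Module.finrank ℂ B : ℂ) ≠ 0 := by
  have : Nontrivial B := by
    refine ⟨⟨0, 1, fun h => ?_⟩⟩
    have := congrArg (Coalgebra.counit (R := ℂ)) h
    simp at this
  exact_mod_cast Module.finrank_pos.ne'

section Relative

variable [Module.Finite ℂ B] [IsInvolutive B]

/-- The projection `e_B` to the part of `X ⊗ Y` on which the two actions in the middle agree:
the action of the averaged sum of the irreducible characters of `B`, weighted by dimensions,
which is the character of the regular module. -/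
def idem (X : BiMod F G) (Y : BiMod G H) : outer X Y ⟶ outer X Y :=
  (Module.finrank ℂ B : ℂ)⁻¹ • coef X Y (regChar B)

lemma coef_idem (X : BiMod F G) (Y : BiMod G H) (f : Module.Dual ℂ B) :
    coef X Y f ≫ idem X Y = f 1 • idem X Y := by
  rw [idem, Linear.comp_smul, coef_comp, regChar_conv IsInvolutive.sq, smul_comm]
  congr 1
  refine hom_ext ?_
  change coefV X Y _ _ = f 1 • coefV X Y _ _
  rw [coefV, coefV, map_smul, map_smul]
  simp

lemma idem_idem (X : BiMod F G) (Y : BiMod G H) : idem X Y ≫ idem X Y = idem X Y := by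
  nth_rewrite 1 [idem]
  rw [Linear.smul_comp, coef_idem, regChar_one, smul_smul, inv_mul_cancel₀ (finrank_ne_zero' B),
    one_smul]

lemma idem_outL (X : BiMod F G) {Y Y' : BiMod G H} (g : Y ⟶ Y') :
    outL X g ≫ idem X Y' = idem X Y ≫ outL X g := by
  rw [idem, idem, Linear.comp_smul, Linear.smul_comp, coef_outL]

lemma idem_outR {X X' : BiMod F G} (g : X ⟶ X') (Y : BiMod G H) :
    outR g Y ≫ idem X' Y = idem X Y ≫ outR g Y := by
  rw [idem, idem, Linear.comp_smul, Linear.smul_comp, coef_outR]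

lemma idem_outer_right (X : BiMod F G) (Y : BiMod G H) (Z : BiMod H K) :
    outR (idem X Y) Z ≫ (outA X Y Z).hom = (outA X Y Z).hom ≫ idem X (outer Y Z) := by
  rw [← cancel_epi (outA X Y Z).inv, Iso.inv_hom_id_assoc, ← cancel_mono (outA X Y Z).inv]
  simp only [Category.assoc, Iso.hom_inv_id, Category.comp_id]
  rw [idem, idem, Linear.smul_comp, coef_outer_right, ← Linear.comp_smul, ← outR_smul]

variable [IsIdempotentComplete T]

lemma exists_split (X : BiMod F G) (Y : BiMod G H) :
    ∃ (P : T) (i : P ⟶ (outer X Y).obj) (r : (outer X Y).obj ⟶ P),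
      i ≫ r = 𝟙 P ∧ r ≫ i = mor (idem X Y) :=
  IsIdempotentComplete.idempotents_split _ (mor (idem X Y)) (congrArg mor (idem_idem X Y))

/-- The relative tensor product: the image of the projection. -/
def comp (X : BiMod F G) (Y : BiMod G H) : BiMod F H :=
  retract (outer X Y) (exists_split X Y).choose_spec.choose
    (exists_split X Y).choose_spec.choose_spec.choose
    (exists_split X Y).choose_spec.choose_spec.choose_spec.1 (idem X Y)
    (exists_split X Y).choose_spec.choose_spec.choose_spec.2

/-- The inclusion of the relative tensor product in the outer tensor product. -/
def ι (X : BiMod F G) (Y : BiMod G H) : comp X Y ⟶ outer X Y := retractι _ _ _ _ _ _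

/-- The projection of the outer tensor product to the relative tensor product. -/
def π (X : BiMod F G) (Y : BiMod G H) : outer X Y ⟶ comp X Y := retractπ _ _ _ _ _ _

@[simp] lemma ι_π (X : BiMod F G) (Y : BiMod G H) : ι X Y ≫ π X Y = 𝟙 _ :=
  hom_ext (exists_split X Y).choose_spec.choose_spec.choose_spec.1

lemma π_ι (X : BiMod F G) (Y : BiMod G H) : π X Y ≫ ι X Y = idem X Y :=
  hom_ext (exists_split X Y).choose_spec.choose_spec.choose_spec.2

lemma idem_π (X : BiMod F G) (Y : BiMod G H) : idem X Y ≫ π X Y = π X Y := by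
  rw [← π_ι, Category.assoc, ι_π, Category.comp_id]

lemma ι_idem (X : BiMod F G) (Y : BiMod G H) : ι X Y ≫ idem X Y = ι X Y := by
  rw [← π_ι, reassoc_of% ι_π]

/-- Two morphisms out of a relative tensor product which agree after projection. -/
lemma π_epi {X : BiMod F G} {Y : BiMod G H} {Z : BiMod F H} {f g : comp X Y ⟶ Z}
    (h : π X Y ≫ f = π X Y ≫ g) : f = g := by
  have := congrArg (ι X Y ≫ ·) h
  simpa [reassoc_of% ι_π] using this

/-- The relative tensor product on morphisms of the second factor. -/
def compL (X : BiMod F G) {Y Y' : BiMod G H} (g : Y ⟶ Y') : comp X Y ⟶ comp X Y' :=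
  ι X Y ≫ outL X g ≫ π X Y'

/-- The relative tensor product on morphisms of the first factor. -/
def compR {X X' : BiMod F G} (f : X ⟶ X') (Y : BiMod G H) : comp X Y ⟶ comp X' Y :=
  ι X Y ≫ outR f Y ≫ π X' Y

lemma π_compL (X : BiMod F G) {Y Y' : BiMod G H} (g : Y ⟶ Y') :
    π X Y ≫ compL X g = outL X g ≫ π X Y' := by
  rw [compL, reassoc_of% π_ι, ← reassoc_of% idem_outL, idem_π]

lemma π_compR {X X' : BiMod F G} (f : X ⟶ X') (Y : BiMod G H) :
    π X Y ≫ compR f Y = outR f Y ≫ π X' Y := by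
  rw [compR, reassoc_of% π_ι, ← reassoc_of% idem_outR, idem_π]

lemma compL_id (X : BiMod F G) (Y : BiMod G H) : compL X (𝟙 Y) = 𝟙 _ := by simp [compL]

lemma compR_id (X : BiMod F G) (Y : BiMod G H) : compR (𝟙 X) Y = 𝟙 _ := by simp [compR]

lemma compL_comp (X : BiMod F G) {Y Y' Y'' : BiMod G H} (g : Y ⟶ Y') (h : Y' ⟶ Y'') :
    compL X (g ≫ h) = compL X g ≫ compL X h := by
  refine π_epi ?_
  rw [π_compL, reassoc_of% π_compL, π_compL, outL_comp, Category.assoc]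

lemma compR_comp {X X' X'' : BiMod F G} (f : X ⟶ X') (g : X' ⟶ X'') (Y : BiMod G H) :
    compR (f ≫ g) Y = compR f Y ≫ compR g Y := by
  refine π_epi ?_
  rw [π_compR, reassoc_of% π_compR, π_compR, outR_comp, Category.assoc]

lemma comp_exchange {X X' : BiMod F G} (f : X ⟶ X') {Y Y' : BiMod G H} (g : Y ⟶ Y') :
    compL X g ≫ compR f Y' = compR f Y ≫ compL X' g := by
  refine π_epi ?_
  rw [reassoc_of% π_compL, π_compR, reassoc_of% π_compR, π_compL, reassoc_of% out_exchange]

end Relative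

section Associativity

variable [Module.Finite ℂ B] [IsInvolutive B] [Module.Finite ℂ C] [IsInvolutive C]

lemma idem_outer_left (X : BiMod F G) (Y : BiMod G H) (Z : BiMod H K) :
    idem (outer X Y) Z ≫ (outA X Y Z).hom = (outA X Y Z).hom ≫ outL X (idem Y Z) := by
  rw [idem, Linear.smul_comp, coef_outer_left, ← Linear.comp_smul, ← outL_smul]
  rfl

variable [IsIdempotentComplete T]

lemma assoc_aux (X : BiMod F G) (Y : BiMod G H) (Z : BiMod H K) :
    outR (π X Y) Z ≫ π (comp X Y) Z ≫ ι (comp X Y) Z ≫ outR (ι X Y) Z ≫ (outA X Y Z).hom ≫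
      outL X (π Y Z) ≫ π X (comp Y Z) = (outA X Y Z).hom ≫ outL X (π Y Z) ≫ π X (comp Y Z) := by
  have h1 : outR (π X Y) Z ≫ outR (ι X Y) Z = outR (idem X Y) Z := by rw [← outR_comp, π_ι]
  have h2 : outL X (idem Y Z) ≫ outL X (π Y Z) = outL X (π Y Z) := by rw [← outL_comp, idem_π]
  rw [reassoc_of% π_ι, reassoc_of% idem_outR, reassoc_of% h1, reassoc_of% idem_outer_right,
    ← reassoc_of% idem_outL, idem_π, reassoc_of% idem_outer_left, reassoc_of% h2]

lemma assoc_inv_aux (X : BiMod F G) (Y : BiMod G H) (Z : BiMod H K) :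
    outL X (π Y Z) ≫ π X (comp Y Z) ≫ ι X (comp Y Z) ≫ outL X (ι Y Z) ≫ (outA X Y Z).inv ≫
      outR (π X Y) Z ≫ π (comp X Y) Z = (outA X Y Z).inv ≫ outR (π X Y) Z ≫ π (comp X Y) Z := by
  have h1 : outL X (π Y Z) ≫ outL X (ι Y Z) = outL X (idem Y Z) := by rw [← outL_comp, π_ι]
  have h2 : outR (idem X Y) Z ≫ outR (π X Y) Z = outR (π X Y) Z := by rw [← outR_comp, idem_π]
  have h3 : outL X (idem Y Z) ≫ (outA X Y Z).inv = (outA X Y Z).inv ≫ idem (outer X Y) Z := by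
    rw [← cancel_epi (outA X Y Z).hom, ← cancel_mono (outA X Y Z).hom]
    simp [idem_outer_left]
  have h4 : idem X (outer Y Z) ≫ (outA X Y Z).inv = (outA X Y Z).inv ≫ outR (idem X Y) Z := by
    rw [← cancel_epi (outA X Y Z).hom, ← cancel_mono (outA X Y Z).hom]
    simp [idem_outer_right]
  rw [reassoc_of% π_ι, reassoc_of% idem_outL, reassoc_of% h1, reassoc_of% h3,
    ← reassoc_of% idem_outR, idem_π, reassoc_of% h4, reassoc_of% h2]

lemma π₃_epi {X : BiMod F G} {Y : BiMod G H} {Z : BiMod H K} {W : BiMod F K}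
    {f g : comp (comp X Y) Z ⟶ W}
    (h : outR (π X Y) Z ≫ π _ Z ≫ f = outR (π X Y) Z ≫ π _ Z ≫ g) : f = g := by
  refine π_epi ?_
  have := congrArg (outR (ι X Y) Z ≫ ·) h
  have h1 : outR (ι X Y) Z ≫ outR (π X Y) Z = 𝟙 _ := by rw [← outR_comp, ι_π, outR_id]
  simpa [reassoc_of% h1] using this

lemma π₃_epi' {X : BiMod F G} {Y : BiMod G H} {Z : BiMod H K} {W : BiMod F K}
    {f g : comp X (comp Y Z) ⟶ W}
    (h : outL X (π Y Z) ≫ π X _ ≫ f = outL X (π Y Z) ≫ π X _ ≫ g) : f = g := by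
  refine π_epi ?_
  have := congrArg (outL X (ι Y Z) ≫ ·) h
  have h1 : outL X (ι Y Z) ≫ outL X (π Y Z) = 𝟙 _ := by rw [← outL_comp, ι_π, outL_id]
  simpa [reassoc_of% h1] using this

/-- The associativity of relative tensor products, induced from that of `T`. -/
def compA (X : BiMod F G) (Y : BiMod G H) (Z : BiMod H K) :
    comp (comp X Y) Z ≅ comp X (comp Y Z) where
  hom := ι (comp X Y) Z ≫ outR (ι X Y) Z ≫ (outA X Y Z).hom ≫ outL X (π Y Z) ≫ π X (comp Y Z)
  inv := ι X (comp Y Z) ≫ outL X (ι Y Z) ≫ (outA X Y Z).inv ≫ outR (π X Y) Z ≫ π (comp X Y) Z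
  hom_inv_id := by
    refine π₃_epi ?_
    simp only [Category.assoc]
    rw [reassoc_of% (assoc_aux X Y Z), assoc_inv_aux]
    simp
  inv_hom_id := by
    refine π₃_epi' ?_
    simp only [Category.assoc]
    rw [reassoc_of% (assoc_inv_aux X Y Z), assoc_aux]
    simp

lemma compA_hom (X : BiMod F G) (Y : BiMod G H) (Z : BiMod H K) :
    outR (π X Y) Z ≫ π (comp X Y) Z ≫ (compA X Y Z).hom =
      (outA X Y Z).hom ≫ outL X (π Y Z) ≫ π X (comp Y Z) := assoc_aux X Y Z

lemma compA_left {X X' : BiMod F G} (f : X ⟶ X') (Y : BiMod G H) (Z : BiMod H K) :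
    compR (compR f Y) Z ≫ (compA X' Y Z).hom = (compA X Y Z).hom ≫ compR f (comp Y Z) := by
  refine π₃_epi ?_
  rw [reassoc_of% π_compR, ← Category.assoc, ← outR_comp, π_compR, outR_comp, Category.assoc,
    compA_hom, reassoc_of% outA_left, reassoc_of% compA_hom, π_compR, ← reassoc_of% out_exchange]

lemma compA_middle (X : BiMod F G) {Y Y' : BiMod G H} (g : Y ⟶ Y') (Z : BiMod H K) :
    compR (compL X g) Z ≫ (compA X Y' Z).hom = (compA X Y Z).hom ≫ compL X (compR g Z) := by
  refine π₃_epi ?_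
  rw [reassoc_of% π_compR, ← Category.assoc, ← outR_comp, π_compL, outR_comp, Category.assoc,
    compA_hom, reassoc_of% outA_middle, reassoc_of% compA_hom, π_compL, ← Category.assoc (outL X _),
    ← outL_comp, ← π_compR, outL_comp, Category.assoc]

lemma compA_right (X : BiMod F G) (Y : BiMod G H) {Z Z' : BiMod H K} (h : Z ⟶ Z') :
    compL (comp X Y) h ≫ (compA X Y Z').hom = (compA X Y Z).hom ≫ compL X (compL Y h) := by
  refine π₃_epi ?_
  have e : outL X (outL Y h) ≫ outL X (π Y Z') = outL X (π Y Z) ≫ outL X (compL Y h) := by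
    rw [← outL_comp, ← outL_comp, π_compL]
  rw [reassoc_of% π_compL, ← reassoc_of% out_exchange, compA_hom, reassoc_of% outA_right,
    reassoc_of% compA_hom, π_compL, reassoc_of% e]

end Associativity

section Pentagon

variable [Module.Finite ℂ B] [IsInvolutive B] [Module.Finite ℂ C] [IsInvolutive C]
  [Module.Finite ℂ E] [IsInvolutive E] [IsIdempotentComplete T]
  {E' : Type} [Ring E'] [HopfAlgebra ℂ E'] {K' : HopfRep E' ⥤ T} [K'.Monoidal]

lemma comp_pentagon (X : BiMod F G) (Y : BiMod G H) (Z : BiMod H K) (W : BiMod K K') :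
    compR (compA X Y Z).hom W ≫ (compA X (comp Y Z) W).hom ≫ compL X (compA Y Z W).hom =
      (compA (comp X Y) Z W).hom ≫ (compA X Y (comp Z W)).hom := by
  refine π₃_epi ?_
  have h1 : outR (outR (ι X Y) Z) W ≫ outR (outR (π X Y) Z) W = 𝟙 _ := by
    rw [← outR_comp, ← outR_comp, ι_π, outR_id, outR_id]
  suffices h : outR (outR (π X Y) Z) W ≫ outR (π (comp X Y) Z) W ≫ π _ W ≫
      compR (compA X Y Z).hom W ≫ (compA X (comp Y Z) W).hom ≫ compL X (compA Y Z W).hom =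
      outR (outR (π X Y) Z) W ≫ outR (π (comp X Y) Z) W ≫ π _ W ≫
      (compA (comp X Y) Z W).hom ≫ (compA X Y (comp Z W)).hom by
    have := congrArg (outR (outR (ι X Y) Z) W ≫ ·) h
    simpa only [reassoc_of% h1] using this
  have h2 : outR (outR (π X Y) Z) W ≫ outR (π (comp X Y) Z) W ≫ outR (compA X Y Z).hom W =
      outR (outA X Y Z).hom W ≫ outR (outL X (π Y Z)) W ≫ outR (π X (comp Y Z)) W := by
    simp only [← outR_comp, compA_hom]
  have h3 : outL X (outR (π Y Z) W) ≫ outL X (π (comp Y Z) W) ≫ outL X (compA Y Z W).hom =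
      outL X (outA Y Z W).hom ≫ outL X (outL Y (π Z W)) ≫ outL X (π Y (comp Z W)) := by
    simp only [← outL_comp, compA_hom]
  have h4 : outR (outA X Y Z).hom W ≫ (outA X (outer Y Z) W).hom ≫ outL X (outA Y Z W).hom =
      (outA (outer X Y) Z W).hom ≫ (outA X Y (outer Z W)).hom :=
    hom_ext (MonoidalCategory.pentagon _ _ _ _)
  rw [reassoc_of% π_compR, reassoc_of% h2, reassoc_of% compA_hom, reassoc_of% outA_middle, π_compL,
    reassoc_of% h3, reassoc_of% h4, reassoc_of% compA_hom, reassoc_of% outA_left,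
    ← reassoc_of% out_exchange, compA_hom, reassoc_of% outA_right]

end Pentagon

end BiMod
end TensorOver
end

noncomputable section

open CategoryTheory
open scoped TensorProduct

namespace HopfRep

open MonoidalCategory

variable {A : Type} [Ring A] [HopfAlgebra ℂ A] [Module.Finite ℂ A]

/-- The gauge transformation `f ↦ f (c ·)` of the function algebra. -/
def gaugeMap (c : A) : fn A ⟶ fn A := coeffMap (evalAt c)

lemma gaugeMap_apply (c b : A) (f : (fn A).carrier) :
    evalAt b (lin (gaugeMap c) f) = evalAt (c * b) f := rfl

lemma evalAt_gaugeMap (c b : A) : evalAt b ∘ₗ lin (gaugeMap c) = evalAt (c * b) := rfl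

lemma gaugeMap_comp (c d : A) (h : c * d = 1) : gaugeMap c ≫ gaugeMap d = 𝟙 (fn A) := by
  refine hom_fn_ext ?_
  ext f
  simp only [lin_comp, LinearMap.comp_apply, gaugeMap_apply, mul_one, h, lin_id,
    LinearMap.id_apply]

lemma comp_coeffMap {V W : HopfRep A} (f : V ⟶ W) (ξ : Module.Dual ℂ W.carrier) :
    f ≫ coeffMap ξ = coeffMap (ξ ∘ₗ lin f) := by
  refine hom_fn_ext ?_
  ext v
  simp

lemma coeffMap_add {V : HopfRep A} (ξ ζ : Module.Dual ℂ V.carrier) :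
    coeffMap (ξ + ζ) = coeffMap ξ + coeffMap ζ := by
  refine hom_fn_ext ?_
  ext v
  simp [lin_add]

lemma coeffMap_smul {V : HopfRep A} (c : ℂ) (ξ : Module.Dual ℂ V.carrier) :
    coeffMap (c • ξ) = c • coeffMap ξ := by
  refine hom_fn_ext ?_
  ext v
  simp [lin_smul]

lemma dmul_add_left {V W : HopfRep A} (ξ ξ' : Module.Dual ℂ V.carrier)
    (ζ : Module.Dual ℂ W.carrier) : dmul (ξ + ξ') ζ = dmul ξ ζ + dmul ξ' ζ :=
  tensor_lin_ext fun v w => by simp [add_mul]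

lemma dmul_add_right {V W : HopfRep A} (ξ : Module.Dual ℂ V.carrier)
    (ζ ζ' : Module.Dual ℂ W.carrier) : dmul ξ (ζ + ζ') = dmul ξ ζ + dmul ξ ζ' :=
  tensor_lin_ext fun v w => by simp [mul_add]

lemma dmul_smul_left {V W : HopfRep A} (c : ℂ) (ξ : Module.Dual ℂ V.carrier)
    (ζ : Module.Dual ℂ W.carrier) : dmul (c • ξ) ζ = c • dmul ξ ζ :=
  tensor_lin_ext fun v w => by simp [mul_assoc]

lemma dmul_smul_right {V W : HopfRep A} (c : ℂ) (ξ : Module.Dual ℂ V.carrier)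
    (ζ : Module.Dual ℂ W.carrier) : dmul ξ (c • ζ) = c • dmul ξ ζ :=
  tensor_lin_ext fun v w => by simp [mul_left_comm]

lemma leftUnitor_eq_coeffMap : (λ_ (fn A)).hom = coeffMap (dmul oneD (evalAt 1)) := by
  refine hom_fn_ext (tensor_lin_ext fun x f => ?_)
  rw [evalAt_one_coeffMap]
  simp

lemma rightUnitor_eq_coeffMap : (ρ_ (fn A)).hom = coeffMap (dmul (evalAt 1) oneD) := by
  refine hom_fn_ext (tensor_lin_ext fun x f => ?_)
  rw [evalAt_one_coeffMap]
  simp [mul_comm]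

lemma tensor_lin_ext₃ {U V W : HopfRep A} {M : Type*} [AddCommGroup M] [Module ℂ M]
    {f g : ((U ⊗ V) ⊗ W).carrier →ₗ[ℂ] M}
    (h : ∀ u v w, f (tmul (tmul u v) w) = g (tmul (tmul u v) w)) : f = g :=
  TensorProduct.ext_threefold h

lemma evalAt_one_coeffMap_apply {V : HopfRep A} (ξ : Module.Dual ℂ V.carrier) (v : V.carrier) :
    evalAt 1 (lin (coeffMap ξ) v) = ξ v := LinearMap.congr_fun (evalAt_one_coeffMap ξ) v

lemma coeffMap_assoc_left (V W : HopfRep A) (ξ : Module.Dual ℂ V.carrier)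
    (ζ : Module.Dual ℂ W.carrier) :
    coeffMap (dmul (dmul ξ ζ) (evalAt 1)) = (α_ V W (fn A)).hom ≫
      V ◁ coeffMap (dmul ζ (evalAt 1)) ≫ coeffMap (dmul ξ (evalAt 1)) := by
  simp only [comp_coeffMap]
  congr 1
  refine tensor_lin_ext₃ fun v w f => ?_
  simp only [LinearMap.comp_apply, assoc_tmul, whiskerLeft_tmul, dmul_tmul,
    evalAt_one_coeffMap_apply, mul_assoc]

lemma coeffMap_assoc_right (V W : HopfRep A) (ξ : Module.Dual ℂ V.carrier)
    (ζ : Module.Dual ℂ W.carrier) :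
    (α_ (fn A) V W).hom ≫ coeffMap (dmul (evalAt 1) (dmul ξ ζ)) =
      coeffMap (dmul (evalAt 1) ξ) ▷ W ≫ coeffMap (dmul (evalAt 1) ζ) := by
  simp only [comp_coeffMap]
  congr 1
  refine tensor_lin_ext₃ fun f v w => ?_
  simp only [LinearMap.comp_apply, assoc_tmul, whiskerRight_tmul, dmul_tmul,
    evalAt_one_coeffMap_apply, mul_assoc]

lemma coeffMap_comm (V W : HopfRep A) (ξ : Module.Dual ℂ V.carrier)
    (ζ : Module.Dual ℂ W.carrier) :
    coeffMap (dmul ξ (evalAt 1)) ▷ W ≫ coeffMap (dmul (evalAt 1) ζ) = (α_ V (fn A) W).hom ≫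
      V ◁ coeffMap (dmul (evalAt 1) ζ) ≫ coeffMap (dmul ξ (evalAt 1)) := by
  simp only [comp_coeffMap]
  congr 1
  refine tensor_lin_ext₃ fun v f w => ?_
  simp only [LinearMap.comp_apply, assoc_tmul, whiskerRight_tmul, whiskerLeft_tmul, dmul_tmul,
    evalAt_one_coeffMap_apply, mul_assoc]

end HopfRep

section UnitModule

open MonoidalCategory HopfRep Functor.LaxMonoidal Functor.OplaxMonoidal HopfAlgebra

variable {T : Type u} [Category.{v} T] [Preadditive T] [Linear ℂ T] [MonoidalCategory T]
  [MonoidalPreadditive T] [MonoidalLinear ℂ T]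
  {A : Type} [Ring A] [HopfAlgebra ℂ A] (F : HopfRep A ⥤ T) [F.Monoidal] [F.Additive]
  [F.Linear ℂ] [Module.Finite ℂ A] [IsInvolutive A]

/-- The left action on the function algebra: `F(V) ⊗ F(A*) ⟶ F(A*)` takes `v ⊗ f` to the product
of the coefficient `ξ ((·) v)` and `f`. -/
def unitL : TrivL F (F.obj (fn A)) :=
  TrivL.ofInv
    (fun V =>
      { toFun := fun ξ => μ F V (fn A) ≫ F.map (coeffMap (dmul ξ (evalAt 1)))
        map_add' := fun ξ ζ => by simp [dmul_add_left, coeffMap_add]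
        map_smul' := fun c ξ => by simp [dmul_smul_left, coeffMap_smul] })
    (by
      intro V W f ξ
      change F.map f ▷ F.obj (fn A) ≫ μ F W (fn A) ≫ F.map (coeffMap (dmul ξ (evalAt 1))) =
        μ F V (fn A) ≫ F.map (coeffMap (dmul (ξ ∘ₗ lin f) (evalAt 1)))
      rw [μ_natural_left_assoc, ← F.map_comp, comp_coeffMap]
      congr 3
      exact tensor_lin_ext fun _ _ => rfl)
    (by
      change _ = μ F (𝟙_ _) (fn A) ≫ F.map (coeffMap (dmul oneD (evalAt 1)))
      rw [← leftUnitor_eq_coeffMap, Functor.Monoidal.map_leftUnitor, Functor.Monoidal.μ_δ_assoc])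
    (by
      intro V W ξ ζ
      change μ F V W ▷ F.obj (fn A) ≫ μ F (V ⊗ W) (fn A) ≫
        F.map (coeffMap (dmul (dmul ξ ζ) (evalAt 1))) = (α_ _ _ _).hom ≫
          F.obj V ◁ (μ F W (fn A) ≫ F.map (coeffMap (dmul ζ (evalAt 1)))) ≫ μ F V (fn A) ≫
            F.map (coeffMap (dmul ξ (evalAt 1)))
      rw [coeffMap_assoc_left, F.map_comp, F.map_comp, MonoidalCategory.whiskerLeft_comp_assoc,
        μ_natural_right_assoc, Functor.LaxMonoidal.associativity_assoc])

/-- The right action on the function algebra: `F(A*) ⊗ F(W) ⟶ F(A*)` takes `f ⊗ w` to the product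
of `f` and the coefficient `ξ ((·) w)`. -/
def unitR : TrivR F (F.obj (fn A)) :=
  TrivR.ofInv IsInvolutive.sq
    (fun V =>
      { toFun := fun ξ => μ F (fn A) V ≫ F.map (coeffMap (dmul (evalAt 1) ξ))
        map_add' := fun ξ ζ => by simp [dmul_add_right, coeffMap_add]
        map_smul' := fun c ξ => by simp [dmul_smul_right, coeffMap_smul] })
    (by
      intro V W f ξ
      change F.obj (fn A) ◁ F.map f ≫ μ F (fn A) W ≫ F.map (coeffMap (dmul (evalAt 1) ξ)) =
        μ F (fn A) V ≫ F.map (coeffMap (dmul (evalAt 1) (ξ ∘ₗ lin f)))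
      rw [μ_natural_right_assoc, ← F.map_comp, comp_coeffMap]
      congr 3
      exact tensor_lin_ext fun _ _ => rfl)
    (by
      change _ = μ F (fn A) (𝟙_ _) ≫ F.map (coeffMap (dmul (evalAt 1) oneD))
      rw [← rightUnitor_eq_coeffMap, Functor.Monoidal.map_rightUnitor, Functor.Monoidal.μ_δ_assoc])
    (by
      intro V W ξ ζ
      change F.obj (fn A) ◁ μ F V W ≫ μ F (fn A) (V ⊗ W) ≫
        F.map (coeffMap (dmul (evalAt 1) (dmul ξ ζ))) = (α_ _ _ _).inv ≫
          (μ F (fn A) V ≫ F.map (coeffMap (dmul (evalAt 1) ξ))) ▷ F.obj W ≫ μ F (fn A) W ≫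
            F.map (coeffMap (dmul (evalAt 1) ζ))
      rw [comp_whiskerRight_assoc, μ_natural_left_assoc, ← F.map_comp, ← coeffMap_assoc_right,
        F.map_comp, ← cancel_epi (α_ _ _ _).hom, Iso.hom_inv_id_assoc,
        ← Functor.LaxMonoidal.associativity_assoc])

lemma unitL_inv (V : HopfRep A) (ξ : Module.Dual ℂ V.carrier) :
    (unitL F).inv V ξ = μ F V (fn A) ≫ F.map (coeffMap (dmul ξ (evalAt 1))) := rfl

lemma unitR_inv (V : HopfRep A) (ξ : Module.Dual ℂ V.carrier) :
    (unitR F).inv V ξ = μ F (fn A) V ≫ F.map (coeffMap (dmul (evalAt 1) ξ)) := rfl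

lemma unitR_hom (V : HopfRep A) (v : V.carrier) :
    (unitR F).hom V v = (ρ_ _).inv ≫ F.obj (fn A) ◁ copairF F (coev' IsInvolutive.sq V) ≫
      (α_ _ _ _).inv ≫ (μ F (fn A) (HopfRep.dual V) ≫
        F.map (coeffMap (dmul (evalAt 1) (bid v)))) ▷ F.obj V := rfl

/-- The function algebra as a bimodule; by the decomposition of `A*` into matrix coefficients,
this is the sum of the `F(V) ⊗ V*` over the irreducible modules `V`. -/
def unit₀ : BiMod F F where
  obj := F.obj (fn A)
  left := unitL F
  right := unitR F
  comm V W v w := comm_of_inv (unitL F) (unitR F) V W (fun ξ ζ => by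
    rw [unitL_inv, unitR_inv, comp_whiskerRight_assoc, μ_natural_left_assoc, ← F.map_comp,
      coeffMap_comm, F.map_comp, F.map_comp, MonoidalCategory.whiskerLeft_comp_assoc,
      μ_natural_right_assoc, Functor.LaxMonoidal.associativity_assoc]) v w

lemma map_gauge (c d : A) (h : c * d = 1) :
    F.map (gaugeMap c) ≫ F.map (gaugeMap d) = 𝟙 (F.obj (fn A)) := by
  rw [← F.map_comp, gaugeMap_comp c d h, F.map_id]

/-- The unit object: the function algebra, with both actions renormalized by the gauge `γ`. -/
def unitM (γ : Aˣ) : BiMod F F :=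
  BiMod.retract (unit₀ F) (F.map (gaugeMap (γ : A))) (F.map (gaugeMap (γ⁻¹ : Aˣ)))
    (map_gauge F _ _ γ.mul_inv) (𝟙 _) (map_gauge F _ _ γ.inv_mul)

/-- The gauge transformation, from the unit object to the function algebra. -/
def unitIso (γ : Aˣ) : unitM F γ ≅ unit₀ F where
  hom := BiMod.retractι _ _ _ _ _ _
  inv := BiMod.retractπ _ _ _ _ _ _
  hom_inv_id := BiMod.hom_ext (map_gauge F _ _ γ.mul_inv)
  inv_hom_id := BiMod.hom_ext (map_gauge F _ _ γ.inv_mul)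


variable {F} {B : Type} [Ring B] [HopfAlgebra ℂ B] {G : HopfRep B ⥤ T} [G.Monoidal]
  {C : Type} [Ring C] [HopfAlgebra ℂ C] {H : HopfRep C ⥤ T} [H.Monoidal]

/-- Contraction of the second factor with a functional. -/
def contr {V W : HopfRep A} (ξ : Module.Dual ℂ W.carrier) : (V ⊗ W).carrier →ₗ[ℂ] V.carrier :=
  (TensorProduct.rid ℂ V.carrier).toLinearMap ∘ₗ
    (TensorProduct.map LinearMap.id ξ : V.carrier ⊗[ℂ] W.carrier →ₗ[ℂ] V.carrier ⊗[ℂ] ℂ)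

@[simp] lemma contr_tmul {V W : HopfRep A} (ξ : Module.Dual ℂ W.carrier) (v : V.carrier)
    (w : W.carrier) : contr ξ (tmul v w) = ξ w • v := rfl

lemma TrivL.hom_contr {X : T} (L : TrivL F X) {U V W : HopfRep A} (ψ : U ⟶ V ⊗ W) (u : U.carrier)
    (ξ : Module.Dual ℂ W.carrier) :
    L.hom U u ≫ F.map ψ ▷ X ≫ δ F V W ▷ X ≫ (α_ _ _ _).hom ≫ F.obj V ◁ L.inv W ξ =
      L.hom V (contr ξ (lin ψ u)) := by
  rw [← reassoc_of% L.naturality]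
  have key : Linear.rightComp ℂ X (δ F V W ▷ X ≫ (α_ _ _ _).hom ≫ F.obj V ◁ L.inv W ξ) ∘ₗ
      L.hom (V ⊗ W) = L.hom V ∘ₗ contr ξ := by
    refine tensor_lin_ext fun v w => ?_
    change L.hom (V ⊗ W) (tmul v w) ≫ δ F V W ▷ X ≫ (α_ _ _ _).hom ≫ F.obj V ◁ L.inv W ξ =
      L.hom V (contr ξ (tmul v w))
    rw [reassoc_of% L.assoc, Iso.inv_hom_id_assoc, ← MonoidalCategory.whiskerLeft_comp, L.hom_inv,
      contr_tmul, map_smul]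
    simp
  exact LinearMap.congr_fun key _

/-- The morphism `A* ⟶ A* ⊗ V` underlying the right action on the function algebra. -/
def unitψ {V : HopfRep A} (v : V.carrier) : fn A ⟶ fn A ⊗ V :=
  (ρ_ _).inv ≫ fn A ◁ coev' IsInvolutive.sq V ≫ (α_ _ _ _).inv ≫
    coeffMap (dmul (evalAt 1) (bid v)) ▷ V

lemma unitR_hom_eq (V : HopfRep A) (v : V.carrier) :
    (unitR F).hom V v = F.map (unitψ v) ≫ δ F (fn A) V := by
  rw [unitR_hom]
  simp only [unitψ, Functor.map_comp, Functor.Monoidal.map_rightUnitor_inv,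
    Functor.Monoidal.map_whiskerRight, Functor.Monoidal.map_associator_inv,
    Functor.Monoidal.map_whiskerLeft, Category.assoc, Functor.Monoidal.μ_δ_assoc,
    Functor.Monoidal.μ_δ, copairF, comp_whiskerRight, MonoidalCategory.whiskerLeft_comp,
    Category.comp_id]

lemma contr_unitψ {V : HopfRep A} (v : V.carrier) (ξ : Module.Dual ℂ V.carrier)
    (f : (fn A).carrier) :
    contr ξ (lin (unitψ v) f) =
      lin (coeffMap (dmul (evalAt 1) (bid v))) (tmul f (toDual ξ)) := by
  simp only [unitψ, lin_comp, LinearMap.comp_apply, rightUnitor_inv, whiskerLeft_tmul, lin_coev',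
    tmul_sum, map_sum, assoc_inv_tmul, whiskerRight_tmul, contr_tmul]
  have h := sum_smul_coord (V := V) (M := (fn A).carrier)
    (lin (coeffMap (dmul (evalAt 1) (bid v))) ∘ₗ
      (TensorProduct.mk ℂ (fn A).carrier (HopfRep.dual V).carrier f) ∘ₗ toDual.toLinearMap) ξ
  exact h

lemma contr_unitψ_fn (f : Module.Dual ℂ A) :
    contr (evalAt 1) (lin (unitψ (toFn (regChar A))) (toFn f)) =
      f 1 • toFn (regChar A ∘ₗ antipode ℂ) := by
  rw [contr_unitψ, ← map_smul, ← conv_regChar IsInvolutive.sq f]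
  refine evalAt_ext fun b => ?_
  rw [coeffMap_apply]
  have h := congrArg (dmul (V := fn A) (W := HopfRep.dual (fn A)) (evalAt 1)
    (bid (toFn (regChar A))))
    (diag_apply (fn A).ρ (HopfRep.dual (fn A)).ρ b (toFn f) (toDual (evalAt 1)))
  refine h.trans ?_
  rw [evalAt_toFn, conv_repr _ _ (Coalgebra.Repr.arbitrary ℂ b),
    ← (Coalgebra.Repr.arbitrary ℂ b).eq]
  simp only [map_sum]
  refine Finset.sum_congr rfl fun i _ => ?_
  change evalAt 1 ((fn A).ρ _ (toFn f)) *
    evalAt 1 ((fn A).ρ (antipode ℂ _) (toFn (regChar A))) = _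
  rw [evalAt_ρ, evalAt_ρ, one_mul, one_mul]; rfl

namespace BiMod

/-- The action of the function algebra on `X` from the left. -/
def lact (X : BiMod F G) : outer (unit₀ F) X ⟶ X :=
  mk' (X := outer (unit₀ F) X) (Y := X) (X.left.inv (fn A) (evalAt 1))
    (fun V v => left_of_inv (X := outer (unit₀ F) X) (Y := X) (X.left.inv (fn A) (evalAt 1)) V
      (fun ξ => by
        change F.obj V ◁ X.left.inv (fn A) (evalAt 1) ≫ X.left.inv V ξ =
          ((α_ _ _ _).inv ≫ (μ F V (fn A) ≫ F.map (coeffMap (dmul ξ (evalAt 1)))) ▷ X.obj) ≫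
            X.left.inv (fn A) (evalAt 1)
        simp only [comp_whiskerRight, Category.assoc]
        rw [X.left.inv_naturality, evalAt_one_coeffMap, X.left.inv_assoc, Iso.inv_hom_id_assoc]) v)
    (fun W w => by
      change (F.obj (fn A) ◁ X.right.hom W w ≫ (α_ (F.obj (fn A)) X.obj (G.obj W)).inv) ≫
        X.left.inv (fn A) (evalAt 1) ▷ G.obj W = X.left.inv (fn A) (evalAt 1) ≫ X.right.hom W w
      rw [left_inv_right_hom, Category.assoc])

/-- The action of the function algebra on `X` from the right. -/
def ract (X : BiMod G F) : outer X (unit₀ F) ⟶ X :=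
  mk' (X := outer X (unit₀ F)) (Y := X) (X.right.inv (fn A) (evalAt 1))
    (fun V v => by
      change (X.left.hom V v ▷ F.obj (fn A) ≫ (α_ (G.obj V) X.obj (F.obj (fn A))).hom) ≫
        G.obj V ◁ X.right.inv (fn A) (evalAt 1) = X.right.inv (fn A) (evalAt 1) ≫ X.left.hom V v
      rw [right_inv_left_hom, Category.assoc])
    (fun W w => right_of_inv (X := outer X (unit₀ F)) (Y := X) (X.right.inv (fn A) (evalAt 1)) W
      (fun ξ => by
        change X.right.inv (fn A) (evalAt 1) ▷ F.obj W ≫ X.right.inv W ξ =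
          ((α_ _ _ _).hom ≫ X.obj ◁ (μ F (fn A) W ≫ F.map (coeffMap (dmul (evalAt 1) ξ)))) ≫
            X.right.inv (fn A) (evalAt 1)
        simp only [MonoidalCategory.whiskerLeft_comp, Category.assoc]
        rw [X.right.inv_naturality, evalAt_one_coeffMap, X.right.inv_assoc,
          Iso.hom_inv_id_assoc]) w)

lemma lact_nat {X Y : BiMod F G} (f : X ⟶ Y) : outL (unit₀ F) f ≫ lact Y = lact X ≫ f :=
  hom_ext (mor_left_inv f _ _)

lemma ract_nat {X Y : BiMod G F} (f : X ⟶ Y) : outR f (unit₀ F) ≫ ract Y = ract X ≫ f :=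
  hom_ext (mor_right_inv f _ _)

lemma lact_outer (X : BiMod F G) (Y : BiMod G H) :
    (outA (unit₀ F) X Y).hom ≫ lact (outer X Y) = outR (lact X) Y :=
  hom_ext (Iso.hom_inv_id_assoc (α_ _ _ _) _)

lemma ract_outer (X : BiMod G F) (Y : BiMod H G) :
    (outA Y X (unit₀ F)).hom ≫ outL Y (ract X) = ract (outer Y X) := rfl

lemma triangle₀ (X : BiMod G F) (Y : BiMod F H) :
    (outA X (unit₀ F) Y).hom ≫ outL X (lact Y) ≫ idem X Y = outR (ract X) Y ≫ idem X Y := by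
  have key : ∀ e : X.obj ⊗ Y.obj ⟶ X.obj ⊗ Y.obj,
      (∀ f, (X.right.hom (fn A) f ▷ Y.obj ≫ (α_ _ _ _).hom ≫
        X.obj ◁ Y.left.inv (fn A) (evalAt 1)) ≫ e = (evalAt 1 f) • e) →
      (α_ X.obj (F.obj (fn A)) Y.obj).hom ≫ X.obj ◁ Y.left.inv (fn A) (evalAt 1) ≫ e =
        X.right.inv (fn A) (evalAt 1) ▷ Y.obj ≫ e := by
    intro e h
    refine TrivR.epiP X.right.inv_hom _ fun f => ?_
    have h1 := h f
    simp only [Category.assoc] at h1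
    rw [h1, ← comp_whiskerRight_assoc, X.right.hom_inv]
    simp
  exact hom_ext (key (mor (idem X Y)) fun f => congrArg mor (coef_idem X Y (toFn.symm f)))

/-- The section of `ract`. -/
def rsec (X : BiMod G F) : X.obj ⟶ (outer X (unit₀ F)).obj :=
  (Module.finrank ℂ A : ℂ)⁻¹ • X.right.hom (fn A) (toFn (regChar A))

lemma rsec_ract (X : BiMod G F) : rsec X ≫ mor (ract X) = 𝟙 X.obj := by
  change ((Module.finrank ℂ A : ℂ)⁻¹ • X.right.hom (fn A) (toFn (regChar A))) ≫
    X.right.inv (fn A) (evalAt 1) = _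
  rw [Linear.smul_comp, X.right.hom_inv, evalAt_toFn, regChar_one, smul_smul,
    inv_mul_cancel₀ (finrank_ne_zero' A), one_smul]

lemma ract_rsec (X : BiMod G F) : mor (ract X) ≫ rsec X = mor (idem X (unit₀ F)) := by
  change X.right.inv (fn A) (evalAt 1) ≫
    ((Module.finrank ℂ A : ℂ)⁻¹ • X.right.hom (fn A) (toFn (regChar A))) =
      (Module.finrank ℂ A : ℂ)⁻¹ • (X.right.hom (fn A) (toFn (regChar A)) ▷ F.obj (fn A) ≫
        (α_ _ _ _).hom ≫ X.obj ◁ (μ F (fn A) (fn A) ≫ F.map (fnMul A)))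
  rw [Linear.comp_smul]
  congr 1
  refine TrivR.epi0 X.right.inv_hom fun f => ?_
  obtain ⟨f, rfl⟩ := toFn.surjective f
  rw [reassoc_of% X.right.hom_inv, evalAt_toFn]
  have h := X.right.hom_tmul (fn A) (fn A) (toFn (regChar A)) (toFn f)
  have h2 := X.right.naturality (fnMul A) (tmul (toFn (regChar A)) (toFn f))
  rw [fnMul_apply, regChar_conv IsInvolutive.sq, h] at h2
  simp only [MonoidalCategory.whiskerLeft_comp, Category.assoc] at h2 ⊢
  rw [← h2, map_smul, map_smul]
  simp

/-- The section of `lact`. -/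
def lsec (X : BiMod F G) : X.obj ⟶ (outer (unit₀ F) X).obj :=
  (Module.finrank ℂ A : ℂ)⁻¹ • X.left.hom (fn A) (toFn (regChar A ∘ₗ antipode ℂ))

lemma lsec_lact (X : BiMod F G) : lsec X ≫ mor (lact X) = 𝟙 X.obj := by
  change ((Module.finrank ℂ A : ℂ)⁻¹ • X.left.hom (fn A) (toFn (regChar A ∘ₗ antipode ℂ))) ≫
    X.left.inv (fn A) (evalAt 1) = _
  rw [Linear.smul_comp, X.left.hom_inv, evalAt_toFn, LinearMap.comp_apply, antipode_one,
    regChar_one, smul_smul, inv_mul_cancel₀ (finrank_ne_zero' A), one_smul]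

lemma lact_lsec (X : BiMod F G) : mor (lact X) ≫ lsec X = mor (idem (unit₀ F) X) := by
  change X.left.inv (fn A) (evalAt 1) ≫
    ((Module.finrank ℂ A : ℂ)⁻¹ • X.left.hom (fn A) (toFn (regChar A ∘ₗ antipode ℂ))) =
      (Module.finrank ℂ A : ℂ)⁻¹ • ((unitR F).hom (fn A) (toFn (regChar A)) ▷ X.obj ≫
        (α_ _ _ _).hom ≫ F.obj (fn A) ◁ X.left.inv (fn A) (evalAt 1))
  rw [Linear.comp_smul]
  congr 1
  refine TrivL.epi0 X.left.inv_hom fun f => ?_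
  obtain ⟨f, rfl⟩ := toFn.surjective f
  rw [reassoc_of% X.left.hom_inv, evalAt_toFn, unitR_hom_eq, comp_whiskerRight, Category.assoc,
    TrivL.hom_contr, contr_unitψ_fn, map_smul]
  simp

end BiMod

end UnitModule
end

noncomputable section

open CategoryTheory
open scoped TensorProduct

section UnitConstraints

open MonoidalCategory HopfRep

variable {T : Type u} [Category.{v} T] [Preadditive T] [Linear ℂ T] [MonoidalCategory T]
  [MonoidalPreadditive T] [MonoidalLinear ℂ T]
  {A : Type} [Ring A] [HopfAlgebra ℂ A] {F : HopfRep A ⥤ T} [F.Monoidal] [F.Additive]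
  [F.Linear ℂ] [Module.Finite ℂ A] [IsInvolutive A]
  {B : Type} [Ring B] [HopfAlgebra ℂ B] {G : HopfRep B ⥤ T} [G.Monoidal]
  {C : Type} [Ring C] [HopfAlgebra ℂ C] {H : HopfRep C ⥤ T} [H.Monoidal]

/-- The scalar `|A|^s`, for `|A|` the dimension of `A`. -/
def dimPow (A : Type) [Ring A] [Algebra ℂ A] (s : ℝ) : ℂ :=
  (((Module.finrank ℂ A : ℝ) ^ s : ℝ) : ℂ)

lemma dimPow_ne_zero (A : Type) [Ring A] [HopfAlgebra ℂ A] [Module.Finite ℂ A] (s : ℝ) :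
    dimPow A s ≠ 0 := by
  have h : (Module.finrank ℂ A : ℝ) ≠ 0 := by exact_mod_cast BiMod.finrank_ne_zero' A
  have h' : 0 < (Module.finrank ℂ A : ℝ) := lt_of_le_of_ne (Nat.cast_nonneg _) h.symm
  exact Complex.ofReal_ne_zero.2 (Real.rpow_pos_of_pos h' s).ne'

namespace BiMod

/-- The renormalized action of the unit object from the left. -/
def lmap (γ : Aˣ) (X : BiMod F G) : outer (unitM F γ) X ⟶ X :=
  dimPow A (-1 / 2) • (outR (unitIso F γ).hom X ≫ lact X)

/-- The renormalized action of the unit object from the right. -/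
def rmap (γ : Aˣ) (X : BiMod G F) : outer X (unitM F γ) ⟶ X :=
  dimPow A (-1 / 2) • (outL X (unitIso F γ).hom ≫ ract X)

lemma idem_lact (X : BiMod F G) : idem (unit₀ F) X ≫ lact X = lact X :=
  hom_ext (by
    rw [mor_comp, ← lact_lsec, Category.assoc, lsec_lact, Category.comp_id])

lemma idem_ract (X : BiMod G F) : idem X (unit₀ F) ≫ ract X = ract X :=
  hom_ext (by
    rw [mor_comp, ← ract_rsec, Category.assoc, rsec_ract, Category.comp_id])

lemma idem_lmap (γ : Aˣ) (X : BiMod F G) : idem (unitM F γ) X ≫ lmap γ X = lmap γ X := by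
  rw [lmap, Linear.comp_smul, ← reassoc_of% idem_outR, idem_lact]

lemma idem_rmap (γ : Aˣ) (X : BiMod G F) : idem X (unitM F γ) ≫ rmap γ X = rmap γ X := by
  rw [rmap, Linear.comp_smul, ← reassoc_of% idem_outL, idem_ract]

lemma lmap_nat (γ : Aˣ) {X Y : BiMod F G} (f : X ⟶ Y) :
    outL (unitM F γ) f ≫ lmap γ Y = lmap γ X ≫ f := by
  rw [lmap, lmap, Linear.comp_smul, Linear.smul_comp, Category.assoc, ← lact_nat,
    reassoc_of% out_exchange]

lemma rmap_nat (γ : Aˣ) {X Y : BiMod G F} (f : X ⟶ Y) :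
    outR f (unitM F γ) ≫ rmap γ Y = rmap γ X ≫ f := by
  rw [rmap, rmap, Linear.comp_smul, Linear.smul_comp, Category.assoc, ← ract_nat,
    ← reassoc_of% out_exchange]

variable [IsIdempotentComplete T]

/-- The left unit constraint. -/
def compLu (γ : Aˣ) (X : BiMod F G) : comp (unitM F γ) X ≅ X :=
  mkIso (ι _ _ ≫ lmap γ X)
    ((dimPow A (-1 / 2))⁻¹ • (lsec X ≫ mor (outR (unitIso F γ).inv X) ≫ mor (π _ _)))
    (by
      have h : mor (lact X) ≫ lsec X ≫ mor (outR (unitIso F γ).inv X) ≫ mor (π _ _) =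
          mor (outR (unitIso F γ).inv X ≫ π _ _) := by
        rw [← Category.assoc, lact_lsec, ← mor_comp, ← mor_comp, ← reassoc_of% idem_outR, idem_π]
      have h2 : outR (unitIso F γ).hom X ≫ outR (unitIso F γ).inv X = 𝟙 _ := by
        rw [← outR_comp, Iso.hom_inv_id, outR_id]
      rw [Linear.comp_smul, lmap, Linear.comp_smul, mor_smul, Linear.smul_comp, smul_smul,
        inv_mul_cancel₀ (dimPow_ne_zero A _), one_smul, mor_comp, mor_comp, Category.assoc,
        Category.assoc, h, ← mor_comp, ← mor_comp, reassoc_of% h2, ι_π, mor_id])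
    (by
      have h2 : outR (unitIso F γ).inv X ≫ outR (unitIso F γ).hom X = 𝟙 _ := by
        rw [← outR_comp, Iso.inv_hom_id, outR_id]
      rw [Linear.smul_comp, lmap, Linear.comp_smul, mor_smul, Linear.comp_smul, smul_smul,
        inv_mul_cancel₀ (dimPow_ne_zero A _), one_smul, Category.assoc, Category.assoc,
        ← mor_comp, ← mor_comp, reassoc_of% π_ι, ← reassoc_of% idem_outR, reassoc_of% h2,
        idem_lact, lsec_lact])

/-- The right unit constraint. -/
def compRu (γ : Aˣ) (X : BiMod G F) : comp X (unitM F γ) ≅ X :=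
  mkIso (ι _ _ ≫ rmap γ X)
    ((dimPow A (-1 / 2))⁻¹ • (rsec X ≫ mor (outL X (unitIso F γ).inv) ≫ mor (π _ _)))
    (by
      have h : mor (ract X) ≫ rsec X ≫ mor (outL X (unitIso F γ).inv) ≫ mor (π _ _) =
          mor (outL X (unitIso F γ).inv ≫ π _ _) := by
        rw [← Category.assoc, ract_rsec, ← mor_comp, ← mor_comp, ← reassoc_of% idem_outL, idem_π]
      have h2 : outL X (unitIso F γ).hom ≫ outL X (unitIso F γ).inv = 𝟙 _ := by
        rw [← outL_comp, Iso.hom_inv_id, outL_id]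
      rw [Linear.comp_smul, rmap, Linear.comp_smul, mor_smul, Linear.smul_comp, smul_smul,
        inv_mul_cancel₀ (dimPow_ne_zero A _), one_smul, mor_comp, mor_comp, Category.assoc,
        Category.assoc, h, ← mor_comp, ← mor_comp, reassoc_of% h2, ι_π, mor_id])
    (by
      have h2 : outL X (unitIso F γ).inv ≫ outL X (unitIso F γ).hom = 𝟙 _ := by
        rw [← outL_comp, Iso.inv_hom_id, outL_id]
      rw [Linear.smul_comp, rmap, Linear.comp_smul, mor_smul, Linear.comp_smul, smul_smul,
        inv_mul_cancel₀ (dimPow_ne_zero A _), one_smul, Category.assoc, Category.assoc,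
        ← mor_comp, ← mor_comp, reassoc_of% π_ι, ← reassoc_of% idem_outL, reassoc_of% h2,
        idem_ract, rsec_ract])

lemma π_compLu (γ : Aˣ) (X : BiMod F G) : π _ _ ≫ (compLu γ X).hom = lmap γ X := by
  change π _ _ ≫ ι _ _ ≫ lmap γ X = _
  rw [reassoc_of% π_ι, idem_lmap]

lemma π_compRu (γ : Aˣ) (X : BiMod G F) : π _ _ ≫ (compRu γ X).hom = rmap γ X := by
  change π _ _ ≫ ι _ _ ≫ rmap γ X = _
  rw [reassoc_of% π_ι, idem_rmap]

lemma compLu_nat (γ : Aˣ) {X Y : BiMod F G} (f : X ⟶ Y) :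
    compL (unitM F γ) f = (compLu γ X).hom ≫ f ≫ (compLu γ Y).inv := by
  rw [← cancel_mono (compLu γ Y).hom, Category.assoc, Category.assoc, Iso.inv_hom_id,
    Category.comp_id]
  refine π_epi ?_
  rw [reassoc_of% π_compL, π_compLu, reassoc_of% π_compLu, lmap_nat]

lemma compRu_nat (γ : Aˣ) {X Y : BiMod G F} (f : X ⟶ Y) :
    compR f (unitM F γ) = (compRu γ X).hom ≫ f ≫ (compRu γ Y).inv := by
  rw [← cancel_mono (compRu γ Y).hom, Category.assoc, Category.assoc, Iso.inv_hom_id,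
    Category.comp_id]
  refine π_epi ?_
  rw [reassoc_of% π_compR, π_compRu, reassoc_of% π_compRu, rmap_nat]

lemma comp_triangle (γ : Aˣ) (X : BiMod G F) (Y : BiMod F H) :
    (compA X (unitM F γ) Y).hom ≫ compL X (compLu γ Y).hom = compR (compRu γ X).hom Y := by
  refine π₃_epi ?_
  have h1 : outL X (π _ _) ≫ outL X (compLu γ Y).hom = dimPow A (-1 / 2) •
      (outL X (outR (unitIso F γ).hom Y) ≫ outL X (lact Y)) := by
    rw [← outL_comp, π_compLu, ← outL_comp, ← outL_smul, lmap]
  have h2 : outR (π _ _) Y ≫ outR (compRu γ X).hom Y = dimPow A (-1 / 2) •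
      (outR (outL X (unitIso F γ).hom) Y ≫ outR (ract X) Y) := by
    rw [← outR_comp, π_compRu, ← outR_comp, ← outR_smul, rmap]
  have h3 := congrArg (· ≫ π X Y) (triangle₀ X Y)
  simp only [Category.assoc, idem_π] at h3
  rw [reassoc_of% compA_hom, π_compL, reassoc_of% h1, π_compR, reassoc_of% h2, Linear.smul_comp,
    Linear.comp_smul, Linear.smul_comp]
  congr 1
  rw [Category.assoc, Category.assoc, ← reassoc_of% outA_middle, h3]

end BiMod

end UnitConstraints
end

noncomputable section

open CategoryTheory
open scoped TensorProduct

namespace HopfRep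

section Gauge

variable {A : Type} [Ring A] [Algebra ℂ A]

/-- Irreducible modules. -/
def IsIrreducible (V : HopfRep A) : Prop :=
  Nontrivial V.carrier ∧ ∀ p : Submodule ℂ V.carrier, (∀ a, ∀ v ∈ p, V.ρ a v ∈ p) → p = ⊥ ∨ p = ⊤

/-- The scalar `√d(V)`, for `d(V)` the dimension of `V`. -/
def sqrtDim (V : HopfRep A) : ℂ := (Real.sqrt (Module.finrank ℂ V.carrier) : ℝ)

lemma exists_gauge (A : Type) [Ring A] [Algebra ℂ A] [Module.Finite ℂ A] [IsSemisimpleRing A] :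
    ∃ γ : Aˣ, ∀ V : HopfRep A, V.IsIrreducible → ∀ v, V.ρ (γ : A) v = V.sqrtDim • v := by
  classical
  obtain ⟨n, d, hd, ⟨e⟩⟩ := IsSemisimpleRing.exists_algEquiv_pi_matrix_of_isAlgClosed ℂ A
  let s : Fin n → ℂ := fun i => ((Real.sqrt (d i) : ℝ) : ℂ)
  have hs : ∀ i, s i ≠ 0 := fun i => by
    have h0 : (0 : ℝ) < d i := by
      have := (hd i).out
      exact_mod_cast Nat.pos_of_ne_zero this
    exact Complex.ofReal_ne_zero.2 (Real.sqrt_pos.2 h0).ne'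
  let g : ∀ i, Matrix (Fin (d i)) (Fin (d i)) ℂ := fun i => s i • 1
  let g' : ∀ i, Matrix (Fin (d i)) (Fin (d i)) ℂ := fun i => (s i)⁻¹ • 1
  have hgg : g * g' = 1 := by
    funext i
    simp [g, g', smul_smul, hs i]
  have hgg' : g' * g = 1 := by
    funext i
    simp [g, g', smul_smul, hs i]
  refine ⟨⟨e.symm g, e.symm g', by rw [← map_mul, hgg, map_one], by rw [← map_mul, hgg', map_one]⟩,
    fun V hV v => ?_⟩
  obtain ⟨hnt, hirr⟩ := hV
  let E : ∀ i, Fin (d i) → Fin (d i) → A := fun i j k => e.symm (Pi.single i (Matrix.single j k 1))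
  have hE1 : ∑ i, ∑ j, E i j j = 1 := by
    simp only [E, ← map_sum]
    rw [← map_one e.symm]
    congr 1
    have h1 : ∀ i, ∑ j, (Pi.single i (Matrix.single j j 1) :
        ∀ i, Matrix (Fin (d i)) (Fin (d i)) ℂ) = Pi.single i 1 := by
      intro i
      have h2 : ∑ j, Matrix.single j j (1 : ℂ) = (1 : Matrix (Fin (d i)) (Fin (d i)) ℂ) := by
        ext a b
        simp only [Matrix.sum_apply, Matrix.single_apply, Matrix.one_apply, ite_and,
          Finset.sum_ite_eq', Finset.mem_univ, if_true]
      rw [← h2]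
      exact (map_sum (AddMonoidHom.single (fun i => Matrix (Fin (d i)) (Fin (d i)) ℂ) i) _ _).symm
    simp only [h1]
    exact Finset.univ_sum_single (1 : ∀ i, Matrix (Fin (d i)) (Fin (d i)) ℂ)
  have hγE : ∀ i j k, e.symm g * E i j k = s i • E i j k := by
    intro i j k
    simp only [E, ← map_mul, ← map_smul]
    congr 1
    funext i'
    by_cases h : i' = i
    · subst h; simp [g]
    · simp [h]
  have hEE : ∀ i j k l, E i j k * E i k l = E i j l := by
    intro i j k l
    simp only [E, ← map_mul]
    congr 1
    funext i'
    by_cases h : i' = i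
    · subst h; simp
    · simp [h]
  have hEE0 : ∀ i j k k' l, k ≠ k' → E i j k * E i k' l = 0 := by
    intro i j k k' l hk
    simp only [E, ← map_mul]
    rw [← map_zero e.symm]
    congr 1
    funext i'
    by_cases h : i' = i
    · subst h; simp [Matrix.single_mul_single_of_ne, hk]
    · simp [h]
  obtain ⟨x, hx⟩ := exists_ne (0 : V.carrier)
  have : ∃ i j, V.ρ (E i j j) x ≠ 0 := by
    by_contra! h
    apply hx
    have : V.ρ 1 x = 0 := by
      rw [← hE1]
      simp [map_sum, LinearMap.sum_apply, h]
    simpa using this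
  obtain ⟨i, k, hw⟩ := this
  let w : Fin (d i) → V.carrier := fun j => V.ρ (E i j k) x
  have hEw : ∀ a j, ∃ c : Fin (d i) → ℂ, V.ρ a (w j) = ∑ l, c l • w l := by
    intro a j
    refine ⟨fun l => e a i l j, ?_⟩
    have h1 : a * E i j k = ∑ l, (e a i l j) • E i l k := by
      apply e.injective
      rw [map_mul, map_sum]
      simp only [E, map_smul, AlgEquiv.apply_symm_apply]
      funext i'
      by_cases h : i' = i
      · subst h
        ext p q
        by_cases hq : k = q <;> simp [Matrix.sum_apply, Matrix.mul_apply, Matrix.single_apply, hq]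
      · simp [h]
    change V.ρ a (V.ρ (E i j k) x) = _
    rw [← Module.End.mul_apply, ← map_mul, h1]
    simp [map_sum, LinearMap.sum_apply, w]
  have hspan : Submodule.span ℂ (Set.range w) = ⊤ := by
    refine (hirr _ ?_).resolve_left ?_
    · intro a v hv
      induction hv using Submodule.span_induction with
      | mem y hy =>
        obtain ⟨j, rfl⟩ := hy
        obtain ⟨c, hc⟩ := hEw a j
        rw [hc]
        exact Submodule.sum_mem _ fun l _ =>
          Submodule.smul_mem _ _ (Submodule.subset_span ⟨l, rfl⟩)
      | zero => simp
      | add y z _ _ hy hz => rw [map_add]; exact Submodule.add_mem _ hy hz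
      | smul c y _ hy => rw [map_smul]; exact Submodule.smul_mem _ _ hy
    · intro h
      apply hw
      have : w k ∈ Submodule.span ℂ (Set.range w) := Submodule.subset_span ⟨k, rfl⟩
      rw [h] at this
      simpa using this
  have hli : LinearIndependent ℂ w := by
    rw [Fintype.linearIndependent_iff]
    intro c hc l
    have h1 := congrArg (V.ρ (E i k l)) hc
    rw [map_sum, map_zero, Finset.sum_eq_single l] at h1
    · simp only [map_smul, w] at h1
      rw [← Module.End.mul_apply, ← map_mul, hEE] at h1
      exact (smul_eq_zero.1 h1).resolve_right hw
    · intro j _ hj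
      simp only [map_smul, w]
      rw [← Module.End.mul_apply, ← map_mul, hEE0 _ _ _ _ _ hj.symm]
      simp
    · simp
  have hdim : Module.finrank ℂ V.carrier = d i := by
    rw [Module.finrank_eq_card_basis (Module.Basis.mk hli hspan.ge)]
    simp
  have hall : v ∈ Submodule.span ℂ (Set.range w) := by rw [hspan]; trivial
  rw [sqrtDim, hdim]
  change V.ρ (e.symm g) v = s i • v
  induction hall using Submodule.span_induction with
  | mem y hy =>
    obtain ⟨j, rfl⟩ := hy
    change V.ρ (e.symm g) (V.ρ (E i j k) x) = s i • V.ρ (E i j k) x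
    rw [← Module.End.mul_apply, ← map_mul, hγE]
    simp
  | zero => simp
  | add y z _ _ hy hz => rw [map_add, hy, hz, smul_add]
  | smul c y _ hy => rw [map_smul, hy, smul_comm]

/-- The gauge `{√d(V)}`, as the (unique, central) unit of `A` which acts on every irreducible
module `V` by the scalar `√d(V)`. -/
def gauge (A : Type) [Ring A] [Algebra ℂ A] [Module.Finite ℂ A] [IsSemisimpleRing A] : Aˣ :=
  (exists_gauge A).choose

lemma gauge_apply [Module.Finite ℂ A] [IsSemisimpleRing A] {V : HopfRep A} (hV : V.IsIrreducible)
    (v : V.carrier) : V.ρ (gauge A : A) v = V.sqrtDim • v := (exists_gauge A).choose_spec V hV v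

end Gauge

end HopfRep
end

noncomputable section

open CategoryTheory
open scoped TensorProduct

section DualModule

open MonoidalCategory HopfRep Functor.LaxMonoidal Functor.OplaxMonoidal HopfAlgebra

variable {T : Type u} [Category.{v} T] [Preadditive T] [Linear ℂ T] [MonoidalCategory T]
  [MonoidalPreadditive T] [MonoidalLinear ℂ T]
  {A : Type} [Ring A] [HopfAlgebra ℂ A] {F : HopfRep A ⥤ T} [F.Monoidal]
  {B : Type} [Ring B] [HopfAlgebra ℂ B] {G : HopfRep B ⥤ T} [G.Monoidal]

lemma comm_of_mixed {X : T} (L : TrivL F X) (R : TrivR G X) (V : HopfRep A) (W : HopfRep B)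
    (w : W.carrier)
    (h : ∀ ξ : Module.Dual ℂ V.carrier, L.inv V ξ ≫ R.hom W w =
      F.obj V ◁ R.hom W w ≫ (α_ _ _ _).inv ≫ L.inv V ξ ▷ G.obj W) (v : V.carrier) :
    L.hom V v ≫ F.obj V ◁ R.hom W w =
      R.hom W w ≫ L.hom V v ▷ G.obj W ≫ (α_ (F.obj V) X (G.obj W)).hom := by
  have e : F.obj V ◁ R.hom W w = ∑ i, L.inv V ((bas V).coord i) ≫ R.hom W w ≫
      L.hom V (bas V i) ▷ G.obj W ≫ (α_ (F.obj V) X (G.obj W)).hom := by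
    have h1 := congrArg (fun t => F.obj V ◁ R.hom W w ≫ (α_ _ _ _).inv ≫ t ▷ G.obj W ≫
      (α_ _ _ _).hom) (L.inv_hom V)
    simp only [sum_whiskerRight, Preadditive.sum_comp, Preadditive.comp_sum, comp_whiskerRight,
      Category.assoc, id_whiskerRight, Category.id_comp, Iso.inv_hom_id, Category.comp_id] at h1
    rw [← h1]
    refine Finset.sum_congr rfl fun i _ => ?_
    rw [reassoc_of% h]
  rw [e, Preadditive.comp_sum]
  simp only [reassoc_of% L.hom_inv, Linear.smul_comp, Category.id_comp]
  conv_rhs => rw [← sum_coord_smul (V := V) (L.hom V) v]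
  simp only [sum_whiskerRight, Preadditive.sum_comp, Preadditive.comp_sum,
    MonoidalLinear.smul_whiskerRight, Linear.smul_comp, Linear.comp_smul]

variable {X' : T} (X : BiMod F G) (p : X.obj ⊗ X' ⟶ 𝟙_ T) (c : 𝟙_ T ⟶ X' ⊗ X.obj)
  (hook : (ρ_ X.obj).inv ≫ X.obj ◁ c ≫ (α_ _ _ _).inv ≫ p ▷ X.obj ≫ (λ_ X.obj).hom = 𝟙 X.obj)
  (hook' : (λ_ X').inv ≫ c ▷ X' ≫ (α_ _ _ _).hom ≫ X' ◁ p ≫ (ρ_ X').hom = 𝟙 X')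

/-- The dual module: the actions on `X*` are the transposes of those on `X`. -/
def BiMod.mate : BiMod G F where
  obj := X'
  left := X.right.mate p c hook hook'
  right := X.left.mate p c hook hook'
  comm V W v w := comm_of_mixed (X.right.mate p c hook hook') (X.left.mate p c hook hook') V W w
    (fun ξ => by
      change mateL p c (X.right.inv V ξ) ≫ mateR p c (X.left.hom W w) =
        G.obj V ◁ mateR p c (X.left.hom W w) ≫ (α_ _ _ _).inv ≫
          mateL p c (X.right.inv V ξ) ▷ F.obj W
      refine bend_inj p c hook' ?_
      rw [bend_comp, bend_mateR p c hook]
      have h1 : bend p (G.obj V ◁ mateR p c (X.left.hom W w) ≫ (α_ _ _ _).inv ≫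
          mateL p c (X.right.inv V ξ) ▷ F.obj W) =
          X.obj ◁ G.obj V ◁ mateR p c (X.left.hom W w) ≫ X.obj ◁ (α_ _ _ _).inv ≫ (α_ _ _ _).inv ≫
            (X.obj ◁ mateL p c (X.right.inv V ξ) ≫ p) ▷ F.obj W ≫ (λ_ _).hom := by
        simp only [bend, MonoidalCategory.whiskerLeft_comp, comp_whiskerRight]
        monoidal
      rw [h1, whisker_mateL p c hook]
      have h2 : X.obj ◁ G.obj V ◁ mateR p c (X.left.hom W w) ≫ X.obj ◁ (α_ _ _ _).inv ≫
          (α_ _ _ _).inv ≫ ((α_ _ _ _).inv ≫ X.right.inv V ξ ▷ X' ≫ p) ▷ F.obj W ≫ (λ_ _).hom =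
          (α_ _ _ _).inv ≫ (X.right.inv V ξ ▷ X') ≫ bend p (mateR p c (X.left.hom W w)) := by
        simp only [bend, comp_whiskerRight, Category.assoc]
        rw [← whisker_exchange_assoc]
        monoidal
      rw [h2, bend_mateR p c hook, ← comp_whiskerRight_assoc, right_inv_left_hom,
        whisker_exchange_assoc]
      have h3 : F.obj W ◁ (X.obj ◁ mateL p c (X.right.inv V ξ) ≫ p) = F.obj W ◁
          ((α_ _ _ _).inv ≫ X.right.inv V ξ ▷ X' ≫ p) := by rw [whisker_mateL p c hook]
      simp only [MonoidalCategory.whiskerLeft_comp] at h3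
      rw [associator_naturality_right_assoc, reassoc_of% h3]
      simp only [comp_whiskerRight]
      monoidal) v

end DualModule
end

noncomputable section

open CategoryTheory
open scoped TensorProduct

section Realized

open MonoidalCategory HopfRep HopfAlgebra

variable {T : Type u} [Category.{v} T] [Preadditive T] [Linear ℂ T] [MonoidalCategory T]
  [MonoidalPreadditive T] [MonoidalLinear ℂ T] {star : T → T}

/-- A finite-dimensional semisimple Hopf algebra `A` realized in `T`: a fully faithful linear tensor
functor `F` from the category of finite-dimensional `A`-modules to `T`, such that the given duality
of `T` restricts to the usual duality of vector spaces on the image of `F`. The latter means that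
the usual pairing `e : V ⊗ V* ⟶ 1` is `A`-linear and that there is an identification
`κ : F(V*) ⟶ F(V)*` under which the two pairings `v ⊗ ξ ↦ ξ v` and `ξ ⊗ v ↦ ξ v` become the
pairings of `F(V)` with `F(V)*` in the duality of `T`. -/
structure HopfIn (D : TensorDuality star) where
  A : Type
  [ring : Ring A]
  [hopf : HopfAlgebra ℂ A]
  [finite : Module.Finite ℂ A]
  [semisimple : IsSemisimpleRing A]
  F : HopfRep A ⥤ T
  [monoidal : F.Monoidal]
  [additive : F.Additive]
  [linear : F.Linear ℂ]
  [full : F.Full]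
  [faithful : F.Faithful]
  pairing : ∀ V : HopfRep A, ∃ (e : V ⊗ HopfRep.dual V ⟶ 𝟙_ (HopfRep A))
    (κ : F.obj (HopfRep.dual V) ⟶ star (F.obj V)),
    (∀ v ξ, oneD (lin e (tmul v (toDual ξ))) = ξ v) ∧
    pairF F e = F.obj V ◁ κ ≫ D.pair (F.obj V) ∧
    pairF F (ev V) = κ ▷ F.obj V ≫ D.pair' (F.obj V)

namespace HopfIn

attribute [instance] HopfIn.ring HopfIn.hopf HopfIn.finite HopfIn.semisimple HopfIn.monoidal
  HopfIn.additive HopfIn.linear HopfIn.full HopfIn.faithful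

variable {D : TensorDuality star}

lemma antipode_antipode (P : HopfIn D) (a : P.A) : antipode ℂ (antipode ℂ a) = a := by
  refine antipode_sq (fun a => ?_) a
  obtain ⟨e, κ, he, -, -⟩ := P.pairing (fn P.A)
  have hlin : oneD ∘ₗ lin e = (contractRight ℂ (fn P.A).carrier :
      (fn P.A).carrier ⊗[ℂ] Module.Dual ℂ (fn P.A).carrier →ₗ[ℂ] ℂ) := by
    refine tensor_lin_ext fun v ξ => ?_
    obtain ⟨ξ, rfl⟩ := toDual.surjective ξ
    exact he v ξ
  refine (Module.forall_dual_apply_eq_zero_iff ℂ _).1 (fun f => ?_) |> sub_eq_zero.1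
  rw [map_sub, sub_eq_zero]
  have h1 := congrArg oneD (lin_comm e a (tmul (toFn f) (toDual (evalAt 1))))
  have h2 := LinearMap.congr_fun hlin
    ((fn P.A ⊗ HopfRep.dual (fn P.A)).ρ a (tmul (toFn f) (toDual (evalAt 1))))
  have h3 := ev'_apply (fn P.A).ρ a (evalAt 1) (toFn f)
  have h4 : oneD ((𝟙_ (HopfRep P.A)).ρ a (lin e (tmul (toFn f) (toDual (evalAt 1))))) =
      Coalgebra.counit (R := ℂ) a * f 1 :=
    congrArg (Coalgebra.counit (R := ℂ) a * ·) (he (toFn f) (evalAt 1))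
  have h5 : evalAt 1 ((fn P.A).ρ (mulOp P.A ((antipode ℂ).lTensor P.A
      (Coalgebra.comul (R := ℂ) a))) (toFn f)) = f (mulOp P.A ((antipode ℂ).lTensor P.A
      (Coalgebra.comul (R := ℂ) a))) := by
    rw [evalAt_ρ, one_mul, evalAt_toFn]
  rw [← h5, ← h3, Algebra.algebraMap_eq_smul_one, map_smul, smul_eq_mul, ← h4, ← h1]
  exact h2.symm

instance (P : HopfIn D) : IsInvolutive P.A := ⟨P.antipode_antipode⟩

variable [IsIdempotentComplete T]

/-- The bicategory `M(T)`: its objects are the Hopf algebras realized in `T`, its `1`-cells are the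
bimodules, which are composed by the relative tensor product, and its `2`-cells are the morphisms of
bimodules. The actions on the unit objects are normalized by the gauge `√d(V)` and the unit
constraints are normalized by `|A|^(-1/2)`. -/
instance : Bicategory (HopfIn D) where
  Hom P Q := BiMod P.F Q.F
  id P := unitM P.F (gauge P.A)
  comp X Y := BiMod.comp X Y
  homCategory P Q := inferInstanceAs (Category (BiMod P.F Q.F))
  whiskerLeft X _ _ g := BiMod.compL X g
  whiskerRight f Y := BiMod.compR f Y
  associator X Y Z := BiMod.compA X Y Z
  leftUnitor {P Q} X := BiMod.compLu (gauge P.A) X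
  rightUnitor {P Q} X := BiMod.compRu (gauge Q.A) X
  whiskerLeft_id X Y := BiMod.compL_id X Y
  whiskerLeft_comp X _ _ _ g h := BiMod.compL_comp X g h
  id_whiskerLeft f := BiMod.compLu_nat _ f
  comp_whiskerLeft X Y _ _ h := by
    rw [← Category.assoc, Iso.eq_comp_inv]
    exact BiMod.compA_right X Y h
  id_whiskerRight X Y := BiMod.compR_id X Y
  comp_whiskerRight f g Y := BiMod.compR_comp f g Y
  whiskerRight_id f := BiMod.compRu_nat _ f
  whiskerRight_comp f Y Z := by
    rw [Iso.eq_inv_comp]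
    exact (BiMod.compA_left f Y Z).symm
  whisker_assoc X _ _ g Z := by
    rw [← Category.assoc, Iso.eq_comp_inv]
    exact BiMod.compA_middle X g Z
  whisker_exchange f g := BiMod.comp_exchange f g
  pentagon X Y Z W := BiMod.comp_pentagon X Y Z W
  triangle {P Q R} X Y := BiMod.comp_triangle (gauge Q.A) X Y

instance (P Q : HopfIn D) : Preadditive (P ⟶ Q) := inferInstanceAs (Preadditive (BiMod P.F Q.F))

instance (P Q : HopfIn D) : Linear ℂ (P ⟶ Q) := inferInstanceAs (Linear ℂ (BiMod P.F Q.F))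

section Cells

variable {P Q R : HopfIn D}

/-- The object of `T` underlying a `1`-cell. -/
def obj (X : P ⟶ Q) : T := BiMod.obj (F := P.F) (G := Q.F) X

/-- The morphism of `T` underlying a `2`-cell. -/
def mor {X Y : P ⟶ Q} (f : X ⟶ Y) : obj X ⟶ obj Y := BiMod.mor (F := P.F) (G := Q.F) f

/-- The projection of the tensor product `X ⊗ Y` in `T` to the relative tensor product. -/
def proj (X : P ⟶ Q) (Y : Q ⟶ R) : obj X ⊗ obj Y ⟶ obj (X ≫ Y) :=
  BiMod.mor (BiMod.π (F := P.F) (G := Q.F) (H := R.F) X Y)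

/-- The inclusion of the relative tensor product in the tensor product `X ⊗ Y` in `T`. -/
def incl (X : P ⟶ Q) (Y : Q ⟶ R) : obj (X ≫ Y) ⟶ obj X ⊗ obj Y :=
  BiMod.mor (BiMod.ι (F := P.F) (G := Q.F) (H := R.F) X Y)

/-- The dual module `X*`: the dual object in `T`, with the transposed actions. -/
def dual (X : P ⟶ Q) : Q ⟶ P :=
  BiMod.mate (F := P.F) (G := Q.F) X (D.pair (obj X)) (D.copair (obj X)) (D.hook (obj X))
    (D.hook_dual (obj X))

/-- The functional `∑ √d(V) χ_V` on `A`, for `χ_V` the characters of the irreducible modules. As the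
character of the regular module is `∑ d(V) χ_V`, it arises from it by the inverse of the gauge. -/
def weight (P : HopfIn D) : Module.Dual ℂ P.A :=
  regChar P.A ∘ₗ LinearMap.mulLeft ℂ ((gauge P.A)⁻¹ : P.Aˣ)

/-- The morphism `X ⊗ X* ⟶ F(V) ⊗ X ⊗ V* ⊗ X* ⟶ F(V) ⊗ V*`, by the trivialization of `X` and the
pairing of `X` in `T`, summed over the irreducible modules `V` with the weights `√d(V)`. -/
def eps (X : P ⟶ Q) : obj X ⊗ obj (dual X) ⟶ obj (𝟙 P) :=
  (BiMod.left (F := P.F) (G := Q.F) X).hom (fn P.A) (toFn (weight P)) ▷ obj (dual X) ≫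
    (α_ (P.F.obj (fn P.A)) (obj X) (obj (dual X))).hom ≫
    P.F.obj (fn P.A) ◁ D.pair (obj X) ≫ (ρ_ (P.F.obj (fn P.A))).hom

end Cells

end HopfIn

end Realized
end

/-! The construction rests on two data attached to the function algebra A* of each Hopf algebra A:
the regular character χ and evaluation at 1. The character is a two-sided integral for convolution
(`regChar_conv`, `conv_regChar_right`) and is invariant under the antipode; evaluation at 1 is
multiplicative. The gauge γ conjugates the product of A* into the actions on the unit bimodule. It
replaces χ by the translate `twistChar γ`, b ↦ χ(γ⁻¹b), which for γ = `gauge A` is the functional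
`weight`, and it replaces evaluation at 1 by evaluation at γ. Hence inserting `twistChar γ` into X
and capping X with X* is a bimodule map to the unit bimodule (`outerPair`), and a cup followed by
the action of the function algebra through evaluation at γ is a bimodule map from the unit bimodule
(`outerCopair`).

Hook identities. The zigzag is straightened by the duality of T. What remains on each side of X is
`twistChar γ` against evaluation at γ, and each such meeting contributes χ(γ⁻¹γ), the dimension of
the algebra (`hook_raw`, `hook_dual_raw`). The resulting |A||B| is cancelled by the unit
constraints, which give |A|^(-1/2) and |B|^(-1/2), and by the product of the scalars of pairing and
copairing, which is the square of |A|^(-1/4)|B|^(-1/4).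

Identifications. A transpose is characterized by the pairings, so transposes in M(T) and in T have
the same underlying morphism (`mor_transpose`). The axioms on X ≅ X** and on Y* ⊗ X* ≅ (X ⊗ Y)*,
other than multiplicativity of the pairing, therefore reduce to those of T once the identifications
of T are known to respect the actions. For X ≅ X** this uses that one map F(V*) ⟶ F(V)* carries both
usual pairings to those of T (`left_inv_pair'`, `right_inv_pair'`). For tensor products, transposing
the projection onto the relative product replaces χ by χ composed with the antipode, which is again
χ (`outerDual_transpose_idem`), so the identification of T passes to relative products.

Multiplicativity. When the pairing of Y is nested inside that of X, the twisted character inserted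
in Y meets evaluation at the gauge on X; together they give |B| times the projection onto the
relative product (`hom_twistChar_inv`, `outerPair_nested`). The unit constraint |B|^(-1/2) and two
factors |B|^(-1/4) cancel this |B|.

Neutrality. As F is full and faithful, every endomorphism of the unit bimodule is a scalar.
Composing with the unit of A* on one side and a normalized integral of A on the other identifies
this scalar with a closed diagram of T (`outerCopair_comp_outerPair`). Each trace in M(T) is thus
|A|^(-1/2)|B|^(-1/2) times the trace in T, and this factor is symmetric in A and B. -/

noncomputable section

open CategoryTheory MonoidalCategory
open scoped TensorProduct

namespace HopfRep

/-! ### Integrals on a semisimple Hopf algebra and on its function algebra. -/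

section Integrals

open HopfAlgebra Coalgebra

variable {A : Type} [Ring A] [HopfAlgebra ℂ A] [Module.Finite ℂ A]

/-- The convolution of `regChar A` with its antipode transform can be computed from the integral
property of either factor. The two values are dim A times the one and dim A times the other, and dim
A is nonzero. -/
lemma regChar_comp_antipode (hS : ∀ a : A, antipode ℂ (antipode ℂ a) = a) :
    regChar A ∘ₗ antipode ℂ = regChar A := by
  have h1 := regChar_conv hS (regChar A ∘ₗ antipode ℂ)
  rw [conv_regChar hS, LinearMap.comp_apply, antipode_one, regChar_one] at h1
  exact smul_right_injective _ (BiMod.finrank_ne_zero' A) h1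

/-- Together with `regChar_conv` this makes the character a two-sided integral, so that one and the
same pairing can respect both actions on the unit bimodule. -/
lemma conv_regChar_right (hS : ∀ a : A, antipode ℂ (antipode ℂ a) = a) (f : Module.Dual ℂ A) :
    conv f (regChar A) = f 1 • regChar A := by
  have h := conv_regChar hS f
  rwa [regChar_comp_antipode hS] at h

/-- Morphisms into the function algebra are determined by evaluation at 1, which is multiplicative.
This turns the structure maps of the unit bimodule into convolutions with coefficient functions, to
which the integral property applies. -/
lemma coeffMap_dmul_evalAt_apply {V : HopfRep A} (ξ : Module.Dual ℂ V.carrier) (v : V.carrier)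
    (f : (fn A).carrier) : lin (coeffMap (dmul ξ (evalAt 1))) (tmul v f) =
      toFn (conv (toFn.symm (lin (coeffMap ξ) v)) (toFn.symm f)) := by
  have h : coeffMap ξ ▷ fn A ≫ fnMul A = coeffMap (dmul ξ (evalAt 1)) := by
    rw [fnMul, comp_coeffMap]
    congr 1
    exact tensor_lin_ext fun v w => by simp [evalAt_one_coeffMap_apply]
  rw [← h, ← fnMul_apply]
  rfl

lemma coeffMap_evalAt_dmul_apply {V : HopfRep A} (ξ : Module.Dual ℂ V.carrier) (v : V.carrier)
    (f : (fn A).carrier) : lin (coeffMap (dmul (evalAt 1) ξ)) (tmul f v) =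
      toFn (conv (toFn.symm f) (toFn.symm (lin (coeffMap ξ) v))) := by
  have h : fn A ◁ coeffMap ξ ≫ fnMul A = coeffMap (dmul (evalAt 1) ξ) := by
    rw [fnMul, comp_coeffMap]
    congr 1
    exact tensor_lin_ext fun v w => by simp [evalAt_one_coeffMap_apply]
  rw [← h, ← fnMul_apply]
  rfl

lemma toFn_symm_coeffMap_one {V : HopfRep A} (ξ : Module.Dual ℂ V.carrier) (v : V.carrier) :
    toFn.symm (lin (coeffMap ξ) v) 1 = ξ v := evalAt_one_coeffMap_apply ξ v

/-- The regular character absorbs multiplication by coefficients from the left. -/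
lemma coeffMap_tmul_regChar (hS : ∀ a : A, antipode ℂ (antipode ℂ a) = a) {V : HopfRep A}
    (ξ : Module.Dual ℂ V.carrier) (v : V.carrier) :
    lin (coeffMap (dmul ξ (evalAt 1))) (tmul v (toFn (regChar A))) = ξ v • toFn (regChar A) := by
  rw [coeffMap_dmul_evalAt_apply, LinearEquiv.symm_apply_apply, conv_regChar_right hS,
    toFn_symm_coeffMap_one, map_smul]

/-- The regular character absorbs multiplication by coefficients from the right. -/
lemma coeffMap_regChar_tmul (hS : ∀ a : A, antipode ℂ (antipode ℂ a) = a) {V : HopfRep A}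
    (ξ : Module.Dual ℂ V.carrier) (v : V.carrier) :
    lin (coeffMap (dmul (evalAt 1) ξ)) (tmul (toFn (regChar A)) v) = ξ v • toFn (regChar A) := by
  rw [coeffMap_evalAt_dmul_apply, LinearEquiv.symm_apply_apply, regChar_conv hS,
    toFn_symm_coeffMap_one, map_smul]

/-- The regular character, translated by `c⁻¹`. -/
def twistChar (γ : Aˣ) : Module.Dual ℂ A := regChar A ∘ₗ LinearMap.mulLeft ℂ ((γ⁻¹ : Aˣ) : A)

/-- With `gaugeMap_regChar` this passes between the twisted character and the regular one; at `γ =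
gauge A` the twisted character is `weight`. -/
lemma gaugeMap_twistChar (γ : Aˣ) :
    lin (gaugeMap (γ : A)) (toFn (twistChar γ)) = toFn (regChar A) := by
  refine evalAt_ext fun b => ?_
  rw [gaugeMap_apply, evalAt_toFn, evalAt_toFn]
  simp [twistChar]

lemma gaugeMap_regChar (γ : Aˣ) :
    lin (gaugeMap ((γ⁻¹ : Aˣ) : A)) (toFn (regChar A)) = toFn (twistChar γ) := by
  refine evalAt_ext fun b => ?_
  rw [gaugeMap_apply, evalAt_toFn, evalAt_toFn]
  rfl

/-- A semisimple Hopf algebra has a normalized left integral. -/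
lemma exists_integral (A : Type) [Ring A] [HopfAlgebra ℂ A] [IsSemisimpleRing A] :
    ∃ t : A, counit (R := ℂ) t = 1 ∧ ∀ a : A, a * t = counit (R := ℂ) a • t := by
  -- By semisimplicity the augmentation ideal has a complementary left ideal. The component of 1 in
  -- it is the integral: `a * t` and `ε(a) • t` differ by an element of both ideals.
  obtain ⟨C, hC⟩ := exists_isCompl (RingHom.ker (Bialgebra.counitAlgHom ℂ A))
  have h1 : (1 : A) ∈ RingHom.ker (Bialgebra.counitAlgHom ℂ A) ⊔ C := by
    rw [hC.sup_eq_top]; trivial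
  obtain ⟨k, hk, t, ht, hkt⟩ := Submodule.mem_sup.1 h1
  have ht1 : counit (R := ℂ) t = 1 := by
    have := congrArg (counit (R := ℂ)) hkt
    rw [map_add, Bialgebra.counit_one] at this
    rwa [show counit (R := ℂ) k = 0 from hk, zero_add] at this
  refine ⟨t, ht1, fun a => sub_eq_zero.1 ?_⟩
  have h2 : a * t - counit (R := ℂ) a • t ∈ C :=
    C.sub_mem (C.mul_mem_left a ht) (C.smul_of_tower_mem _ ht)
  have h3 : a * t - counit (R := ℂ) a • t ∈ RingHom.ker (Bialgebra.counitAlgHom ℂ A) := by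
    change counit (R := ℂ) (a * t - counit (R := ℂ) a • t) = 0
    rw [map_sub, map_smul, Bialgebra.counit_mul, ht1]
    simp
  have h4 := Submodule.mem_inf.2 ⟨h3, h2⟩
  rw [hC.inf_eq_bot] at h4
  exact (Submodule.mem_bot _).1 h4

/-- A normalized right integral, on which the regular character is `1`. -/
lemma exists_right_integral (hS : ∀ a : A, antipode ℂ (antipode ℂ a) = a) [IsSemisimpleRing A] :
    ∃ t : A, counit (R := ℂ) t = 1 ∧ (∀ a : A, t * a = counit (R := ℂ) a • t) ∧
      ∀ a : A, regChar A (a * t) = counit (R := ℂ) a := by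
  obtain ⟨t, ht1, ht⟩ := exists_integral A
  -- The antipode reverses products, so it turns the left integral into a right one; involutivity
  -- allows `a` to be written as an antipode.
  have hr : ∀ a : A, antipode ℂ t * a = counit (R := ℂ) a • antipode ℂ t := by
    intro a
    rw [← hS a, ← antipode_mul_antidistrib, ht, map_smul, hS]
    simp
  have h1 : counit (R := ℂ) (antipode ℂ t) = 1 := by simp [ht1]
  refine ⟨antipode ℂ t, h1, hr, fun a => ?_⟩
  -- The regular character is a trace, hence cyclic; this moves the right integral to the front.
  have h2 : ∀ x y : A, regChar A (x * y) = regChar A (y * x) := by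
    intro x y
    have hm : ∀ x y : A, LinearMap.mul ℂ A (x * y) = LinearMap.mul ℂ A x * LinearMap.mul ℂ A y := by
      intro x y; ext z; simp [mul_assoc]
    simp only [regChar, LinearMap.comp_apply, hm]
    exact LinearMap.trace_mul_comm ℂ _ _
  rw [h2, hr, map_smul]
  -- Left multiplication by a right integral has rank one, and its trace is the counit of the
  -- integral.
  have h3 : LinearMap.mul ℂ A (antipode ℂ t) =
      (counit (R := ℂ) (A := A)).smulRight (antipode ℂ t) := by
    ext x; simp [hr]
  have h4 : regChar A (antipode ℂ t) = 1 := by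
    rw [regChar, LinearMap.comp_apply, h3, LinearMap.trace_smulRight, h1]
  rw [h4]; simp

lemma one_ρ (a : A) (x : (𝟙_ (HopfRep A)).carrier) :
    (𝟙_ (HopfRep A)).ρ a x = counit (R := ℂ) a • x := rfl

/-- The trivial module is irreducible of dimension 1, so the gauge acts on it by √1, while it acts
there through the counit. This keeps the counit a unit of the renormalized product, as the
computation of traces requires. -/
lemma counit_gauge (A : Type) [Ring A] [HopfAlgebra ℂ A] [Module.Finite ℂ A] [IsSemisimpleRing A] :
    counit (R := ℂ) (gauge A : A) = 1 := by
  have hirr : (𝟙_ (HopfRep A)).IsIrreducible := by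
    refine ⟨inferInstanceAs (Nontrivial ℂ), fun p _ => ?_⟩
    exact eq_bot_or_eq_top (α := Submodule ℂ ℂ) p
  have h := gauge_apply hirr one
  have h2 : (𝟙_ (HopfRep A)).sqrtDim = 1 := by
    have : Module.finrank ℂ (𝟙_ (HopfRep A)).carrier = 1 := Module.finrank_self ℂ
    rw [sqrtDim, this]; simp
  rw [h2, one_ρ] at h
  have h3 := congrArg oneD h
  rwa [map_smul, map_smul, oneD_one, smul_eq_mul, smul_eq_mul, mul_one, mul_one] at h3

/-- The unit of the function algebra. -/
def fnUnit (A : Type) [Ring A] [HopfAlgebra ℂ A] [Module.Finite ℂ A] : 𝟙_ (HopfRep A) ⟶ fn A :=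
  coeffMap oneD

lemma fnUnit_apply : lin (fnUnit A) one = toFn counit := by
  refine evalAt_ext fun b => ?_
  rw [fnUnit, coeffMap_apply, one_ρ, map_smul, oneD_one, smul_eq_mul, mul_one, evalAt_toFn]

/-- The invariant functional on the function algebra given by a right integral. -/
def fnInt (t : A) (ht : ∀ a : A, t * a = counit (R := ℂ) a • t) : fn A ⟶ 𝟙_ (HopfRep A) :=
  mk' (V := fn A) (W := 𝟙_ (HopfRep A)) (evalAt t) (fun a f => by
    rw [evalAt_ρ, ht, one_ρ, evalAt, map_smul]; rfl)

lemma fnInt_apply (t : A) (ht : ∀ a : A, t * a = counit (R := ℂ) a • t) (f : Module.Dual ℂ A) :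
    lin (fnInt t ht) (toFn f) = f t • one := eq_smul_one _

/-- An invariant morphism to the function algebra is a multiple of the unit. -/
lemma hom_one_fn (f : 𝟙_ (HopfRep A) ⟶ fn A) : f = evalAt 1 (lin f one) • fnUnit A := by
  refine hom_fn_ext (unit_lin_ext ?_)
  rw [LinearMap.comp_apply, LinearMap.comp_apply, lin_smul, LinearMap.smul_apply, map_smul,
    fnUnit_apply, evalAt_toFn]
  simp

end Integrals

end HopfRep
end

/-! ### Graphical calculus of actions on caps and cups, and the unit bimodule. -/

noncomputable section

open CategoryTheory MonoidalCategory
open scoped TensorProduct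

section CapsAndCups

variable {T : Type u} [Category.{v} T] [MonoidalCategory T] {X X' : T}
  (p : X ⊗ X' ⟶ 𝟙_ T) (c : 𝟙_ T ⟶ X' ⊗ X)

/-- A morphism `X ⟶ P ⊗ X`, followed by the pairing of `X`. -/
def capL {P : T} (k : X ⟶ P ⊗ X) : X ⊗ X' ⟶ P := k ▷ X' ≫ (α_ _ _ _).hom ≫ P ◁ p ≫ (ρ_ P).hom

/-- The copairing of `X`, followed by a morphism `P ⊗ X' ⟶ X'`. -/
def cupL {P : T} (k : P ⊗ X' ⟶ X') : P ⟶ X' ⊗ X :=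
  (ρ_ P).inv ≫ P ◁ c ≫ (α_ _ _ _).inv ≫ k ▷ X

lemma capL_comp {P Q : T} (k : X ⟶ P ⊗ X) (t : P ⟶ Q) : capL p (k ≫ t ▷ X) = capL p k ≫ t := by
  simp only [capL, comp_whiskerRight, Category.assoc, associator_naturality_left_assoc,
    ← whisker_exchange_assoc, rightUnitor_naturality]

/-- Two strands leave `X` in succession and are merged by `m`. The cap only closes what is left of
`X`, so the merging may take place before or after it. -/
lemma capL_mul {P Q S : T} (k : X ⟶ P ⊗ X) (l : X ⟶ Q ⊗ X) (m : P ⊗ Q ⟶ S) :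
    capL p (k ≫ P ◁ l ≫ (α_ _ _ _).inv ≫ m ▷ X) =
      k ▷ X' ≫ (α_ _ _ _).hom ≫ P ◁ capL p l ≫ m := by
  have h := capL_comp p (k ≫ P ◁ l ≫ (α_ _ _ _).inv) m
  simp only [Category.assoc] at h
  rw [h]
  simp only [capL, comp_whiskerRight, MonoidalCategory.whiskerLeft_comp]
  monoidal

/-- The same interchange when the strand `P` comes from outside, as it does for the left action on
the target of the pairing. -/
lemma whisker_capL_mul {P Q S : T} (l : X ⟶ Q ⊗ X) (m : P ⊗ Q ⟶ S) :
    P ◁ capL p l ≫ m = (α_ _ _ _).inv ≫ ((P ◁ l ≫ (α_ _ _ _).inv ≫ m ▷ X) ▷ X') ≫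
      (α_ _ _ _).hom ≫ S ◁ p ≫ (ρ_ S).hom := by
  simp only [capL, comp_whiskerRight, Category.assoc, MonoidalCategory.whiskerLeft_comp]
  rw [associator_naturality_left_assoc, ← whisker_exchange_assoc]
  have e : (ρ_ (P ⊗ Q)).hom ≫ m = m ▷ 𝟙_ T ≫ (ρ_ _).hom := by simp
  rw [← e]
  monoidal

lemma cupL_comp {P Q : T} (t : Q ⟶ P) (k : P ⊗ X' ⟶ X') :
    cupL c (t ▷ X' ≫ k) = t ≫ cupL c k := by
  simp only [cupL, comp_whiskerRight]
  rw [← associator_inv_naturality_left_assoc, whisker_exchange_assoc,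
    rightUnitor_inv_naturality_assoc]

/-- Of two consecutive actions on the leg `X'`, the inner one can be made part of the cup while the
outer one still acts on the leg. -/
lemma cupL_mul {P Q : T} (k : P ⊗ X' ⟶ X') (l : Q ⊗ X' ⟶ X') :
    cupL c ((α_ _ _ _).hom ≫ P ◁ l ≫ k) = P ◁ cupL c l ≫ (α_ _ _ _).inv ≫ k ▷ X := by
  simp only [cupL, comp_whiskerRight, MonoidalCategory.whiskerLeft_comp]
  monoidal

lemma bend_mateR_eq
    (hook : (ρ_ X).inv ≫ X ◁ c ≫ (α_ _ _ _).inv ≫ p ▷ X ≫ (λ_ X).hom = 𝟙 X)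
    {P : T} (k : X ⟶ P ⊗ X) : bend p (mateR p c k) = capL p k := bend_mateR p c hook k

/-- A transposed action slides along the cup to the leg `X`, where it is the original action. This
is checked after bending down: `whisker_mateL` carries the action across the pairing and the hook
identity straightens the strand. -/
lemma cupL_mateL
    (hook : (ρ_ X).inv ≫ X ◁ c ≫ (α_ _ _ _).inv ≫ p ▷ X ≫ (λ_ X).hom = 𝟙 X)
    (hook' : (λ_ X').inv ≫ c ▷ X' ≫ (α_ _ _ _).hom ≫ X' ◁ p ≫ (ρ_ X').hom = 𝟙 X')
    {P : T} (k : X ⊗ P ⟶ X) : cupL c (mateL p c k) = unbend c k := by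
  refine bend_inj p c hook' ?_
  rw [bend_unbend p c hook]
  have h1 : bend p (cupL c (mateL p c k)) = X ◁ (ρ_ P).inv ≫ X ◁ P ◁ c ≫ X ◁ (α_ _ _ _).inv ≫
      (α_ _ _ _).inv ≫ (X ◁ mateL p c k ≫ p) ▷ X ≫ (λ_ _).hom := by
    simp only [bend, cupL, comp_whiskerRight, MonoidalCategory.whiskerLeft_comp]
    monoidal
  rw [h1, whisker_mateL p c hook]
  have h2 : X ◁ (ρ_ P).inv ≫ X ◁ P ◁ c ≫ X ◁ (α_ _ _ _).inv ≫
      (α_ _ _ _).inv ≫ ((α_ _ _ _).inv ≫ k ▷ X' ≫ p) ▷ X ≫ (λ_ _).hom =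
      (ρ_ _).inv ≫ (X ⊗ P) ◁ c ≫ k ▷ (X' ⊗ X) ≫ (α_ _ _ _).inv ≫ p ▷ X ≫ (λ_ _).hom := by
    simp only [comp_whiskerRight]
    monoidal
  rw [h2, whisker_exchange_assoc, ← rightUnitor_inv_naturality_assoc, hook, Category.comp_id]

/-- A zigzag with `r` on its cup and `k` on its cap: straightening leaves the two operations in
succession on one strand. It underlies the first hook identity of M(T). -/
lemma whisker_unbend_capL
    (hook : (ρ_ X).inv ≫ X ◁ c ≫ (α_ _ _ _).inv ≫ p ▷ X ≫ (λ_ X).hom = 𝟙 X)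
    {P Q : T} (r : X ⊗ Q ⟶ X) (k : X ⟶ P ⊗ X) :
    X ◁ unbend c r ≫ (α_ _ _ _).inv ≫ capL p k ▷ X = k ▷ Q ≫ (α_ _ _ _).hom ≫ P ◁ r := by
  conv_rhs => rw [← bend_unbend p c hook r]
  have h : X ◁ unbend c r ≫ (α_ _ _ _).inv ≫ capL p k ▷ X = X ◁ unbend c r ≫ k ▷ (X' ⊗ X) ≫
      (α_ _ _ _).hom ≫ P ◁ (α_ _ _ _).inv ≫ P ◁ p ▷ X ≫ P ◁ (λ_ X).hom := by
    simp only [capL, comp_whiskerRight]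
    monoidal
  rw [h, whisker_exchange_assoc]
  simp only [bend, MonoidalCategory.whiskerLeft_comp]
  monoidal

/-- The zigzag on `X'`, for the second hook identity. Nothing has to be straightened: after an
exchange, cup and cap form `mateR p c k` by definition, so no hook identity is assumed. -/
lemma cupL_whisker_capL {P Q : T} (l : Q ⊗ X' ⟶ X') (k : X ⟶ P ⊗ X) :
    cupL c l ▷ X' ≫ (α_ _ _ _).hom ≫ X' ◁ capL p k =
      Q ◁ mateR p c k ≫ (α_ _ _ _).inv ≫ l ▷ P := by
  change _ = Q ◁ unbend c (capL p k) ≫ (α_ _ _ _).inv ≫ l ▷ P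
  have h : cupL c l ▷ X' ≫ (α_ _ _ _).hom ≫ X' ◁ capL p k = (ρ_ Q).inv ▷ X' ≫
      (α_ _ _ _).hom ≫ Q ◁ c ▷ X' ≫ Q ◁ (α_ _ _ _).hom ≫ (α_ _ _ _).inv ≫ l ▷ (X ⊗ X') ≫
        X' ◁ capL p k := by
    simp only [cupL, comp_whiskerRight]
    monoidal
  rw [h, ← whisker_exchange]
  simp only [unbend, MonoidalCategory.whiskerLeft_comp]
  monoidal

end CapsAndCups

/-! ### Inverse trivializations as contractions of direct ones. -/

section Contractions

open HopfRep Functor.LaxMonoidal Functor.OplaxMonoidal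

variable {T : Type u} [Category.{v} T] [Preadditive T] [Linear ℂ T] [MonoidalCategory T]
  [MonoidalPreadditive T] [MonoidalLinear ℂ T]
  {A : Type} [Ring A] [HopfAlgebra ℂ A] {F : HopfRep A ⥤ T} [F.Monoidal] {X : T}

/-- The inverse morphisms of a left action, by contraction of its direct morphisms. -/
lemma TrivL.whisker_hom_pairF (L : TrivL F X) {V W : HopfRep A} (e : V ⊗ W ⟶ 𝟙_ _)
    (w : W.carrier) (ξ : Module.Dual ℂ V.carrier) (h : ∀ v, oneD (lin e (tmul v w)) = ξ v) :
    F.obj V ◁ L.hom W w ≫ (α_ _ _ _).inv ≫ pairF F e ▷ X ≫ (λ_ X).hom = L.inv V ξ := by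
  refine TrivL.epi0 L.inv_hom fun v => ?_
  have h1 := L.hom_tmul V W v w
  -- Naturality along `e` reduces the trivialization at `v ⊗ w` to that at a multiple of 1, where
  -- the unit axiom applies.
  have h2 := L.naturality e (tmul v w)
  rw [h1, eq_smul_one (lin e (tmul v w)), h, map_smul] at h2
  simp only [Category.assoc] at h2
  simp only [pairF, comp_whiskerRight, Category.assoc]
  rw [← reassoc_of% h2, Linear.smul_comp, reassoc_of% L.unit, Iso.inv_hom_id, L.hom_inv]

/-- The inverse morphisms of a right action, by contraction of its direct morphisms. -/
lemma TrivR.whisker_hom_pairF (R : TrivR F X) {V W : HopfRep A} (e : V ⊗ W ⟶ 𝟙_ _)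
    (v : V.carrier) (ζ : Module.Dual ℂ W.carrier) (h : ∀ w, oneD (lin e (tmul v w)) = ζ w) :
    R.hom V v ▷ F.obj W ≫ (α_ _ _ _).hom ≫ X ◁ pairF F e ≫ (ρ_ X).hom = R.inv W ζ := by
  refine TrivR.epi0 R.inv_hom fun w => ?_
  have h1 := R.hom_tmul V W v w
  have h2 := R.naturality e (tmul v w)
  rw [h1, eq_smul_one (lin e (tmul v w)), h, map_smul] at h2
  simp only [Category.assoc] at h2
  simp only [pairF, MonoidalCategory.whiskerLeft_comp, Category.assoc]
  rw [← reassoc_of% h2, Linear.smul_comp, reassoc_of% R.unit, Iso.inv_hom_id, R.hom_inv]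

end Contractions

/-! ### The twisted character and evaluation at the gauge as intertwiners. -/

section UnitActions

open HopfRep Functor.LaxMonoidal Functor.OplaxMonoidal HopfAlgebra

variable {T : Type u} [Category.{v} T] [Preadditive T] [Linear ℂ T] [MonoidalCategory T]
  [MonoidalPreadditive T] [MonoidalLinear ℂ T]
  {A : Type} [Ring A] [HopfAlgebra ℂ A] {F : HopfRep A ⥤ T} [F.Monoidal] [F.Additive]
  [F.Linear ℂ] [Module.Finite ℂ A] [IsInvolutive A]

/-- The renormalized product of coefficients with functions. -/
def HopfRep.gaugeMulL (γ : Aˣ) {V : HopfRep A} (ξ : Module.Dual ℂ V.carrier) : V ⊗ fn A ⟶ fn A :=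
  V ◁ gaugeMap (γ : A) ≫ coeffMap (dmul ξ (evalAt 1)) ≫ gaugeMap ((γ⁻¹ : Aˣ) : A)

/-- The renormalized product of functions with coefficients. -/
def HopfRep.gaugeMulR (γ : Aˣ) {V : HopfRep A} (ξ : Module.Dual ℂ V.carrier) : fn A ⊗ V ⟶ fn A :=
  gaugeMap (γ : A) ▷ V ≫ coeffMap (dmul (evalAt 1) ξ) ≫ gaugeMap ((γ⁻¹ : Aˣ) : A)

/-- The gauge makes the twisted character regular, the integral property absorbs the coefficient,
and the inverse gauge twists back. -/
lemma HopfRep.gaugeMulL_twistChar (γ : Aˣ) {V : HopfRep A} (ξ : Module.Dual ℂ V.carrier)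
    (v : V.carrier) : lin (gaugeMulL γ ξ) (tmul v (toFn (twistChar γ))) =
      ξ v • toFn (twistChar γ) := by
  simp only [gaugeMulL, lin_comp, LinearMap.comp_apply, whiskerLeft_tmul, gaugeMap_twistChar,
    coeffMap_tmul_regChar IsInvolutive.sq, map_smul, gaugeMap_regChar]

lemma HopfRep.gaugeMulR_twistChar (γ : Aˣ) {V : HopfRep A} (ξ : Module.Dual ℂ V.carrier)
    (v : V.carrier) : lin (gaugeMulR γ ξ) (tmul (toFn (twistChar γ)) v) =
      ξ v • toFn (twistChar γ) := by
  simp only [gaugeMulR, lin_comp, LinearMap.comp_apply, whiskerRight_tmul, gaugeMap_twistChar,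
    coeffMap_regChar_tmul IsInvolutive.sq, map_smul, gaugeMap_regChar]

/-- The final inverse gauge moves the evaluation point from `γ` to 1, where evaluation is
multiplicative; the initial gauge moves the value on the function back to `γ`. -/
lemma HopfRep.evalAt_gaugeMulL (γ : Aˣ) {V : HopfRep A} (ξ : Module.Dual ℂ V.carrier) :
    evalAt (γ : A) ∘ₗ lin (gaugeMulL γ ξ) = dmul ξ (evalAt (γ : A)) := by
  refine tensor_lin_ext fun v f => ?_
  simp only [gaugeMulL, lin_comp, LinearMap.comp_apply, whiskerLeft_tmul, gaugeMap_apply,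
    Units.inv_mul, evalAt_one_coeffMap_apply, dmul_tmul, mul_one]

lemma HopfRep.evalAt_gaugeMulR (γ : Aˣ) {V : HopfRep A} (ξ : Module.Dual ℂ V.carrier) :
    evalAt (γ : A) ∘ₗ lin (gaugeMulR γ ξ) = dmul (evalAt (γ : A)) ξ := by
  refine tensor_lin_ext fun f v => ?_
  simp only [gaugeMulR, lin_comp, LinearMap.comp_apply, whiskerRight_tmul, gaugeMap_apply,
    Units.inv_mul, evalAt_one_coeffMap_apply, dmul_tmul, mul_one]

variable (F) in
/-- The left action on the unit object. -/
def unitActL (γ : Aˣ) (V : HopfRep A) (ξ : Module.Dual ℂ V.carrier) :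
    F.obj V ⊗ F.obj (fn A) ⟶ F.obj (fn A) := μ F V (fn A) ≫ F.map (gaugeMulL γ ξ)

variable (F) in
/-- The right action on the unit object. -/
def unitActR (γ : Aˣ) (V : HopfRep A) (ξ : Module.Dual ℂ V.carrier) :
    F.obj (fn A) ⊗ F.obj V ⟶ F.obj (fn A) := μ F (fn A) V ≫ F.map (gaugeMulR γ ξ)

variable (F) in
lemma unitM_left_inv (γ : Aˣ) (V : HopfRep A) (ξ : Module.Dual ℂ V.carrier) :
    (unitM F γ).left.inv V ξ = unitActL F γ V ξ := by
  change F.obj V ◁ F.map (gaugeMap (γ : A)) ≫ (μ F V (fn A) ≫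
    F.map (coeffMap (dmul ξ (evalAt 1)))) ≫ F.map (gaugeMap ((γ⁻¹ : Aˣ) : A)) = _
  simp only [unitActL, gaugeMulL, Functor.map_comp, Category.assoc, μ_natural_right_assoc]

variable (F) in
lemma unitM_right_inv (γ : Aˣ) (V : HopfRep A) (ξ : Module.Dual ℂ V.carrier) :
    (unitM F γ).right.inv V ξ = unitActR F γ V ξ := by
  change F.map (gaugeMap (γ : A)) ▷ F.obj V ≫ (μ F (fn A) V ≫
    F.map (coeffMap (dmul (evalAt 1) ξ))) ≫ F.map (gaugeMap ((γ⁻¹ : Aˣ) : A)) = _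
  simp only [unitActR, gaugeMulR, Functor.map_comp, Category.assoc, μ_natural_left_assoc]

/-- Naturality of the trivialization along `gaugeMulL` transports the absorption property to `X`. It
makes the pairing left linear. -/
lemma TrivL.twistChar_left {X : T} (L : TrivL F X) (γ : Aˣ) (V : HopfRep A)
    (ξ : Module.Dual ℂ V.carrier) :
    F.obj V ◁ L.hom (fn A) (toFn (twistChar γ)) ≫ (α_ _ _ _).inv ≫ unitActL F γ V ξ ▷ X =
      L.inv V ξ ≫ L.hom (fn A) (toFn (twistChar γ)) := by
  refine TrivL.epi0 L.inv_hom fun v => ?_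
  have h := L.naturality (gaugeMulL γ ξ) (tmul v (toFn (twistChar γ)))
  rw [gaugeMulL_twistChar, L.hom_tmul, map_smul] at h
  simp only [Category.assoc] at h
  rw [unitActL, comp_whiskerRight, ← h, reassoc_of% L.hom_inv]
  simp

/-- Here the coefficient multiplies from the other side: a further strand leaving `X` is absorbed by
the function strand. It makes the pairing compatible with the transposed right action on the dual.
-/
lemma TrivL.twistChar_right {X : T} (L : TrivL F X) (γ : Aˣ) (V : HopfRep A)
    (ξ : Module.Dual ℂ V.carrier) (v : V.carrier) :
    L.hom (fn A) (toFn (twistChar γ)) ≫ F.obj (fn A) ◁ L.hom V v ≫ (α_ _ _ _).inv ≫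
      unitActR F γ V ξ ▷ X = ξ v • L.hom (fn A) (toFn (twistChar γ)) := by
  have h := L.naturality (gaugeMulR γ ξ) (tmul (toFn (twistChar γ)) v)
  rw [gaugeMulR_twistChar, L.hom_tmul, map_smul] at h
  simp only [Category.assoc] at h
  rw [unitActR, comp_whiskerRight, ← h]

/-- The counterpart for copairings: multiplicativity of evaluation at `γ` makes the action of the
function algebra through it linear over the renormalized left action. `evalAt_right` does the same
for the right action. -/
lemma TrivL.evalAt_left {X : T} (L : TrivL F X) (γ : Aˣ) (V : HopfRep A)
    (ξ : Module.Dual ℂ V.carrier) :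
    (α_ _ _ _).hom ≫ F.obj V ◁ L.inv (fn A) (evalAt (γ : A)) ≫ L.inv V ξ =
      unitActL F γ V ξ ▷ X ≫ L.inv (fn A) (evalAt (γ : A)) := by
  rw [unitActL, comp_whiskerRight, Category.assoc, L.inv_naturality, evalAt_gaugeMulL, L.inv_assoc]

lemma TrivL.evalAt_right {X : T} (L : TrivL F X) (γ : Aˣ) (V : HopfRep A)
    (ξ : Module.Dual ℂ V.carrier) :
    (α_ _ _ _).hom ≫ F.obj (fn A) ◁ L.inv V ξ ≫ L.inv (fn A) (evalAt (γ : A)) =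
      unitActR F γ V ξ ▷ X ≫ L.inv (fn A) (evalAt (γ : A)) := by
  rw [unitActR, comp_whiskerRight, Category.assoc, L.inv_naturality, evalAt_gaugeMulR, L.inv_assoc]

end UnitActions
end

/-! ### Pairing and copairing of a bimodule with its dual, before projection. -/

noncomputable section

open CategoryTheory MonoidalCategory
open scoped TensorProduct

section

variable {T : Type u} [Category.{v} T] [MonoidalCategory T] {X X' : T}
  (p : X ⊗ X' ⟶ 𝟙_ T) (c : 𝟙_ T ⟶ X' ⊗ X)

/-- A strand emitted by the dual leg of a cap is, by definition of the transpose, emitted by `X`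
itself, after the strand `P` has left. -/
lemma whisker_mateR_capL
    (hook : (ρ_ X).inv ≫ X ◁ c ≫ (α_ _ _ _).inv ≫ p ▷ X ≫ (λ_ X).hom = 𝟙 X)
    {P Q : T} (k : X ⟶ P ⊗ X) (l : X ⟶ Q ⊗ X) :
    X ◁ mateR p c l ≫ (α_ _ _ _).inv ≫ capL p k ▷ Q =
      k ▷ X' ≫ (α_ _ _ _).hom ≫ P ◁ capL p l := by
  rw [← bend_mateR_eq p c hook l]
  have h : X ◁ mateR p c l ≫ (α_ _ _ _).inv ≫ capL p k ▷ Q = X ◁ mateR p c l ≫ k ▷ (X' ⊗ Q) ≫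
      (α_ _ _ _).hom ≫ P ◁ (α_ _ _ _).inv ≫ P ◁ p ▷ Q ≫ P ◁ (λ_ Q).hom := by
    simp only [capL, comp_whiskerRight]
    monoidal
  rw [h, whisker_exchange_assoc]
  simp only [bend, MonoidalCategory.whiskerLeft_comp]
  monoidal

/-- A strand absorbed by the dual leg is absorbed by `X` instead, again after `k`. This is
`whisker_mateL` once `k` has been exchanged with the action on `X'`. -/
lemma whisker_mateL_capL
    (hook : (ρ_ X).inv ≫ X ◁ c ≫ (α_ _ _ _).inv ≫ p ▷ X ≫ (λ_ X).hom = 𝟙 X)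
    {P Q : T} (k : X ⟶ P ⊗ X) (r : X ⊗ Q ⟶ X) :
    X ◁ mateL p c r ≫ capL p k = (α_ _ _ _).inv ≫
      (k ▷ Q ≫ (α_ _ _ _).hom ≫ P ◁ r) ▷ X' ≫ (α_ _ _ _).hom ≫ P ◁ p ≫ (ρ_ P).hom := by
  have h1 : X ◁ mateL p c r ≫ capL p k = k ▷ (Q ⊗ X') ≫ (α_ _ _ _).hom ≫
      P ◁ (X ◁ mateL p c r ≫ p) ≫ (ρ_ P).hom := by
    simp only [capL, MonoidalCategory.whiskerLeft_comp, Category.assoc]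
    rw [whisker_exchange_assoc, associator_naturality_right_assoc]
  rw [h1, whisker_mateL p c hook]
  simp only [comp_whiskerRight, MonoidalCategory.whiskerLeft_comp]
  monoidal

end

section PairingOfBimodules

open HopfRep Functor.LaxMonoidal Functor.OplaxMonoidal HopfAlgebra

variable {T : Type u} [Category.{v} T] [Preadditive T] [Linear ℂ T] [MonoidalCategory T]
  [MonoidalPreadditive T] [MonoidalLinear ℂ T]
  {A : Type} [Ring A] [HopfAlgebra ℂ A] {F : HopfRep A ⥤ T} [F.Monoidal] [F.Additive]
  [F.Linear ℂ] [Module.Finite ℂ A] [IsInvolutive A]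
  {B : Type} [Ring B] [HopfAlgebra ℂ B] {G : HopfRep B ⥤ T} [G.Monoidal] [G.Additive]
  [G.Linear ℂ] [Module.Finite ℂ B] [IsInvolutive B]

namespace BiMod

variable (X : BiMod F G) {X' : T} (p : X.obj ⊗ X' ⟶ 𝟙_ T) (c : 𝟙_ T ⟶ X' ⊗ X.obj)
  (hook : (ρ_ X.obj).inv ≫ X.obj ◁ c ≫ (α_ _ _ _).inv ≫ p ▷ X.obj ≫ (λ_ X.obj).hom = 𝟙 X.obj)
  (hook' : (λ_ X').inv ≫ c ▷ X' ≫ (α_ _ _ _).hom ≫ X' ◁ p ≫ (ρ_ X').hom = 𝟙 X')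

/-- The pairing of a bimodule with its dual, before projection to the relative tensor product. -/
def outerPair (γ : Aˣ) : outer X (X.mate p c hook hook') ⟶ unitM F γ :=
  mk' (X := outer X (X.mate p c hook hook')) (Y := unitM F γ)
    (capL p (X.left.hom (fn A) (toFn (twistChar γ))))
    (fun V v => by
      -- Linearity is tested on inverse trivializations, since those of the unit bimodule are
      -- explicit (`unitActL`).
      refine left_of_inv (X := outer X (X.mate p c hook hook')) (Y := unitM F γ) _ V (fun ξ => ?_) v
      rw [unitM_left_inv]
      change F.obj V ◁ capL p (X.left.hom (fn A) (toFn (twistChar γ))) ≫ unitActL F γ V ξ =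
        ((α_ _ _ _).inv ≫ X.left.inv V ξ ▷ X') ≫ capL p (X.left.hom (fn A) (toFn (twistChar γ)))
      rw [whisker_capL_mul, TrivL.twistChar_left]
      simp only [capL, comp_whiskerRight, Category.assoc])
    (fun V v => by
      -- On the right the dual has explicit direct trivializations (`mateR`), so only the target is
      -- tested against the inverse morphisms of the unit bimodule.
      refine TrivR.mono0 (unitM F γ).right.inv_hom fun ζ => ?_
      refine Eq.trans ?_ ((Category.assoc _ _ _).trans (congrArg (fun t =>
        capL p (X.left.hom (fn A) (toFn (twistChar γ))) ≫ t)
          ((unitM F γ).right.hom_inv V v ζ))).symm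
      rw [unitM_right_inv]
      change ((X.obj ◁ mateR p c (X.left.hom V v) ≫ (α_ _ _ _).inv) ≫
        capL p (X.left.hom (fn A) (toFn (twistChar γ))) ▷ F.obj V) ≫ unitActR F γ V ζ =
        capL p (X.left.hom (fn A) (toFn (twistChar γ))) ≫ (ζ v • 𝟙 (F.obj (fn A)))
      rw [Category.assoc (X.obj ◁ _), whisker_mateR_capL p c hook, Category.assoc, Category.assoc,
        ← capL_mul,
        TrivL.twistChar_right, Linear.comp_smul, Category.comp_id]
      simp [capL])

/-- The action on the dual moves to `X` by `whisker_mateL_capL`; there `hk` says that `k` lets the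
right trivialization meet its own inverse, leaving a scalar. -/
lemma coefV_capL {P : T} (k : X.obj ⟶ P ⊗ X.obj) (V : HopfRep B) (v : V.carrier)
    (ξ : Module.Dual ℂ V.carrier)
    (hk : X.right.hom V v ≫ k ▷ G.obj V ≫ (α_ _ _ _).hom ≫ P ◁ X.right.inv V ξ = ξ v • k) :
    coefV X (X.mate p c hook hook') v ξ ≫ capL p k = ξ v • capL p k := by
  change (X.right.hom V v ▷ X' ≫ (α_ _ _ _).hom ≫ X.obj ◁ mateL p c (X.right.inv V ξ)) ≫
    capL p k = _
  rw [Category.assoc, Category.assoc, whisker_mateL_capL p c hook, Iso.hom_inv_id_assoc,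
    ← comp_whiskerRight_assoc, hk]
  simp [capL]

/-- This is why the pairing factors through the relative tensor product. The two actions on `X`
commute, so averaging over `B` contributes the value of the regular character at 1, which is dim B
and cancels the normalization of `idem`. -/
lemma idem_outerPair (γ : Aˣ) : idem X (X.mate p c hook hook') ≫ X.outerPair p c hook hook' γ =
    X.outerPair p c hook hook' γ := by
  have h : coef X (X.mate p c hook hook') (regChar B) ≫ X.outerPair p c hook hook' γ =
      (Module.finrank ℂ B : ℂ) • X.outerPair p c hook hook' γ := by
    refine hom_ext ?_
    refine (X.coefV_capL p c hook hook' _ (fn B) (toFn (regChar B)) (evalAt 1) ?_).trans ?_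
    · change X.right.hom (fn B) (toFn (regChar B)) ≫
        X.left.hom (fn A) (toFn (twistChar γ)) ▷ G.obj (fn B) ≫ (α_ _ _ _).hom ≫
          F.obj (fn A) ◁ X.right.inv (fn B) (evalAt 1) = _
      rw [← reassoc_of% X.comm, ← MonoidalCategory.whiskerLeft_comp, X.right.hom_inv]
      simp
      rfl
    · rw [evalAt_toFn, regChar_one]; rfl
  rw [idem, Linear.smul_comp, h, smul_smul, inv_mul_cancel₀ (finrank_ne_zero' B), one_smul]

/-- The copairing of a bimodule with its dual, before projection to the relative tensor product. -/
def outerCopair (γ : Bˣ) : unitM G γ ⟶ outer (X.mate p c hook hook') X :=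
  mk' (X := unitM G γ) (Y := outer (X.mate p c hook hook') X)
    (cupL c ((X.right.mate p c hook hook').inv (fn B) (evalAt (γ : B))))
    (fun V v => by
      refine left_of_inv (X := unitM G γ) (Y := outer (X.mate p c hook hook') X) _ V
        (fun ξ => ?_) v
      rw [unitM_left_inv]
      change G.obj V ◁ cupL c ((X.right.mate p c hook hook').inv (fn B) (evalAt (γ : B))) ≫
        (α_ (G.obj V) X' X.obj).inv ≫ (X.right.mate p c hook hook').inv V ξ ▷ X.obj =
          unitActL G γ V ξ ≫ cupL c ((X.right.mate p c hook hook').inv (fn B) (evalAt (γ : B)))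
      rw [← cupL_comp, ← TrivL.evalAt_left, cupL_mul])
    (fun V v => by
      refine right_of_inv (X := unitM G γ) (Y := outer (X.mate p c hook hook') X) _ V
        (fun ξ => ?_) v
      rw [unitM_right_inv]
      change cupL c ((X.right.mate p c hook hook').inv (fn B) (evalAt (γ : B))) ▷ G.obj V ≫
        (α_ X' X.obj (G.obj V)).hom ≫ X' ◁ X.right.inv V ξ =
          unitActR G γ V ξ ≫ cupL c ((X.right.mate p c hook hook').inv (fn B) (evalAt (γ : B)))
      -- The right action of `V` sits on the leg `X`, the function algebra acts on the leg `X'`; in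
      -- the cup the former can be exchanged for its transpose.
      have e : cupL c ((X.right.mate p c hook hook').inv V ξ) = unbend c (X.right.inv V ξ) :=
        cupL_mateL p c hook hook' _
      rw [← cupL_comp, ← TrivL.evalAt_right, cupL_mul, e]
      -- The two actions are on different legs of the cup and therefore interchange, whatever `l`
      -- is.
      have h : ∀ l : G.obj (fn B) ⊗ X' ⟶ X', cupL c l ▷ G.obj V ≫ (α_ X' X.obj (G.obj V)).hom ≫
          X' ◁ X.right.inv V ξ = G.obj (fn B) ◁ unbend c (X.right.inv V ξ) ≫ (α_ _ _ _).inv ≫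
            l ▷ X.obj := by
        intro l
        have h1 : cupL c l ▷ G.obj V ≫ (α_ X' X.obj (G.obj V)).hom ≫ X' ◁ X.right.inv V ξ =
            (ρ_ _).inv ▷ _ ≫ (α_ _ _ _).hom ≫ G.obj (fn B) ◁ (c ▷ G.obj V ≫ (α_ _ _ _).hom) ≫
              (α_ _ _ _).inv ≫ l ▷ (X.obj ⊗ G.obj V) ≫ X' ◁ X.right.inv V ξ := by
          simp only [cupL, comp_whiskerRight, MonoidalCategory.whiskerLeft_comp]
          monoidal
        rw [h1, ← whisker_exchange]
        simp only [unbend, MonoidalCategory.whiskerLeft_comp]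
        monoidal
      exact h _)

/-- The gauge moves the evaluation point from 1 to `γ`. In this form the unit constraint can be
contracted with the twisted character of a pairing. -/
lemma lmap_mor (γ : Aˣ) : mor (lmap γ X) =
    dimPow A (-1 / 2) • X.left.inv (fn A) (evalAt (γ : A)) := by
  have h := X.left.inv_naturality (gaugeMap (γ : A)) (evalAt 1)
  rw [evalAt_gaugeMap, mul_one] at h
  rw [← h]; rfl

lemma rmap_mor (γ : Bˣ) : mor (rmap γ X) =
    dimPow B (-1 / 2) • X.right.inv (fn B) (evalAt (γ : B)) := by
  have h := X.right.inv_naturality (gaugeMap (γ : B)) (evalAt 1)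
  rw [evalAt_gaugeMap, mul_one] at h
  rw [← h]; rfl

/-- As 1/2 - 1 = -1/2, a unit constraint and its inverse carry the same scalar. -/
lemma finrank_dimPow (A : Type) [Ring A] [HopfAlgebra ℂ A] [Module.Finite ℂ A] :
    (dimPow A (-1 / 2))⁻¹ * (Module.finrank ℂ A : ℂ)⁻¹ = dimPow A (-1 / 2) := by
  have h : (Module.finrank ℂ A : ℝ) ≠ 0 := by exact_mod_cast BiMod.finrank_ne_zero' A
  have h' : 0 < (Module.finrank ℂ A : ℝ) := lt_of_le_of_ne (Nat.cast_nonneg _) h.symm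
  have e : dimPow A (-1 / 2) * dimPow A (-1 / 2) = (Module.finrank ℂ A : ℂ)⁻¹ := by
    rw [dimPow, ← Complex.ofReal_mul, ← Real.rpow_add h']
    norm_num [Real.rpow_neg_one]
  rw [← e, ← mul_assoc, inv_mul_cancel₀ (dimPow_ne_zero A _), one_mul]

variable [IsIdempotentComplete T]

/-- The inverse constraint is defined through the averaged character composed with the antipode.
Antipode invariance removes the antipode, and the inverse gauge produces the twisted character. -/
lemma compLu_inv_mor (γ : Aˣ) : mor (compLu γ X).inv =
    dimPow A (-1 / 2) • (X.left.hom (fn A) (toFn (twistChar γ)) ≫ mor (π (unitM F γ) X)) := by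
  have h := X.left.naturality (gaugeMap ((γ⁻¹ : Aˣ) : A)) (toFn (regChar A))
  rw [gaugeMap_regChar] at h
  have h' : ∀ {Q : T} (q : F.obj (fn A) ⊗ X.obj ⟶ Q), (dimPow A (-1 / 2))⁻¹ •
      (((Module.finrank ℂ A : ℂ)⁻¹ • X.left.hom (fn A) (toFn (regChar A ∘ₗ antipode ℂ))) ≫
        F.map (gaugeMap ((γ⁻¹ : Aˣ) : A)) ▷ X.obj ≫ q) =
      dimPow A (-1 / 2) • (X.left.hom (fn A) (toFn (twistChar γ)) ≫ q) := by
    intro Q q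
    rw [regChar_comp_antipode IsInvolutive.sq, Linear.smul_comp, smul_smul, finrank_dimPow, h,
      Category.assoc]
  exact h' _

lemma compRu_inv_mor (γ : Bˣ) : mor (compRu γ X).inv =
    dimPow B (-1 / 2) • (X.right.hom (fn B) (toFn (twistChar γ)) ≫ mor (π X (unitM G γ))) := by
  have h := X.right.naturality (gaugeMap ((γ⁻¹ : Bˣ) : B)) (toFn (regChar B))
  rw [gaugeMap_regChar] at h
  have h' : ∀ {Q : T} (q : X.obj ⊗ G.obj (fn B) ⟶ Q), (dimPow B (-1 / 2))⁻¹ •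
      (((Module.finrank ℂ B : ℂ)⁻¹ • X.right.hom (fn B) (toFn (regChar B))) ≫
        X.obj ◁ G.map (gaugeMap ((γ⁻¹ : Bˣ) : B)) ≫ q) =
      dimPow B (-1 / 2) • (X.right.hom (fn B) (toFn (twistChar γ)) ≫ q) := by
    intro Q q
    rw [Linear.smul_comp, smul_smul, finrank_dimPow, h, Category.assoc]
  exact h' _

end BiMod

end PairingOfBimodules
end

/-! ### The hook identities in M(T). -/

noncomputable section

open CategoryTheory MonoidalCategory
open scoped TensorProduct

section RigidityOfBimodules

open HopfRep HopfAlgebra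

variable {T : Type u} [Category.{v} T] [Preadditive T] [Linear ℂ T] [MonoidalCategory T]
  [MonoidalPreadditive T] [MonoidalLinear ℂ T]
  {A : Type} [Ring A] [HopfAlgebra ℂ A] {F : HopfRep A ⥤ T} [F.Monoidal] [F.Additive]
  [F.Linear ℂ] [Module.Finite ℂ A] [IsInvolutive A]
  {B : Type} [Ring B] [HopfAlgebra ℂ B] {G : HopfRep B ⥤ T} [G.Monoidal] [G.Additive]
  [G.Linear ℂ] [Module.Finite ℂ B] [IsInvolutive B]
  {C : Type} [Ring C] [HopfAlgebra ℂ C] {H : HopfRep C ⥤ T} [H.Monoidal]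
  [Module.Finite ℂ C] [IsInvolutive C]
  {E : Type} [Ring E] [HopfAlgebra ℂ E] {K : HopfRep E ⥤ T} [K.Monoidal]

lemma dimPow_add (A : Type) [Ring A] [HopfAlgebra ℂ A] [Module.Finite ℂ A] (s t : ℝ) :
    dimPow A s * dimPow A t = dimPow A (s + t) := by
  have h : (Module.finrank ℂ A : ℝ) ≠ 0 := by exact_mod_cast BiMod.finrank_ne_zero' A
  have h' : 0 < (Module.finrank ℂ A : ℝ) := lt_of_le_of_ne (Nat.cast_nonneg _) h.symm
  rw [dimPow, dimPow, dimPow, ← Complex.ofReal_mul, ← Real.rpow_add h']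

lemma dimPow_neg_one (A : Type) [Ring A] [HopfAlgebra ℂ A] [Module.Finite ℂ A] :
    dimPow A (-1) = (Module.finrank ℂ A : ℂ)⁻¹ := by
  simp [dimPow, Real.rpow_neg_one]

/-- Collects the scalars of a hook identity: `s` and `k` come from the unit constraints, `t` from
pairing and copairing, `n` from the unnormalized zigzag. -/
lemma smul_comp_smul_aux {X₁ X₂ X₃ X₄ X₅ X₆ : T} (r : X₁ ⟶ X₂) (a : X₂ ⟶ X₃) (b : X₃ ⟶ X₄)
    (d : X₄ ⟶ X₅) (e : X₅ ⟶ X₆) (s t k n : ℂ) {z : X₁ ⟶ X₆} (h : r ≫ a ≫ b ≫ d ≫ e = n • z) :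
    s • (r ≫ (t • (a ≫ b ≫ d ≫ (k • e)))) = (s * (t * (k * n))) • z := by
  simp only [Linear.comp_smul, h, smul_smul]
  congr 1; ring

/-- The normalization `|A|^(-1/4) |B|^(-1/4)` of the pairings. -/
def pairScale (A B : Type) [Ring A] [Algebra ℂ A] [Ring B] [Algebra ℂ B] : ℂ :=
  dimPow A (-1 / 4) * dimPow B (-1 / 4)

lemma pairScale_comm (A B : Type) [Ring A] [Algebra ℂ A] [Ring B] [Algebra ℂ B] :
    pairScale A B = pairScale B A := mul_comm _ _

lemma pairScale_sq (A B : Type) [Ring A] [HopfAlgebra ℂ A] [Module.Finite ℂ A]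
    [Ring B] [HopfAlgebra ℂ B] [Module.Finite ℂ B] :
    pairScale A B * pairScale A B = dimPow A (-1 / 2) * dimPow B (-1 / 2) := by
  rw [pairScale, mul_mul_mul_comm, dimPow_add, dimPow_add]
  norm_num

/-- The balance behind the normalization: the exponents of |A| and of |B| are each -1/2 (unit
constraint) - 1/2 (pairing and copairing) + 1 (zigzag). -/
lemma pairScale_normalize (A B : Type) [Ring A] [HopfAlgebra ℂ A] [Module.Finite ℂ A]
    [Ring B] [HopfAlgebra ℂ B] [Module.Finite ℂ B] :
    dimPow B (-1 / 2) * (pairScale A B * pairScale A B * (dimPow A (-1 / 2) *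
      ((Module.finrank ℂ A : ℂ) * Module.finrank ℂ B))) = 1 := by
  have hA := BiMod.finrank_ne_zero' A
  have hB := BiMod.finrank_ne_zero' B
  have h : dimPow A (-1 / 2) * dimPow A (-1 / 2) = (Module.finrank ℂ A : ℂ)⁻¹ := by
    rw [dimPow_add, ← dimPow_neg_one]; norm_num
  have h' : dimPow B (-1 / 2) * dimPow B (-1 / 2) = (Module.finrank ℂ B : ℂ)⁻¹ := by
    rw [dimPow_add, ← dimPow_neg_one]; norm_num
  rw [pairScale_sq]
  calc _ = (dimPow A (-1 / 2) * dimPow A (-1 / 2)) * (dimPow B (-1 / 2) * dimPow B (-1 / 2)) *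
        ((Module.finrank ℂ A : ℂ) * Module.finrank ℂ B) := by ring
    _ = 1 := by rw [h, h']; field_simp

lemma HopfRep.evalAt_twistChar (γ : Aˣ) :
    evalAt (γ : A) (toFn (twistChar γ)) = Module.finrank ℂ A := by
  rw [evalAt_toFn, ← regChar_one]
  change regChar A (((γ⁻¹ : Aˣ) : A) * γ) = _
  rw [Units.inv_mul]

namespace BiMod

section

variable [IsIdempotentComplete T]

lemma compRu_inv_comp_mor (γ : Bˣ) (X : BiMod F G) {Z : BiMod F G}
    (q : comp X (unitM G γ) ⟶ Z) (q' : X.obj ⊗ G.obj (fn B) ⟶ Z.obj)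
    (h : mor (π X (unitM G γ) ≫ q) = q') : mor ((compRu γ X).inv ≫ q) =
    dimPow B (-1 / 2) • (X.right.hom (fn B) (toFn (twistChar γ)) ≫ q') := by
  rw [← h]
  refine (congrArg (· ≫ mor q) (compRu_inv_mor X γ)).trans ?_
  exact (Linear.smul_comp _ _ _ _ _ _).trans (congrArg _ (Category.assoc _ _ _))

lemma compLu_inv_comp_mor (γ : Aˣ) (X : BiMod F G) {Z : BiMod F G}
    (q : comp (unitM F γ) X ⟶ Z) (q' : F.obj (fn A) ⊗ X.obj ⟶ Z.obj)
    (h : mor (π (unitM F γ) X ≫ q) = q') : mor ((compLu γ X).inv ≫ q) =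
    dimPow A (-1 / 2) • (X.left.hom (fn A) (toFn (twistChar γ)) ≫ q') := by
  rw [← h]
  refine (congrArg (· ≫ mor q) (compLu_inv_mor X γ)).trans ?_
  exact (Linear.smul_comp _ _ _ _ _ _).trans (congrArg _ (Category.assoc _ _ _))

lemma compA_inv (X : BiMod F G) (Y : BiMod G H) (Z : BiMod H K) :
    outL X (π Y Z) ≫ π X (comp Y Z) ≫ (compA X Y Z).inv =
      (outA X Y Z).inv ≫ outR (π X Y) Z ≫ π (comp X Y) Z := assoc_inv_aux X Y Z

end

variable (X : BiMod F G) {X' : T} (p : X.obj ⊗ X' ⟶ 𝟙_ T) (c : 𝟙_ T ⟶ X' ⊗ X.obj)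
  (hook : (ρ_ X.obj).inv ≫ X.obj ◁ c ≫ (α_ _ _ _).inv ≫ p ▷ X.obj ≫ (λ_ X.obj).hom = 𝟙 X.obj)
  (hook' : (λ_ X').inv ≫ c ▷ X' ≫ (α_ _ _ _).hom ≫ X' ◁ p ≫ (ρ_ X').hom = 𝟙 X')

/-- After straightening, `X` carries the twisted character against evaluation at the gauge, once for
the left and once for the right action. Each contraction is a scalar, the dimension of the algebra,
by `evalAt_twistChar`. -/
lemma hook_raw (γ : Aˣ) (γ' : Bˣ) : X.right.hom (fn B) (toFn (twistChar γ')) ≫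
    mor (outL X (X.outerCopair p c hook hook' γ')) ≫ (α_ X.obj X' X.obj).inv ≫
    mor (outR (X.outerPair p c hook hook' γ) X) ≫ X.left.inv (fn A) (evalAt (γ : A)) =
      ((Module.finrank ℂ A : ℂ) * Module.finrank ℂ B) • 𝟙 X.obj := by
  have h := whisker_unbend_capL p c hook (X.right.inv (fn B) (evalAt (γ' : B)))
    (X.left.hom (fn A) (toFn (twistChar γ)))
  have e : cupL c ((X.right.mate p c hook hook').inv (fn B) (evalAt (γ' : B))) =
      unbend c (X.right.inv (fn B) (evalAt (γ' : B))) := cupL_mateL p c hook hook' _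
  change X.right.hom (fn B) (toFn (twistChar γ')) ≫
    X.obj ◁ cupL c ((X.right.mate p c hook hook').inv (fn B) (evalAt (γ' : B))) ≫
      (α_ X.obj X' X.obj).inv ≫ capL p (X.left.hom (fn A) (toFn (twistChar γ))) ▷ X.obj ≫
        X.left.inv (fn A) (evalAt (γ : A)) = _
  rw [e, reassoc_of% h, ← reassoc_of% right_inv_left_hom, X.left.hom_inv, evalAt_twistChar,
    reassoc_of% X.right.hom_inv, evalAt_twistChar]
  simp [smul_smul, mul_comm]

/-- Here both contractions involve the transposed actions on `X'`. Since these commute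
(`left_inv_right_hom`), each direct trivialization can be brought next to its own inverse. -/
lemma hook_dual_raw (γ : Aˣ) (γ' : Bˣ) :
    (X.mate p c hook hook').left.hom (fn B) (toFn (twistChar γ')) ≫
    mor (outR (X.outerCopair p c hook hook' γ') (X.mate p c hook hook')) ≫ (α_ X' X.obj X').hom ≫
    mor (outL (X.mate p c hook hook') (X.outerPair p c hook hook' γ)) ≫
      (X.mate p c hook hook').right.inv (fn A) (evalAt (γ : A)) =
      ((Module.finrank ℂ A : ℂ) * Module.finrank ℂ B) • 𝟙 X' := by
  have h := cupL_whisker_capL p c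
    ((X.right.mate p c hook hook').inv (fn B) (evalAt (γ' : B)))
    (X.left.hom (fn A) (toFn (twistChar γ)))
  have h2 := left_inv_right_hom (X.mate p c hook hook') (fn B) (fn A) (evalAt (γ' : B))
    (toFn (twistChar γ))
  change (X.right.mate p c hook hook').hom (fn B) (toFn (twistChar γ')) ≫
    cupL c ((X.right.mate p c hook hook').inv (fn B) (evalAt (γ' : B))) ▷ X' ≫
      (α_ X' X.obj X').hom ≫ X' ◁ capL p (X.left.hom (fn A) (toFn (twistChar γ))) ≫
        (X.left.mate p c hook hook').inv (fn A) (evalAt (γ : A)) = _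
  change (X.right.mate p c hook hook').inv (fn B) (evalAt (γ' : B)) ≫
    (X.left.mate p c hook hook').hom (fn A) (toFn (twistChar γ)) =
    G.obj (fn B) ◁ mateR p c (X.left.hom (fn A) (toFn (twistChar γ))) ≫ (α_ _ _ _).inv ≫
      (X.right.mate p c hook hook').inv (fn B) (evalAt (γ' : B)) ▷ F.obj (fn A) at h2
  rw [reassoc_of% h, ← reassoc_of% h2, TrivR.hom_inv, evalAt_twistChar, reassoc_of% TrivL.hom_inv,
    evalAt_twistChar]
  simp [smul_smul, mul_comm]

variable [IsIdempotentComplete T]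

/-- The pairing of a bimodule with its dual. -/
def cpair (γ : Aˣ) : comp X (X.mate p c hook hook') ⟶ unitM F γ :=
  ι _ _ ≫ (pairScale A B • X.outerPair p c hook hook' γ)

/-- The copairing of a bimodule with its dual. -/
def ccopair (γ : Bˣ) : unitM G γ ⟶ comp (X.mate p c hook hook') X :=
  (pairScale A B • X.outerCopair p c hook hook' γ) ≫ π _ _

lemma π_cpair (γ : Aˣ) : π _ _ ≫ X.cpair p c hook hook' γ =
    pairScale A B • X.outerPair p c hook hook' γ := by
  rw [cpair, reassoc_of% π_ι, Linear.comp_smul, idem_outerPair]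

/-- The inverse right unit constraint inserts the twisted character and then projects. All
constraints of M(T) are induced from T, so the projection carries the relative zigzag to the outer
one, and only `hook_raw` and the count of scalars remain. -/
lemma cpair_hook (γ : Aˣ) (γ' : Bˣ) : (compRu γ' X).inv ≫ compL X (X.ccopair p c hook hook' γ') ≫
    (compA X (X.mate p c hook hook') X).inv ≫ compR (X.cpair p c hook hook' γ) X ≫
      (compLu γ X).hom = 𝟙 X := by
  -- The projections inside the relative zigzag disappear, because the associator is natural for
  -- them and the outer pairing already factors through its own.
  have h : π X (unitM G γ') ≫ compL X (X.ccopair p c hook hook' γ') ≫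
      (compA X (X.mate p c hook hook') X).inv ≫ compR (X.cpair p c hook hook' γ) X ≫
      (compLu γ X).hom = (pairScale A B * pairScale A B) •
        (outL X (X.outerCopair p c hook hook' γ') ≫ (outA X (X.mate p c hook hook') X).inv ≫
          outR (X.outerPair p c hook hook' γ) X ≫ lmap γ X) := by
    rw [reassoc_of% π_compL, ccopair, outL_comp, Category.assoc, reassoc_of% compA_inv,
      reassoc_of% π_compR, π_compLu,
      reassoc_of% (outR_comp (π X (X.mate p c hook hook')) (X.cpair p c hook hook' γ) X).symm,
      π_cpair, outL_smul, outR_smul]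
    simp only [Linear.smul_comp, Linear.comp_smul, smul_smul]
  refine hom_ext ((X.compRu_inv_comp_mor γ' _ _ (congrArg mor h)).trans ?_)
  rw [mor_smul, mor_comp, mor_comp, mor_comp, lmap_mor]
  refine (smul_comp_smul_aux _ _ _ _ _ _ _ _ _ (X.hook_raw p c hook hook' γ γ')).trans ?_
  rw [pairScale_normalize, one_smul]; rfl

lemma cpair_hook_dual (γ : Aˣ) (γ' : Bˣ) : (compLu γ' (X.mate p c hook hook')).inv ≫
    compR (X.ccopair p c hook hook' γ') (X.mate p c hook hook') ≫
    (compA (X.mate p c hook hook') X (X.mate p c hook hook')).hom ≫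
      compL (X.mate p c hook hook') (X.cpair p c hook hook' γ) ≫
      (compRu γ (X.mate p c hook hook')).hom = 𝟙 (X.mate p c hook hook') := by
  have h : π (unitM G γ') (X.mate p c hook hook') ≫
      compR (X.ccopair p c hook hook' γ') (X.mate p c hook hook') ≫
      (compA (X.mate p c hook hook') X (X.mate p c hook hook')).hom ≫
        compL (X.mate p c hook hook') (X.cpair p c hook hook' γ) ≫
        (compRu γ (X.mate p c hook hook')).hom = (pairScale A B * pairScale A B) •
        (outR (X.outerCopair p c hook hook' γ') _ ≫ (outA (X.mate p c hook hook') X _).hom ≫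
          outL _ (X.outerPair p c hook hook' γ) ≫ rmap γ _) := by
    rw [reassoc_of% π_compR, ccopair, outR_comp, Category.assoc, reassoc_of% compA_hom,
      reassoc_of% π_compL, π_compRu,
      reassoc_of% (outL_comp (X.mate p c hook hook') (π X (X.mate p c hook hook'))
        (X.cpair p c hook hook' γ)).symm, π_cpair, outL_smul, outR_smul]
    simp only [Linear.smul_comp, Linear.comp_smul, smul_smul]
  refine hom_ext (((X.mate p c hook hook').compLu_inv_comp_mor γ' _ _ (congrArg mor h)).trans ?_)
  rw [mor_smul, mor_comp, mor_comp, mor_comp, rmap_mor]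
  refine (smul_comp_smul_aux _ _ _ _ _ _ _ _ _ (X.hook_dual_raw p c hook hook' γ γ')).trans ?_
  rw [pairScale_normalize]; exact one_smul ℂ (𝟙 X')

end BiMod

end RigidityOfBimodules
end

/-! ### Transposes in a bicategory with rigidity pairs. -/

noncomputable section

open CategoryTheory

namespace RigidityPairs

open Bicategory

universe w₁ v₁ u₁

variable {B : Type u₁} [Bicategory.{w₁, v₁} B] {dual : ∀ ⦃a b : B⦄, (a ⟶ b) → (b ⟶ a)}
  (R : RigidityPairs B dual) {a b : B}

/-- The second hook identity recovers a morphism into a dual from its composite with the pairing.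
`whisker_unbend` is the converse and uses the first hook identity. -/
lemma eq_of_whisker_pair {X : a ⟶ b} {Z : b ⟶ a} (g : Z ⟶ dual X) :
    (λ_ Z).inv ≫ R.copair X ▷ Z ≫ (α_ _ _ _).hom ≫ dual X ◁ (X ◁ g ≫ R.pair X) ≫
      (ρ_ (dual X)).hom = g := by
  have h : (λ_ Z).inv ≫ R.copair X ▷ Z ≫ (α_ _ _ _).hom ≫ dual X ◁ (X ◁ g ≫ R.pair X) ≫
      (ρ_ (dual X)).hom = (λ_ Z).inv ≫ (R.copair X ▷ Z ≫ (dual X ≫ X) ◁ g) ≫ (α_ _ _ _).hom ≫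
        dual X ◁ R.pair X ≫ (ρ_ (dual X)).hom := by
    bicategory
  have e : (λ_ Z).inv ≫ 𝟙 b ◁ g = g ≫ (λ_ (dual X)).inv := by bicategory
  rw [h, ← whisker_exchange, Category.assoc, reassoc_of% e, R.hook_dual, Category.comp_id]

/-- Morphisms to a dual are determined by the pairing. -/
lemma whisker_pair_inj {X : a ⟶ b} {Z : b ⟶ a} {g h : Z ⟶ dual X}
    (e : X ◁ g ≫ R.pair X = X ◁ h ≫ R.pair X) : g = h := by
  rw [← R.eq_of_whisker_pair g, e, R.eq_of_whisker_pair]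

lemma whisker_unbend {X : a ⟶ b} {Z : b ⟶ a} (q : X ≫ Z ⟶ 𝟙 a) :
    X ◁ ((λ_ Z).inv ≫ R.copair X ▷ Z ≫ (α_ _ _ _).hom ≫ dual X ◁ q ≫ (ρ_ (dual X)).hom) ≫
      R.pair X = q := by
  have h : X ◁ ((λ_ Z).inv ≫ R.copair X ▷ Z ≫ (α_ _ _ _).hom ≫ dual X ◁ q ≫
      (ρ_ (dual X)).hom) ≫ R.pair X = X ◁ (λ_ Z).inv ≫ X ◁ R.copair X ▷ Z ≫
        X ◁ (α_ _ _ _).hom ≫ (α_ _ _ _).inv ≫ ((X ≫ dual X) ◁ q ≫ R.pair X ▷ 𝟙 a) ≫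
        (ρ_ (𝟙 a)).hom := by
    bicategory
  have h2 := congrArg (· ▷ Z) (R.hook X)
  simp only [comp_whiskerRight, id_whiskerRight] at h2
  rw [h, whisker_exchange]
  have h3 : X ◁ (λ_ Z).inv ≫ X ◁ R.copair X ▷ Z ≫ X ◁ (α_ _ _ _).hom ≫ (α_ _ _ _).inv ≫
      (R.pair X ▷ (X ≫ Z) ≫ 𝟙 a ◁ q) ≫ (ρ_ (𝟙 a)).hom =
      ((ρ_ X).inv ▷ Z ≫ (X ◁ R.copair X) ▷ Z ≫ (α_ X (dual X) X).inv ▷ Z ≫ R.pair X ▷ X ▷ Z ≫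
        (λ_ X).hom ▷ Z) ≫ q := by
    bicategory
  rw [h3, h2, Category.id_comp]

/-- By `whisker_pair_inj` this equation characterizes the transpose. Transposes in T and in M(T) are
compared through it, without reference to the copairings. -/
lemma whisker_transpose_pair {X Y : a ⟶ b} (f : X ⟶ Y) :
    X ◁ R.transpose f ≫ R.pair X = f ▷ dual Y ≫ R.pair Y := by
  rw [← R.whisker_unbend (f ▷ dual Y ≫ R.pair Y)]
  simp [transpose]

lemma transpose_eq {X Y : a ⟶ b} (f : X ⟶ Y) (g : dual Y ⟶ dual X)
    (h : X ◁ g ≫ R.pair X = f ▷ dual Y ≫ R.pair Y) : R.transpose f = g :=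
  R.whisker_pair_inj ((R.whisker_transpose_pair f).trans h.symm)

lemma transpose_comp {X Y Z : a ⟶ b} (f : X ⟶ Y) (g : Y ⟶ Z) :
    R.transpose (f ≫ g) = R.transpose g ≫ R.transpose f := by
  refine R.transpose_eq _ _ ?_
  rw [Bicategory.whiskerLeft_comp, Category.assoc, R.whisker_transpose_pair,
    whisker_exchange_assoc, R.whisker_transpose_pair, Bicategory.comp_whiskerRight, Category.assoc]

lemma transpose_id (X : a ⟶ b) : R.transpose (𝟙 X) = 𝟙 (dual X) :=
  R.transpose_eq _ _ (by simp)

end RigidityPairs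
end

/-! ### The rigidity pairs of M(T) and their transposes. -/

noncomputable section

open CategoryTheory MonoidalCategory
open scoped TensorProduct

namespace TensorDuality

variable {T : Type u} [Category.{v} T] [MonoidalCategory T] {dual : T → T} (D : TensorDuality dual)

lemma whisker_pair_inj {X Z : T} {g h : Z ⟶ dual X}
    (e : X ◁ g ≫ D.pair X = X ◁ h ≫ D.pair X) : g = h :=
  RigidityPairs.whisker_pair_inj (a := MonoidalSingleObj.star T) (b := MonoidalSingleObj.star T)
    D.toRigidityPairs e

lemma whisker_transpose_pair {X Y : T} (f : X ⟶ Y) :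
    X ◁ D.transpose f ≫ D.pair X = f ▷ dual Y ≫ D.pair Y :=
  RigidityPairs.whisker_transpose_pair (a := MonoidalSingleObj.star T)
    (b := MonoidalSingleObj.star T) D.toRigidityPairs f

lemma transpose_eq {X Y : T} (f : X ⟶ Y) (g : dual Y ⟶ dual X)
    (h : X ◁ g ≫ D.pair X = f ▷ dual Y ≫ D.pair Y) : D.transpose f = g :=
  RigidityPairs.transpose_eq (a := MonoidalSingleObj.star T)
    (b := MonoidalSingleObj.star T) D.toRigidityPairs f g h

lemma transpose_comp {X Y Z : T} (f : X ⟶ Y) (g : Y ⟶ Z) :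
    D.transpose (f ≫ g) = D.transpose g ≫ D.transpose f :=
  RigidityPairs.transpose_comp (a := MonoidalSingleObj.star T)
    (b := MonoidalSingleObj.star T) D.toRigidityPairs f g

lemma transpose_id (X : T) : D.transpose (𝟙 X) = 𝟙 (dual X) :=
  RigidityPairs.transpose_id (a := MonoidalSingleObj.star T)
    (b := MonoidalSingleObj.star T) D.toRigidityPairs X

lemma bidual_natural {X Y : T} (f : X ⟶ Y) :
    f ≫ (D.bidual Y).hom = (D.bidual X).hom ≫ D.transpose (D.transpose f) :=
  FrobeniusDuality.bidual_natural (a := MonoidalSingleObj.star T)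
    (b := MonoidalSingleObj.star T) D f

lemma bidual_dual (X : T) :
    (D.bidual (dual X)).hom ≫ D.transpose (D.bidual X).hom = 𝟙 (dual X) :=
  FrobeniusDuality.bidual_dual (a := MonoidalSingleObj.star T)
    (b := MonoidalSingleObj.star T) D X

lemma bidual_comp (X Y : T) :
    (D.bidual (X ⊗ Y)).hom ≫ D.transpose (D.dualComp X Y).hom =
      (D.bidual X).hom ▷ Y ≫ dual (dual X) ◁ (D.bidual Y).hom ≫
        (D.dualComp (dual Y) (dual X)).hom :=
  FrobeniusDuality.bidual_comp (a := MonoidalSingleObj.star T)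
    (b := MonoidalSingleObj.star T) (c := MonoidalSingleObj.star T) D X Y

lemma multiplicative (X Y : T) :
    (X ⊗ Y) ◁ (D.dualComp X Y).hom ≫ D.pair (X ⊗ Y) =
      (α_ X Y (dual Y ⊗ dual X)).hom ≫ X ◁ (α_ Y (dual Y) (dual X)).inv ≫
        X ◁ (D.pair Y ▷ dual X) ≫ X ◁ (λ_ (dual X)).hom ≫ D.pair X :=
  FrobeniusDuality.multiplicative (a := MonoidalSingleObj.star T)
    (b := MonoidalSingleObj.star T) (c := MonoidalSingleObj.star T) D X Y

end TensorDuality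

section

open HopfRep HopfAlgebra

variable {T : Type u} [Category.{v} T] [Preadditive T] [Linear ℂ T] [MonoidalCategory T]
  [MonoidalPreadditive T] [MonoidalLinear ℂ T]
  {A : Type} [Ring A] [HopfAlgebra ℂ A] {F : HopfRep A ⥤ T} [F.Monoidal]
  {B : Type} [Ring B] [HopfAlgebra ℂ B] {G : HopfRep B ⥤ T} [G.Monoidal]

namespace BiMod

variable {X Y : BiMod F G} {X' Y' : T} (p : X.obj ⊗ X' ⟶ 𝟙_ T) (c : 𝟙_ T ⟶ X' ⊗ X.obj)
  (hook : (ρ_ X.obj).inv ≫ X.obj ◁ c ≫ (α_ _ _ _).inv ≫ p ▷ X.obj ≫ (λ_ X.obj).hom = 𝟙 X.obj)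
  (hook' : (λ_ X').inv ≫ c ▷ X' ≫ (α_ _ _ _).hom ≫ X' ◁ p ≫ (ρ_ X').hom = 𝟙 X')
  (q : Y.obj ⊗ Y' ⟶ 𝟙_ T) (d : 𝟙_ T ⟶ Y' ⊗ Y.obj)
  (kook : (ρ_ Y.obj).inv ≫ Y.obj ◁ d ≫ (α_ _ _ _).inv ≫ q ▷ Y.obj ≫ (λ_ Y.obj).hom = 𝟙 Y.obj)
  (kook' : (λ_ Y').inv ≫ d ▷ Y' ≫ (α_ _ _ _).hom ≫ Y' ◁ q ≫ (ρ_ Y').hom = 𝟙 Y')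

/-- The transpose of a morphism of bimodules. -/
def mateMap (f : X ⟶ Y) (t : Y' ⟶ X') (ht : X.obj ◁ t ≫ p = mor f ▷ Y' ≫ q) :
    Y.mate q d kook kook' ⟶ X.mate p c hook hook' :=
  mk' (X := Y.mate q d kook kook') (Y := X.mate p c hook hook') t
    (fun V v => by
      refine left_of_inv (X := Y.mate q d kook kook') (Y := X.mate p c hook hook') t V
        (fun ξ => ?_) v
      change G.obj V ◁ t ≫ mateL p c (X.right.inv V ξ) = mateL q d (Y.right.inv V ξ) ≫ t
      refine whisker_inj p c hook' ?_
      -- Under the pairing, `ht` trades `t` on the dual for `f` on the bimodule, so linearity of `t`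
      -- becomes linearity of `f` for the opposite action.
      have h := mor_right_inv f V ξ
      rw [MonoidalCategory.whiskerLeft_comp, Category.assoc, whisker_mateL p c hook,
        MonoidalCategory.whiskerLeft_comp, Category.assoc, ht, whisker_exchange_assoc,
        whisker_mateL q d kook, associator_inv_naturality_right_assoc, whisker_exchange_assoc, ht,
        ← comp_whiskerRight_assoc, ← h, associator_inv_naturality_left_assoc, comp_whiskerRight,
        Category.assoc])
    (fun V v => by
      change mateR q d (Y.left.hom V v) ≫ t ▷ F.obj V = t ≫ mateR p c (X.left.hom V v)
      refine bend_inj p c hook' ?_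
      have h := mor_left f V v
      have h1 : bend p (mateR q d (Y.left.hom V v) ≫ t ▷ F.obj V) =
          X.obj ◁ mateR q d (Y.left.hom V v) ≫ (α_ _ _ _).inv ≫ (X.obj ◁ t ≫ p) ▷ F.obj V ≫
            (λ_ _).hom := by
        simp [bend]
      have h2 : X.obj ◁ mateR q d (Y.left.hom V v) ≫ (α_ _ _ _).inv ≫ (mor f ▷ Y' ≫ q) ▷ F.obj V ≫
          (λ_ _).hom = mor f ▷ Y' ≫ bend q (mateR q d (Y.left.hom V v)) := by
        simp only [bend]
        rw [← whisker_exchange_assoc]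
        simp
      have h3 : X.obj ◁ t ≫ capL p (X.left.hom V v) =
          X.left.hom V v ▷ Y' ≫ (α_ _ _ _).hom ≫ F.obj V ◁ (X.obj ◁ t ≫ p) ≫ (ρ_ _).hom := by
        simp only [capL, MonoidalCategory.whiskerLeft_comp, Category.assoc]
        rw [whisker_exchange_assoc, associator_naturality_right_assoc]
      rw [h1, ht, h2, bend_mateR_eq q d kook, bend_comp, bend_mateR_eq p c hook, h3, ht]
      simp only [capL, MonoidalCategory.whiskerLeft_comp, Category.assoc]
      rw [← associator_naturality_middle_assoc, ← comp_whiskerRight_assoc (X.left.hom V v), h,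
        ← comp_whiskerRight_assoc])

variable [F.Additive] [F.Linear ℂ] [Module.Finite ℂ A] [IsInvolutive A]
  [G.Additive] [G.Linear ℂ] [Module.Finite ℂ B] [IsInvolutive B] [IsIdempotentComplete T]

/-- Besides `ht` this needs only that `f` respects the left trivialization at the twisted character.
It shows that the transpose taken in T satisfies the equation characterizing the transpose in M(T).
-/
lemma mateMap_cpair (γ : Aˣ) (f : X ⟶ Y) (t : Y' ⟶ X')
    (ht : X.obj ◁ t ≫ p = mor f ▷ Y' ≫ q) :
    compL X (mateMap p c hook hook' q d kook kook' f t ht) ≫ X.cpair p c hook hook' γ =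
      compR f (Y.mate q d kook kook') ≫ Y.cpair q d kook kook' γ := by
  refine π_epi ?_
  rw [reassoc_of% π_compL, reassoc_of% π_compR, π_cpair, π_cpair, Linear.comp_smul,
    Linear.comp_smul]
  congr 1
  refine hom_ext ?_
  change X.obj ◁ t ≫ capL p (X.left.hom (fn A) (toFn (twistChar γ))) =
    mor f ▷ Y' ≫ capL q (Y.left.hom (fn A) (toFn (twistChar γ)))
  have h3 : X.obj ◁ t ≫ capL p (X.left.hom (fn A) (toFn (twistChar γ))) =
      X.left.hom (fn A) (toFn (twistChar γ)) ▷ Y' ≫ (α_ _ _ _).hom ≫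
        F.obj (fn A) ◁ (X.obj ◁ t ≫ p) ≫ (ρ_ _).hom := by
    simp only [capL, MonoidalCategory.whiskerLeft_comp, Category.assoc]
    rw [whisker_exchange_assoc, associator_naturality_right_assoc]
  rw [h3, ht]
  simp only [capL, MonoidalCategory.whiskerLeft_comp, Category.assoc]
  rw [← associator_naturality_middle_assoc,
    ← comp_whiskerRight_assoc (X.left.hom (fn A) (toFn (twistChar γ))), mor_left,
    ← comp_whiskerRight_assoc]

end BiMod

end

namespace HopfIn

open HopfRep

variable {T : Type u} [Category.{v} T] [Preadditive T] [Linear ℂ T] [MonoidalCategory T]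
  [MonoidalPreadditive T] [MonoidalLinear ℂ T] {star : T → T} {D : TensorDuality star}
  [IsIdempotentComplete T]

variable (D) in
/-- The rigidity pairs in `M(T)`. -/
def rigid : RigidityPairs (HopfIn D) (fun _ _ X => HopfIn.dual X) where
  pair {P Q} X := BiMod.cpair (F := P.F) (G := Q.F) X (D.pair (obj X)) (D.copair (obj X))
    (D.hook (obj X)) (D.hook_dual (obj X)) (gauge P.A)
  copair {P Q} X := BiMod.ccopair (F := P.F) (G := Q.F) X (D.pair (obj X)) (D.copair (obj X))
    (D.hook (obj X)) (D.hook_dual (obj X)) (gauge Q.A)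
  hook {P Q} X := BiMod.cpair_hook (F := P.F) (G := Q.F) X _ _ _ _ (gauge P.A) (gauge Q.A)
  hook_dual {P Q} X := BiMod.cpair_hook_dual (F := P.F) (G := Q.F) X _ _ _ _ (gauge P.A) (gauge Q.A)

variable {P Q R : HopfIn D}

/-- Source and target are bimodules over the same two algebras, so the normalizations of their
pairings agree and no scalar appears. -/
lemma mor_transpose {X Y : P ⟶ Q} (f : X ⟶ Y) :
    mor ((rigid D).transpose f) = D.transpose (mor f) := by
  have h := (rigid D).transpose_eq f (BiMod.mateMap (F := P.F) (G := Q.F) (X := X) (Y := Y)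
    (D.pair (obj X)) (D.copair (obj X)) (D.hook (obj X)) (D.hook_dual (obj X))
    (D.pair (obj Y)) (D.copair (obj Y)) (D.hook (obj Y)) (D.hook_dual (obj Y)) f
    (D.transpose (mor f)) (D.whisker_transpose_pair (mor f)))
    (BiMod.mateMap_cpair (F := P.F) (G := Q.F) (X := X) (Y := Y) _ _ _ _ _ _ _ _ _ _ _ _)
  exact congrArg mor h

lemma mor_inj {X Y : P ⟶ Q} {f g : X ⟶ Y} (h : mor f = mor g) : f = g :=
  BiMod.hom_ext (F := P.F) (G := Q.F) h

end HopfIn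
end

/-! ### The identification of a bimodule with its bidual. -/

noncomputable section

open CategoryTheory MonoidalCategory
open scoped TensorProduct

namespace TensorDuality

variable {T : Type u} [Category.{v} T] [MonoidalCategory T] {dual : T → T} (D : TensorDuality dual)

/-- Naturality of X ≅ X** gives the pairing on X* ⊗ X the same mobility of transposes as the pairing
on X ⊗ X*. -/
lemma transpose_pair' {X Y : T} (f : X ⟶ Y) :
    D.transpose f ▷ X ≫ D.pair' X = dual Y ◁ f ≫ D.pair' Y := by
  rw [pair', pair', ← MonoidalCategory.whiskerLeft_comp_assoc, D.bidual_natural,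
    MonoidalCategory.whiskerLeft_comp_assoc, D.whisker_transpose_pair, whisker_exchange_assoc]

/-- Compatibility of X ≅ X** with tensor products carries multiplicativity of the pairing for the
duals over to `pair'`. -/
lemma multiplicative' (X Y : T) :
    (D.dualComp X Y).hom ▷ (X ⊗ Y) ≫ D.pair' (X ⊗ Y) =
      (α_ (dual Y) (dual X) (X ⊗ Y)).hom ≫ dual Y ◁ (α_ (dual X) X Y).inv ≫
        dual Y ◁ (D.pair' X ▷ Y) ≫ dual Y ◁ (λ_ Y).hom ≫ D.pair' Y := by
  have h : (D.dualComp X Y).hom ▷ (X ⊗ Y) ≫ D.pair' (X ⊗ Y) =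
      (dual Y ⊗ dual X) ◁ ((D.bidual (X ⊗ Y)).hom ≫ D.transpose (D.dualComp X Y).hom) ≫
        D.pair (dual Y ⊗ dual X) := by
    rw [pair', MonoidalCategory.whiskerLeft_comp, Category.assoc, D.whisker_transpose_pair,
      whisker_exchange_assoc]
  rw [h, D.bidual_comp]
  simp only [MonoidalCategory.whiskerLeft_comp, Category.assoc]
  rw [D.multiplicative]
  simp only [pair', comp_whiskerRight, MonoidalCategory.whiskerLeft_comp, Category.assoc]
  -- The identification Y ≅ Y** slides past the inner cap, which is closed first.
  have h2 : ∀ {Z : T} (q : dual X ⊗ dual (dual X) ⟶ 𝟙_ T) (r : Y ⟶ Z),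
      (dual Y ⊗ dual X) ◁ dual (dual X) ◁ r ≫ (α_ _ _ _).hom ≫ dual Y ◁ (α_ _ _ _).inv ≫
        dual Y ◁ q ▷ Z ≫ dual Y ◁ (λ_ Z).hom =
      (α_ _ _ _).hom ≫ dual Y ◁ (α_ _ _ _).inv ≫
        dual Y ◁ q ▷ Y ≫ dual Y ◁ (λ_ Y).hom ≫ dual Y ◁ r := by
    intro Z q r
    have e : (dual X ⊗ dual (dual X)) ◁ r ≫ q ▷ Z ≫ (λ_ Z).hom =
        q ▷ Y ≫ (λ_ Y).hom ≫ r := by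
      rw [whisker_exchange_assoc, id_whiskerLeft]; simp
    have e' := congrArg (dual Y ◁ ·) e
    simp only [MonoidalCategory.whiskerLeft_comp] at e'
    rw [← e']
    monoidal
  rw [reassoc_of% h2]
  monoidal

end TensorDuality

namespace HopfIn

open HopfRep

variable {T : Type u} [Category.{v} T] [Preadditive T] [Linear ℂ T] [MonoidalCategory T]
  [MonoidalPreadditive T] [MonoidalLinear ℂ T] {star : T → T} {D : TensorDuality star}
  (P : HopfIn D) {X : T}

/-- The right action on the dual object, transposed from a left action. -/
def mateL' (L : TrivL P.F X) : TrivR P.F (star X) :=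
  L.mate (D.pair X) (D.copair X) (D.hook X) (D.hook_dual X)

/-- The left action on the dual object, transposed from a right action. -/
def mateR' (L : TrivR P.F X) : TrivL P.F (star X) :=
  L.mate (D.pair X) (D.copair X) (D.hook X) (D.hook_dual X)

/-- The inverse trivialization is a contraction of the direct one for `V*` along the usual pairing,
which `κ` identifies with the pairing of T. Multiplicativity nests the two pairings, so the
transpose can be read off as the transposed action at `V*`. -/
lemma transpose_left_inv (L : TrivL P.F X) (V : HopfRep P.A) (ξ : Module.Dual ℂ V.carrier)
    (e : V ⊗ HopfRep.dual V ⟶ 𝟙_ (HopfRep P.A))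
    (κ : P.F.obj (HopfRep.dual V) ⟶ star (P.F.obj V))
    (he : ∀ v ξ, oneD (lin e (tmul v (toDual ξ))) = ξ v)
    (hκ : pairF P.F e = P.F.obj V ◁ κ ≫ D.pair (P.F.obj V)) :
    (P.mateL' L).hom (HopfRep.dual V) (toDual ξ) ≫ star X ◁ κ ≫ (D.dualComp (P.F.obj V) X).hom =
      D.transpose (L.inv V ξ) := by
  refine (D.transpose_eq _ _ ?_).symm
  rw [← L.whisker_hom_pairF e (toDual ξ) ξ (fun v => he v ξ)]
  change (P.F.obj V ⊗ X) ◁ (mateR (D.pair X) (D.copair X) (L.hom _ (toDual ξ)) ≫ _) ≫ _ = _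
  generalize L.hom (HopfRep.dual V) (toDual ξ) = k
  rw [MonoidalCategory.whiskerLeft_comp, MonoidalCategory.whiskerLeft_comp, Category.assoc,
    Category.assoc, D.multiplicative]
  have h1 : (P.F.obj V ⊗ X) ◁ mateR (D.pair X) (D.copair X) k ≫ (P.F.obj V ⊗ X) ◁ star X ◁ κ ≫
      (α_ (P.F.obj V) X (star X ⊗ star (P.F.obj V))).hom ≫
      P.F.obj V ◁ (α_ X (star X) (star (P.F.obj V))).inv ≫
      P.F.obj V ◁ D.pair X ▷ star (P.F.obj V) ≫ P.F.obj V ◁ (λ_ (star (P.F.obj V))).hom ≫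
      D.pair (P.F.obj V) = (α_ _ _ _).hom ≫ P.F.obj V ◁ bend (D.pair X)
        (mateR (D.pair X) (D.copair X) k ≫ star X ◁ κ) ≫ D.pair (P.F.obj V) := by
    simp only [bend, MonoidalCategory.whiskerLeft_comp]
    monoidal
  rw [h1, bend_whisker, bend_mateR_eq _ _ (D.hook X), MonoidalCategory.whiskerLeft_comp,
    Category.assoc, ← hκ, whisker_capL_mul]
  simp only [comp_whiskerRight, Category.assoc, Iso.hom_inv_id_assoc]
  have h2 : (P.F.obj V ◁ k) ▷ star X ≫ (α_ _ _ _).inv ▷ star X ≫ (pairF P.F e ▷ X) ▷ star X ≫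
      (α_ _ _ _).hom ≫ 𝟙_ T ◁ D.pair X ≫ (ρ_ _).hom = (P.F.obj V ◁ k) ▷ star X ≫
      (α_ _ _ _).inv ▷ star X ≫ (pairF P.F e ▷ X) ▷ star X ≫ (λ_ X).hom ▷ star X ≫ D.pair X := by
    have e : (α_ (𝟙_ T) X (star X)).hom ≫ 𝟙_ T ◁ D.pair X ≫ (ρ_ _).hom =
        (λ_ X).hom ▷ star X ≫ D.pair X := by
      rw [id_whiskerLeft]; monoidal
    rw [e]
  exact h2

/-- Mirror image of `transpose_left_inv`. The left action on the dual is defined by its inverse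
morphisms, so the contraction is performed on the dual side. -/
lemma transpose_right_inv (R : TrivR P.F X) (V : HopfRep P.A) (ξ : Module.Dual ℂ V.carrier)
    (e : V ⊗ HopfRep.dual V ⟶ 𝟙_ (HopfRep P.A))
    (κ : P.F.obj (HopfRep.dual V) ⟶ star (P.F.obj V))
    (he : ∀ v ξ, oneD (lin e (tmul v (toDual ξ))) = ξ v)
    (hκ : pairF P.F e = P.F.obj V ◁ κ ≫ D.pair (P.F.obj V)) :
    (P.mateR' R).hom (HopfRep.dual V) (toDual ξ) ≫ κ ▷ star X ≫ (D.dualComp X (P.F.obj V)).hom =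
      D.transpose (R.inv V ξ) := by
  refine (D.transpose_eq _ _ ?_).symm
  have h0 : X ◁ (P.mateR' R).inv V ξ ≫ D.pair X = (α_ _ _ _).inv ≫ R.inv V ξ ▷ star X ≫ D.pair X :=
    whisker_mateL (D.pair X) (D.copair X) (D.hook X) (R.inv V ξ)
  rw [← (P.mateR' R).whisker_hom_pairF e (toDual ξ) ξ (fun v => he v ξ), hκ] at h0
  rw [← cancel_epi (α_ _ _ _).inv, ← h0]
  rw [MonoidalCategory.whiskerLeft_comp, MonoidalCategory.whiskerLeft_comp, Category.assoc,
    Category.assoc, D.multiplicative]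
  simp only [MonoidalCategory.whiskerLeft_comp, comp_whiskerRight]
  monoidal

/-- The actions on X* are transposed along X ⊗ X* ⟶ 1, but those on X** are to be compared with
those on X along X* ⊗ X ⟶ 1. `transpose_left_inv` uses the usual pairing on V ⊗ V*, and the rest
uses the one on V* ⊗ V: the same `κ` has to serve both. -/
lemma left_inv_pair' (L : TrivL P.F X) (V : HopfRep P.A) (ξ : Module.Dual ℂ V.carrier) :
    star X ◁ L.inv V ξ ≫ D.pair' X =
      (α_ _ _ _).inv ≫ (P.mateL' L).inv V ξ ▷ X ≫ D.pair' X := by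
  obtain ⟨e, κ, he, hκ, hκ'⟩ := P.pairing V
  rw [← D.transpose_pair', ← P.transpose_left_inv L V ξ e κ he hκ,
    ← (P.mateL' L).whisker_hom_pairF (ev V) (toDual ξ) ξ (fun v => rfl), hκ']
  simp only [comp_whiskerRight, Category.assoc, D.multiplicative']
  simp only [MonoidalCategory.whiskerLeft_comp, comp_whiskerRight]
  monoidal

lemma right_inv_pair' (R : TrivR P.F X) (V : HopfRep P.A) (ξ : Module.Dual ℂ V.carrier) :
    star X ◁ R.inv V ξ ≫ D.pair' X =
      (α_ _ _ _).inv ≫ ((P.mateR' R).hom (HopfRep.dual V) (toDual ξ) ▷ X ≫ (α_ _ _ _).hom ≫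
        P.F.obj (HopfRep.dual V) ◁ D.pair' X ≫ (ρ_ _).hom) ▷ P.F.obj V ≫ pairF P.F (ev V) := by
  obtain ⟨e, κ, he, hκ, hκ'⟩ := P.pairing V
  rw [← D.transpose_pair', ← P.transpose_right_inv R V ξ e κ he hκ, hκ']
  simp only [comp_whiskerRight, Category.assoc, D.multiplicative']
  have h : ∀ {Y Z S W : T} (k : Y ⟶ Z) (q : star X ⊗ X ⟶ 𝟙_ T) (l : Z ⊗ S ⟶ W),
      k ▷ star X ▷ (X ⊗ S) ≫ (α_ _ _ _).hom ≫ Z ◁ (α_ _ _ _).inv ≫ Z ◁ q ▷ S ≫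
        Z ◁ (λ_ S).hom ≫ l = (α_ _ _ _).hom ≫ Y ◁ (α_ _ _ _).inv ≫ Y ◁ q ▷ S ≫
          Y ◁ (λ_ S).hom ≫ k ▷ S ≫ l := by
    intro Y Z S W k q l
    rw [whisker_exchange_assoc, whisker_exchange_assoc, whisker_exchange_assoc]
    monoidal
  rw [h]
  monoidal

/-- Against the pairing of X* the twice transposed action acts through the once transposed one, by
definition; `left_inv_pair'` shows that the original action on X does the same. -/
lemma bidual_left (L : TrivL P.F X) (V : HopfRep P.A) (ξ : Module.Dual ℂ V.carrier) :
    P.F.obj V ◁ (D.bidual X).hom ≫ (P.mateR' (P.mateL' L)).inv V ξ =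
      L.inv V ξ ≫ (D.bidual X).hom := by
  refine D.whisker_pair_inj (X := star X) ?_
  have h2 : star X ◁ (P.mateR' (P.mateL' L)).inv V ξ ≫ D.pair (star X) =
      (α_ _ _ _).inv ≫ (P.mateL' L).inv V ξ ▷ star (star X) ≫ D.pair (star X) :=
    whisker_mateL (D.pair (star X)) (D.copair (star X)) (D.hook (star X)) ((P.mateL' L).inv V ξ)
  rw [MonoidalCategory.whiskerLeft_comp, Category.assoc, h2, MonoidalCategory.whiskerLeft_comp,
    Category.assoc]
  refine Eq.trans ?_ (P.left_inv_pair' L V ξ).symm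
  rw [associator_inv_naturality_right_assoc, whisker_exchange_assoc]
  rfl

lemma bidual_right (R : TrivR P.F X) (V : HopfRep P.A) (ξ : Module.Dual ℂ V.carrier) :
    (D.bidual X).hom ▷ P.F.obj V ≫ (P.mateL' (P.mateR' R)).inv V ξ =
      R.inv V ξ ≫ (D.bidual X).hom := by
  refine D.whisker_pair_inj (X := star X) ?_
  have h3 : bend (D.pair (star X)) ((P.mateL' (P.mateR' R)).hom (HopfRep.dual V) (toDual ξ)) =
      capL (D.pair (star X)) ((P.mateR' R).hom (HopfRep.dual V) (toDual ξ)) :=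
    bend_mateR_eq (D.pair (star X)) (D.copair (star X)) (D.hook (star X)) _
  rw [MonoidalCategory.whiskerLeft_comp _ (R.inv V ξ), Category.assoc]
  refine Eq.trans ?_ (P.right_inv_pair' R V ξ).symm
  rw [← (P.mateL' (P.mateR' R)).whisker_hom_pairF (ev V) (toDual ξ) ξ (fun v => rfl)]
  -- The right action on X** is explicit only in its direct morphisms, so its inverse has been
  -- written as a contraction with the usual pairing; this carries such a contraction across the
  -- pairing of X* with X**.
  have h4 : ∀ {Z : T} (l : star (star X) ⟶ star (star X) ⊗ Z) (q : Z ⊗ P.F.obj V ⟶ 𝟙_ T),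
      star X ◁ ((D.bidual X).hom ▷ P.F.obj V ≫ l ▷ P.F.obj V ≫ (α_ _ _ _).hom ≫
        star (star X) ◁ q ≫ (ρ_ _).hom) ≫ D.pair (star X) =
      (α_ _ _ _).inv ≫ (star X ◁ (D.bidual X).hom) ▷ P.F.obj V ≫
        bend (D.pair (star X)) l ▷ P.F.obj V ≫ q := by
    intro Z l q
    have e : (star X ⊗ star (star X)) ◁ q ≫ D.pair (star X) ▷ 𝟙_ T ≫ (ρ_ _).hom =
        D.pair (star X) ▷ (Z ⊗ P.F.obj V) ≫ (λ_ _).hom ≫ q := by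
      rw [whisker_exchange_assoc, id_whiskerLeft]
      monoidal
    have e' : star X ◁ ((D.bidual X).hom ▷ P.F.obj V ≫ l ▷ P.F.obj V ≫ (α_ _ _ _).hom ≫
        star (star X) ◁ q ≫ (ρ_ _).hom) ≫ D.pair (star X) =
        star X ◁ ((D.bidual X).hom ▷ P.F.obj V ≫ l ▷ P.F.obj V ≫ (α_ _ _ _).hom) ≫
          (α_ _ _ _).inv ≫ (star X ⊗ star (star X)) ◁ q ≫ D.pair (star X) ▷ 𝟙_ T ≫
            (ρ_ _).hom := by
      simp only [MonoidalCategory.whiskerLeft_comp]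
      monoidal
    rw [e', e]
    simp only [bend, comp_whiskerRight, MonoidalCategory.whiskerLeft_comp]
    monoidal
  rw [h4, h3]
  simp only [capL, TensorDuality.pair', comp_whiskerRight, MonoidalCategory.whiskerLeft_comp,
    Category.assoc]
  have h5 : ∀ {Z : T} (l : star X ⟶ Z ⊗ star X), star X ◁ (D.bidual X).hom ≫ l ▷ star (star X) ≫
      (α_ _ _ _).hom = l ▷ X ≫ (α_ _ _ _).hom ≫ Z ◁ star X ◁ (D.bidual X).hom := by
    intro Z l
    rw [whisker_exchange_assoc]; simp
  have h6 := congrArg (· ▷ P.F.obj V) (h5 ((P.mateR' R).hom (HopfRep.dual V) (toDual ξ)))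
  simp only [comp_whiskerRight] at h6
  rw [reassoc_of% h6]

variable [IsIdempotentComplete T]

/-- The identification of a bimodule with its bidual. -/
def bid {P Q : HopfIn D} (Y : P ⟶ Q) : Y ≅ dual (dual Y) :=
  BiMod.mkIso (F := P.F) (G := Q.F) (X := Y) (Y := dual (dual Y))
    (BiMod.mk' (F := P.F) (G := Q.F) (X := Y) (Y := dual (dual Y)) (D.bidual (obj Y)).hom
      (fun V v => BiMod.left_of_inv (F := P.F) (G := Q.F) (X := Y) (Y := dual (dual Y)) _ V
        (fun ξ => P.bidual_left (BiMod.left (F := P.F) (G := Q.F) Y) V ξ) v)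
      (fun V v => BiMod.right_of_inv (F := P.F) (G := Q.F) (X := Y) (Y := dual (dual Y)) _ V
        (fun ξ => Q.bidual_right (BiMod.right (F := P.F) (G := Q.F) Y) V ξ) v))
    (D.bidual (obj Y)).inv (D.bidual (obj Y)).hom_inv_id (D.bidual (obj Y)).inv_hom_id

/-- Twofold use of `mor_transpose` reduces the claim to naturality in T. -/
lemma bid_natural {P Q : HopfIn D} {X Y : P ⟶ Q} (f : X ⟶ Y) :
    f ≫ (bid Y).hom = (bid X).hom ≫ (rigid D).transpose ((rigid D).transpose f) := by
  refine mor_inj ((D.bidual_natural (mor f)).trans ?_)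
  exact congrArg ((D.bidual (obj X)).hom ≫ ·)
    ((mor_transpose ((rigid D).transpose f)).trans
      (congrArg (D.transpose ·) (mor_transpose f))).symm

lemma bid_dual {P Q : HopfIn D} (X : P ⟶ Q) :
    (bid (dual X)).hom ≫ (rigid D).transpose (bid X).hom = 𝟙 (dual X) := by
  refine mor_inj (Eq.trans ?_ (D.bidual_dual (obj X)))
  exact congrArg ((D.bidual (star (obj X))).hom ≫ ·) (mor_transpose (bid X).hom)

end HopfIn
end

/-! ### The dual of the outer tensor product. -/

noncomputable section

open CategoryTheory MonoidalCategory
open scoped TensorProduct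

namespace TensorDuality

lemma transpose_smul {T : Type u} [Category.{v} T] [Preadditive T] [Linear ℂ T]
    [MonoidalCategory T] [MonoidalPreadditive T] [MonoidalLinear ℂ T] {star : T → T}
    (D : TensorDuality star) (s : ℂ) {X Y : T} (f : X ⟶ Y) :
    D.transpose (s • f) = s • D.transpose f := by
  refine D.transpose_eq _ _ ?_
  rw [MonoidalLinear.whiskerLeft_smul, MonoidalLinear.smul_whiskerRight, Linear.smul_comp,
    Linear.smul_comp, D.whisker_transpose_pair]

end TensorDuality

section DualOfOuter

open HopfRep HopfAlgebra

variable {T : Type u} [Category.{v} T] [Preadditive T] [Linear ℂ T] [MonoidalCategory T]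
  [MonoidalPreadditive T] [MonoidalLinear ℂ T] {star : T → T} (D : TensorDuality star)
  {A : Type} [Ring A] [HopfAlgebra ℂ A] {F : HopfRep A ⥤ T} [F.Monoidal]
  {B : Type} [Ring B] [HopfAlgebra ℂ B] {G : HopfRep B ⥤ T} [G.Monoidal]
  {C : Type} [Ring C] [HopfAlgebra ℂ C] {H : HopfRep C ⥤ T} [H.Monoidal]

namespace BiMod

/-- The dual bimodule, for a duality of `T`. -/
abbrev dualIn (X : BiMod F G) : BiMod G F :=
  X.mate (D.pair X.obj) (D.copair X.obj) (D.hook X.obj) (D.hook_dual X.obj)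

/-- The transposed morphism of bimodules, for a duality of `T`. -/
def transposeIn {X Y : BiMod F G} (f : X ⟶ Y) : Y.dualIn D ⟶ X.dualIn D :=
  mateMap _ _ _ _ _ _ _ _ f (D.transpose (mor f)) (D.whisker_transpose_pair (mor f))

/-- The pairing of x ⊗ y is nested by multiplicativity. The action of `R` then reaches the inner
pairing, that of y, and is transposed there. -/
lemma dualComp_left {x y : T} (R : TrivR G y) (V : HopfRep B) (ξ : Module.Dual ℂ V.carrier) :
    G.obj V ◁ (D.dualComp x y).hom ≫ mateL (D.pair (x ⊗ y)) (D.copair (x ⊗ y))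
      ((α_ _ _ _).hom ≫ x ◁ R.inv V ξ) =
      ((α_ _ _ _).inv ≫ mateL (D.pair y) (D.copair y) (R.inv V ξ) ▷ star x) ≫
        (D.dualComp x y).hom := by
  refine D.whisker_pair_inj ?_
  have h := whisker_mateL (D.pair (x ⊗ y)) (D.copair (x ⊗ y)) (D.hook (x ⊗ y))
    ((α_ _ _ _).hom ≫ x ◁ R.inv V ξ)
  have h' := whisker_mateL (D.pair y) (D.copair y) (D.hook y) (R.inv V ξ)
  rw [MonoidalCategory.whiskerLeft_comp, Category.assoc, h,
    associator_inv_naturality_right_assoc, whisker_exchange_assoc, D.multiplicative]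
  generalize R.inv V ξ = r at *
  simp only [MonoidalCategory.whiskerLeft_comp, Category.assoc]
  rw [D.multiplicative]
  have h1 : (x ⊗ y) ◁ mateL (D.pair y) (D.copair y) r ▷ star x ≫ (α_ _ _ _).hom ≫
      x ◁ (α_ _ _ _).inv ≫ x ◁ D.pair y ▷ star x ≫ x ◁ (λ_ (star x)).hom ≫ D.pair x =
      (α_ _ _ _).hom ≫ x ◁ (α_ _ _ _).inv ≫
        x ◁ (y ◁ mateL (D.pair y) (D.copair y) r ≫ D.pair y) ▷ star x ≫
          x ◁ (λ_ (star x)).hom ≫ D.pair x := by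
    simp only [comp_whiskerRight, MonoidalCategory.whiskerLeft_comp]
    monoidal
  rw [h1, h']
  simp only [comp_whiskerRight, MonoidalCategory.whiskerLeft_comp]
  monoidal

/-- The same nesting, with the action on the outer pair. -/
lemma dualComp_right {x y : T} (L : TrivL F x) (V : HopfRep A) (v : V.carrier) :
    (star y ◁ mateR (D.pair x) (D.copair x) (L.hom V v) ≫ (α_ _ _ _).inv) ≫
      (D.dualComp x y).hom ▷ F.obj V = (D.dualComp x y).hom ≫
        mateR (D.pair (x ⊗ y)) (D.copair (x ⊗ y)) (L.hom V v ▷ y ≫ (α_ _ _ _).hom) := by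
  refine bend_inj (D.pair (x ⊗ y)) (D.copair (x ⊗ y)) (D.hook_dual (x ⊗ y)) ?_
  rw [bend_comp (D.pair (x ⊗ y)) (D.dualComp x y).hom, bend_mateR_eq _ _ (D.hook (x ⊗ y))]
  have h := bend_mateR_eq (D.pair x) (D.copair x) (D.hook x) (L.hom V v)
  generalize L.hom V v = l at *
  have h1 : ∀ (m : star x ⟶ star x ⊗ F.obj V), bend (D.pair (x ⊗ y))
      ((star y ◁ m ≫ (α_ _ _ _).inv) ≫ (D.dualComp x y).hom ▷ F.obj V) =
      (x ⊗ y) ◁ star y ◁ m ≫ (x ⊗ y) ◁ (α_ _ _ _).inv ≫ (α_ _ _ _).inv ≫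
        ((x ⊗ y) ◁ (D.dualComp x y).hom ≫ D.pair (x ⊗ y)) ▷ F.obj V ≫ (λ_ _).hom := by
    intro m
    simp [bend]
  have h2 : (x ⊗ y) ◁ (D.dualComp x y).hom ≫ capL (D.pair (x ⊗ y)) (l ▷ y ≫ (α_ _ _ _).hom) =
      (l ▷ y ≫ (α_ _ _ _).hom) ▷ (star y ⊗ star x) ≫ (α_ _ _ _).hom ≫
        F.obj V ◁ ((x ⊗ y) ◁ (D.dualComp x y).hom ≫ D.pair (x ⊗ y)) ≫ (ρ_ _).hom := by
    simp only [capL, MonoidalCategory.whiskerLeft_comp, Category.assoc]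
    rw [whisker_exchange_assoc, associator_naturality_right_assoc]
  rw [h1, h2, D.multiplicative]
  -- The inner pairing of y is closed before the strand of `F(V)` leaves x*.
  have h3 : ∀ (m : star x ⟶ star x ⊗ F.obj V), (x ⊗ y) ◁ star y ◁ m ≫
      (x ⊗ y) ◁ (α_ _ _ _).inv ≫ (α_ _ _ _).inv ≫
      ((α_ x y (star y ⊗ star x)).hom ≫ x ◁ (α_ y (star y) (star x)).inv ≫
        x ◁ D.pair y ▷ star x ≫ x ◁ (λ_ (star x)).hom ≫ D.pair x) ▷ F.obj V ≫ (λ_ _).hom =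
      (α_ x y (star y ⊗ star x)).hom ≫ x ◁ (α_ y (star y) (star x)).inv ≫
        x ◁ D.pair y ▷ star x ≫ x ◁ (λ_ (star x)).hom ≫ bend (D.pair x) m := by
    intro m
    have e : (y ⊗ star y) ◁ m ≫ D.pair y ▷ (star x ⊗ F.obj V) ≫ (λ_ _).hom =
        D.pair y ▷ star x ≫ (λ_ (star x)).hom ≫ m := by
      rw [whisker_exchange_assoc, id_whiskerLeft]
      simp
    have e' := congrArg (x ◁ ·) e
    simp only [MonoidalCategory.whiskerLeft_comp] at e'
    simp only [bend]
    rw [← reassoc_of% e']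
    simp only [comp_whiskerRight]
    monoidal
  rw [h3, h]
  simp only [capL, comp_whiskerRight, MonoidalCategory.whiskerLeft_comp]
  -- The closed inner pairing slides past the trivialization of x.
  have h4 : ∀ {Z : T} (k : x ⟶ F.obj V ⊗ x) (q : y ⊗ star y ⟶ 𝟙_ T),
      (α_ x y (star y ⊗ star x)).hom ≫ x ◁ (α_ y (star y) (star x)).inv ≫
        x ◁ q ▷ star x ≫ x ◁ (λ_ (star x)).hom ≫ k ▷ star x =
      k ▷ y ▷ (star y ⊗ star x) ≫ (α_ _ _ _).hom ≫
        (F.obj V ⊗ x) ◁ (α_ _ _ _).inv ≫ (F.obj V ⊗ x) ◁ q ▷ star x ≫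
          (F.obj V ⊗ x) ◁ (λ_ _).hom := by
    intro Z k q
    rw [whisker_exchange, whisker_exchange_assoc, whisker_exchange_assoc]
    simp
  rw [reassoc_of% (h4 (Z := x) l (D.pair y))]
  monoidal

variable (X : BiMod F G) (Y : BiMod G H)

/-- The identification of the outer tensor product of the duals with the dual of the outer
tensor product. -/
def outerDual : outer (Y.dualIn D) (X.dualIn D) ≅ (outer X Y).dualIn D :=
  mkIso (X := outer (Y.dualIn D) (X.dualIn D)) (Y := (outer X Y).dualIn D)
    (mk' (X := outer (Y.dualIn D) (X.dualIn D)) (Y := (outer X Y).dualIn D)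
      (D.dualComp X.obj Y.obj).hom
      (fun V v => left_of_inv (X := outer (Y.dualIn D) (X.dualIn D)) (Y := (outer X Y).dualIn D)
        _ V (fun ξ => dualComp_left D Y.right V ξ) v)
      (fun V v => dualComp_right D X.left V v))
    (D.dualComp X.obj Y.obj).inv (D.dualComp X.obj Y.obj).hom_inv_id
    (D.dualComp X.obj Y.obj).inv_hom_id

/-- In `coefV` a strand leaves `X` and is absorbed by `Y`. Written as contractions along `e`, this
and the opposite process are the same diagram: `X` emits `V`, `Y` emits `W`, and `e` closes them. -/
lemma coefV_eq_hom_inv {V W : HopfRep B} (e : V ⊗ W ⟶ 𝟙_ (HopfRep B)) (v : V.carrier)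
    (w : W.carrier) (ξ : Module.Dual ℂ V.carrier) (ζ : Module.Dual ℂ W.carrier)
    (h : ∀ v, oneD (lin e (tmul v w)) = ξ v) (h' : ∀ w, oneD (lin e (tmul v w)) = ζ w) :
    X.obj ◁ Y.left.hom W w ≫ (α_ _ _ _).inv ≫ X.right.inv W ζ ▷ Y.obj = coefV X Y v ξ := by
  rw [coefV, ← Y.left.whisker_hom_pairF e w ξ h, ← X.right.whisker_hom_pairF e v ζ h']
  simp only [comp_whiskerRight, MonoidalCategory.whiskerLeft_comp]
  rw [← associator_naturality_right_assoc, ← whisker_exchange_assoc]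
  monoidal

/-- Transposition reverses the order of the two factors. In the form given by `coefV_eq_hom_inv`,
emission by Y becomes emission by Y*, and absorption by X becomes absorption by X*, which is a
coefficient action on Y* ⊗ X*. -/
lemma dualComp_transpose_coefV {V W : HopfRep B} (e : V ⊗ W ⟶ 𝟙_ (HopfRep B)) (v : V.carrier)
    (w : W.carrier) (ξ : Module.Dual ℂ V.carrier) (ζ : Module.Dual ℂ W.carrier)
    (h : ∀ v, oneD (lin e (tmul v w)) = ξ v) (h' : ∀ w, oneD (lin e (tmul v w)) = ζ w) :
    (D.dualComp X.obj Y.obj).hom ≫ D.transpose (coefV X Y v ξ) =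
      coefV (Y.dualIn D) (X.dualIn D) w ζ ≫ (D.dualComp X.obj Y.obj).hom := by
  refine D.whisker_pair_inj ?_
  rw [MonoidalCategory.whiskerLeft_comp, Category.assoc, D.whisker_transpose_pair,
    whisker_exchange_assoc, D.multiplicative, ← coefV_eq_hom_inv X Y e v w ξ ζ h h']
  have hy := bend_mateR_eq (D.pair Y.obj) (D.copair Y.obj) (D.hook Y.obj) (Y.left.hom W w)
  have hx := whisker_mateL (D.pair X.obj) (D.copair X.obj) (D.hook X.obj) (X.right.inv W ζ)
  change _ = (X.obj ⊗ Y.obj) ◁ ((mateR (D.pair Y.obj) (D.copair Y.obj) (Y.left.hom W w) ▷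
    star X.obj ≫ (α_ _ _ _).hom ≫ star Y.obj ◁
      mateL (D.pair X.obj) (D.copair X.obj) (X.right.inv W ζ)) ≫ _) ≫ _
  -- From here on the actions enter only through the two transposition identities `hx` and `hy`.
  generalize X.right.inv W ζ = r at *
  generalize Y.left.hom W w = l at *
  generalize mateR (D.pair Y.obj) (D.copair Y.obj) l = l' at *
  generalize mateL (D.pair X.obj) (D.copair X.obj) r = r' at *
  rw [MonoidalCategory.whiskerLeft_comp, Category.assoc, D.multiplicative]
  generalize X.obj = x at *
  generalize Y.obj = y at *
  have h1 : (x ⊗ y) ◁ (l' ▷ star x ≫ (α_ _ _ _).hom ≫ star y ◁ r') ≫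
      (α_ x y (star y ⊗ star x)).hom ≫ x ◁ (α_ y (star y) (star x)).inv ≫
        x ◁ D.pair y ▷ star x ≫ x ◁ (λ_ (star x)).hom ≫ D.pair x =
      (α_ _ _ _).hom ≫ x ◁ (α_ _ _ _).inv ≫ x ◁ bend (D.pair y) l' ▷ star x ≫
        x ◁ r' ≫ D.pair x := by
    have e : (y ⊗ star y) ◁ r' ≫ D.pair y ▷ star x ≫ (λ_ _).hom =
        D.pair y ▷ _ ≫ (λ_ _).hom ≫ r' := by
      rw [whisker_exchange_assoc, id_whiskerLeft]
      simp
    have e' := congrArg (x ◁ ·) e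
    simp only [MonoidalCategory.whiskerLeft_comp] at e'
    have e2 : (x ⊗ y) ◁ (l' ▷ star x ≫ (α_ _ _ _).hom ≫ star y ◁ r') ≫
      (α_ x y (star y ⊗ star x)).hom ≫ x ◁ (α_ y (star y) (star x)).inv ≫
        x ◁ D.pair y ▷ star x ≫ x ◁ (λ_ (star x)).hom ≫ D.pair x =
        (x ⊗ y) ◁ (l' ▷ star x ≫ (α_ _ _ _).hom) ≫ (α_ _ _ _).hom ≫ x ◁ (α_ _ _ _).inv ≫
          x ◁ (y ⊗ star y) ◁ r' ≫ x ◁ D.pair y ▷ star x ≫ x ◁ (λ_ (star x)).hom ≫ D.pair x := by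
      simp only [MonoidalCategory.whiskerLeft_comp]
      monoidal
    rw [e2, reassoc_of% e']
    simp only [bend, comp_whiskerRight, MonoidalCategory.whiskerLeft_comp]
    monoidal
  rw [h1, hy, hx]
  simp only [capL, comp_whiskerRight, MonoidalCategory.whiskerLeft_comp]
  have h4 : ∀ {S : T} (k : x ⊗ S ⟶ x) (q : y ⊗ star y ⟶ 𝟙_ T),
      k ▷ y ▷ (star y ⊗ star x) ≫ (α_ x y (star y ⊗ star x)).hom ≫
        x ◁ (α_ y (star y) (star x)).inv ≫ x ◁ q ▷ star x ≫ x ◁ (λ_ (star x)).hom =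
      (α_ _ _ _).hom ≫ (x ⊗ S) ◁ (α_ y (star y) (star x)).inv ≫ (x ⊗ S) ◁ q ▷ star x ≫
        (x ⊗ S) ◁ (λ_ (star x)).hom ≫ k ▷ star x := by
    intro S k q
    rw [whisker_exchange, whisker_exchange_assoc, whisker_exchange_assoc]
    simp
  simp only [Category.assoc]
  rw [reassoc_of% h4]
  monoidal

section

variable [Module.Finite ℂ B] [IsInvolutive B]

/-- The contragredient of the function algebra has the antipode in its coefficients. -/
lemma coefV_dual_toFn (f : Module.Dual ℂ B) :
    coefV X Y (V := HopfRep.dual (fn B)) (toDual (evalAt 1)) (HopfRep.bid (toFn f)) =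
      coefV X Y (toFn (f ∘ₗ antipode ℂ)) (evalAt 1) := by
  rw [coefV_eq]
  congr 1
  refine evalAt_ext fun b => ?_
  rw [coeffMap_apply, evalAt_toFn]
  change evalAt 1 ((fn B).ρ (antipode ℂ b) (toFn f)) = f (antipode ℂ b)
  rw [evalAt_ρ, one_mul, evalAt_toFn]

/-- Transposition replaces the averaging character by its composite with the antipode, which is the
same character. Hence the identification of the outer products carries one projection to the
transpose of the other, and passes to their images. -/
lemma outerDual_transpose_idem :
    (outerDual D X Y).hom ≫ transposeIn D (idem X Y) =
      idem (Y.dualIn D) (X.dualIn D) ≫ (outerDual D X Y).hom := by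
  have h := dualComp_transpose_coefV D X Y (ev' IsInvolutive.sq (fn B)) (toFn (regChar B))
    (toDual (evalAt 1)) (evalAt 1) (HopfRep.bid (toFn (regChar B))) (fun _ => rfl) (fun _ => rfl)
  rw [coefV_dual_toFn, regChar_comp_antipode IsInvolutive.sq] at h
  have h2 := congrArg ((Module.finrank ℂ B : ℂ)⁻¹ • ·) h
  refine hom_ext (Eq.trans ?_ (h2.trans ?_))
  · change (D.dualComp X.obj Y.obj).hom ≫ D.transpose
      ((Module.finrank ℂ B : ℂ)⁻¹ • coefV X Y (toFn (regChar B)) (evalAt 1)) = _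
    rw [← Linear.comp_smul, D.transpose_smul]
  · exact (Linear.smul_comp _ _ _ _ _ _).symm

end

end BiMod

end DualOfOuter
end

/-! ### The dual of the relative tensor product, and multiplicativity of the pairings. -/

noncomputable section

open CategoryTheory MonoidalCategory
open scoped TensorProduct

section DualOfRelative

open HopfRep HopfAlgebra

variable {T : Type u} [Category.{v} T] [Preadditive T] [Linear ℂ T] [MonoidalCategory T]
  [MonoidalPreadditive T] [MonoidalLinear ℂ T] {star : T → T} (D : TensorDuality star)
  {A : Type} [Ring A] [HopfAlgebra ℂ A] {F : HopfRep A ⥤ T} [F.Monoidal]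
  {B : Type} [Ring B] [HopfAlgebra ℂ B] {G : HopfRep B ⥤ T} [G.Monoidal]
  {C : Type} [Ring C] [HopfAlgebra ℂ C] {H : HopfRep C ⥤ T} [H.Monoidal]
  [Module.Finite ℂ B] [IsInvolutive B]

namespace BiMod

variable (X : BiMod F G) (Y : BiMod G H)

lemma transposeIn_comp {X Y Z : BiMod F G} (f : X ⟶ Y) (g : Y ⟶ Z) :
    transposeIn D (f ≫ g) = transposeIn D g ≫ transposeIn D f :=
  hom_ext (D.transpose_comp (mor f) (mor g))

lemma transposeIn_id (X : BiMod F G) : transposeIn D (𝟙 X) = 𝟙 (X.dualIn D) :=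
  hom_ext (D.transpose_id X.obj)

/-- Multiplicativity in T in the presence of a strand emitted by x: the inner pairing of y closes
first and slides past `k`. -/
lemma capL_nested {x y P : T} (k : x ⟶ P ⊗ x) :
    (x ⊗ y) ◁ (D.dualComp x y).hom ≫ capL (D.pair (x ⊗ y)) (k ▷ y ≫ (α_ _ _ _).hom) =
      (α_ x y (star y ⊗ star x)).hom ≫ x ◁ (α_ y (star y) (star x)).inv ≫
        x ◁ D.pair y ▷ star x ≫ x ◁ (λ_ (star x)).hom ≫ capL (D.pair x) k := by
  have h2 : (x ⊗ y) ◁ (D.dualComp x y).hom ≫ capL (D.pair (x ⊗ y)) (k ▷ y ≫ (α_ _ _ _).hom) =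
      (k ▷ y ≫ (α_ _ _ _).hom) ▷ (star y ⊗ star x) ≫ (α_ _ _ _).hom ≫
        P ◁ ((x ⊗ y) ◁ (D.dualComp x y).hom ≫ D.pair (x ⊗ y)) ≫ (ρ_ _).hom := by
    simp only [capL, MonoidalCategory.whiskerLeft_comp, Category.assoc]
    rw [whisker_exchange_assoc, associator_naturality_right_assoc]
  have h4 : (α_ x y (star y ⊗ star x)).hom ≫ x ◁ (α_ y (star y) (star x)).inv ≫
        x ◁ D.pair y ▷ star x ≫ x ◁ (λ_ (star x)).hom ≫ k ▷ star x =
      k ▷ y ▷ (star y ⊗ star x) ≫ (α_ _ _ _).hom ≫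
        (P ⊗ x) ◁ (α_ _ _ _).inv ≫ (P ⊗ x) ◁ D.pair y ▷ star x ≫
          (P ⊗ x) ◁ (λ_ _).hom := by
    rw [whisker_exchange, whisker_exchange_assoc, whisker_exchange_assoc]
    simp
  rw [h2, D.multiplicative]
  simp only [capL, comp_whiskerRight, MonoidalCategory.whiskerLeft_comp]
  rw [reassoc_of% h4]
  monoidal

/-- Contraction of the middle actions of `X ⊗ Y` by the function algebra is a multiple of the
projection to the relative tensor product. -/
lemma hom_twistChar_inv (γ : Bˣ) :
    X.obj ◁ Y.left.hom (fn B) (toFn (twistChar γ)) ≫ (α_ _ _ _).inv ≫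
      X.right.inv (fn B) (evalAt (γ : B)) ▷ Y.obj =
    (Module.finrank ℂ B : ℂ) • mor (idem X Y) := by
  rw [coefV_eq_hom_inv X Y (V := HopfRep.dual (fn B)) (ev (fn B)) (toDual (evalAt (γ : B)))
    (toFn (twistChar γ)) (HopfRep.bid (toFn (twistChar γ))) (evalAt (γ : B))
    (fun ξ => rfl) (fun w => rfl), coefV_eq, idem, mor_smul, smul_smul,
    mul_inv_cancel₀ (finrank_ne_zero' B), one_smul, mor_coef]
  congr 1
  -- The inverse gauge of the twisted character cancels the evaluation point: the coefficient is b ↦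
  -- χ(γ⁻¹γS(b)), and χ is invariant under the antipode S.
  refine evalAt_ext fun b => ?_
  rw [coeffMap_apply, evalAt_toFn, ← regChar_comp_antipode IsInvolutive.sq]
  change evalAt (γ : B) ((fn B).ρ (antipode ℂ b) (toFn (twistChar γ))) = regChar B (antipode ℂ b)
  rw [evalAt_ρ, evalAt_toFn]
  change regChar B (((γ⁻¹ : Bˣ) : B) * (γ * antipode ℂ b)) = _
  rw [Units.inv_mul_cancel_left]

variable [Module.Finite ℂ C] [IsInvolutive C] [IsIdempotentComplete T]

/-- The identification of the relative tensor product of the duals with the dual of the relative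
tensor product. -/
def compDual : comp (Y.dualIn D) (X.dualIn D) ≅ (comp X Y).dualIn D where
  hom := ι _ _ ≫ (outerDual D X Y).hom ≫ transposeIn D (ι X Y)
  inv := transposeIn D (π X Y) ≫ (outerDual D X Y).inv ≫ π _ _
  hom_inv_id := by
    -- The transposed projection and inclusion compose to the transposed `idem`, which corresponds
    -- to the projection for the duals.
    have h : transposeIn D (ι X Y) ≫ transposeIn D (π X Y) = transposeIn D (idem X Y) := by
      rw [← transposeIn_comp, π_ι]
    simp only [Category.assoc]
    rw [reassoc_of% h, reassoc_of% outerDual_transpose_idem, Iso.hom_inv_id_assoc, idem_π, ι_π]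
  inv_hom_id := by
    have h : transposeIn D (π X Y) ≫ transposeIn D (idem X Y) ≫ transposeIn D (ι X Y) =
        𝟙 _ := by
      rw [← transposeIn_comp, ι_idem, ← transposeIn_comp, ι_π, transposeIn_id]
    simp only [Category.assoc]
    rw [reassoc_of% π_ι, ← reassoc_of% outerDual_transpose_idem, Iso.inv_hom_id_assoc, h]

lemma π_compDual : π _ _ ≫ (compDual D X Y).hom = (outerDual D X Y).hom ≫
    transposeIn D (ι X Y) := by
  have h : transposeIn D (idem X Y) ≫ transposeIn D (ι X Y) = transposeIn D (ι X Y) := by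
    rw [← transposeIn_comp, ι_idem]
  rw [compDual, reassoc_of% π_ι, ← reassoc_of% outerDual_transpose_idem, h]

variable [F.Additive] [F.Linear ℂ] [Module.Finite ℂ A] [IsInvolutive A]
  [G.Additive] [G.Linear ℂ] [H.Additive] [H.Linear ℂ]

/-- The outer pairing of a bimodule with its dual, for a duality of `T`. -/
abbrev outerPairIn (X : BiMod F G) (γ : Aˣ) : outer X (X.dualIn D) ⟶ unitM F γ :=
  X.outerPair (D.pair X.obj) (D.copair X.obj) (D.hook X.obj) (D.hook_dual X.obj) γ

/-- The pairing of a bimodule with its dual, for a duality of `T`. -/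
abbrev cpairIn (X : BiMod F G) (γ : Aˣ) : comp X (X.dualIn D) ⟶ unitM F γ :=
  X.cpair (D.pair X.obj) (D.copair X.obj) (D.hook X.obj) (D.hook_dual X.obj) γ

/-- The pairing of T carries `f` across, and left linearity of `f` moves it past the twisted
character. -/
lemma transposeIn_outerPair {X Y : BiMod F G} (γ : Aˣ) (f : X ⟶ Y) :
    outL X (transposeIn D f) ≫ X.outerPairIn D γ = outR f (Y.dualIn D) ≫ Y.outerPairIn D γ := by
  refine hom_ext ?_
  change X.obj ◁ D.transpose (mor f) ≫ capL (D.pair X.obj) (X.left.hom (fn A) (toFn (twistChar γ)))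
    = mor f ▷ star Y.obj ≫ capL (D.pair Y.obj) (Y.left.hom (fn A) (toFn (twistChar γ)))
  have h3 : X.obj ◁ D.transpose (mor f) ≫ capL (D.pair X.obj)
      (X.left.hom (fn A) (toFn (twistChar γ))) =
      X.left.hom (fn A) (toFn (twistChar γ)) ▷ star Y.obj ≫ (α_ _ _ _).hom ≫
        F.obj (fn A) ◁ (X.obj ◁ D.transpose (mor f) ≫ D.pair X.obj) ≫ (ρ_ _).hom := by
    simp only [capL, MonoidalCategory.whiskerLeft_comp, Category.assoc]
    rw [whisker_exchange_assoc, associator_naturality_right_assoc]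
  rw [h3, D.whisker_transpose_pair]
  simp only [capL, MonoidalCategory.whiskerLeft_comp, Category.assoc]
  rw [← associator_naturality_middle_assoc,
    ← comp_whiskerRight_assoc (X.left.hom (fn A) (toFn (twistChar γ))), mor_left,
    ← comp_whiskerRight_assoc]

/-- The pairing of `Y` emits a function on `B`, inserted as the twisted character; the unit
constraint makes it act on X* through evaluation at the gauge. Transposed to `X`, this is the
contraction of `hom_twistChar_inv` and gives |B| times the projection. The remaining factor
|B|^(-1/2) is that of the unit constraint. -/
lemma outerPair_nested (γ : Aˣ) (γ' : Bˣ) :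
    (outA X Y (outer (Y.dualIn D) (X.dualIn D))).hom ≫
      outL X (outA Y (Y.dualIn D) (X.dualIn D)).inv ≫
      outL X (outR (Y.outerPairIn D γ') (X.dualIn D)) ≫ outL X (lmap γ' (X.dualIn D)) ≫
        X.outerPairIn D γ =
    (dimPow B (-1 / 2) * Module.finrank ℂ B) • (outR (idem X Y) _ ≫
      outL (outer X Y) (outerDual D X Y).hom ≫ (outer X Y).outerPairIn D γ) := by
  refine hom_ext ?_
  simp only [mor_smul, mor_comp, mor_outL, lmap_mor]
  -- The diagram depends on the actions only through `hkr`, which says that the two actions on x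
  -- commute, and `hm`, the value of the middle contraction.
  have key : ∀ {x y : T} (r : x ⊗ G.obj (fn B) ⟶ x) (k : x ⟶ F.obj (fn A) ⊗ x)
      (k' : y ⟶ G.obj (fn B) ⊗ y) (hkr : r ≫ k = k ▷ _ ≫ (α_ _ _ _).hom ≫ F.obj (fn A) ◁ r)
      (s : ℂ) (m : x ⊗ y ⟶ x ⊗ y) (hm : x ◁ k' ≫ (α_ _ _ _).inv ≫ r ▷ y = s • m),
      (α_ x y (star y ⊗ star x)).hom ≫ x ◁ (α_ y (star y) (star x)).inv ≫
        x ◁ capL (D.pair y) k' ▷ star x ≫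
          x ◁ (dimPow B (-1 / 2) • mateL (D.pair x) (D.copair x) r) ≫
          capL (D.pair x) k =
      (dimPow B (-1 / 2) * s) • (m ▷ (star y ⊗ star x) ≫
        (x ⊗ y) ◁ (D.dualComp x y).hom ≫ capL (D.pair (x ⊗ y)) (k ▷ y ≫ (α_ _ _ _).hom)) := by
    intro x y r k k' hkr s m hm
    rw [mul_smul, ← Linear.smul_comp, ← MonoidalLinear.smul_whiskerRight, ← hm]
    have h1 := whisker_mateL_capL (D.pair x) (D.copair x) (D.hook x) k r
    rw [← hkr] at h1
    rw [MonoidalLinear.whiskerLeft_smul, Linear.smul_comp, h1, capL_nested]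
    simp only [Linear.comp_smul]
    congr 1
    have h4 : (r ▷ y) ▷ (star y ⊗ star x) ≫ (α_ x y (star y ⊗ star x)).hom ≫
        x ◁ (α_ y (star y) (star x)).inv ≫ x ◁ D.pair y ▷ star x ≫ x ◁ (λ_ (star x)).hom =
        (α_ _ _ _).hom ≫ (x ⊗ G.obj (fn B)) ◁ (α_ y (star y) (star x)).inv ≫
          (x ⊗ G.obj (fn B)) ◁ D.pair y ▷ star x ≫ (x ⊗ G.obj (fn B)) ◁ (λ_ (star x)).hom ≫
            r ▷ star x := by
      rw [whisker_exchange, whisker_exchange_assoc, whisker_exchange_assoc]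
      simp
    simp only [comp_whiskerRight, Category.assoc]
    rw [reassoc_of% h4]
    simp only [capL, comp_whiskerRight, MonoidalCategory.whiskerLeft_comp]
    monoidal
  exact key (X.right.inv (fn B) (evalAt (γ' : B))) (X.left.hom (fn A) (toFn (twistChar γ)))
    (Y.left.hom (fn B) (toFn (twistChar γ'))) (right_inv_left_hom X _ _ _ _) _ _
    (hom_twistChar_inv X Y γ')

/-- The three projections onto relative products have sections, so identities between pairings may
be checked on the outer product of four bimodules. -/
lemma π₄_epi {E : Type} [Ring E] [HopfAlgebra ℂ E] {K : HopfRep E ⥤ T} [K.Monoidal]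
    {E' : Type} [Ring E'] [HopfAlgebra ℂ E'] {K' : HopfRep E' ⥤ T} [K'.Monoidal]
    [Module.Finite ℂ E] [IsInvolutive E]
    {Z : BiMod H K} {W : BiMod K K'} {U : BiMod F K'}
    {f g : comp (comp X Y) (comp Z W) ⟶ U}
    (h : outL (outer X Y) (π Z W) ≫ outR (π X Y) (comp Z W) ≫ π _ _ ≫ f =
      outL (outer X Y) (π Z W) ≫ outR (π X Y) (comp Z W) ≫ π _ _ ≫ g) : f = g := by
  refine π_epi ?_
  have h1 : outR (ι X Y) (comp Z W) ≫ outR (π X Y) (comp Z W) = 𝟙 _ := by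
    rw [← outR_comp, ι_π, outR_id]
  have h2 : outL (comp X Y) (ι Z W) ≫ outL (comp X Y) (π Z W) = 𝟙 _ := by
    rw [← outL_comp, ι_π, outL_id]
  have h3 := congrArg (fun t => outL (comp X Y) (ι Z W) ≫ outR (ι X Y) _ ≫ t) h
  simp only [← reassoc_of% out_exchange, reassoc_of% h1, reassoc_of% h2] at h3
  exact h3

/-- The exponents of |B| add up to -1/4 - 1/4 - 1/2 + 1 = 0: two pairings, one unit constraint and
one contraction over `B`. -/
lemma pairScale_multiplicative (A B C : Type) [Ring A] [HopfAlgebra ℂ A] [Module.Finite ℂ A]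
    [Ring B] [HopfAlgebra ℂ B] [Module.Finite ℂ B] [Ring C] [HopfAlgebra ℂ C] [Module.Finite ℂ C] :
    pairScale A B * (pairScale B C * (dimPow B (-1 / 2) * Module.finrank ℂ B)) =
      pairScale A C := by
  have hB := finrank_ne_zero' B
  have h : dimPow B (-1 / 4) * dimPow B (-1 / 4) * dimPow B (-1 / 2) =
      (Module.finrank ℂ B : ℂ)⁻¹ := by
    rw [dimPow_add, dimPow_add, ← dimPow_neg_one]; norm_num
  calc _ = dimPow A (-1 / 4) * dimPow C (-1 / 4) * ((dimPow B (-1 / 4) * dimPow B (-1 / 4) *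
        dimPow B (-1 / 2)) * Module.finrank ℂ B) := by
        rw [pairScale, pairScale]; ring
    _ = _ := by rw [h, inv_mul_cancel₀ hB, mul_one, pairScale]

lemma cpair_multiplicative (γ : Aˣ) (γ' : Bˣ) :
    compL (comp X Y) (compDual D X Y).hom ≫ (comp X Y).cpairIn D γ =
      (compA X Y (comp (Y.dualIn D) (X.dualIn D))).hom ≫
        compL X (compA Y (Y.dualIn D) (X.dualIn D)).inv ≫
        compL X (compR (Y.cpairIn D γ') (X.dualIn D)) ≫ compL X (compLu γ' (X.dualIn D)).hom ≫
          X.cpairIn D γ := by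
  refine π₄_epi X Y ?_
  -- The projection onto the relative product of X and Y crosses the pairing as a transpose, merges
  -- there with the transposed inclusion into the transposed `idem`, and crosses back.
  have hl : outL (outer X Y) (π (Y.dualIn D) (X.dualIn D)) ≫ outR (π X Y) _ ≫ π _ _ ≫
      compL (comp X Y) (compDual D X Y).hom ≫ (comp X Y).cpairIn D γ = pairScale A C •
        (outR (idem X Y) _ ≫ outL (outer X Y) (outerDual D X Y).hom ≫
          (outer X Y).outerPairIn D γ) := by
    have h1 : outL (outer X Y) (π (Y.dualIn D) (X.dualIn D)) ≫
        outL (outer X Y) (compDual D X Y).hom = outL (outer X Y) (outerDual D X Y).hom ≫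
          outL (outer X Y) (transposeIn D (ι X Y)) := by
      rw [← outL_comp, π_compDual, outL_comp]
    have h2 : outL (outer X Y) (transposeIn D (ι X Y)) ≫ outL (outer X Y) (transposeIn D (π X Y)) =
        outL (outer X Y) (transposeIn D (idem X Y)) := by
      rw [← outL_comp, ← transposeIn_comp, π_ι]
    rw [reassoc_of% π_compL, π_cpair, ← reassoc_of% out_exchange, reassoc_of% h1,
      Linear.comp_smul, ← transposeIn_outerPair, Linear.comp_smul, Linear.comp_smul,
      reassoc_of% h2, transposeIn_outerPair, reassoc_of% out_exchange]
  -- On the other side the projections between the inner factors disappear, leaving the diagram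
  -- evaluated by `outerPair_nested`.
  have h1 : outL X (outL Y (π (Y.dualIn D) (X.dualIn D))) ≫ outL X (π Y _) ≫
      outL X (compA Y (Y.dualIn D) (X.dualIn D)).inv ≫
      outL X (compR (Y.cpairIn D γ') (X.dualIn D)) ≫ outL X (compLu γ' (X.dualIn D)).hom =
      pairScale B C • (
      outL X (outA Y (Y.dualIn D) (X.dualIn D)).inv ≫
        outL X (outR (Y.outerPairIn D γ') (X.dualIn D)) ≫ outL X (lmap γ' (X.dualIn D))) := by
    simp only [← outL_comp]
    rw [reassoc_of% compA_inv, reassoc_of% π_compR, π_compLu,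
      reassoc_of% (outR_comp (π Y (Y.dualIn D)) (Y.cpairIn D γ') (X.dualIn D)).symm, π_cpair,
      outR_smul, Linear.smul_comp, Linear.comp_smul, outL_smul]
  rw [hl, reassoc_of% compA_hom, reassoc_of% outA_right, reassoc_of% π_compL, reassoc_of% π_compL,
    reassoc_of% π_compL, π_cpair, reassoc_of% h1]
  simp only [Linear.comp_smul, Linear.smul_comp, smul_smul, Category.assoc]
  rw [outerPair_nested, smul_smul, mul_assoc, pairScale_multiplicative]

end BiMod

end DualOfRelative
end

/-! ### Assembling the Frobenius duality. -/

noncomputable section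

open CategoryTheory MonoidalCategory
open scoped TensorProduct

namespace BiMod

open HopfRep HopfAlgebra

variable {T : Type u} [Category.{v} T] [Preadditive T] [Linear ℂ T] [MonoidalCategory T]
  [MonoidalPreadditive T] [MonoidalLinear ℂ T]
  {A : Type} [Ring A] [HopfAlgebra ℂ A] {F : HopfRep A ⥤ T} [F.Monoidal]
  {B : Type} [Ring B] [HopfAlgebra ℂ B] {G : HopfRep B ⥤ T} [G.Monoidal]
  {C : Type} [Ring C] [HopfAlgebra ℂ C] {H : HopfRep C ⥤ T} [H.Monoidal]
  [Module.Finite ℂ B] [IsInvolutive B] [IsIdempotentComplete T]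

/-- The inclusions are natural because the projection `idem` commutes with morphisms of either
factor. -/
lemma compR_compL_ι {X X' : BiMod F G} (f : X ⟶ X') {Y Y' : BiMod G H} (g : Y ⟶ Y') :
    compR f Y ≫ compL X' g ≫ ι X' Y' = ι X Y ≫ outR f Y ≫ outL X' g := by
  refine π_epi ?_
  rw [reassoc_of% π_compR, reassoc_of% π_compL, π_ι, reassoc_of% π_ι, idem_outL,
    ← reassoc_of% idem_outR]

end BiMod

/-- Compatibility of X ≅ X** with tensor products in T, extended by naturality along `i` and `j`;
these will be the inclusions of the relative products of the bimodules and of their duals. -/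
lemma TensorDuality.bidual_transpose_dualComp {T : Type u} [Category.{v} T] [MonoidalCategory T]
    {star : T → T} (D : TensorDuality star) {x y z w : T} (i : z ⟶ x ⊗ y)
    (j : w ⟶ star y ⊗ star x) :
    (D.bidual z).hom ≫ D.transpose (j ≫ (D.dualComp x y).hom ≫ D.transpose i) =
      i ≫ ((D.bidual x).hom ▷ y ≫ star (star x) ◁ (D.bidual y).hom) ≫
        (D.dualComp (star y) (star x)).hom ≫ D.transpose j := by
  rw [D.transpose_comp, D.transpose_comp, Category.assoc, ← reassoc_of% D.bidual_natural,
    reassoc_of% D.bidual_comp, Category.assoc]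

namespace HopfIn

open HopfRep

variable {T : Type u} [Category.{v} T] [Preadditive T] [Linear ℂ T] [MonoidalCategory T]
  [MonoidalPreadditive T] [MonoidalLinear ℂ T] {star : T → T} {D : TensorDuality star}
  [IsIdempotentComplete T]

/-- The identification of the tensor product of the duals with the dual of the tensor product. -/
def dcomp {P Q R : HopfIn D} (X : P ⟶ Q) (Y : Q ⟶ R) : dual Y ≫ dual X ≅ dual (X ≫ Y) :=
  BiMod.compDual (F := P.F) (G := Q.F) (H := R.F) D X Y

/-- The identification for a relative product is that of T between the inclusion and a transposed
inclusion. Hence `bidual_transpose_dualComp` applies, and `compR_compL_ι` rewrites the outcome in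
terms of relative products. -/
lemma bid_comp {P Q R : HopfIn D} (X : P ⟶ Q) (Y : Q ⟶ R) :
    (bid (X ≫ Y)).hom ≫ (rigid D).transpose (dcomp X Y).hom =
      Bicategory.whiskerRight (bid X).hom Y ≫
        Bicategory.whiskerLeft (dual (dual X)) (bid Y).hom ≫ (dcomp (dual Y) (dual X)).hom := by
  refine mor_inj ?_
  have h1 : mor ((bid (X ≫ Y)).hom ≫ (rigid D).transpose (dcomp X Y).hom) =
      (D.bidual (obj (X ≫ Y))).hom ≫ D.transpose (incl (dual Y) (dual X) ≫
        (D.dualComp (obj X) (obj Y)).hom ≫ D.transpose (incl X Y)) :=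
    congrArg ((D.bidual (obj (X ≫ Y))).hom ≫ ·) (mor_transpose (dcomp X Y).hom)
  refine h1.trans ((D.bidual_transpose_dualComp _ _).trans ?_)
  have h2 := congrArg (fun t => BiMod.mor t ≫ (D.dualComp (star (obj Y)) (star (obj X))).hom ≫
      D.transpose (incl (dual Y) (dual X)))
    (BiMod.compR_compL_ι (F := P.F) (G := Q.F) (H := R.F) (X := X) (X' := dual (dual X))
      (bid X).hom (Y := Y) (Y' := dual (dual Y)) (bid Y).hom)
  refine Eq.trans ?_ (h2.symm.trans ?_)
  · exact (Category.assoc _ _ _).symm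
  · exact (Category.assoc _ _ _).trans (congrArg _ (Category.assoc _ _ _))

variable (D) in
/-- The Frobenius duality of `M(T)`. -/
def frobenius : FrobeniusDuality (HopfIn D) (fun _ _ X => HopfIn.dual X) where
  toRigidityPairs := rigid D
  bidual X := bid X
  dualComp X Y := dcomp X Y
  multiplicative {P Q R} X Y := BiMod.cpair_multiplicative (F := P.F) (G := Q.F) (H := R.F) D X Y
    (gauge P.A) (gauge Q.A)
  bidual_natural f := bid_natural f
  bidual_comp X Y := bid_comp X Y
  bidual_dual X := bid_dual X

/-- `weight` is by definition the twisted character of the gauge, so `eps` is the morphism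
underlying the outer pairing. -/
lemma proj_pair {P Q : HopfIn D} (X : P ⟶ Q) :
    proj X (dual X) ≫ mor ((frobenius D).pair X) =
      (dimPow P.A (-1 / 4) * dimPow Q.A (-1 / 4)) • eps X :=
  congrArg BiMod.mor (BiMod.π_cpair (F := P.F) (G := Q.F) X (D.pair (obj X)) (D.copair (obj X))
    (D.hook (obj X)) (D.hook_dual (obj X)) (gauge P.A))

end HopfIn
end

/-! ### Closed diagrams of bimodules as scalars of T. -/

noncomputable section

open CategoryTheory MonoidalCategory
open scoped TensorProduct

namespace HopfRep

open HopfAlgebra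

variable {A : Type} [Ring A] [HopfAlgebra ℂ A] [Module.Finite ℂ A]

/-- Acting by the inverse of `γ` on the argument moves the evaluation point to 1, where evaluation
separates morphisms. -/
lemma hom_fn_ext_unit {V : HopfRep A} (γ : Aˣ) {f g : V ⟶ fn A}
    (h : ∀ v, evalAt (γ : A) (lin f v) = evalAt (γ : A) (lin g v)) : f = g := by
  refine hom_fn_ext (LinearMap.ext fun v => ?_)
  have h1 := h (V.ρ ((γ⁻¹ : Aˣ) : A) v)
  simp only [lin_comm, evalAt_ρ, Units.mul_inv] at h1
  exact h1

variable [IsInvolutive A]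

/-- Evaluation at `γ` is multiplicative for the renormalized product and takes the value ε(γ) = 1 on
the counit function, so the latter remains a unit on the right. -/
lemma whisker_fnUnit_gaugeMulL (γ : Aˣ) (hγ : Coalgebra.counit (R := ℂ) (γ : A) = 1) :
    fn A ◁ fnUnit A ≫ gaugeMulL γ (V := fn A) (evalAt (γ : A)) = (ρ_ (fn A)).hom := by
  refine hom_fn_ext_unit γ fun x => ?_
  revert x
  have h : (evalAt (γ : A) ∘ₗ lin (gaugeMulL γ (V := fn A) (evalAt (γ : A)))) ∘ₗ
      lin (fn A ◁ fnUnit A) = evalAt (γ : A) ∘ₗ lin (ρ_ (fn A)).hom := by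
    refine tensor_lin_ext fun f x => ?_
    obtain ⟨c, rfl⟩ := exists_smul_one x
    rw [evalAt_gaugeMulL]
    simp only [LinearMap.comp_apply, whiskerLeft_tmul, map_smul, fnUnit_apply, dmul_tmul,
      LinearMap.smul_apply, evalAt_toFn, hγ]
    refine Eq.trans ?_ (congrArg (evalAt (γ : A)) (rightUnitor_tmul (c • one) f)).symm
    rw [map_smul, map_smul, oneD_one, smul_eq_mul, smul_eq_mul]
    exact mul_comm _ _
  exact fun x => LinearMap.congr_fun h x

/-- An endomorphism of the function algebra which commutes with multiplications is scalar. -/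
lemma exists_eq_smul_id (γ : Aˣ) (hγ : Coalgebra.counit (R := ℂ) (γ : A) = 1) (g : fn A ⟶ fn A)
    (h : fn A ◁ g ≫ gaugeMulL γ (V := fn A) (evalAt (γ : A)) =
      gaugeMulL γ (V := fn A) (evalAt (γ : A)) ≫ g) : ∃ s : ℂ, g = s • 𝟙 (fn A) := by
  refine ⟨evalAt 1 (lin (fnUnit A ≫ g) one), ?_⟩
  -- The image of the unit function is invariant, hence a multiple of the unit function. Linearity
  -- `h` spreads this multiple to all functions.
  have h1 := hom_one_fn (fnUnit A ≫ g)
  have h2 := congrArg (fn A ◁ fnUnit A ≫ ·) h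
  simp only [← Category.assoc, ← MonoidalCategory.whiskerLeft_comp, whisker_fnUnit_gaugeMulL γ hγ]
    at h2
  rw [h1] at h2
  have h3 : ∀ s : ℂ, fn A ◁ (s • fnUnit A) = s • fn A ◁ fnUnit A := by
    intro s
    refine hom_ext (tensor_lin_ext fun f x => ?_)
    simp only [whiskerLeft_tmul, lin_smul, LinearMap.smul_apply]
    exact TensorProduct.tmul_smul _ _ _
  rw [h3, Linear.smul_comp, whisker_fnUnit_gaugeMulL γ hγ] at h2
  rw [← cancel_epi (ρ_ (fn A)).hom, ← h2, Linear.comp_smul, Category.comp_id]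

end HopfRep

namespace BiMod

open HopfRep HopfAlgebra Functor.LaxMonoidal Functor.OplaxMonoidal

variable {T : Type u} [Category.{v} T] [Preadditive T] [Linear ℂ T] [MonoidalCategory T]
  [MonoidalPreadditive T] [MonoidalLinear ℂ T]
  {A : Type} [Ring A] [HopfAlgebra ℂ A] {F : HopfRep A ⥤ T} [F.Monoidal] [F.Additive]
  [F.Linear ℂ] [Module.Finite ℂ A] [IsInvolutive A]
  {B : Type} [Ring B] [HopfAlgebra ℂ B] {G : HopfRep B ⥤ T} [G.Monoidal] [G.Additive]
  [G.Linear ℂ] [Module.Finite ℂ B] [IsInvolutive B]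

/-- The endomorphisms of a unit bimodule are scalars. -/
lemma exists_eq_smul_id [F.Full] [F.Faithful] (γ : Aˣ)
    (hγ : Coalgebra.counit (R := ℂ) (γ : A) = 1) (τ : unitM F γ ⟶ unitM F γ) :
    ∃ s : ℂ, τ = s • 𝟙 (unitM F γ) := by
  -- Fullness lifts the endomorphism to a map of `A`-modules; faithfulness will lift its
  -- compatibility with the left action.
  obtain ⟨g, hg⟩ := F.map_surjective (X := fn A) (Y := fn A) (mor τ)
  have h := mor_left_inv τ (fn A) (evalAt (γ : A))
  rw [unitM_left_inv] at h
  have h' : F.obj (fn A) ◁ F.map g ≫ μ F (fn A) (fn A) ≫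
      F.map (gaugeMulL γ (V := fn A) (evalAt (γ : A))) = (μ F (fn A) (fn A) ≫
      F.map (gaugeMulL γ (V := fn A) (evalAt (γ : A)))) ≫ F.map g := by
    rw [hg]; exact h
  rw [μ_natural_right_assoc, Category.assoc, cancel_epi, ← F.map_comp, ← F.map_comp] at h'
  obtain ⟨s, hs⟩ := HopfRep.exists_eq_smul_id γ hγ g (F.map_injective h')
  refine ⟨s, hom_ext ?_⟩
  rw [← hg, hs, F.map_smul, F.map_id]
  rfl

/-- On the unit function the action through evaluation at `γ` is multiplication by ε(γ) = 1, so the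
bare cup of T remains. -/
lemma unit_cupL {X X' : T} (c : 𝟙_ T ⟶ X' ⊗ X) (L : TrivL F X') (γ : Aˣ)
    (hγ : Coalgebra.counit (R := ℂ) (γ : A) = 1) :
    (ε F ≫ F.map (fnUnit A)) ≫ cupL c (L.inv (fn A) (evalAt (γ : A))) = c := by
  rw [← cupL_comp, comp_whiskerRight, Category.assoc, L.inv_naturality]
  have h : evalAt (γ : A) ∘ₗ lin (fnUnit A) = oneD := by
    refine unit_lin_ext ?_
    rw [LinearMap.comp_apply, fnUnit_apply, evalAt_toFn, hγ, oneD_one]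
  rw [h, ← L.inv_unit, ← comp_whiskerRight_assoc]
  simp only [Functor.Monoidal.ε_η, id_whiskerRight, Category.id_comp, cupL, id_whiskerLeft]
  monoidal

/-- The integral evaluates the twisted character at `t`, where it is 1 by assumption, so the bare
cap of T remains. -/
lemma capL_counit {X X' : T} (p : X ⊗ X' ⟶ 𝟙_ T) (L : TrivL F X) (γ : Aˣ) (t : A)
    (ht : ∀ a : A, t * a = Coalgebra.counit (R := ℂ) a • t)
    (hw : twistChar γ t = 1) :
    capL p (L.hom (fn A) (toFn (twistChar γ))) ≫ F.map (fnInt t ht) ≫ η F = p := by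
  rw [← capL_comp, comp_whiskerRight, ← reassoc_of% L.naturality, fnInt_apply, hw, one_smul, L.unit]
  simp only [capL, comp_whiskerRight, id_whiskerLeft]
  monoidal

/-- The closed diagram formed by a copairing, a morphism and a pairing of bimodules is the scalar
given by the diagram formed in `T`. -/
lemma outerCopair_comp_outerPair [F.Full] [F.Faithful] [IsSemisimpleRing A] (γ : Aˣ)
    (hγ : Coalgebra.counit (R := ℂ) (γ : A) = 1)
    {X : BiMod F G} {X' : T} (p : X.obj ⊗ X' ⟶ 𝟙_ T) (c : 𝟙_ T ⟶ X' ⊗ X.obj)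
    (hook : (ρ_ X.obj).inv ≫ X.obj ◁ c ≫ (α_ _ _ _).inv ≫ p ▷ X.obj ≫ (λ_ X.obj).hom = 𝟙 X.obj)
    (hook' : (λ_ X').inv ≫ c ▷ X' ≫ (α_ _ _ _).hom ≫ X' ◁ p ≫ (ρ_ X').hom = 𝟙 X')
    {U : BiMod G F} {U' : T} (q : U.obj ⊗ U' ⟶ 𝟙_ T) (d : 𝟙_ T ⟶ U' ⊗ U.obj)
    (kook : (ρ_ U.obj).inv ≫ U.obj ◁ d ≫ (α_ _ _ _).inv ≫ q ▷ U.obj ≫ (λ_ U.obj).hom = 𝟙 U.obj)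
    (kook' : (λ_ U').inv ≫ d ▷ U' ≫ (α_ _ _ _).hom ≫ U' ◁ q ≫ (ρ_ U').hom = 𝟙 U')
    (Φ : outer (U.mate q d kook kook') U ⟶ outer X (X.mate p c hook hook'))
    (φ : U' ⊗ U.obj ⟶ X.obj ⊗ X') (hφ : mor Φ = φ) (s : ℂ) (hs : d ≫ φ ≫ p = s • 𝟙 (𝟙_ T)) :
    U.outerCopair q d kook kook' γ ≫ Φ ≫ X.outerPair p c hook hook' γ = s • 𝟙 (unitM F γ) := by
  obtain ⟨t, ht1, ht, htw⟩ := exists_right_integral (A := A) IsInvolutive.sq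
  -- The composite is some scalar `r`. Placing it between the unit function and the integral strips
  -- cup and cap of their actions, and since ε(t) = 1 this preserves `r`; so `r` is compared with
  -- the diagram in T.
  obtain ⟨r, hr⟩ := exists_eq_smul_id γ hγ (U.outerCopair q d kook kook' γ ≫ Φ ≫
    X.outerPair p c hook hook' γ)
  -- The value is χ(γ⁻¹t) = ε(γ⁻¹), which is 1 because ε(γ) is.
  have hw : twistChar γ t = 1 := by
    change regChar A (((γ⁻¹ : Aˣ) : A) * t) = 1
    rw [htw]
    have h := congrArg (Coalgebra.counit (R := ℂ)) (Units.inv_mul γ)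
    rwa [Bialgebra.counit_mul, hγ, mul_one, Bialgebra.counit_one] at h
  have h1 := unit_cupL d (U.right.mate q d kook kook') γ hγ
  have h2 := capL_counit p X.left γ t ht hw
  have h3 : cupL d ((U.right.mate q d kook kook').inv (fn A) (evalAt (γ : A))) ≫ φ ≫
      capL p (X.left.hom (fn A) (toFn (twistChar γ))) = r • 𝟙 (F.obj (fn A)) := by
    rw [← hφ]; exact congrArg mor hr
  have h4 := congrArg (fun y => (ε F ≫ F.map (fnUnit A)) ≫ y ≫ F.map (fnInt t ht) ≫ η F) h3
  simp only [Category.assoc] at h4 h1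
  have h5 : fnUnit A ≫ fnInt t ht = 𝟙 _ := by
    refine HopfRep.hom_ext (unit_lin_ext ?_)
    rw [lin_comp, LinearMap.comp_apply, fnUnit_apply, fnInt_apply, ht1, one_smul]; rfl
  rw [h2, reassoc_of% h1, hs, Linear.smul_comp, Category.id_comp, Linear.comp_smul,
    Linear.comp_smul, ← F.map_comp_assoc, h5, F.map_id, Category.id_comp,
    Functor.Monoidal.ε_η] at h4
  rw [hr]
  refine hom_ext ?_
  -- The two scalars agree on the unit object of T; tensoring with F(A*) transfers the equality to
  -- the unit bimodule.
  have h6 := congrArg (fun y => (λ_ (F.obj (fn A))).inv ≫ y ▷ F.obj (fn A) ≫ (λ_ _).hom) h4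
  simp only [MonoidalLinear.smul_whiskerRight, id_whiskerRight, Linear.smul_comp, Linear.comp_smul,
    Category.id_comp, Iso.inv_hom_id] at h6
  exact h6.symm

end BiMod
end

/-! ### Traces and neutrality. -/

noncomputable section

open CategoryTheory MonoidalCategory
open scoped TensorProduct

section Interchange

variable {T : Type u} [Category.{v} T] [MonoidalCategory T]

lemma comp_whiskerRight_comp {x y z w w' k : T} (d : k ⟶ x ⊗ w) (f : x ⟶ y) (g : y ⟶ z)
    (p : z ⊗ w ⟶ w') : d ≫ (f ≫ g) ▷ w ≫ p = d ≫ f ▷ w ≫ g ▷ w ≫ p := by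
  rw [comp_whiskerRight, Category.assoc]

lemma whiskerLeft_comp_comp {x y z w w' k : T} (d : k ⟶ w ⊗ x) (f : x ⟶ y) (g : y ⟶ z)
    (p : w ⊗ z ⟶ w') : d ≫ w ◁ (f ≫ g) ≫ p = d ≫ w ◁ f ≫ w ◁ g ≫ p := by
  rw [MonoidalCategory.whiskerLeft_comp, Category.assoc]

end Interchange

namespace BiMod

open HopfRep HopfAlgebra

variable {T : Type u} [Category.{v} T] [Preadditive T] [Linear ℂ T] [MonoidalCategory T]
  [MonoidalPreadditive T] [MonoidalLinear ℂ T] [IsIdempotentComplete T]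
  {A : Type} [Ring A] [HopfAlgebra ℂ A] {F : HopfRep A ⥤ T} [F.Monoidal] [F.Additive]
  [F.Linear ℂ] [Module.Finite ℂ A] [IsInvolutive A]
  {B : Type} [Ring B] [HopfAlgebra ℂ B] {G : HopfRep B ⥤ T} [G.Monoidal] [G.Additive]
  [G.Linear ℂ] [Module.Finite ℂ B] [IsInvolutive B]

/-- A common form of both traces: `Ψ` is the map induced on relative products by `Φ`. The copairing
of `U` and the pairing of `X` each contribute one factor `pairScale`, with the algebras in opposite
order. -/
lemma ccopair_comp_cpair [F.Full] [F.Faithful] [IsSemisimpleRing A] (γ : Aˣ)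
    (hγ : Coalgebra.counit (R := ℂ) (γ : A) = 1)
    {X : BiMod F G} {X' : T} (p : X.obj ⊗ X' ⟶ 𝟙_ T) (c : 𝟙_ T ⟶ X' ⊗ X.obj)
    (hook : (ρ_ X.obj).inv ≫ X.obj ◁ c ≫ (α_ _ _ _).inv ≫ p ▷ X.obj ≫ (λ_ X.obj).hom = 𝟙 X.obj)
    (hook' : (λ_ X').inv ≫ c ▷ X' ≫ (α_ _ _ _).hom ≫ X' ◁ p ≫ (ρ_ X').hom = 𝟙 X')
    {U : BiMod G F} {U' : T} (q : U.obj ⊗ U' ⟶ 𝟙_ T) (d : 𝟙_ T ⟶ U' ⊗ U.obj)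
    (kook : (ρ_ U.obj).inv ≫ U.obj ◁ d ≫ (α_ _ _ _).inv ≫ q ▷ U.obj ≫ (λ_ U.obj).hom = 𝟙 U.obj)
    (kook' : (λ_ U').inv ≫ d ▷ U' ≫ (α_ _ _ _).hom ≫ U' ◁ q ≫ (ρ_ U').hom = 𝟙 U')
    (Φ : outer (U.mate q d kook kook') U ⟶ outer X (X.mate p c hook hook'))
    (φ : U' ⊗ U.obj ⟶ X.obj ⊗ X') (hφ : mor Φ = φ)
    (Ψ : comp (U.mate q d kook kook') U ⟶ comp X (X.mate p c hook hook'))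
    (hΨ : π _ _ ≫ Ψ = Φ ≫ π _ _) (s : ℂ) (hs : d ≫ φ ≫ p = s • 𝟙 (𝟙_ T)) :
    U.ccopair q d kook kook' γ ≫ Ψ ≫ X.cpair p c hook hook' γ =
      (pairScale A B * pairScale A B * s) • 𝟙 (unitM F γ) := by
  rw [ccopair, Category.assoc, reassoc_of% hΨ, π_cpair, Linear.comp_smul, Linear.comp_smul,
    Linear.smul_comp, outerCopair_comp_outerPair γ hγ p c hook hook' q d kook kook' Φ φ hφ s hs,
    pairScale_comm B A, smul_smul, smul_smul, mul_assoc]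

end BiMod

namespace HopfIn

open HopfRep

variable {T : Type u} [Category.{v} T] [Preadditive T] [Linear ℂ T] [MonoidalCategory T]
  [MonoidalPreadditive T] [MonoidalLinear ℂ T] {star : T → T} {D : TensorDuality star}
  [IsIdempotentComplete T]

/-- The copairing in the left trace is that of the dual, so `U` is X* and `U'` is X**; the inserted
morphism acts on the first factor. -/
lemma leftTrace_eq_smul {P Q : HopfIn D} {X : P ⟶ Q} (f : X ⟶ X) (s : ℂ)
    (hs : D.copair (star (obj X)) ≫ (D.bidual (obj X)).inv ▷ star (obj X) ≫
      mor f ▷ star (obj X) ≫ D.pair (obj X) = s • 𝟙 (𝟙_ T)) :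
    (frobenius D).leftTrace f = (pairScale P.A Q.A * pairScale P.A Q.A * s) • 𝟙 (𝟙 P) := by
  have h := BiMod.ccopair_comp_cpair (F := P.F) (G := Q.F) (gauge P.A) (counit_gauge P.A) (X := X)
    (D.pair (obj X)) (D.copair (obj X)) (D.hook (obj X)) (D.hook_dual (obj X))
    (U := dual X) (D.pair (star (obj X))) (D.copair (star (obj X))) (D.hook (star (obj X)))
    (D.hook_dual (star (obj X)))
    (BiMod.outR (F := P.F) (G := Q.F) (H := P.F) ((bid X).inv ≫ f) (dual X))
    (((D.bidual (obj X)).inv ≫ mor f) ▷ star (obj X)) rfl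
    (BiMod.compR (F := P.F) (G := Q.F) (H := P.F) ((bid X).inv ≫ f) (dual X))
    (BiMod.π_compR (F := P.F) (G := Q.F) (H := P.F) _ _) s
    (.trans (comp_whiskerRight_comp _ _ _ _) hs)
  refine Eq.trans ?_ h
  change _ = (frobenius D).copair (dual X) ≫ Bicategory.whiskerRight ((bid X).inv ≫ f) (dual X) ≫
    (frobenius D).pair X
  rw [Bicategory.comp_whiskerRight, Category.assoc]
  rfl

/-- Here the pairing is that of the dual and `U` is X itself. The algebras exchange their roles,
which `pairScale_comm` undoes. -/
lemma rightTrace_eq_smul {P Q : HopfIn D} {X : P ⟶ Q} (f : X ⟶ X) (s : ℂ)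
    (hs : D.copair (obj X) ≫ star (obj X) ◁ mor f ≫ star (obj X) ◁ (D.bidual (obj X)).hom ≫
      D.pair (star (obj X)) = s • 𝟙 (𝟙_ T)) :
    (frobenius D).rightTrace f = (pairScale P.A Q.A * pairScale P.A Q.A * s) • 𝟙 (𝟙 Q) := by
  have h := BiMod.ccopair_comp_cpair (F := Q.F) (G := P.F) (gauge Q.A) (counit_gauge Q.A)
    (X := dual X) (D.pair (star (obj X))) (D.copair (star (obj X))) (D.hook (star (obj X)))
    (D.hook_dual (star (obj X)))
    (U := X) (D.pair (obj X)) (D.copair (obj X)) (D.hook (obj X)) (D.hook_dual (obj X))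
    (BiMod.outL (F := Q.F) (G := P.F) (H := Q.F) (dual X) (f ≫ (bid X).hom))
    (star (obj X) ◁ (mor f ≫ (D.bidual (obj X)).hom)) rfl
    (BiMod.compL (F := Q.F) (G := P.F) (H := Q.F) (dual X) (f ≫ (bid X).hom))
    (BiMod.π_compL (F := Q.F) (G := P.F) (H := Q.F) _ _) s
    (.trans (whiskerLeft_comp_comp _ _ _ _) hs)
  rw [pairScale_comm P.A Q.A]
  refine Eq.trans ?_ h
  change _ = (frobenius D).copair X ≫ Bicategory.whiskerLeft (dual X) (f ≫ (bid X).hom) ≫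
    (frobenius D).pair (dual X)
  rw [Bicategory.whiskerLeft_comp, Category.assoc]
  rfl

/-- Both traces are those of T multiplied by the same factor, the square of `pairScale`. -/
lemma frobenius_isNeutral (hD : D.IsNeutral) : (frobenius D).IsNeutral := fun {P Q} X f => by
  obtain ⟨s, hl, hr⟩ := hD (a := MonoidalSingleObj.star T) (b := MonoidalSingleObj.star T)
    (obj X) (mor f)
  exact ⟨_, leftTrace_eq_smul f s hl, rightTrace_eq_smul f s hr⟩

end HopfIn
end

open CategoryTheory MonoidalCategory in
theorem mainTheorem2 {T : Type u} [Category.{v} T] [Preadditive T] [Linear ℂ T]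
    [MonoidalCategory T] [MonoidalPreadditive T] [MonoidalLinear ℂ T]
    [Limits.HasFiniteBiproducts T] [IsIdempotentComplete T]
    (hss : ∀ X : T, IsSemisimpleRing (End X))
    (hunit : Function.Bijective (fun c : ℂ => c • 𝟙 (𝟙_ T)))
    {star : T → T} (D : TensorDuality star) :
    ∃ E : FrobeniusDuality (HopfIn D) (fun _ _ X => HopfIn.dual X),
      (∀ {P Q : HopfIn D} (X : P ⟶ Q),
        HopfIn.proj X (HopfIn.dual X) ≫ HopfIn.mor (E.pair X) =
          (dimPow P.A (-1 / 4) * dimPow Q.A (-1 / 4)) • HopfIn.eps X) ∧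
      (∀ {P Q : HopfIn D} (X : P ⟶ Q),
        HopfIn.mor (E.bidual X).hom = (D.bidual (HopfIn.obj X)).hom) ∧
      (∀ {P Q R : HopfIn D} (X : P ⟶ Q) (Y : Q ⟶ R),
        HopfIn.mor (E.dualComp X Y).hom =
          HopfIn.incl (HopfIn.dual Y) (HopfIn.dual X) ≫
            (D.dualComp (HopfIn.obj X) (HopfIn.obj Y)).hom ≫
              D.transpose (HopfIn.incl X Y)) ∧
      (D.IsNeutral → E.IsNeutral) :=
  -- The identifications were constructed with the required underlying morphisms, so these two
  -- clauses hold by definition.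
  ⟨HopfIn.frobenius D, fun X => HopfIn.proj_pair X, fun _ => rfl, fun _ _ => rfl,
    HopfIn.frobenius_isNeutral⟩
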